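/- Let $\mathcal G_0$ be the set of right continuous nondecreasing maps $g:[0,1)\to[0,1]$ (extended by $g(1):=1$) with the $L^2([0,1],\mathrm{Leb})$-distance and its Borel $\sigma$-field. Let $\beta>0$ and let $\mathbb Q_0$ be the Dirichlet process with parameter $\beta$, i.e. the (existing and unique) probability measure on $\mathcal G_0$ such that for all $0=t_0<t_1<\dots<t_N<t_{N+1}=1$ the vector $(g_{t_1},\dots,g_{t_N})$ has on $\{0=x_0<x_1<\dots<x_N<x_{N+1}=1\}$ the Lebesgue density $$\frac{\Gamma(\beta)}{\prod_{i=0}^N\Gamma(\beta(t_{i+1}-t_i))}\prod_{i=0}^N(x_{i+1}-x_i)^{\beta(t_{i+1}-t_i)-1}.$$ For $\vec\alpha=(\alpha_1,\dots,\alpha_m):[0,1]\to\mathbb R^m$ write $\int\vec\alpha(g_s)ds=\big(\int_0^1\alpha_i(g_s)ds\big)_{i\le m}$. Let $\mathfrak Z^1(\mathcal G_0)$ be the set of functions $u(g)=U(\int\vec\alpha(g_s)ds)$ with $m\in\mathbb N$, $U\in C^1(\mathbb R^m)$, $\vec\alpha\in C^1([0,1],\mathbb R^m)$, and let $\mathfrak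 Z^\infty_0(\mathcal G_0)$ be the set of those $u$ having such a representation with $U$, $\vec\alpha$ of class $C^\infty$ and $\alpha_i'(0)=\alpha_i'(1)=0$ for all $i$. For $u\in\mathfrak Z^1(\mathcal G_0)$ let $\mathbb Du(g)\in L^2([0,1],\mathrm{Leb})$ be the $L^2$-gradient of $u$ at $g$, and regard $\mathbb D$ as an operator from $\mathfrak Z^1(\mathcal G_0)\subset L^2(\mathcal G_0,\mathbb Q_0)$ to $L^2(\mathcal G_0\times[0,1],\mathbb Q_0\otimes\mathrm{Leb})$. It is closable; its closure is denoted by $(\overline{\mathbb D},\mathrm{Dom}(\overline{\mathbb D}))$. For $u,v\in\mathfrak Z^1(\mathcal G_0)$ put $\mathbb E(u,v)=\int_{\mathcal G_0}\langle\mathbb Du(g),\mathbb Dv(g)\rangle_{L^2}\,d\mathbb Q_0(g)$. For smooth $\varphi:[0,1]\to\mathbb R$ with $\varphi(0)=\varphi(1)=0$ let $$V^\beta_{\varphi,0}(g)=\sum_{a\in J_g}\Big[\tfrac{\varphi'(g(a+))+\varphi'(g(a-))}2-\tfrac{\varphi(g(a+))-\varphi(g(a-))}{g(a+)-g(a-)}\Big]+\beta\int_0^1\varphi'(g_s)\,ds-\tfrac{\varphi'(0)+\varphi'(1)}2,$$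 where $J_g$ is the set of jump locations of $g$, let $D_\varphi u(g)=\frac{d}{dt}\big|_{t=0}u(e_{t\varphi}\circ g)$, where $e_{t\varphi}$ is the flow of $\varphi$ on $[0,1]$, and let $D_\varphi^*$ be the adjoint in $L^2(\mathcal G_0,\mathbb Q_0)$ of $(D_\varphi,\mathfrak Z^1(\mathcal G_0))$. Then: (i) $(\mathbb E,\mathfrak Z^1(\mathcal G_0))$ is closable. Its closure $(\mathbb E,\mathrm{Dom}(\mathbb E))$ is a regular, recurrent Dirichlet form on $L^2(\mathcal G_0,\mathbb Q_0)$. Moreover $\mathrm{Dom}(\mathbb E)=\mathrm{Dom}(\overline{\mathbb D})$, and $\mathbb E(u,v)=\int_{\mathcal G_0\times[0,1]}\overline{\mathbb D}u\cdot\overline{\mathbb D}v\;d(\mathbb Q_0\otimes\mathrm{Leb})$ for all $u,v\in\mathrm{Dom}(\overline{\mathbb D})$. (ii) $\mathfrak Z^\infty_0(\mathcal G_0)$ is a core for $(\mathbb E,\mathrm{Dom}(\mathbb E))$, i.e. it is contained in $\mathrm{Dom}(\mathbb E)$ and dense there with respect to the norm $(\mathbb E(u,u)+\|u\|_{L^2}^2)^{1/2}$.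 (iii) The generator of $(\mathbb E,\mathrm{Dom}(\mathbb E))$ is the Friedrichs extension of the (well-defined, densely defined, symmetric, nonpositive) operator $(\mathbb L,\mathfrak Z^\infty_0(\mathcal G_0))$ given, for $u(g)=U(\int\vec\alpha(g_s)ds)$ as in the definition of $\mathfrak Z_0^\infty(\mathcal G_0)$ and $u_i(g)=\partial_iU(\int\vec\alpha(g_s)ds)$, by $$\mathbb Lu(g)=-\sum_{i=1}^mD^*_{\alpha_i'}u_i(g)=\sum_{i,j=1}^m\partial_i\partial_jU\big(\textstyle\int\vec\alpha(g_s)ds\big)\int_0^1\alpha_i'(g_s)\alpha_j'(g_s)\,ds+\sum_{i=1}^m\partial_iU\big(\textstyle\int\vec\alpha(g_s)ds\big)\,V^\beta_{\alpha_i',0}(g).$$ (iv) $(\mathbb E,\mathrm{Dom}(\mathbb E))$ has the square field operator $\Gamma(u,v)=\langle\overline{\mathbb D}u,\overline{\mathbb D}v\rangle_{L^2(\mathrm{Leb})}\in L^1(\mathcal G_0,\mathbb Q_0)$ on $\mathrm{Dom}(\mathbb E)\cap L^\infty(\mathcal G_0,\mathbb Q_0)$. That is, for all $u,v,w\in\mathrm{Dom}(\mathbb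 E)\cap L^\infty(\mathcal G_0,\mathbb Q_0)$ the products $uv,uw,vw$ belong to $\mathrm{Dom}(\mathbb E)$ and $$2\int w\cdot\Gamma(u,v)\,d\mathbb Q_0=\mathbb E(u,vw)+\mathbb E(uw,v)-\mathbb E(uv,w).$$ -/

import Mathlib

open MeasureTheory Filter Topology Set
open scoped ContDiff RealInnerProductSpace

noncomputable section

namespace WassersteinForm

/-! ## Symmetric forms on real Hilbert spaces and on `L²(X, m)` -/

/-- A nonnegative symmetric bilinear form with domain a linear subspace of `H`. -/
structure SymmForm (H : Type*) [NormedAddCommGroup H] [InnerProductSpace ℝ H] where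
  dom : Submodule ℝ H
  form : dom →ₗ[ℝ] dom →ₗ[ℝ] ℝ
  symm : ∀ u v, form u v = form v u
  nonneg : ∀ u, 0 ≤ form u u

section Hilbert

variable {H : Type*} [NormedAddCommGroup H] [InnerProductSpace ℝ H]

/-- `E₁(u, u) = E(u, u) + ‖u‖²`. -/
def SymmForm.energy (E : SymmForm H) (u : E.dom) : ℝ := E.form u u + ‖(u : H)‖ ^ 2

/-- The domain is complete with respect to the norm `E₁(u, u) ^ (1/2)`. -/
def SymmForm.IsClosed (E : SymmForm H) : Prop :=
  ∀ u : ℕ → E.dom,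
    (∀ ε > 0, ∃ N, ∀ p ≥ N, ∀ q ≥ N, E.energy (u p - u q) < ε) →
      ∃ v : E.dom, Tendsto (fun n => E.energy (u n - v)) atTop (𝓝 0)

/-- The graph of the generator `L` of a form: `u ∈ Dom(L)` and `L u = f` if and only if
`u ∈ Dom(E)` and `E(u, v) = -⟨f, v⟩` for all `v ∈ Dom(E)`. -/
def SymmForm.generatorGraph (E : SymmForm H) : Set (H × H) :=
  {p | ∃ hu : p.1 ∈ E.dom, ∀ v : E.dom, E.form ⟨p.1, hu⟩ v = -⟪p.2, (v : H)⟫}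

/-- A densely defined, symmetric, nonpositive operator. -/
structure IsNonposSymmetric (L : H →ₗ.[ℝ] H) : Prop where
  dense : Dense (L.domain : Set H)
  symm : ∀ u v : L.domain, ⟪L u, (v : H)⟫ = ⟪(u : H), L v⟫
  nonpos : ∀ u : L.domain, ⟪L u, (u : H)⟫ ≤ 0

/-- The graph of the Friedrichs extension of a densely defined nonpositive symmetric operator `L`:
the restriction of the adjoint `L*` to the domain of the closure of the quadratic form
`q(u) = -⟨L u, u⟩`, `u ∈ Dom(L)`. -/
def friedrichsGraph (L : H →ₗ.[ℝ] H) : Set (H × H) :=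
  {p | (∃ u : ℕ → L.domain,
          Tendsto (fun n => (u n : H)) atTop (𝓝 p.1) ∧
          ∀ ε > 0, ∃ N, ∀ i ≥ N, ∀ j ≥ N, -⟪L (u i - u j), ((u i - u j : L.domain) : H)⟫ < ε) ∧
       ∀ v : L.domain, ⟪p.1, L v⟫ = ⟪p.2, (v : H)⟫}

end Hilbert

section Measure

variable {X : Type*} [MeasurableSpace X]

/-- `E` is a Dirichlet form on `L²(X, m)`: densely defined, closed, and the unit contraction
`(0 ∨ u) ∧ 1` operates on it. -/
structure IsDirichletForm {m : Measure X} (E : SymmForm (Lp ℝ 2 m)) : Prop where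
  dense : Dense (E.dom : Set (Lp ℝ 2 m))
  closed : E.IsClosed
  markov : ∀ u : E.dom, ∃ v : E.dom,
    (∀ᵐ x ∂m, (v : Lp ℝ 2 m) x = min (max 0 ((u : Lp ℝ 2 m) x)) 1) ∧ E.form v v ≤ E.form u u

/-- `E` is regular: the state space is locally compact and separable, the measure is finite on
compact sets and has full support, and `Dom(E) ∩ C_c(X)` is dense in `Dom(E)` for the `E₁`-norm and
in `C_c(X)` for the uniform norm. -/
structure IsRegularForm [TopologicalSpace X] {m : Measure X} (E : SymmForm (Lp ℝ 2 m)) : Prop where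
  locallyCompact : LocallyCompactSpace X
  separable : TopologicalSpace.SeparableSpace X
  finiteOnCompacts : IsFiniteMeasureOnCompacts m
  fullSupport : m.IsOpenPosMeasure
  dense_dom : ∀ u : E.dom, ∀ ε > 0, ∃ v : E.dom, ∃ f : X → ℝ, Continuous f ∧
    HasCompactSupport f ∧ (v : Lp ℝ 2 m) =ᵐ[m] f ∧ E.energy (u - v) < ε
  dense_cc : ∀ f : X → ℝ, Continuous f → HasCompactSupport f → ∀ ε > 0,
    ∃ v : E.dom, ∃ h : X → ℝ, Continuous h ∧ HasCompactSupport h ∧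
      (v : Lp ℝ 2 m) =ᵐ[m] h ∧ ∀ x, |f x - h x| < ε

/-- `E` is recurrent: for all nonnegative `f ∈ L¹ ∩ L²`, the potential
`G f = ∫₀^∞ T_t f dt = lim_n G_{1/n} f` takes only the values `0` and `∞`, almost everywhere. Here
the resolvent `G_a f` is the element of `Dom(E)` with `E(G_a f, v) + a ⟨G_a f, v⟩ = ⟨f, v⟩` for all
`v ∈ Dom(E)`; for a Dirichlet form, `G_{1/n} f` is nonnegative and increases with `n`. -/
def IsRecurrent {m : Measure X} (E : SymmForm (Lp ℝ 2 m)) : Prop :=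
  ∀ f : Lp ℝ 2 m, (∀ᵐ x ∂m, 0 ≤ f x) → Integrable f m →
    ∀ u : ℕ → E.dom,
      (∀ (n : ℕ) (v : E.dom),
        E.form (u n) v + (1 / ((n : ℝ) + 1)) * ⟪(u n : Lp ℝ 2 m), (v : Lp ℝ 2 m)⟫
          = ⟪f, (v : Lp ℝ 2 m)⟫) →
      ∀ᵐ x ∂m, (∀ n, (u n : Lp ℝ 2 m) x = 0) ∨
        Tendsto (fun n => (u n : Lp ℝ 2 m) x) atTop atTop

/-- The sequence `f` is Cauchy for the form `e`. -/
def FormCauchy (e : (X → ℝ) → (X → ℝ) → ℝ) (f : ℕ → X → ℝ) : Prop :=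
  ∀ ε > 0, ∃ N, ∀ p ≥ N, ∀ q ≥ N, e (f p - f q) (f p - f q) < ε

/-- Closability in `L²(X, m)` of a form `e` given on a linear space `C` of functions. -/
def FormClosable (m : Measure X) (C : Set (X → ℝ)) (e : (X → ℝ) → (X → ℝ) → ℝ) : Prop :=
  ∀ f : ℕ → X → ℝ, (∀ n, f n ∈ C) → FormCauchy e f →
    Tendsto (fun n => eLpNorm (f n) 2 m) atTop (𝓝 0) →
      Tendsto (fun n => e (f n) (f n)) atTop (𝓝 0)

/-- `f` is a sequence in `C` which is Cauchy for `e` and converges to `u` in `L²(X, m)`. -/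
structure IsApproximating (m : Measure X) (C : Set (X → ℝ)) (e : (X → ℝ) → (X → ℝ) → ℝ)
    (f : ℕ → X → ℝ) (u : Lp ℝ 2 m) : Prop where
  mem : ∀ n, f n ∈ C
  cauchy : FormCauchy e f
  tendsto : Tendsto (fun n => eLpNorm (f n - ⇑u) 2 m) atTop (𝓝 0)

/-- `E` is the closure of the form `e` with domain `C`. -/
structure IsFormClosure (m : Measure X) (C : Set (X → ℝ)) (e : (X → ℝ) → (X → ℝ) → ℝ)
    (E : SymmForm (Lp ℝ 2 m)) : Prop where
  mem_dom : ∀ u : Lp ℝ 2 m, u ∈ E.dom ↔ ∃ f, IsApproximating m C e f u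
  form_eq : ∀ (u v : E.dom) (f h : ℕ → X → ℝ),
    IsApproximating m C e f u → IsApproximating m C e h v →
      Tendsto (fun n => e (f n) (h n)) atTop (𝓝 (E.form u v))

/-- `C` is a core: it is contained in `Dom(E)` and dense there with respect to the `E₁`-norm. -/
structure IsCore {m : Measure X} (E : SymmForm (Lp ℝ 2 m)) (C : Set (X → ℝ)) : Prop where
  mem : ∀ f ∈ C, ∃ v : E.dom, (v : Lp ℝ 2 m) =ᵐ[m] f
  dense : ∀ u : E.dom, ∀ ε > 0, ∃ f ∈ C, ∃ v : E.dom,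
    (v : Lp ℝ 2 m) =ᵐ[m] f ∧ E.energy (u - v) < ε

end Measure

/-! ## The space of monotone maps -/

/-- Lebesgue measure on `[0, 1]`. -/
abbrev leb : Measure ℝ := volume.restrict (Icc (0 : ℝ) 1)

/-- Right continuous nondecreasing maps `[0, 1) → [0, 1]`. -/
@[ext]
structure G0 where
  toFun : Ico (0 : ℝ) 1 → Icc (0 : ℝ) 1
  mono : Monotone toFun
  rightCts : ∀ t, ContinuousWithinAt toFun (Ici t) t

namespace G0

/-- The extension of `g` to the real line, by `0` on `(-∞, 0)` and by `1` on `[1, ∞)`. -/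
def extend (g : G0) (t : ℝ) : ℝ :=
  if h : t ∈ Ico (0 : ℝ) 1 then (g.toFun ⟨t, h⟩ : ℝ) else if t < 0 then 0 else 1

instance : CoeFun G0 (fun _ => ℝ → ℝ) := ⟨extend⟩

theorem apply_of_mem (g : G0) {t : ℝ} (h : t ∈ Ico (0 : ℝ) 1) :
    g t = (g.toFun ⟨t, h⟩ : ℝ) := by
  simp only [extend, dif_pos h]

theorem apply_mem (g : G0) (t : ℝ) : g t ∈ Icc (0 : ℝ) 1 := by
  by_cases h : t ∈ Ico (0 : ℝ) 1
  · rw [g.apply_of_mem h]; exact (g.toFun ⟨t, h⟩).2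
  · simp only [extend, dif_neg h]
    split_ifs <;> simp

theorem monotone (g : G0) : Monotone (g : ℝ → ℝ) := by
  intro s t hst
  by_cases hs : s ∈ Ico (0 : ℝ) 1
  · by_cases ht : t ∈ Ico (0 : ℝ) 1
    · rw [g.apply_of_mem hs, g.apply_of_mem ht]
      exact g.mono (show (⟨s, hs⟩ : Ico (0 : ℝ) 1) ≤ ⟨t, ht⟩ from hst)
    · have h1 : ¬ t < 0 := not_lt.2 (hs.1.trans hst)
      have : g t = 1 := by simp only [extend, dif_neg ht, if_neg h1]
      rw [this]; exact (g.apply_mem s).2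
  · by_cases h0 : s < 0
    · have : g s = 0 := by simp only [extend, dif_neg hs, if_pos h0]
      rw [this]; exact (g.apply_mem t).1
    · have hs1 : 1 ≤ s := by
        by_contra hc
        exact hs ⟨not_lt.1 h0, not_le.1 hc⟩
      have ht : t ∉ Ico (0 : ℝ) 1 := fun h => absurd h.2 (not_lt.2 (hs1.trans hst))
      have ht0 : ¬ t < 0 := by linarith
      have e1 : g s = 1 := by simp only [extend, dif_neg hs, if_neg h0]
      have e2 : g t = 1 := by simp only [extend, dif_neg ht, if_neg ht0]
      rw [e1, e2]

theorem memLp (g : G0) : MemLp (g : ℝ → ℝ) 2 leb := by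
  refine MemLp.of_bound g.monotone.measurable.aestronglyMeasurable 1 (Eventually.of_forall ?_)
  intro t
  rw [Real.norm_eq_abs, abs_of_nonneg (g.apply_mem t).1]
  exact (g.apply_mem t).2

/-- The class of `g` in `L²([0, 1], Leb)`. -/
def toL2 (g : G0) : Lp ℝ 2 leb := g.memLp.toLp _

theorem tendsto_right (g : G0) {t : ℝ} (h : t ∈ Ico (0 : ℝ) 1) :
    Tendsto (g : ℝ → ℝ) (𝓝[>] t) (𝓝 (g t)) := by
  have h1 : ContinuousWithinAt (fun x : Ico (0 : ℝ) 1 => (g.toFun x : ℝ)) (Ici ⟨t, h⟩) ⟨t, h⟩ :=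
    continuous_subtype_val.continuousAt.comp_continuousWithinAt (g.rightCts ⟨t, h⟩)
  rw [Metric.continuousWithinAt_iff] at h1
  rw [Metric.tendsto_nhdsWithin_nhds]
  intro ε hε
  obtain ⟨δ, hδ, H⟩ := h1 ε hε
  refine ⟨min δ (1 - t), lt_min hδ (by linarith [h.2]), ?_⟩
  intro x hx hd
  have hx' : t < x := hx
  have hd' : x - t < min δ (1 - t) := by
    rwa [Real.dist_eq, abs_of_pos (by linarith)] at hd
  have hxm : x ∈ Ico (0 : ℝ) 1 :=
    ⟨by linarith [h.1], by linarith [min_le_right δ (1 - t)]⟩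
  have := H (x := ⟨x, hxm⟩) (show (⟨t, h⟩ : Ico (0 : ℝ) 1) ≤ ⟨x, hxm⟩ from hx'.le)
    (by
      rw [Subtype.dist_eq]
      exact hd.trans_le (min_le_left _ _))
  rw [g.apply_of_mem hxm, g.apply_of_mem h]
  exact this

theorem toL2_injective : Function.Injective toL2 := by
  intro f g hfg
  have hae : (f : ℝ → ℝ) =ᵐ[leb] g := (MemLp.toLp_eq_toLp_iff f.memLp g.memLp).1 hfg
  have key : ∀ t (_ : t ∈ Ico (0 : ℝ) 1), f t = g t := by
    intro t ht
    have hfr : ∃ᶠ s in 𝓝[>] t, f s = g s := by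
      intro hcon
      have h2 : ∀ᶠ s in 𝓝[>] t, s < 1 :=
        (eventually_lt_nhds ht.2).filter_mono nhdsWithin_le_nhds
      obtain ⟨u, hu, hsub⟩ := (mem_nhdsGT_iff_exists_Ioo_subset).1 (hcon.and h2)
      have hu' : t < u := hu
      have h3 : volume (Ioo t u) = 0 := by
        have h4 : ∀ᵐ s ∂(volume : Measure ℝ), s ∈ Icc (0 : ℝ) 1 → f s = g s :=
          (ae_restrict_iff' measurableSet_Icc).1 hae
        refine measure_mono_null ?_ h4
        intro s hs hc
        have := hsub hs
        exact this.1 (hc ⟨ht.1.trans hs.1.le, this.2.le⟩)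
      rw [Real.volume_Ioo, ENNReal.ofReal_eq_zero] at h3
      linarith
    by_contra hne
    have := (((f.tendsto_right ht).prodMk_nhds (g.tendsto_right ht)).eventually
      ((isClosed_diagonal (X := ℝ)).isOpen_compl.mem_nhds (show (f t, g t) ∈ (diagonal ℝ)ᶜ from hne)))
    exact hfr (this.mono fun s hs => hs)
  ext t
  have := key t t.2
  rwa [f.apply_of_mem t.2, g.apply_of_mem t.2] at this

/-- The `L²([0, 1], Leb)`-distance. -/
instance : MetricSpace G0 := MetricSpace.induced toL2 toL2_injective inferInstance

instance : MeasurableSpace G0 := borel G0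

instance : BorelSpace G0 := ⟨rfl⟩

/-- The convex combination `(1 - t) g + t h`, for `t ∈ [0, 1]`
(any other `t` is first projected to `[0, 1]`). -/
def segment (g h : G0) (t : ℝ) : G0 where
  toFun s := ⟨(1 - (projIcc 0 1 zero_le_one t : ℝ)) * g.toFun s
      + (projIcc 0 1 zero_le_one t : ℝ) * h.toFun s,
    (convex_Icc (0 : ℝ) 1) (g.toFun s).2 (h.toFun s).2
      (sub_nonneg.2 (projIcc 0 1 zero_le_one t).2.2) (projIcc 0 1 zero_le_one t).2.1 (by ring)⟩
  mono := by
    intro s r hsr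
    have h0 := (projIcc (0 : ℝ) 1 zero_le_one t).2.1
    have h1 := sub_nonneg.2 (projIcc (0 : ℝ) 1 zero_le_one t).2.2
    have hg : (g.toFun s : ℝ) ≤ g.toFun r := g.mono hsr
    have hh : (h.toFun s : ℝ) ≤ h.toFun r := h.mono hsr
    refine Subtype.mk_le_mk.2 ?_
    exact add_le_add (mul_le_mul_of_nonneg_left hg h1) (mul_le_mul_of_nonneg_left hh h0)
  rightCts := by
    intro s
    have hg : ContinuousWithinAt (fun x => (g.toFun x : ℝ)) (Ici s) s :=
      continuous_subtype_val.continuousAt.comp_continuousWithinAt (g.rightCts s)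
    have hh : ContinuousWithinAt (fun x => (h.toFun x : ℝ)) (Ici s) s :=
      continuous_subtype_val.continuousAt.comp_continuousWithinAt (h.rightCts s)
    have hc : ContinuousWithinAt (fun x => (1 - (projIcc (0 : ℝ) 1 zero_le_one t : ℝ))
        * (g.toFun x : ℝ) + (projIcc (0 : ℝ) 1 zero_le_one t : ℝ) * (h.toFun x : ℝ)) (Ici s) s :=
      (continuousWithinAt_const.mul hg).add (continuousWithinAt_const.mul hh)
    exact Topology.IsInducing.subtypeVal.continuousWithinAt_iff.2 hc

end G0

/-! ## The Dirichlet process -/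

/-- `(x₁, …, x_N) ↦ (0, x₁, …, x_N, 1)`. -/
def pad {N : ℕ} (x : Fin N → ℝ) : Fin (N + 2) → ℝ :=
  Fin.cons (α := fun _ => ℝ) 0 (Fin.snoc (α := fun _ => ℝ) x 1)

open Classical in
/-- The finite dimensional distribution at the times `0 < t₁ < ⋯ < t_N < 1`, a measure concentrated
on the simplex `0 < x₁ < ⋯ < x_N < 1`. -/
def dirichletLaw (β : ℝ) {N : ℕ} (t : Fin N → ℝ) : Measure (Fin N → ℝ) :=
  (volume : Measure (Fin N → ℝ)).withDensity fun x =>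
    if StrictMono (pad x) then
      ENNReal.ofReal
        (Real.Gamma β / (∏ i : Fin (N + 1), Real.Gamma (β * (pad t i.succ - pad t i.castSucc)))
          * ∏ i : Fin (N + 1),
              (pad x i.succ - pad x i.castSucc) ^ (β * (pad t i.succ - pad t i.castSucc) - 1))
    else 0

/-- `Q` is the law of the Dirichlet process with parameter `β` on the space of monotone maps. -/
structure IsDirichletProcess (β : ℝ) (Q : Measure G0) : Prop where
  isProbability : IsProbabilityMeasure Q
  fdd : ∀ (N : ℕ) (t : Fin N → ℝ), StrictMono (pad t) →
    Q.map (fun g i => g (t i)) = dirichletLaw β t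

/-! ## Cylinder functions -/

/-- The derivative of a function on `[0, 1]` (one-sided at the end points). -/
def D01 (φ : ℝ → ℝ) : ℝ → ℝ := derivWithin φ (Icc 0 1)

/-- The vector `(∫₀¹ α_i(g(s)) ds)_i`. -/
def cylArg {m : ℕ} (α : Fin m → ℝ → ℝ) (g : G0) : Fin m → ℝ :=
  fun i => ∫ s in (0 : ℝ)..1, α i (g s)

/-- The partial derivative `∂_i U`. -/
def partialD {m : ℕ} (i : Fin m) (U : (Fin m → ℝ) → ℝ) (x : Fin m → ℝ) : ℝ :=
  fderiv ℝ U x (Pi.single i 1)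

/-- The cylinder functions `g ↦ U(∫ α(g_s) ds)` with `U` and `α` of class `C^k`. -/
def cyl (k : WithTop ℕ∞) : Set (G0 → ℝ) :=
  {u | ∃ (m : ℕ) (U : (Fin m → ℝ) → ℝ) (α : Fin m → ℝ → ℝ),
    ContDiff ℝ k U ∧ (∀ i, ContDiffOn ℝ k (α i) (Icc 0 1)) ∧ u = fun g => U (cylArg α g)}

/-- `U` and `α` are smooth, and `α_i'(0) = α_i'(1) = 0` for all `i`. -/
structure IsSmoothNeumann {m : ℕ} (U : (Fin m → ℝ) → ℝ) (α : Fin m → ℝ → ℝ) : Prop where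
  smooth_U : ContDiff ℝ ∞ U
  smooth_α : ∀ i, ContDiffOn ℝ ∞ (α i) (Icc 0 1)
  left : ∀ i, D01 (α i) 0 = 0
  right : ∀ i, D01 (α i) 1 = 0

/-- The smooth cylinder functions `g ↦ U(∫ α(g_s) ds)` with `α_i'(0) = α_i'(1) = 0`. -/
def cylNeumann : Set (G0 → ℝ) :=
  {u | ∃ (m : ℕ) (U : (Fin m → ℝ) → ℝ) (α : Fin m → ℝ → ℝ),
    IsSmoothNeumann U α ∧ u = fun g => U (cylArg α g)}

/-! ## The gradient and the Wasserstein Dirichlet integral -/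

/-- `w ∈ L²([0, 1], Leb)` is the `L²`-gradient of `u` at `g`: for all directions `f = h - g` whose
flow `t ↦ g + t f` stays for small `t ≥ 0` within the (convex) space of monotone maps, the
derivative of `u` at `g` in direction `f` is `⟨w, f⟩`. The differences of these directions span a
dense subspace of `L²`, so that there is at most one such `w`. -/
def HasGradientAt (u : G0 → ℝ) (g : G0) (w : Lp ℝ 2 leb) : Prop :=
  ∀ h : G0, Tendsto (fun t : ℝ => t⁻¹ * (u (g.segment h t) - u g)) (𝓝[>] 0)
    (𝓝 (∫ s, w s * (h s - g s) ∂leb))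

open Classical in
/-- The gradient of `u` at `g` (and `0` if there is none). -/
def gradAt (u : G0 → ℝ) (g : G0) : Lp ℝ 2 leb :=
  if h : ∃ w, HasGradientAt u g w then h.choose else 0

/-- `𝔼(u, v) = ∫ ⟨𝔻u(g), 𝔻v(g)⟩ dQ(g)`. -/
def wForm (Q : Measure G0) (u v : G0 → ℝ) : ℝ := ∫ g, ⟪gradAt u g, gradAt v g⟫ ∂Q

/-- The graph of the operator `𝔻` from `L²(Q)` to `L²(Q ⊗ Leb)`, with domain the cylinder functions
of class `C¹`. -/
def gradGraph (Q : Measure G0) : Set (Lp ℝ 2 Q × Lp ℝ 2 (Q.prod leb)) :=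
  {p | ∃ f ∈ cyl 1, p.1 =ᵐ[Q] f ∧ ∀ᵐ g ∂Q, (fun s => p.2 (g, s)) =ᵐ[leb] gradAt f g}

/-! ## Drift, directional derivatives and the operator -/

/-- The set of jump locations of `g`. -/
def jumpSet (g : G0) : Set ℝ := {a | Function.leftLim (g : ℝ → ℝ) a ≠ g a}

/-- The drift term `V^β_φ(g)`. -/
def drift (β : ℝ) (φ : ℝ → ℝ) (g : G0) : ℝ :=
  (∑' a : jumpSet g,
    ((D01 φ (g a) + D01 φ (Function.leftLim (g : ℝ → ℝ) a)) / 2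
      - (φ (g a) - φ (Function.leftLim (g : ℝ → ℝ) a))
          / (g a - Function.leftLim (g : ℝ → ℝ) a)))
  + β * ∫ s in (0 : ℝ)..1, D01 φ (g s)

/-- The drift term on the interval, `V^β_{φ,0}(g) = V^β_φ(g) - (φ'(0) + φ'(1)) / 2`. -/
def drift0 (β : ℝ) (φ : ℝ → ℝ) (g : G0) : ℝ := drift β φ g - (D01 φ 0 + D01 φ 1) / 2

/-- The operator `L` on the cylinder function given by `U` and `α`. -/
def opL (β : ℝ) {m : ℕ} (U : (Fin m → ℝ) → ℝ) (α : Fin m → ℝ → ℝ) (g : G0) : ℝ :=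
  (∑ i, ∑ j, partialD i (partialD j U) (cylArg α g)
      * ∫ s in (0 : ℝ)..1, D01 (α i) (g s) * D01 (α j) (g s))
  + ∑ i, partialD i U (cylArg α g) * drift0 β (D01 (α i)) g

/-- The graph of the operator `L` in `L²(Q)`, with domain the smooth cylinder functions
satisfying the boundary conditions. -/
def opGraph (β : ℝ) (Q : Measure G0) : Set (Lp ℝ 2 Q × Lp ℝ 2 Q) :=
  {p | ∃ (m : ℕ) (U : (Fin m → ℝ) → ℝ) (α : Fin m → ℝ → ℝ), IsSmoothNeumann U α ∧
    p.1 =ᵐ[Q] (fun g => U (cylArg α g)) ∧ p.2 =ᵐ[Q] opL β U α}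

/-- `D_φ u(g) = d`: the derivative at `t = 0` of `u(e_{tφ} ∘ g)`, where `e_{tφ}` is the flow of the
vector field `φ` on `[0, 1]`. The curve `γ` is `t ↦ e_{tφ} ∘ g` for `t` near `0`. -/
def HasDirDerivAt (φ : ℝ → ℝ) (u : G0 → ℝ) (g : G0) (d : ℝ) : Prop :=
  ∃ γ : ℝ → G0, γ 0 = g ∧
    (∃ ε > 0, ∀ s ∈ Ico (0 : ℝ) 1, ∀ t ∈ Ioo (-ε) ε,
      HasDerivAt (fun r => γ r s) (φ (γ t s)) t) ∧
    HasDerivAt (fun t => u (γ t)) d 0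

/-- `D_φ* v = w`, where `D_φ*` is the adjoint in `L²(Q)` of the operator `D_φ` defined on the
cylinder functions of class `C¹`. -/
structure IsAdjointValue (Q : Measure G0) (φ : ℝ → ℝ) (v w : G0 → ℝ) : Prop where
  memLp_left : MemLp v 2 Q
  memLp_right : MemLp w 2 Q
  adjoint : ∀ f ∈ cyl 1, ∃ d : G0 → ℝ, MemLp d 2 Q ∧ (∀ g, HasDirDerivAt φ f g (d g)) ∧
    ∫ g, d g * v g ∂Q = ∫ g, f g * w g ∂Q

/-! ## The square field operator -/

/-- `Γ(u, v)(g) = ∫₀¹ F(g, s) G(g, s) ds` for the gradients `F` and `G` of `u` and `v`. -/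
def squareField {Q : Measure G0} (F G : Lp ℝ 2 (Q.prod leb)) (g : G0) : ℝ :=
  ∫ s, F (g, s) * G (g, s) ∂leb

end WassersteinForm

end

open WassersteinForm

noncomputable section

namespace WassersteinForm

/-! Everything rests on integration by parts. For a `C³` field `φ` with `φ(0) = φ(1) = 0`,
differentiation of cylinder functions in the direction `φ ∘ g` has the adjoint `v ↦ -D_φ v - V_φ v`,
with an almost surely bounded drift `V_φ`. At the times of a uniform grid this is a change of
variables: the displacement `x_j ↦ x_j + τ φ(x_j)` preserves the simplex and changes the Dirichlet
density by explicit factors (`integral_shift`); differentiating at `τ = 0` produces a divergence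
term (`integral_dirichletLaw_byParts`). This term is a sum of trapezoidal errors over the gaps, plus
`β` times a Riemann sum of difference quotients, minus boundary values (`gridDrift_eq`). It is
bounded uniformly in the grid, and as the mesh tends to zero only the jumps of `g` survive in the
first sum, because the trapezoidal kernel vanishes on the diagonal (`tendsto_trapSum`,
`tendsto_gridDrift`).

Closability follows by duality. The gradient of a cylinder function is a finite sum of tensors `v(g)
φ(g_s)`. If `f_n → 0` and the gradients of `f_n` converge to `y`, then `y` is orthogonal to the
tensors with `φ(0) = φ(1) = 0`. Almost surely `g_s` lies in `(0, 1)`, so these approximate all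
tensors; hence `y` is orthogonal to the gradients of the `f_n` themselves, and `y = 0`
(`IsDirichletProcess.closure_gradSubmodule_fst_eq_zero`). The closed form is therefore `⟨T u, T v⟩`
for the closed gradient `T`.

The other assertions are properties of `T`. Smooth approximations of `|x|` and weak limits give the
Markov property; `T 1 = 0` and an ergodic argument for the resolvent give recurrence
(`IsMarkovGradient.isRecurrent`). Regularity comes from compactness of `G0` (Helly),
Stone–Weierstrass and positivity of the Dirichlet densities. The smooth functions with boundary
conditions form a core, since `α_i'` can be approximated by functions vanishing at the end points.
Integration by parts identifies `L` as the restriction of the generator to this core, and an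
abstract lemma (`SymmForm.generatorGraph_eq_friedrichsGraph`) identifies the generator with the
Friedrichs extension. Bounded approximating sequences give the product rule, and with it the square
field operator.

The process exists as a limit point of laws of step functions with consistent Dirichlet distributed
values. It is unique because Riemann sums express integrals of cylinder functions through finite
dimensional distributions. -/

instance isProbabilityMeasure_leb : IsProbabilityMeasure leb :=
  ⟨by simp [leb]⟩

theorem ae_mem_Ioo_leb : ∀ᵐ s ∂leb, s ∈ Ioo (0 : ℝ) 1 := by
  rw [leb, ← restrict_Ioo_eq_restrict_Icc]
  exact ae_restrict_mem measurableSet_Ioo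

theorem intervalIntegral_eq_leb (f : ℝ → ℝ) : ∫ s in (0 : ℝ)..1, f s = ∫ s, f s ∂leb := by
  rw [intervalIntegral.integral_of_le zero_le_one, ← integral_Icc_eq_integral_Ioc]

/-! ### Monotone maps: evaluation, segments and the `L²`-distance. -/

namespace G0

theorem apply_of_neg (g : G0) {t : ℝ} (h : t < 0) : g t = 0 := by
  have : t ∉ Ico (0 : ℝ) 1 := fun h' => absurd h'.1 (not_le.2 h)
  simp only [extend, dif_neg this, if_pos h]

theorem apply_of_one_le (g : G0) {t : ℝ} (h : 1 ≤ t) : g t = 1 := by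
  have h1 : t ∉ Ico (0 : ℝ) 1 := fun h' => absurd h'.2 (not_lt.2 h)
  have h2 : ¬ t < 0 := by linarith
  simp only [extend, dif_neg h1, if_neg h2]

theorem measurable (g : G0) : Measurable (g : ℝ → ℝ) := g.monotone.measurable

theorem abs_apply_le (g : G0) (t : ℝ) : |g t| ≤ 1 := by
  rw [abs_of_nonneg (g.apply_mem t).1]; exact (g.apply_mem t).2

theorem tendsto_nhdsGT (g : G0) (t : ℝ) : Tendsto (g : ℝ → ℝ) (𝓝[>] t) (𝓝 (g t)) := by
  rcases lt_or_ge t 0 with h | h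
  · refine tendsto_const_nhds.congr' ?_
    filter_upwards [(eventually_lt_nhds h).filter_mono nhdsWithin_le_nhds] with s hs
    rw [g.apply_of_neg h, g.apply_of_neg hs]
  · rcases lt_or_ge t 1 with h' | h'
    · exact g.tendsto_right ⟨h, h'⟩
    · refine tendsto_const_nhds.congr' ?_
      filter_upwards [self_mem_nhdsWithin] with s hs
      rw [g.apply_of_one_le h', g.apply_of_one_le (h'.trans (le_of_lt hs))]

theorem tendsto_nhdsGE (g : G0) (t : ℝ) : Tendsto (g : ℝ → ℝ) (𝓝[≥] t) (𝓝 (g t)) := by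
  rw [← Ioi_insert, nhdsWithin_insert]
  exact (tendsto_pure_nhds (g : ℝ → ℝ) t).sup (g.tendsto_nhdsGT t)

theorem segment_apply (g h : G0) {t : ℝ} (ht : t ∈ Icc (0 : ℝ) 1) (s : ℝ) :
    g.segment h t s = (1 - t) * g s + t * h s := by
  by_cases hs : s ∈ Ico (0 : ℝ) 1
  · rw [apply_of_mem _ hs, apply_of_mem _ hs, apply_of_mem _ hs]
    simp only [segment, projIcc_of_mem zero_le_one ht]
  · rcases lt_or_ge s 0 with h0 | h0
    · simp [apply_of_neg _ h0]
    · have h1 : 1 ≤ s := by by_contra hc; exact hs ⟨h0, not_le.1 hc⟩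
      simp [apply_of_one_le _ h1]

theorem segment_zero (g h : G0) : g.segment h 0 = g := by
  ext s; simp [segment]

/-- A right continuous monotone function with values in `[0, 1]`, restricted to `[0, 1)`. -/
def ofFun (F : ℝ → ℝ) (hF : Monotone F) (h01 : ∀ t, F t ∈ Icc (0 : ℝ) 1)
    (hc : ∀ t, ContinuousWithinAt F (Ici t) t) : G0 where
  toFun s := ⟨F s, h01 s⟩
  mono := fun s t hst => Subtype.mk_le_mk.2 (hF hst)
  rightCts := by
    intro t
    refine Topology.IsInducing.subtypeVal.continuousWithinAt_iff.2 ?_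
    exact (hc t).comp continuous_subtype_val.continuousWithinAt fun x hx => hx

theorem ofFun_apply (F : ℝ → ℝ) (hF : Monotone F) (h01 : ∀ t, F t ∈ Icc (0 : ℝ) 1)
    (hc : ∀ t, ContinuousWithinAt F (Ici t) t) {s : ℝ} (hs : s ∈ Ico (0 : ℝ) 1) :
    ofFun F hF h01 hc s = F s := by
  rw [apply_of_mem _ hs]; rfl

theorem dist_sq (g h : G0) : dist g h ^ 2 = ∫ s, (g s - h s) ^ 2 ∂leb := by
  have h1 : dist g h = ‖g.toL2 - h.toL2‖ := dist_eq_norm g.toL2 h.toL2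
  rw [h1, ← real_inner_self_eq_norm_sq, L2.inner_def]
  refine integral_congr_ae ?_
  filter_upwards [Lp.coeFn_sub g.toL2 h.toL2, g.memLp.coeFn_toLp, h.memLp.coeFn_toLp] with s h1 h2 h3
  rw [h1, Pi.sub_apply, toL2, h2, toL2, h3, real_inner_self_eq_norm_sq, Real.norm_eq_abs, sq_abs]

/-- All values lie in `[0, 1]`, so dominated convergence turns almost everywhere convergence into
convergence in `L²`. -/
theorem tendsto_of_ae {ι : Type*} {l : Filter ι} [l.IsCountablyGenerated] {g : ι → G0} {g₀ : G0}
    (h : ∀ᵐ s ∂leb, Tendsto (fun i => g i s) l (𝓝 (g₀ s))) : Tendsto g l (𝓝 g₀) := by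
  rw [tendsto_iff_dist_tendsto_zero]
  have : Tendsto (fun i => dist (g i) g₀ ^ 2) l (𝓝 0) := by
    simp_rw [dist_sq]
    rw [show (0 : ℝ) = ∫ s, 0 ∂leb by simp]
    refine tendsto_integral_filter_of_dominated_convergence (fun _ => 1) ?_ ?_ ?_ ?_
    · exact Eventually.of_forall fun i =>
        (((g i).measurable.sub g₀.measurable).pow_const 2).aestronglyMeasurable
    · refine Eventually.of_forall fun i => Eventually.of_forall fun s => ?_
      have h1 := (g i).apply_mem s
      have h2 := g₀.apply_mem s
      rw [Real.norm_eq_abs, abs_of_nonneg (sq_nonneg _)]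
      nlinarith [h1.1, h1.2, h2.1, h2.2]
    · exact integrable_const _
    · filter_upwards [h] with s hs
      have := (hs.sub_const (g₀ s)).pow 2
      simpa using this
  have h2 := this.sqrt
  simpa [Real.sqrt_sq dist_nonneg] using h2

theorem integrable_sub (g h : G0) : Integrable (fun s => g s - h s) leb :=
  (g.memLp.integrable one_le_two).sub (h.memLp.integrable one_le_two)

/-- Nonnegativity of the variance of `|g - h|` under the probability measure `leb`. -/
theorem integral_abs_sub_le (g h : G0) : ∫ s, |g s - h s| ∂leb ≤ dist g h := by
  have h0 : 0 ≤ ∫ s, |g s - h s| ∂leb := integral_nonneg fun _ => abs_nonneg _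
  refine abs_le_of_sq_le_sq' ?_ dist_nonneg |>.2
  rw [dist_sq]
  have hm : MemLp (fun s => |g s - h s|) 2 leb := (g.memLp.sub h.memLp).abs
  have hv := ProbabilityTheory.variance_nonneg (fun s => |g s - h s|) leb
  rw [ProbabilityTheory.variance_eq_sub hm] at hv
  simpa [sq_abs] using hv

/-! ### Compactness -/

/-- The right regularisation of a function on the rationals. -/
def rightReg (x : ℚ → ℝ) (t : ℝ) : ℝ := ⨅ q : {q : ℚ // t < q}, x q

instance (t : ℝ) : Nonempty {q : ℚ // t < q} :=
  let ⟨q, hq⟩ := exists_rat_gt t; ⟨⟨q, hq⟩⟩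

/-- Monotone functions on the rationals with values in `[0, 1]`. -/
def ratMono : Set (ℚ → ℝ) := {x | Monotone x ∧ ∀ q, x q ∈ Icc (0 : ℝ) 1}

/-- Tychonoff: the monotone functions are a closed subset of a product of compact intervals. -/
theorem isCompact_ratMono : IsCompact ratMono := by
  have h1 : IsCompact (Set.pi univ fun _ : ℚ => Icc (0 : ℝ) 1) :=
    isCompact_univ_pi fun _ => isCompact_Icc
  refine h1.of_isClosed_subset ?_ fun x hx q _ => hx.2 q
  have h2 : IsClosed {x : ℚ → ℝ | Monotone x} := by
    have : {x : ℚ → ℝ | Monotone x} = ⋂ (p : ℚ) (q : ℚ) (_ : p ≤ q), {x | x p ≤ x q} := by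
      ext x; simp [Monotone]
    rw [this]
    exact isClosed_iInter fun p => isClosed_iInter fun q => isClosed_iInter fun _ =>
      isClosed_le (continuous_apply p) (continuous_apply q)
  have h3 : IsClosed {x : ℚ → ℝ | ∀ q, x q ∈ Icc (0 : ℝ) 1} := by
    simp only [Set.ofPred_forall]
    exact isClosed_iInter fun q => isClosed_Icc.preimage (continuous_apply q)
  exact h2.inter h3

theorem bddBelow_rightReg {x : ℚ → ℝ} (hx : x ∈ ratMono) (t : ℝ) :
    BddBelow (range fun q : {q : ℚ // t < q} => x q) :=
  ⟨0, by rintro _ ⟨q, rfl⟩; exact (hx.2 q).1⟩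

theorem rightReg_le {x : ℚ → ℝ} (hx : x ∈ ratMono) {t : ℝ} {q : ℚ} (h : t < q) :
    rightReg x t ≤ x q :=
  ciInf_le (bddBelow_rightReg hx t) (⟨q, h⟩ : {q : ℚ // t < q})

theorem le_rightReg {x : ℚ → ℝ} (hx : x ∈ ratMono) {t : ℝ} {q : ℚ} (h : (q : ℝ) ≤ t) :
    x q ≤ rightReg x t :=
  le_ciInf fun p => hx.1 (by exact_mod_cast (h.trans_lt p.2).le)

theorem rightReg_mono {x : ℚ → ℝ} (hx : x ∈ ratMono) : Monotone (rightReg x) := fun _ _ hst =>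
  le_ciInf fun q => rightReg_le hx (hst.trans_lt q.2)

theorem rightReg_mem {x : ℚ → ℝ} (hx : x ∈ ratMono) (t : ℝ) : rightReg x t ∈ Icc (0 : ℝ) 1 := by
  obtain ⟨q, hq⟩ := exists_rat_gt t
  exact ⟨le_ciInf fun q => (hx.2 q).1, (rightReg_le hx hq).trans (hx.2 q).2⟩

theorem rightReg_rightCts {x : ℚ → ℝ} (hx : x ∈ ratMono) (t : ℝ) :
    ContinuousWithinAt (rightReg x) (Ici t) t := by
  rw [ContinuousWithinAt, tendsto_order]
  constructor
  · intro a ha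
    filter_upwards [self_mem_nhdsWithin] with s hs
    exact ha.trans_le (rightReg_mono hx hs)
  · intro a ha
    obtain ⟨q, hq⟩ := exists_lt_of_ciInf_lt ha
    filter_upwards [(eventually_lt_nhds q.2).filter_mono nhdsWithin_le_nhds] with s hs
    exact (rightReg_le hx hs).trans_lt hq

/-- The monotone map given by a monotone function on the rationals. -/
def ofRat (x : ratMono) : G0 :=
  ofFun (rightReg x) (rightReg_mono x.2) (rightReg_mem x.2) (rightReg_rightCts x.2)

theorem ofRat_surjective : Function.Surjective ofRat := by
  intro g
  have hx : (fun q : ℚ => g q) ∈ ratMono :=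
    ⟨fun p q hpq => g.monotone (by exact_mod_cast hpq), fun q => g.apply_mem q⟩
  refine ⟨⟨_, hx⟩, ?_⟩
  ext t
  change rightReg (fun q : ℚ => g q) t = g.toFun t
  rw [← g.apply_of_mem t.2]
  refine le_antisymm ?_ (le_ciInf fun q => g.monotone q.2.le)
  refine le_of_tendsto_of_tendsto tendsto_const_nhds (g.tendsto_nhdsGT t) ?_
  filter_upwards [self_mem_nhdsWithin] with s hs
  obtain ⟨q, hq, hq'⟩ := exists_rat_btwn (show (t : ℝ) < s from hs)
  exact (rightReg_le hx hq).trans (g.monotone hq'.le)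

/-- Helly's argument: at a continuity point `t` of the limit, the values at rationals on both sides
of `t` squeeze `rightReg y t`. The discontinuities are countable, hence null. -/
theorem continuous_ofRat : Continuous ofRat := by
  rw [continuous_iff_continuousAt]
  intro x
  refine tendsto_of_ae ?_
  have hc : {t | ¬ ContinuousAt (rightReg x) t}.Countable :=
    (rightReg_mono x.2).countable_not_continuousAt
  have h0 : ∀ᵐ t ∂leb, ContinuousAt (rightReg x) t :=
    ae_restrict_of_ae (hc.ae_notMem volume |>.mono fun t ht => by simpa using ht)
  filter_upwards [h0, ae_mem_Ioo_leb] with t ht ht01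
  have e : ∀ y : ratMono, ofRat y t = rightReg y t := fun y =>
    ofFun_apply _ _ _ _ ⟨ht01.1.le, ht01.2⟩
  simp only [e]
  have hev : ∀ q : ℚ, Tendsto (fun y : ratMono => (y : ℚ → ℝ) q) (𝓝 x) (𝓝 ((x : ℚ → ℝ) q)) :=
    fun q => ((continuous_apply q).comp continuous_subtype_val).tendsto x
  rw [tendsto_order]
  constructor
  · intro a ha
    obtain ⟨l, hl, hl'⟩ := exists_Ioc_subset_of_mem_nhds
      (ht.eventually (lt_mem_nhds ha)) (exists_lt t)
    obtain ⟨q, hq, hqt⟩ := exists_rat_btwn hl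
    -- Two rationals below `t` are needed, since `rightReg x r ≤ x q` requires `r < q`.
    obtain ⟨r, hr, hrq⟩ := exists_rat_btwn hq
    have h1 : a < rightReg x r := hl' ⟨hr, (hrq.trans hqt).le⟩
    have h2 : a < (x : ℚ → ℝ) q := h1.trans_le (rightReg_le x.2 hrq)
    filter_upwards [(hev q).eventually (lt_mem_nhds h2)] with y hy
    exact hy.trans_le (le_rightReg y.2 hqt.le)
  · intro a ha
    obtain ⟨q, hq⟩ := exists_lt_of_ciInf_lt ha
    filter_upwards [(hev q).eventually (gt_mem_nhds hq)] with y hy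
    exact (rightReg_le y.2 q.2).trans_lt hy

instance : CompactSpace G0 := by
  have : CompactSpace ratMono := isCompact_iff_compactSpace.1 isCompact_ratMono
  refine ⟨?_⟩
  rw [← ofRat_surjective.range_eq, ← image_univ]
  exact isCompact_univ.image continuous_ofRat

instance : SecondCountableTopology G0 := UniformSpace.secondCountable_of_separable G0

/-! ### Evaluation -/

theorem intervalIntegrable (g : G0) (a b : ℝ) : IntervalIntegrable (g : ℝ → ℝ) volume a b :=
  g.monotone.intervalIntegrable

/-- Outside `[0, 1]` the extensions of `g` and `h` agree, so the interval of integration is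
arbitrary. -/
theorem abs_integral_sub_le (g h : G0) {a b : ℝ} (hab : a ≤ b) :
    |(∫ r in a..b, g r) - ∫ r in a..b, h r| ≤ dist g h := by
  rw [← intervalIntegral.integral_sub (g.intervalIntegrable a b) (h.intervalIntegrable a b)]
  refine le_trans ?_ (integral_abs_sub_le g h)
  refine (intervalIntegral.abs_integral_le_integral_abs hab).trans ?_
  rw [intervalIntegral.integral_of_le hab]
  have hz : ∀ s, s ∉ Icc (0 : ℝ) 1 → |g s - h s| = 0 := by
    intro s hs
    rcases lt_or_ge s 0 with h0 | h0
    · simp [apply_of_neg _ h0]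
    · have h1 : 1 ≤ s := by by_contra hc; exact hs ⟨h0, (not_le.1 hc).le⟩
      simp [apply_of_one_le _ h1]
  rw [show ∫ s, |g s - h s| ∂leb = ∫ s, |g s - h s| from
    setIntegral_eq_integral_of_forall_compl_eq_zero hz]
  refine setIntegral_le_integral ?_ (Eventually.of_forall fun _ => abs_nonneg _)
  refine (integrableOn_iff_integrable_of_support_subset (s := Icc (0 : ℝ) 1) ?_).1
    (integrable_sub g h).abs
  intro s hs
  by_contra hc
  exact hs (hz s hc)

theorem abs_integral_le (g : G0) (a b : ℝ) : |∫ r in a..b, g r| ≤ |b - a| := by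
  have := intervalIntegral.norm_integral_le_of_norm_le_const (C := 1) (f := (g : ℝ → ℝ)) (a := a)
    (b := b) fun x _ => g.abs_apply_le x
  simpa using this

theorem continuous_integral (δ : ℝ) (hδ : 0 ≤ δ) :
    Continuous fun p : G0 × ℝ => ∫ r in p.2..(p.2 + δ), p.1 r := by
  rw [continuous_iff_continuousAt]
  rintro ⟨g, s⟩
  rw [ContinuousAt, tendsto_iff_dist_tendsto_zero]
  refine squeeze_zero (fun _ => dist_nonneg)
    (g := fun p : G0 × ℝ => dist p.1 g + (|p.2 - s| + |p.2 - s|)) ?_ ?_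
  · rintro ⟨h, u⟩
    rw [Real.dist_eq]
    have h1 := abs_integral_sub_le h g (show u ≤ u + δ by linarith)
    have h2 : (∫ r in u..(u + δ), g r) - ∫ r in s..(s + δ), g r
        = (∫ r in (s + δ)..(u + δ), g r) - ∫ r in s..u, g r := by
      have a1 := intervalIntegral.integral_add_adjacent_intervals (g.intervalIntegrable s u)
        (g.intervalIntegrable u (u + δ))
      have a2 := intervalIntegral.integral_add_adjacent_intervals (g.intervalIntegrable s (s + δ))
        (g.intervalIntegrable (s + δ) (u + δ))
      linarith
    have h3 := g.abs_integral_le (s + δ) (u + δ)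
    have h4 := g.abs_integral_le s u
    rw [show u + δ - (s + δ) = u - s by ring] at h3
    have h5 := abs_sub (∫ r in (s + δ)..(u + δ), g r) (∫ r in s..u, g r)
    rw [← h2] at h5
    have h6 := abs_sub_le (∫ r in u..(u + δ), h r) (∫ r in u..(u + δ), g r)
      (∫ r in s..(s + δ), g r)
    dsimp only
    linarith
  · have : Continuous fun p : G0 × ℝ => dist p.1 g + (|p.2 - s| + |p.2 - s|) := by fun_prop
    have h := this.tendsto (g, s)
    simpa using h

/-- The mean of `g` over `[s, s + δ]`. -/
def avg (δ : ℝ) (g : G0) (s : ℝ) : ℝ := δ⁻¹ * ∫ r in s..(s + δ), g r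

theorem continuous_avg {δ : ℝ} (hδ : 0 ≤ δ) : Continuous fun p : G0 × ℝ => avg δ p.1 p.2 :=
  continuous_const.mul (continuous_integral δ hδ)

theorem le_avg (g : G0) {δ : ℝ} (hδ : 0 < δ) (s : ℝ) : g s ≤ avg δ g s := by
  have := intervalIntegral.integral_mono_on (f := fun _ => g s) (g := g) (a := s) (b := s + δ)
    (by linarith) (by simp) (g.intervalIntegrable _ _) (fun x hx => g.monotone hx.1)
  rw [intervalIntegral.integral_const, smul_eq_mul, add_sub_cancel_left] at this
  rw [avg, inv_mul_eq_div, le_div_iff₀ hδ]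
  linarith

theorem avg_le (g : G0) {δ : ℝ} (hδ : 0 < δ) (s : ℝ) : avg δ g s ≤ g (s + δ) := by
  have := intervalIntegral.integral_mono_on (g := fun _ => g (s + δ)) (f := g) (a := s) (b := s + δ)
    (by linarith) (g.intervalIntegrable _ _) (by simp) (fun x hx => g.monotone hx.2)
  rw [intervalIntegral.integral_const, smul_eq_mul, add_sub_cancel_left] at this
  rw [avg, inv_mul_eq_div, div_le_iff₀ hδ]
  linarith

theorem tendsto_avg (g : G0) (s : ℝ) {δ : ℕ → ℝ} (hδ : ∀ n, 0 < δ n)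
    (h : Tendsto δ atTop (𝓝 0)) : Tendsto (fun n => avg (δ n) g s) atTop (𝓝 (g s)) := by
  refine tendsto_of_tendsto_of_tendsto_of_le_of_le tendsto_const_nhds
    ?_ (fun n => g.le_avg (hδ n) s) (fun n => g.avg_le (hδ n) s)
  refine (g.tendsto_nhdsGT s).comp (tendsto_nhdsWithin_iff.2 ⟨?_, ?_⟩)
  · simpa using h.const_add s
  · exact Eventually.of_forall fun n => by simpa using hδ n

/-- Evaluation is not continuous in `g`. The forward means `avg δ` are jointly continuous and
converge to it by right continuity. -/
theorem measurable_eval : Measurable fun p : G0 × ℝ => p.1 p.2 := by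
  refine measurable_of_tendsto_metrizable (f := fun (n : ℕ) (p : G0 × ℝ) =>
    avg (1 / ((n : ℝ) + 1)) p.1 p.2) (fun n => (continuous_avg (by positivity)).measurable) ?_
  rw [tendsto_pi_nhds]
  exact fun p => tendsto_avg p.1 p.2 (fun n => by positivity) tendsto_one_div_add_atTop_nhds_zero_nat

theorem measurable_eval_at (t : ℝ) : Measurable fun g : G0 => g t :=
  measurable_eval.comp (measurable_id.prodMk measurable_const)

theorem measurable_eval_pi {ι : Type*} (t : ι → ℝ) : Measurable fun (g : G0) i => g (t i) :=
  measurable_pi_iff.2 fun i => measurable_eval_at (t i)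

/-! ### Lebesgue measure under a monotone map -/

/-- If `g s < c < h s`, then `g < c` persists up to some `u > s` by right continuity, while `h < c`
is possible only up to `s`. The two laws then give different mass to `(-∞, c)`. -/
theorem le_of_map_leb_eq {g h : G0} (hgh : leb.map (g : ℝ → ℝ) = leb.map (h : ℝ → ℝ))
    {s : ℝ} (hs : s ∈ Ico (0 : ℝ) 1) : h s ≤ g s := by
  by_contra! hlt
  obtain ⟨c, hc, hc'⟩ := exists_between hlt
  have h1 := (g.tendsto_right hs).eventually (gt_mem_nhds hc)
  have h2 : ∀ᶠ r in 𝓝[>] s, r < 1 := (eventually_lt_nhds hs.2).filter_mono nhdsWithin_le_nhds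
  obtain ⟨u, ⟨hu, hu1⟩, hsu⟩ := ((h1.and h2).and self_mem_nhdsWithin).exists
  have hsu' : s < u := hsu
  have e : leb ((g : ℝ → ℝ) ⁻¹' Iio c) = leb ((h : ℝ → ℝ) ⁻¹' Iio c) := by
    rw [← Measure.map_apply g.measurable measurableSet_Iio,
      ← Measure.map_apply h.measurable measurableSet_Iio, hgh]
  have l1 : ENNReal.ofReal u ≤ leb ((g : ℝ → ℝ) ⁻¹' Iio c) := by
    calc ENNReal.ofReal u = leb (Icc 0 u) := by
          rw [leb, Measure.restrict_apply measurableSet_Icc,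
            inter_eq_self_of_subset_left (Icc_subset_Icc_right hu1.le), Real.volume_Icc, sub_zero]
      _ ≤ _ := measure_mono fun r hr => (g.monotone hr.2).trans_lt hu
  have l2 : leb ((h : ℝ → ℝ) ⁻¹' Iio c) ≤ ENNReal.ofReal s := by
    rw [leb, Measure.restrict_apply (h.measurable measurableSet_Iio)]
    calc volume ((h : ℝ → ℝ) ⁻¹' Iio c ∩ Icc 0 1) ≤ volume (Icc 0 s) := by
          refine measure_mono fun r hr => ⟨hr.2.1, ?_⟩
          by_contra! hsr
          exact absurd ((h.monotone hsr.le).trans_lt hr.1) (not_lt.2 hc'.le)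
      _ = ENNReal.ofReal s := by rw [Real.volume_Icc, sub_zero]
  rw [e] at l1
  have := (ENNReal.ofReal_le_ofReal_iff hs.1).1 (l1.trans l2)
  linarith

theorem ext_of_map_leb {g h : G0} (hgh : leb.map (g : ℝ → ℝ) = leb.map (h : ℝ → ℝ)) : g = h := by
  ext t
  rw [← g.apply_of_mem t.2, ← h.apply_of_mem t.2]
  exact le_antisymm (le_of_map_leb_eq hgh.symm t.2) (le_of_map_leb_eq hgh t.2)

/-- The two integrals are the real and imaginary parts of the characteristic function of the law of
`g` under `leb`, and this law determines `g`. -/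
theorem ext_of_integral_cos_sin {g h : G0}
    (hcos : ∀ ξ : ℝ, ∫ s, Real.cos (ξ * g s) ∂leb = ∫ s, Real.cos (ξ * h s) ∂leb)
    (hsin : ∀ ξ : ℝ, ∫ s, Real.sin (ξ * g s) ∂leb = ∫ s, Real.sin (ξ * h s) ∂leb) : g = h := by
  refine ext_of_map_leb ?_
  have : IsProbabilityMeasure (leb.map (g : ℝ → ℝ)) :=
    Measure.isProbabilityMeasure_map g.measurable.aemeasurable
  have : IsProbabilityMeasure (leb.map (h : ℝ → ℝ)) :=
    Measure.isProbabilityMeasure_map h.measurable.aemeasurable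
  refine Measure.ext_of_charFun ?_
  have key : ∀ (k : G0) (ξ : ℝ), charFun (leb.map (k : ℝ → ℝ)) ξ =
      (∫ s, Real.cos (ξ * k s) ∂leb : ℝ) + (∫ s, Real.sin (ξ * k s) ∂leb : ℝ) * Complex.I := by
    intro k ξ
    rw [charFun_apply_real, integral_map k.measurable.aemeasurable (by fun_prop)]
    have e : ∀ s, Complex.exp (ξ * (k s) * Complex.I)
        = ((Real.cos (ξ * k s) : ℝ) : ℂ) + ((Real.sin (ξ * k s) : ℝ) : ℂ) * Complex.I := by
      intro s
      rw [Complex.exp_mul_I]; push_cast; rfl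
    simp_rw [e]
    have hb : ∀ f : ℝ → ℝ, Continuous f → (∀ x, |f x| ≤ 1) →
        Integrable (fun s => ((f (ξ * k s) : ℝ) : ℂ)) leb := fun f hf h1 =>
      (Integrable.of_bound ((hf.measurable.comp
        (k.measurable.const_mul ξ)).aestronglyMeasurable) 1
          (Eventually.of_forall fun s => h1 _)).ofReal
    rw [integral_add (hb _ Real.continuous_cos Real.abs_cos_le_one)
      ((hb _ Real.continuous_sin Real.abs_sin_le_one).mul_const _), integral_mul_const,
      integral_complex_ofReal, integral_complex_ofReal]
  funext ξ
  rw [key, key, hcos, hsin]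

end G0

/-! ### Extension of functions on the unit interval -/

/-- The derivative is extended by induction and then integrated; the base case extends by constants
beyond the end points. -/
theorem exists_contDiff_extension (n : ℕ) : ∀ f : ℝ → ℝ, ContDiffOn ℝ n f (Icc 0 1) →
    ∃ F : ℝ → ℝ, ContDiff ℝ n F ∧ EqOn F f (Icc 0 1) := by
  induction n with
  | zero =>
    intro f hf
    have hc : ContinuousOn f (Icc 0 1) := hf.continuousOn
    refine ⟨IccExtend (zero_le_one' ℝ) ((Icc 0 1).domRestrict f), ?_, ?_⟩
    · exact contDiff_zero.2 (hc.domRestrict.Icc_extend')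
    · intro x hx
      rw [IccExtend_of_mem _ _ hx]; rfl
  | succ n ih =>
    intro f hf
    have hu : UniqueDiffOn ℝ (Icc (0 : ℝ) 1) := uniqueDiffOn_Icc zero_lt_one
    have h := (contDiffOn_succ_iff_derivWithin (n := (n : WithTop ℕ∞)) hu).1 (by exact_mod_cast hf)
    obtain ⟨G, hG, hGf⟩ := ih _ h.2.2
    have hd : ∀ x, HasDerivAt (fun x => f 0 + ∫ r in (0 : ℝ)..x, G r) (G x) x := fun x =>
      (hG.continuous.integral_hasStrictDerivAt 0 x).hasDerivAt.const_add _
    refine ⟨fun x => f 0 + ∫ r in (0 : ℝ)..x, G r, ?_, ?_⟩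
    · have : ContDiff ℝ ((n : WithTop ℕ∞) + 1) (fun x => f 0 + ∫ r in (0 : ℝ)..x, G r) := by
        rw [contDiff_succ_iff_deriv]
        refine ⟨fun x => (hd x).differentiableAt, by simp, ?_⟩
        rwa [show deriv (fun x => f 0 + ∫ r in (0 : ℝ)..x, G r) = G from
          funext fun x => (hd x).deriv]
      exact_mod_cast this
    · intro x hx
      have := intervalIntegral.integral_eq_sub_of_hasDerivAt_of_le (f := f) (f' := G) hx.1
        (h.1.continuousOn.mono (Icc_subset_Icc_right hx.2)) (fun y hy => ?_)
        (hG.continuous.intervalIntegrable 0 x)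
      · simp [this]
      · have hy' : y ∈ Ioo (0 : ℝ) 1 := ⟨hy.1, hy.2.trans_le hx.2⟩
        have := (h.1 y (Ioo_subset_Icc_self hy')).hasDerivWithinAt
        rw [← hGf (Ioo_subset_Icc_self hy')] at this
        exact this.hasDerivAt (Icc_mem_nhds hy'.1 hy'.2)

theorem D01_eq_deriv {f F : ℝ → ℝ} (hF : Differentiable ℝ F) (h : EqOn F f (Icc 0 1)) :
    EqOn (D01 f) (deriv F) (Icc 0 1) := by
  intro x hx
  rw [D01, ← derivWithin_congr h (h hx)]
  exact (hF x).derivWithin (uniqueDiffOn_Icc zero_lt_one x hx)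

theorem cylArg_congr {m : ℕ} {α A : Fin m → ℝ → ℝ} (h : ∀ i, EqOn (A i) (α i) (Icc 0 1)) :
    cylArg α = cylArg A := by
  funext g i
  simp only [cylArg]
  exact intervalIntegral.integral_congr fun s _ => (h i (g.apply_mem s)).symm

theorem exists_globalRep {m n : ℕ} {α : Fin m → ℝ → ℝ}
    (h : ∀ i, ContDiffOn ℝ n (α i) (Icc 0 1)) :
    ∃ A : Fin m → ℝ → ℝ, (∀ i, ContDiff ℝ n (A i)) ∧ (∀ i, EqOn (A i) (α i) (Icc 0 1)) := by
  choose A hA hA' using fun i => exists_contDiff_extension n (α i) (h i)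
  exact ⟨A, hA, hA'⟩

/-- Only the values of `α i` on `[0, 1]` matter, so globally `C¹` representatives are available and
one-sided derivatives disappear. -/
theorem mem_cyl_one_iff {f : G0 → ℝ} : f ∈ cyl 1 ↔
    ∃ (m : ℕ) (U : (Fin m → ℝ) → ℝ) (A : Fin m → ℝ → ℝ),
      ContDiff ℝ 1 U ∧ (∀ i, ContDiff ℝ 1 (A i)) ∧ f = fun g => U (cylArg A g) := by
  constructor
  · rintro ⟨m, U, α, hU, hα, rfl⟩
    obtain ⟨A, hA, hA'⟩ := exists_globalRep (n := 1) (fun i => by exact_mod_cast hα i)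
    refine ⟨m, U, A, hU, fun i => by exact_mod_cast hA i, ?_⟩
    rw [cylArg_congr hA']
  · rintro ⟨m, U, A, hU, hA, rfl⟩
    exact ⟨m, U, A, hU, fun i => (hA i).contDiffOn, rfl⟩

/-! ### Algebra of cylinder functions -/

theorem cylArg_append_castAdd {m n : ℕ} (α : Fin m → ℝ → ℝ) (α' : Fin n → ℝ → ℝ) (g : G0) :
    (fun i => cylArg (Fin.append α α') g (Fin.castAdd n i)) = cylArg α g := by
  funext i; simp [cylArg]

theorem cylArg_append_natAdd {m n : ℕ} (α : Fin m → ℝ → ℝ) (α' : Fin n → ℝ → ℝ) (g : G0) :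
    (fun i => cylArg (Fin.append α α') g (Fin.natAdd m i)) = cylArg α' g := by
  funext i; simp [cylArg]

theorem contDiff_append {m n : ℕ} {k : WithTop ℕ∞} {U : (Fin m → ℝ) → ℝ} {U' : (Fin n → ℝ) → ℝ}
    {Φ : ℝ × ℝ → ℝ} (hΦ : ContDiff ℝ k Φ) (hU : ContDiff ℝ k U) (hU' : ContDiff ℝ k U') :
    ContDiff ℝ k fun x : Fin (m + n) → ℝ =>
      Φ (U fun i => x (Fin.castAdd n i), U' fun i => x (Fin.natAdd m i)) := by
  refine hΦ.comp ((hU.comp ?_).prodMk (hU'.comp ?_))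
  · exact contDiff_pi.2 fun i => contDiff_apply ℝ ℝ _
  · exact contDiff_pi.2 fun i => contDiff_apply ℝ ℝ _

/-- Concatenating the two vectors `α` and `α'` makes both functions depend on one common argument.
-/
theorem cyl_comp₂ {k : WithTop ℕ∞} {Φ : ℝ × ℝ → ℝ} (hΦ : ContDiff ℝ k Φ) {f h : G0 → ℝ}
    (hf : f ∈ cyl k) (hh : h ∈ cyl k) : (fun g => Φ (f g, h g)) ∈ cyl k := by
  obtain ⟨m, U, α, hU, hα, rfl⟩ := hf
  obtain ⟨n, U', α', hU', hα', rfl⟩ := hh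
  refine ⟨m + n, _, Fin.append α α', contDiff_append hΦ hU hU', ?_, ?_⟩
  · intro i
    refine Fin.addCases (fun i => ?_) (fun i => ?_) i
    · simpa using hα i
    · simpa using hα' i
  · funext g
    rw [cylArg_append_castAdd, cylArg_append_natAdd]

theorem cylNeumann_comp₂ {Φ : ℝ × ℝ → ℝ} (hΦ : ContDiff ℝ ∞ Φ) {f h : G0 → ℝ}
    (hf : f ∈ cylNeumann) (hh : h ∈ cylNeumann) : (fun g => Φ (f g, h g)) ∈ cylNeumann := by
  obtain ⟨m, U, α, hα, rfl⟩ := hf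
  obtain ⟨n, U', α', hα', rfl⟩ := hh
  refine ⟨m + n, _, Fin.append α α', ⟨contDiff_append hΦ hα.smooth_U hα'.smooth_U, ?_, ?_, ?_⟩, ?_⟩
  · intro i
    refine Fin.addCases (fun i => ?_) (fun i => ?_) i
    · simpa using hα.smooth_α i
    · simpa using hα'.smooth_α i
  · intro i
    refine Fin.addCases (fun i => ?_) (fun i => ?_) i
    · simpa using hα.left i
    · simpa using hα'.left i
  · intro i
    refine Fin.addCases (fun i => ?_) (fun i => ?_) i
    · simpa using hα.right i
    · simpa using hα'.right i
  · funext g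
    rw [cylArg_append_castAdd, cylArg_append_natAdd]

theorem cylNeumann_subset : cylNeumann ⊆ cyl 1 := by
  rintro f ⟨m, U, α, hα, rfl⟩
  exact ⟨m, U, α, hα.smooth_U.of_le (by exact_mod_cast le_top),
    fun i => (hα.smooth_α i).of_le (by exact_mod_cast le_top), rfl⟩

theorem const_mem_cylNeumann (c : ℝ) : (fun _ => c) ∈ cylNeumann :=
  ⟨0, fun _ => c, fun _ _ => 0, ⟨contDiff_const, fun i => i.elim0, fun i => i.elim0,
    fun i => i.elim0⟩, rfl⟩

theorem const_mem_cyl (c : ℝ) : (fun _ => c) ∈ cyl 1 := cylNeumann_subset (const_mem_cylNeumann c)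

section CylOps

variable {f h : G0 → ℝ}

theorem cyl_add (hf : f ∈ cyl 1) (hh : h ∈ cyl 1) : f + h ∈ cyl 1 :=
  cyl_comp₂ (Φ := fun p => p.1 + p.2) (by fun_prop) hf hh

theorem cyl_mul (hf : f ∈ cyl 1) (hh : h ∈ cyl 1) : f * h ∈ cyl 1 :=
  cyl_comp₂ (Φ := fun p => p.1 * p.2) (by fun_prop) hf hh

theorem cyl_smul (c : ℝ) (hf : f ∈ cyl 1) : c • f ∈ cyl 1 :=
  cyl_comp₂ (Φ := fun p => c * p.1) (by fun_prop) hf hf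

theorem cyl_comp {ψ : ℝ → ℝ} (hψ : ContDiff ℝ 1 ψ) (hf : f ∈ cyl 1) : ψ ∘ f ∈ cyl 1 :=
  cyl_comp₂ (Φ := fun p => ψ p.1) (by fun_prop) hf hf

theorem cylNeumann_add (hf : f ∈ cylNeumann) (hh : h ∈ cylNeumann) : f + h ∈ cylNeumann :=
  cylNeumann_comp₂ (Φ := fun p => p.1 + p.2) (by fun_prop) hf hh

theorem cylNeumann_smul (c : ℝ) (hf : f ∈ cylNeumann) : c • f ∈ cylNeumann :=
  cylNeumann_comp₂ (Φ := fun p => c * p.1) (by fun_prop) hf hf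

end CylOps

/-! ### Continuity and bounds -/

theorem exists_bound_Icc {a : ℝ → ℝ} (ha : Continuous a) :
    ∃ C, 0 ≤ C ∧ ∀ x ∈ Icc (0 : ℝ) 1, |a x| ≤ C := by
  obtain ⟨C, hC⟩ := isCompact_Icc.exists_bound_of_continuousOn (s := Icc (0 : ℝ) 1) ha.continuousOn
  exact ⟨C, (norm_nonneg _).trans (hC 0 (by simp)), hC⟩

theorem exists_lipschitz_Icc {a : ℝ → ℝ} (ha : ContDiff ℝ 1 a) :
    ∃ C, 0 ≤ C ∧ ∀ x ∈ Icc (0 : ℝ) 1, ∀ y ∈ Icc (0 : ℝ) 1, |a y - a x| ≤ C * |y - x| := by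
  obtain ⟨C, hC0, hC⟩ := exists_bound_Icc (ha.continuous_deriv (le_refl _))
  refine ⟨C, hC0, fun x hx y hy => ?_⟩
  exact (convex_Icc (0 : ℝ) 1).norm_image_sub_le_of_norm_deriv_le
    (fun z _ => (ha.differentiable one_ne_zero) z) hC hx hy

theorem measurable_comp_eval {a : ℝ → ℝ} (ha : Measurable a) :
    Measurable fun p : G0 × ℝ => a (p.1 p.2) := ha.comp G0.measurable_eval

theorem integrable_comp_apply {a : ℝ → ℝ} (ha : Continuous a) (g : G0) :
    Integrable (fun s => a (g s)) leb := by
  obtain ⟨C, -, hC⟩ := exists_bound_Icc ha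
  exact Integrable.of_bound (ha.measurable.comp g.measurable).aestronglyMeasurable C
    (Eventually.of_forall fun s => hC _ (g.apply_mem s))

/-- A `C¹` function is Lipschitz on `[0, 1]`, so each coordinate is Lipschitz for the `L¹`-distance,
and this is dominated by the metric. -/
theorem continuous_cylArg {m : ℕ} {A : Fin m → ℝ → ℝ} (hA : ∀ i, ContDiff ℝ 1 (A i)) :
    Continuous (cylArg A) := by
  refine continuous_pi fun i => ?_
  obtain ⟨C, hC0, hC⟩ := exists_lipschitz_Icc (hA i)
  simp only [cylArg, intervalIntegral_eq_leb]
  refine (LipschitzWith.of_dist_le_mul (K := C.toNNReal) fun g h => ?_).continuous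
  rw [Real.dist_eq, Real.coe_toNNReal C hC0,
    ← integral_sub (integrable_comp_apply (hA i).continuous g)
      (integrable_comp_apply (hA i).continuous h)]
  calc |∫ s, (A i (g s) - A i (h s)) ∂leb| ≤ ∫ s, |A i (g s) - A i (h s)| ∂leb :=
        abs_integral_le_integral_abs
    _ ≤ ∫ s, C * |g s - h s| ∂leb := by
        refine integral_mono_of_nonneg (Eventually.of_forall fun _ => abs_nonneg _)
          ((G0.integrable_sub g h).abs.const_mul C) (Eventually.of_forall fun s => ?_)
        exact hC _ (h.apply_mem s) _ (g.apply_mem s)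
    _ = C * ∫ s, |g s - h s| ∂leb := integral_const_mul _ _
    _ ≤ C * dist g h := mul_le_mul_of_nonneg_left (G0.integral_abs_sub_le g h) hC0

theorem cyl_continuous {f : G0 → ℝ} (hf : f ∈ cyl 1) : Continuous f := by
  obtain ⟨m, U, A, hU, hA, rfl⟩ := mem_cyl_one_iff.1 hf
  exact hU.continuous.comp (continuous_cylArg hA)

theorem exists_bound_of_continuous {f : G0 → ℝ} (hf : Continuous f) :
    ∃ C, 0 ≤ C ∧ ∀ g, |f g| ≤ C := by
  obtain ⟨C, hC⟩ := isCompact_univ.exists_bound_of_continuousOn (hf.continuousOn (s := univ))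
  exact ⟨max C 0, le_max_right _ _, fun g => (hC g (mem_univ g)).trans (le_max_left _ _)⟩

theorem continuous_partialD {m : ℕ} {U : (Fin m → ℝ) → ℝ} (hU : ContDiff ℝ 1 U) (i : Fin m) :
    Continuous (partialD i U) := by
  have := hU.continuous_fderiv one_ne_zero
  exact this.clm_apply continuous_const

theorem fderiv_eq_sum_partialD {m : ℕ} (U : (Fin m → ℝ) → ℝ) (x v : Fin m → ℝ) :
    fderiv ℝ U x v = ∑ i, partialD i U x * v i := by
  conv_lhs => rw [← Finset.univ_sum_single v, map_sum]
  refine Finset.sum_congr rfl fun i _ => ?_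
  have : (Pi.single i (v i) : Fin m → ℝ) = v i • Pi.single i 1 := by
    rw [← Pi.single_smul, smul_eq_mul, mul_one]
  rw [this, map_smul, smul_eq_mul, mul_comm]; rfl

/-! ### Derivatives along curves -/

/-- The bound `R` confines the curve to a compact interval, on which `deriv a` is bounded; this
dominates the differentiated integrand. -/
theorem hasDerivAt_integral_comp {a : ℝ → ℝ} (ha : ContDiff ℝ 1 a) {c c' : ℝ → ℝ → ℝ} {ε M R : ℝ}
    (hε : 0 < ε) (hcm : ∀ t ∈ Ioo (-ε) ε, Measurable (c t)) (hc'm : Measurable (c' 0))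
    (hR : ∀ t ∈ Ioo (-ε) ε, ∀ s ∈ Ioo (0 : ℝ) 1, |c t s| ≤ R)
    (hM : ∀ t ∈ Ioo (-ε) ε, ∀ s ∈ Ioo (0 : ℝ) 1, |c' t s| ≤ M)
    (hd : ∀ t ∈ Ioo (-ε) ε, ∀ s ∈ Ioo (0 : ℝ) 1, HasDerivAt (fun r => c r s) (c' t s) t) :
    HasDerivAt (fun t => ∫ s, a (c t s) ∂leb) (∫ s, deriv a (c 0 s) * c' 0 s ∂leb) 0 := by
  have ha' := ha.continuous_deriv (le_refl _)
  obtain ⟨C, hC⟩ := (isCompact_Icc (a := -R) (b := R)).exists_bound_of_continuousOn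
    ha'.continuousOn
  obtain ⟨C0, hC0⟩ := (isCompact_Icc (a := -R) (b := R)).exists_bound_of_continuousOn
    ha.continuous.continuousOn
  have h0 : (0 : ℝ) ∈ Ioo (-ε) ε := ⟨by linarith, hε⟩
  refine (hasDerivAt_integral_of_dominated_loc_of_deriv_le (F := fun t s => a (c t s))
    (F' := fun t s => deriv a (c t s) * c' t s) (bound := fun _ => C * M) (Ioo_mem_nhds h0.1 h0.2)
    ?_ ?_ ?_ ?_ ?_ ?_).2
  · filter_upwards [Ioo_mem_nhds h0.1 h0.2] with t ht
    exact (ha.continuous.measurable.comp (hcm t ht)).aestronglyMeasurable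
  · refine Integrable.of_bound (ha.continuous.measurable.comp (hcm 0 h0)).aestronglyMeasurable C0 ?_
    filter_upwards [ae_mem_Ioo_leb] with s hs
    exact hC0 _ (abs_le.1 (hR 0 h0 s hs))
  · exact ((ha'.measurable.comp (hcm 0 h0)).mul hc'm).aestronglyMeasurable
  · filter_upwards [ae_mem_Ioo_leb] with s hs t ht
    rw [norm_mul]
    have h1 := hC _ (abs_le.1 (hR t ht s hs))
    exact mul_le_mul h1 (hM t ht s hs) (norm_nonneg _) ((norm_nonneg _).trans h1)
  · exact integrable_const _
  · filter_upwards [ae_mem_Ioo_leb] with s hs t ht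
    exact ((ha.differentiable one_ne_zero) _).hasDerivAt.comp t (hd t ht s hs)

/-- The gradient of a cylinder function. -/
def cylGrad {m : ℕ} (U : (Fin m → ℝ) → ℝ) (A : Fin m → ℝ → ℝ) (p : G0 × ℝ) : ℝ :=
  ∑ i, partialD i U (cylArg A p.1) * deriv (A i) (p.1 p.2)

section CylGrad

variable {m : ℕ} {U : (Fin m → ℝ) → ℝ} {A : Fin m → ℝ → ℝ}

theorem continuous_partialD_cylArg (hU : ContDiff ℝ 1 U) (hA : ∀ i, ContDiff ℝ 1 (A i))
    (i : Fin m) : Continuous fun g => partialD i U (cylArg A g) :=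
  (continuous_partialD hU i).comp (continuous_cylArg hA)

theorem measurable_cylGrad (hU : ContDiff ℝ 1 U) (hA : ∀ i, ContDiff ℝ 1 (A i)) :
    Measurable (cylGrad U A) :=
  Finset.measurable_fun_sum _ fun i _ =>
    ((continuous_partialD_cylArg hU hA i).measurable.comp measurable_fst).mul
      (measurable_comp_eval ((hA i).continuous_deriv (le_refl _)).measurable)

theorem exists_bound_cylGrad (hU : ContDiff ℝ 1 U) (hA : ∀ i, ContDiff ℝ 1 (A i)) :
    ∃ C, ∀ p, |cylGrad U A p| ≤ C := by
  choose B hB0 hB using fun i => exists_bound_of_continuous (continuous_partialD_cylArg hU hA i)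
  choose C hC0 hC using fun i => exists_bound_Icc ((hA i).continuous_deriv (le_refl _))
  refine ⟨∑ i, B i * C i, fun p => (Finset.abs_sum_le_sum_abs _ _).trans ?_⟩
  refine Finset.sum_le_sum fun i _ => ?_
  rw [abs_mul]
  exact mul_le_mul (hB i _) (hC i _ (p.1.apply_mem _)) (abs_nonneg _) (hB0 i)

theorem hasDerivAt_cyl_curve (hU : ContDiff ℝ 1 U) (hA : ∀ i, ContDiff ℝ 1 (A i))
    {c c' : ℝ → ℝ → ℝ} {ε M R : ℝ} (g : G0) (hg : c 0 = g)
    (hε : 0 < ε) (hcm : ∀ t ∈ Ioo (-ε) ε, Measurable (c t)) (hc'm : Measurable (c' 0))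
    (hR : ∀ t ∈ Ioo (-ε) ε, ∀ s ∈ Ioo (0 : ℝ) 1, |c t s| ≤ R)
    (hM : ∀ t ∈ Ioo (-ε) ε, ∀ s ∈ Ioo (0 : ℝ) 1, |c' t s| ≤ M)
    (hd : ∀ t ∈ Ioo (-ε) ε, ∀ s ∈ Ioo (0 : ℝ) 1, HasDerivAt (fun r => c r s) (c' t s) t) :
    HasDerivAt (fun t => U fun i => ∫ s, A i (c t s) ∂leb)
      (∫ s, cylGrad U A (g, s) * c' 0 s ∂leb) 0 := by
  have h1 : HasDerivAt (fun t => fun i => ∫ s, A i (c t s) ∂leb)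
      (fun i => ∫ s, deriv (A i) (c 0 s) * c' 0 s ∂leb) 0 :=
    hasDerivAt_pi.2 fun i => hasDerivAt_integral_comp (hA i) hε hcm hc'm hR hM hd
  have h2 := ((hU.differentiable one_ne_zero) _).hasFDerivAt.comp_hasDerivAt (0 : ℝ) h1
  refine h2.congr_deriv ?_
  have e : (fun i => ∫ s, A i (c 0 s) ∂leb) = cylArg A g := by
    funext i; simp only [cylArg, intervalIntegral_eq_leb, hg]
  have h0 : (0 : ℝ) ∈ Ioo (-ε) ε := ⟨by linarith, hε⟩
  rw [e, fderiv_eq_sum_partialD, hg]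
  simp only [cylGrad, Finset.sum_mul]
  rw [integral_finsetSum]
  · refine Finset.sum_congr rfl fun i _ => ?_
    simp_rw [mul_assoc]
    rw [integral_const_mul]
  · intro i _
    obtain ⟨C, hC0, hC⟩ := exists_bound_Icc ((hA i).continuous_deriv (le_refl _))
    simp_rw [mul_assoc]
    refine Integrable.const_mul ?_ _
    refine Integrable.of_bound ((((hA i).continuous_deriv (le_refl _)).measurable.comp
      g.measurable).mul hc'm).aestronglyMeasurable (C * M) ?_
    filter_upwards [ae_mem_Ioo_leb] with s hs
    rw [Real.norm_eq_abs]
    rw [abs_mul]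
    exact mul_le_mul (hC _ (g.apply_mem s)) (hM 0 h0 s hs) (abs_nonneg _) hC0

theorem memLp_cylGrad (hU : ContDiff ℝ 1 U) (hA : ∀ i, ContDiff ℝ 1 (A i)) (g : G0) :
    MemLp (fun s => cylGrad U A (g, s)) 2 leb := by
  obtain ⟨C, hC⟩ := exists_bound_cylGrad hU hA
  exact MemLp.of_bound ((measurable_cylGrad hU hA).comp
    measurable_prodMk_left).aestronglyMeasurable C (Eventually.of_forall fun s => hC _)

end CylGrad

/-! ### Gradients -/

theorem hasGradientAt_iff {u : G0 → ℝ} {g : G0} {w : Lp ℝ 2 leb} : HasGradientAt u g w ↔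
    ∀ h : G0, HasDerivWithinAt (fun t => u (g.segment h t))
      (∫ s, w s * (h s - g s) ∂leb) (Ici 0) 0 := by
  refine forall_congr' fun h => ?_
  rw [hasDerivWithinAt_iff_tendsto_slope, Ici_sdiff_left]
  refine tendsto_congr fun t => ?_
  simp [slope_def_field, G0.segment_zero, div_eq_inv_mul]

theorem integrable_mul_sub (w : Lp ℝ 2 leb) (g h : G0) :
    Integrable (fun s => w s * (h s - g s)) leb :=
  (Lp.memLp w).integrable_mul (h.memLp.sub g.memLp)

/-- Subtracting two directions `k - g` and `k₀ - g` removes `g`. With `k` the indicator of a half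
line and `k₀ = 0` on `[0, 1)`, the function `w - w'` has integral zero over every `[a, ∞)`, and
these sets form a generating π-system. -/
theorem HasGradientAt.unique {u : G0 → ℝ} {g : G0} {w w' : Lp ℝ 2 leb}
    (h : HasGradientAt u g w) (h' : HasGradientAt u g w') : w = w' := by
  have key : ∀ k : G0, ∫ s, w s * (k s - g s) ∂leb = ∫ s, w' s * (k s - g s) ∂leb := fun k =>
    tendsto_nhds_unique (h k) (h' k)
  have key2 : ∀ k : G0, ∫ s, (w - w') s * (k s - g s) ∂leb = 0 := fun k => by
    have : ∫ s, (w - w') s * (k s - g s) ∂leb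
        = ∫ s, (w s * (k s - g s) - w' s * (k s - g s)) ∂leb := by
      refine integral_congr_ae ?_
      filter_upwards [Lp.coeFn_sub w w'] with s hs
      rw [hs, Pi.sub_apply]; ring
    rw [this, integral_sub (integrable_mul_sub w g k) (integrable_mul_sub w' g k), key, sub_self]
  have step : ∀ a : ℝ, ∃ k : G0, ∀ s ∈ Ico (0 : ℝ) 1, k s = if a ≤ s then 1 else 0 := by
    intro a
    have hm : Monotone fun s : ℝ => if a ≤ s then (1 : ℝ) else 0 := by
      intro s t hst
      dsimp only
      split_ifs with h1 h2
      · exact le_rfl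
      · exact absurd (h1.trans hst) h2
      · exact zero_le_one
      · exact le_rfl
    refine ⟨G0.ofFun (fun s => if a ≤ s then 1 else 0) hm ?_ ?_, fun s hs =>
      G0.ofFun_apply _ _ _ _ hs⟩
    · intro s; split_ifs <;> simp
    · intro s
      by_cases h1 : a ≤ s
      · refine (continuousWithinAt_const (b := (1 : ℝ))).congr (fun r hr => ?_) ?_
        · simp [h1.trans (show s ≤ r from hr)]
        · simp [h1]
      · refine (continuousWithinAt_const (b := (0 : ℝ))).congr_of_eventuallyEq ?_ (by simp [h1])
        filter_upwards [mem_nhdsWithin_of_mem_nhds (Iio_mem_nhds (not_le.1 h1))] with r hr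
        simp [not_le.2 (show r < a from hr)]
  have hint : Integrable (w - w' : Lp ℝ 2 leb) leb := (Lp.memLp _).integrable one_le_two
  have h0 : (w - w' : Lp ℝ 2 leb) =ᵐ[leb] 0 := by
    -- For `a = 1` the indicator vanishes on `[0, 1)`; this is the reference map.
    obtain ⟨k0, hk0⟩ := step 1
    have hI : ∀ a, ∫ s in Ici a, (w - w') s ∂leb = 0 := by
      intro a
      obtain ⟨k, hk⟩ := step a
      have e1 := key2 k
      have e2 := key2 k0
      have e3 : ∫ s, (w - w') s * (k s - k0 s) ∂leb = 0 := by
        rw [← sub_self (0 : ℝ)]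
        nth_rewrite 1 [← e1]
        rw [← e2, ← integral_sub (integrable_mul_sub _ g k) (integrable_mul_sub _ g k0)]
        exact integral_congr_ae (Eventually.of_forall fun s => by ring)
      rw [← e3, ← integral_indicator measurableSet_Ici]
      refine integral_congr_ae ?_
      filter_upwards [ae_mem_Ioo_leb] with s hs
      rw [hk s (Ioo_subset_Ico_self hs), hk0 s (Ioo_subset_Ico_self hs), if_neg (not_le.2 hs.2)]
      by_cases hsa : a ≤ s
      · rw [indicator_of_mem (show s ∈ Ici a from hsa)]; simp [hsa]
      · rw [indicator_of_notMem (show s ∉ Ici a from hsa)]; simp [hsa]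
    refine ae_eq_zero_of_forall_setIntegral_isClosed_eq_zero hint ?_ |>.trans (by rfl)
    intro s hs
    have hgen : borel ℝ = MeasurableSpace.generateFrom (range Ici) := borel_eq_generateFrom_Ici ℝ
    have hall : ∀ s, MeasurableSet s → ∫ x in s, (w - w') x ∂leb = 0 := by
      intro s hs
      induction s, hs using MeasurableSpace.induction_on_inter
        ((BorelSpace.measurable_eq (α := ℝ)).trans hgen) isPiSystem_Ici with
      | empty => simp
      | basic t ht => obtain ⟨a, rfl⟩ := ht; exact hI a
      | compl t ht ih =>
        have htot : ∫ x, (w - w') x ∂leb = 0 := by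
          have := hI 0
          rw [Measure.restrict_restrict measurableSet_Ici,
            inter_eq_self_of_subset_right (Icc_subset_Ici_self)] at this
          exact this
        have := integral_add_compl ht hint
        rw [ih, htot, zero_add] at this
        exact this
      | iUnion t hd ht ih =>
        rw [integral_iUnion ht hd hint.integrableOn]
        simp only [ih, tsum_zero]
    exact hall s hs.measurableSet
  have h1 : w - w' = 0 := by
    refine Lp.ext (h0.trans ?_)
    exact (Lp.coeFn_zero ℝ 2 leb).symm
  exact sub_eq_zero.1 h1

theorem HasGradientAt.gradAt_eq {u : G0 → ℝ} {g : G0} {w : Lp ℝ 2 leb}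
    (h : HasGradientAt u g w) : gradAt u g = w := by
  have hex : ∃ w, HasGradientAt u g w := ⟨w, h⟩
  rw [gradAt, dif_pos hex]
  exact hex.choose_spec.unique h

theorem HasGradientAt.of_ae {u : G0 → ℝ} {g : G0} {w : Lp ℝ 2 leb}
    {F : ℝ → ℝ} (hw : w =ᵐ[leb] F)
    (h : ∀ k : G0, HasDerivWithinAt (fun t => u (g.segment k t))
      (∫ s, F s * (k s - g s) ∂leb) (Ici 0) 0) : HasGradientAt u g w := by
  rw [hasGradientAt_iff]
  intro k
  convert h k using 1
  refine integral_congr_ae ?_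
  filter_upwards [hw] with s hs
  rw [hs]

theorem hasGradientAt_cyl {m : ℕ} {U : (Fin m → ℝ) → ℝ} {A : Fin m → ℝ → ℝ}
    (hU : ContDiff ℝ 1 U) (hA : ∀ i, ContDiff ℝ 1 (A i)) (g : G0) :
    HasGradientAt (fun g => U (cylArg A g)) g (memLp_cylGrad hU hA g).toLp := by
  refine HasGradientAt.of_ae (memLp_cylGrad hU hA g).coeFn_toLp fun k => ?_
  -- The affine curve is differentiated on both sides of `0`, although for `t < 0` it may leave the
  -- space of monotone maps. It agrees with `segment` for `t ∈ [0, 1]`, which is enough for the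
  -- one-sided derivative.
  have h := hasDerivAt_cyl_curve hU hA (c := fun t s => (1 - t) * g s + t * k s)
    (c' := fun _ s => k s - g s) (ε := 1) (M := 2) (R := 4) g (by simp) one_pos
    (fun t _ => (g.measurable.const_mul _).add (k.measurable.const_mul _))
    (k.measurable.sub g.measurable) ?_ ?_ ?_
  · refine h.hasDerivWithinAt.congr_of_eventuallyEq ?_ ?_
    · have : Iio (1 : ℝ) ∈ 𝓝[≥] (0 : ℝ) := mem_nhdsWithin_of_mem_nhds (Iio_mem_nhds one_pos)
      filter_upwards [this, self_mem_nhdsWithin] with t ht ht0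
      congr 1; funext i
      simp only [cylArg, intervalIntegral_eq_leb]
      simp_rw [G0.segment_apply g k ⟨ht0, le_of_lt ht⟩]
    · congr 1; funext i
      simp only [cylArg, intervalIntegral_eq_leb, G0.segment_zero]
      simp
  · intro t ht s _
    have h1 := g.apply_mem s
    have h2 := k.apply_mem s
    have ht1 : |t| ≤ 1 := abs_le.2 ⟨ht.1.le, ht.2.le⟩
    have a1 : |(1 - t)| ≤ 2 := by rw [abs_le]; constructor <;> linarith [ht.1, ht.2]
    calc |(1 - t) * g s + t * k s| ≤ |1 - t| * |g s| + |t| * |k s| := by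
          rw [← abs_mul, ← abs_mul]; exact abs_add_le _ _
      _ ≤ 2 * 1 + 1 * 1 := by
          gcongr
          · exact g.abs_apply_le s
          · exact k.abs_apply_le s
      _ ≤ 4 := by norm_num
  · intro t _ s _
    have h1 := g.abs_apply_le s
    have h2 := k.abs_apply_le s
    have := abs_sub (k s) (g s)
    linarith
  · intro t _ s _
    have : HasDerivAt (fun r : ℝ => (1 - r) * g s + r * k s) ((0 - 1) * g s + 1 * k s) t :=
      (((hasDerivAt_const t (1 : ℝ)).sub (hasDerivAt_id t)).mul_const _).add
        ((hasDerivAt_id t).mul_const _)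
    convert this using 1; ring

theorem gradAt_cyl {m : ℕ} {U : (Fin m → ℝ) → ℝ} {A : Fin m → ℝ → ℝ}
    (hU : ContDiff ℝ 1 U) (hA : ∀ i, ContDiff ℝ 1 (A i)) (g : G0) :
    gradAt (fun g => U (cylArg A g)) g =ᵐ[leb] fun s => cylGrad U A (g, s) := by
  rw [(hasGradientAt_cyl hU hA g).gradAt_eq]
  exact (memLp_cylGrad hU hA g).coeFn_toLp

/-- `G` is a bounded measurable version of the gradient of `f`. -/
structure IsGrad (f : G0 → ℝ) (G : G0 × ℝ → ℝ) : Prop where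
  meas : Measurable G
  bdd : ∃ C, ∀ p, |G p| ≤ C
  ae_eq : ∀ g, gradAt f g =ᵐ[leb] fun s => G (g, s)
  hasGradientAt : ∀ g, HasGradientAt f g (gradAt f g)

theorem isGrad_cylGrad {m : ℕ} {U : (Fin m → ℝ) → ℝ} {A : Fin m → ℝ → ℝ}
    (hU : ContDiff ℝ 1 U) (hA : ∀ i, ContDiff ℝ 1 (A i)) :
    IsGrad (fun g => U (cylArg A g)) (cylGrad U A) where
  meas := measurable_cylGrad hU hA
  bdd := exists_bound_cylGrad hU hA
  ae_eq := gradAt_cyl hU hA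
  hasGradientAt g := by
    rw [(hasGradientAt_cyl hU hA g).gradAt_eq]; exact hasGradientAt_cyl hU hA g

theorem exists_isGrad {f : G0 → ℝ} (hf : f ∈ cyl 1) : ∃ G, IsGrad f G := by
  obtain ⟨m, U, A, hU, hA, rfl⟩ := mem_cyl_one_iff.1 hf
  exact ⟨_, isGrad_cylGrad hU hA⟩

namespace IsGrad

variable {f h : G0 → ℝ} {F H : G0 × ℝ → ℝ}

theorem hasDerivWithinAt (hf : IsGrad f F) (g k : G0) :
    HasDerivWithinAt (fun t => f (g.segment k t)) (∫ s, F (g, s) * (k s - g s) ∂leb) (Ici 0) 0 := by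
  convert hasGradientAt_iff.1 (hf.hasGradientAt g) k using 1
  refine integral_congr_ae ?_
  filter_upwards [hf.ae_eq g] with s hs
  rw [hs]

theorem of_hasDerivWithinAt (hm : Measurable F) (hb : ∃ C, ∀ p, |F p| ≤ C)
    (hd : ∀ g k : G0, HasDerivWithinAt (fun t => f (g.segment k t))
      (∫ s, F (g, s) * (k s - g s) ∂leb) (Ici 0) 0) : IsGrad f F := by
  obtain ⟨C, hC⟩ := hb
  have hL : ∀ g : G0, MemLp (fun s => F (g, s)) 2 leb := fun g =>
    MemLp.of_bound (hm.comp measurable_prodMk_left).aestronglyMeasurable C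
      (Eventually.of_forall fun s => hC _)
  have hg : ∀ g, HasGradientAt f g (hL g).toLp := fun g =>
    HasGradientAt.of_ae (hL g).coeFn_toLp (hd g)
  refine ⟨hm, ⟨C, hC⟩, fun g => ?_, fun g => ?_⟩
  · rw [(hg g).gradAt_eq]; exact (hL g).coeFn_toLp
  · rw [(hg g).gradAt_eq]; exact hg g

theorem integrable_mul (hf : IsGrad f F) (g k : G0) :
    Integrable (fun s => F (g, s) * (k s - g s)) leb := by
  obtain ⟨C, hC⟩ := hf.bdd
  refine (G0.integrable_sub k g).bdd_mul (c := C)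
    (hf.meas.comp measurable_prodMk_left).aestronglyMeasurable
    (Eventually.of_forall fun s => hC _)

/-- Chain rule for functions of two variables. -/
theorem comp₂ {Φ : ℝ × ℝ → ℝ} (hΦ : ContDiff ℝ 1 Φ) (hfc : Continuous f) (hhc : Continuous h)
    (hf : IsGrad f F) (hh : IsGrad h H) :
    IsGrad (fun g => Φ (f g, h g)) fun p =>
      fderiv ℝ Φ (f p.1, h p.1) (1, 0) * F p + fderiv ℝ Φ (f p.1, h p.1) (0, 1) * H p := by
  have hc : ∀ v, Continuous fun g => fderiv ℝ Φ (f g, h g) v := fun v =>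
    ((hΦ.continuous_fderiv one_ne_zero).comp (hfc.prodMk hhc)).clm_apply continuous_const
  refine of_hasDerivWithinAt ?_ ?_ fun g k => ?_
  · exact (((hc _).measurable.comp measurable_fst).mul hf.meas).add
      (((hc _).measurable.comp measurable_fst).mul hh.meas)
  · obtain ⟨C1, h1, hC1⟩ := exists_bound_of_continuous (hc (1, 0))
    obtain ⟨C2, h2, hC2⟩ := exists_bound_of_continuous (hc (0, 1))
    obtain ⟨B1, hB1⟩ := hf.bdd
    obtain ⟨B2, hB2⟩ := hh.bdd
    refine ⟨C1 * B1 + C2 * B2, fun p => (abs_add_le _ _).trans ?_⟩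
    rw [abs_mul, abs_mul]
    exact add_le_add (mul_le_mul (hC1 _) (hB1 _) (abs_nonneg _) h1)
      (mul_le_mul (hC2 _) (hB2 _) (abs_nonneg _) h2)
  · have hd := (hf.hasDerivWithinAt g k).prodMk (hh.hasDerivWithinAt g k)
    have hΦd := (hΦ.differentiable one_ne_zero (f (g.segment k 0), h (g.segment k 0))).hasFDerivAt
    have := hΦd.comp_hasDerivWithinAt (0 : ℝ) hd
    refine this.congr_deriv ?_
    rw [G0.segment_zero]
    have e : ∀ a b : ℝ, fderiv ℝ Φ (f g, h g) (a, b)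
        = a * fderiv ℝ Φ (f g, h g) (1, 0) + b * fderiv ℝ Φ (f g, h g) (0, 1) := by
      intro a b
      rw [← smul_eq_mul, ← smul_eq_mul, ← map_smul, ← map_smul, ← map_add]; simp
    rw [e]
    simp_rw [add_mul, mul_assoc]
    rw [integral_add ((hf.integrable_mul g k).const_mul _) ((hh.integrable_mul g k).const_mul _),
      integral_const_mul, integral_const_mul]
    ring

theorem congr {F' : G0 × ℝ → ℝ} (hf : IsGrad f F) (h : F = F') : IsGrad f F' := h ▸ hf

theorem add (hfc : Continuous f) (hhc : Continuous h) (hf : IsGrad f F) (hh : IsGrad h H) :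
    IsGrad (f + h) (F + H) := by
  refine (comp₂ (Φ := fun p => p.1 + p.2) (by fun_prop) hfc hhc hf hh).congr ?_
  funext p
  have : ∀ x, HasFDerivAt (fun p : ℝ × ℝ => p.1 + p.2)
    (ContinuousLinearMap.fst ℝ ℝ ℝ + ContinuousLinearMap.snd ℝ ℝ ℝ) x := fun x =>
    hasFDerivAt_fst.add hasFDerivAt_snd
  rw [(this _).fderiv]; simp

theorem smul (c : ℝ) (hfc : Continuous f) (hf : IsGrad f F) : IsGrad (c • f) (c • F) := by
  refine (comp₂ (Φ := fun p => c * p.1) (by fun_prop) hfc hfc hf hf).congr ?_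
  funext p
  have : ∀ x, HasFDerivAt (fun p : ℝ × ℝ => c * p.1) (c • ContinuousLinearMap.fst ℝ ℝ ℝ) x :=
    fun x => hasFDerivAt_fst.const_mul c
  rw [(this _).fderiv]; simp

theorem sub (hfc : Continuous f) (hhc : Continuous h) (hf : IsGrad f F) (hh : IsGrad h H) :
    IsGrad (f - h) (F - H) := by
  have := hf.add hfc (hhc.const_smul (-1 : ℝ)) (hh.smul (-1) hhc)
  simpa [sub_eq_add_neg] using this

theorem mul (hfc : Continuous f) (hhc : Continuous h) (hf : IsGrad f F) (hh : IsGrad h H) :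
    IsGrad (f * h) fun p => f p.1 * H p + h p.1 * F p := by
  refine (comp₂ (Φ := fun p => p.1 * p.2) (by fun_prop) hfc hhc hf hh).congr ?_
  funext p
  have : ∀ x : ℝ × ℝ, HasFDerivAt (fun p : ℝ × ℝ => p.1 * p.2)
    (x.1 • ContinuousLinearMap.snd ℝ ℝ ℝ + x.2 • ContinuousLinearMap.fst ℝ ℝ ℝ) x := fun x =>
    hasFDerivAt_fst.mul hasFDerivAt_snd
  rw [(this _).fderiv]; simp [add_comm]

theorem comp {ψ : ℝ → ℝ} (hψ : ContDiff ℝ 1 ψ) (hfc : Continuous f) (hf : IsGrad f F) :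
    IsGrad (ψ ∘ f) fun p => deriv ψ (f p.1) * F p := by
  refine (comp₂ (Φ := fun p => ψ p.1) (by fun_prop) hfc hfc hf hf).congr ?_
  funext p
  have : ∀ x : ℝ × ℝ, HasFDerivAt (fun p : ℝ × ℝ => ψ p.1)
    (deriv ψ x.1 • ContinuousLinearMap.fst ℝ ℝ ℝ) x := fun x =>
    ((hψ.differentiable one_ne_zero) x.1).hasDerivAt.comp_hasFDerivAt x hasFDerivAt_fst
  rw [(this _).fderiv]; simp

end IsGrad

/-! ### Gaps of padded vectors -/

/-- The increments of a finite sequence. -/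
def gap {n : ℕ} (z : Fin (n + 1) → ℝ) (i : Fin n) : ℝ := z i.succ - z i.castSucc

theorem pad_zero {N : ℕ} (x : Fin N → ℝ) : pad x 0 = 0 := rfl

theorem pad_last {N : ℕ} (x : Fin N → ℝ) : pad x (Fin.last (N + 1)) = 1 := by
  rw [pad, ← Fin.succ_last, Fin.cons_succ, Fin.snoc_last]

theorem pad_succ_castSucc {N : ℕ} (x : Fin N → ℝ) (i : Fin N) : pad x i.castSucc.succ = x i := by
  rw [pad, Fin.cons_succ, Fin.snoc_castSucc]

/-- Padding prepends the value `0`, so the position `i` becomes `i + 1`; this is the index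
`i.castSucc.succ`. -/
theorem pad_insertNth {N : ℕ} (i : Fin (N + 1)) (y : ℝ) (x : Fin N → ℝ) :
    pad (i.insertNth (α := fun _ => ℝ) y x) =
      i.castSucc.succ.insertNth (α := fun _ => ℝ) y (pad x) := by
  funext k
  refine Fin.succAboveCases i.castSucc.succ ?_ (fun j => ?_) k
  · rw [Fin.insertNth_apply_same, pad_succ_castSucc, Fin.insertNth_apply_same]
  · rw [Fin.insertNth_apply_succAbove]
    refine Fin.cases ?_ (fun j => ?_) j
    · rw [Fin.succ_succAbove_zero, pad_zero, pad_zero]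
    · rw [Fin.succ_succAbove_succ]
      refine Fin.lastCases ?_ (fun j => ?_) j
      · have : i.castSucc.succAbove (Fin.last N) = Fin.last (N + 1) := by
          rw [Fin.succAbove_of_le_castSucc _ _ (by
            rw [Fin.castSucc_le_castSucc_iff]; exact Fin.le_last i), Fin.succ_last]
        rw [this, Fin.succ_last, Fin.succ_last, pad_last, pad_last]
      · rw [Fin.castSucc_succAbove_castSucc, pad_succ_castSucc, pad_succ_castSucc,
          Fin.insertNth_apply_succAbove]

theorem strictMono_iff_gap {n : ℕ} {z : Fin (n + 1) → ℝ} : StrictMono z ↔ ∀ i, 0 < gap z i := by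
  rw [Fin.strictMono_iff_lt_succ]
  exact forall_congr' fun i => sub_pos.symm

section Insert

variable {N : ℕ} (i : Fin (N + 1)) (y : ℝ) (z : Fin (N + 2) → ℝ)

theorem gap_insertNth_castSucc :
    gap (i.castSucc.succ.insertNth (α := fun _ => ℝ) y z) i.castSucc = y - z i.castSucc := by
  rw [gap, Fin.insertNth_apply_same]
  congr 1
  have : i.castSucc.castSucc = i.castSucc.succ.succAbove i.castSucc := by
    ext; simp [Fin.succAbove]
  rw [this, Fin.insertNth_apply_succAbove]

theorem gap_insertNth_succ :
    gap (i.castSucc.succ.insertNth (α := fun _ => ℝ) y z) i.succ = z i.succ - y := by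
  have h : i.succ.succ = i.castSucc.succ.succAbove i.succ := by
    ext; simp [Fin.succAbove]
  rw [gap, ← Fin.succ_castSucc, Fin.insertNth_apply_same, h, Fin.insertNth_apply_succAbove]

theorem gap_insertNth_succAbove {j : Fin (N + 1)} (hj : j ≠ i) :
    gap (i.castSucc.succ.insertNth (α := fun _ => ℝ) y z) (i.castSucc.succAbove j) = gap z j := by
  have hj' : (j : ℕ) ≠ i := fun h => hj (Fin.ext h)
  have h1 : (i.castSucc.succAbove j).succ = i.castSucc.succ.succAbove j.succ := by
    rw [Fin.succ_succAbove_succ]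
  have h2 : (i.castSucc.succAbove j).castSucc = i.castSucc.succ.succAbove j.castSucc := by
    ext
    simp only [Fin.succAbove, Fin.lt_def, Fin.val_castSucc, Fin.val_succ]
    split_ifs <;> simp <;> omega
  rw [gap, h1, h2, Fin.insertNth_apply_succAbove, Fin.insertNth_apply_succAbove, gap]

/-- The inserted point splits the gap `i` into two adjacent ones, with indices `i.castSucc` and
`i.succ`. Splitting off these two indices leaves the unchanged gaps of `z`. -/
theorem forall_gap_insertNth (P : Fin (N + 2) → ℝ → Prop) :
    (∀ l, P l (gap (i.castSucc.succ.insertNth (α := fun _ => ℝ) y z) l)) ↔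
      P i.castSucc (y - z i.castSucc) ∧ P i.succ (z i.succ - y) ∧
        ∀ j, P (i.castSucc.succAbove (i.succAbove j)) (gap z (i.succAbove j)) := by
  rw [Fin.forall_iff_succAbove i.castSucc, Fin.forall_iff_succAbove i, gap_insertNth_castSucc,
    Fin.succAbove_castSucc_self, gap_insertNth_succ]
  refine and_congr_right fun _ => and_congr_right fun _ => forall_congr' fun j => ?_
  rw [gap_insertNth_succAbove _ _ _ (Fin.succAbove_ne i j)]

theorem strictMono_insertNth_iff :
    StrictMono (i.castSucc.succ.insertNth (α := fun _ => ℝ) y z) ↔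
      StrictMono z ∧ z i.castSucc < y ∧ y < z i.succ := by
  rw [strictMono_iff_gap, strictMono_iff_gap, forall_gap_insertNth i y z fun _ r => 0 < r,
    Fin.forall_iff_succAbove i, sub_pos, sub_pos]
  constructor
  · rintro ⟨h1, h2, h3⟩
    exact ⟨⟨sub_pos.2 (h1.trans h2), h3⟩, h1, h2⟩
  · rintro ⟨⟨_, h3⟩, h1, h2⟩
    exact ⟨h1, h2, h3⟩

theorem prod_gap_insertNth {M : Type*} [CommMonoid M] (P : Fin (N + 2) → ℝ → M) :
    ∏ l, P l (gap (i.castSucc.succ.insertNth (α := fun _ => ℝ) y z) l) =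
      P i.castSucc (y - z i.castSucc) * (P i.succ (z i.succ - y) *
        ∏ j, P (i.castSucc.succAbove (i.succAbove j)) (gap z (i.succAbove j))) := by
  rw [Fin.prod_univ_succAbove _ i.castSucc, Fin.prod_univ_succAbove _ i, gap_insertNth_castSucc,
    Fin.succAbove_castSucc_self, gap_insertNth_succ]
  congr 2
  refine Finset.prod_congr rfl fun j _ => ?_
  rw [gap_insertNth_succAbove _ _ _ (Fin.succAbove_ne i j)]

end Insert

/-! ### The Dirichlet densities -/

/-- The Dirichlet density on the simplex. -/
def dirichletPDF (β : ℝ) {N : ℕ} (t x : Fin N → ℝ) : ℝ :=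
  Real.Gamma β / (∏ i, Real.Gamma (β * gap (pad t) i)) * ∏ i, gap (pad x) i ^ (β * gap (pad t) i - 1)

/-- The open simplex. -/
def simplex (N : ℕ) : Set (Fin N → ℝ) := {x | StrictMono (pad x)}

theorem continuous_pad_apply {N : ℕ} (k : Fin (N + 2)) : Continuous fun x : Fin N → ℝ => pad x k := by
  refine Fin.cases ?_ (fun k => ?_) k
  · simp only [pad_zero]; exact continuous_const
  · refine Fin.lastCases ?_ (fun k => ?_) k
    · simp only [Fin.succ_last, pad_last]; exact continuous_const
    · simp only [pad_succ_castSucc]; exact continuous_apply k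

theorem continuous_gap_pad {N : ℕ} (k : Fin (N + 1)) :
    Continuous fun x : Fin N → ℝ => gap (pad x) k :=
  (continuous_pad_apply _).sub (continuous_pad_apply _)

theorem isOpen_simplex (N : ℕ) : IsOpen (simplex N) := by
  have : simplex N = ⋂ k, {x | 0 < gap (pad x) k} := by
    ext x; simp [simplex, strictMono_iff_gap]
  rw [this]
  exact isOpen_iInter_of_finite fun k => isOpen_lt continuous_const (continuous_gap_pad k)

theorem measurableSet_simplex (N : ℕ) : MeasurableSet (simplex N) := (isOpen_simplex N).measurableSet

theorem measurable_dirichletPDF (β : ℝ) {N : ℕ} (t : Fin N → ℝ) :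
    Measurable (dirichletPDF β t) :=
  (Finset.measurable_fun_prod _ fun k _ =>
    (continuous_gap_pad k).measurable.pow_const _).const_mul _

theorem dirichletLaw_eq (β : ℝ) {N : ℕ} (t : Fin N → ℝ) :
    dirichletLaw β t = volume.withDensity
      ((simplex N).indicator fun x => ENNReal.ofReal (dirichletPDF β t x)) := by
  classical
  rw [dirichletLaw]
  congr 1
  funext x
  by_cases h : StrictMono (pad x)
  · rw [indicator_of_mem (show x ∈ simplex N from h), if_pos h]; rfl
  · rw [indicator_of_notMem (show x ∉ simplex N from h), if_neg h]

theorem measurable_indicator_pdf (β : ℝ) {N : ℕ} (t : Fin N → ℝ) :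
    Measurable ((simplex N).indicator fun x => ENNReal.ofReal (dirichletPDF β t x)) :=
  (measurable_dirichletPDF β t).ennreal_ofReal.indicator (measurableSet_simplex N)

theorem dirichletPDF_pos {β : ℝ} (hβ : 0 < β) {N : ℕ} {t x : Fin N → ℝ} (ht : t ∈ simplex N)
    (hx : x ∈ simplex N) : 0 < dirichletPDF β t x := by
  refine mul_pos (div_pos (Real.Gamma_pos_of_pos hβ) (Finset.prod_pos fun i _ => ?_))
    (Finset.prod_pos fun i _ => ?_)
  · exact Real.Gamma_pos_of_pos (mul_pos hβ (strictMono_iff_gap.1 ht i))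
  · exact Real.rpow_pos_of_pos (strictMono_iff_gap.1 hx i) _

theorem ae_mem_simplex (β : ℝ) {N : ℕ} (t : Fin N → ℝ) :
    ∀ᵐ x ∂(dirichletLaw β t), x ∈ simplex N := by
  rw [dirichletLaw_eq, ae_withDensity_iff (measurable_indicator_pdf β t)]
  refine Eventually.of_forall fun x hx => ?_
  by_contra h
  exact hx (indicator_of_notMem h _)

/-- The Euler integral on the interval `(p, q)`. -/
theorem lintegral_beta_Ioo {a b p q : ℝ} (ha : 0 < a) (hb : 0 < b) (hpq : p < q) :
    ∫⁻ y in Ioo p q, ENNReal.ofReal ((y - p) ^ (a - 1) * (q - y) ^ (b - 1)) =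
      ENNReal.ofReal ((q - p) ^ (a + b - 1) * ProbabilityTheory.beta a b) := by
  have hL : 0 < q - p := sub_pos.2 hpq
  have himg : (fun x => p + (q - p) * x) '' Ioo (0 : ℝ) 1 = Ioo p q := by
    have : (fun x => p + (q - p) * x) = (fun x => (q - p) * x + p) := by funext x; ring
    rw [this, image_affine_Ioo hL]; simp
  have hbp := ProbabilityTheory.beta_pos ha hb
  have hd : ∀ x ∈ Ioo (0 : ℝ) 1, HasDerivWithinAt (fun x => p + (q - p) * x) (q - p) (Ioo 0 1) x :=
    fun x _ => by
      simpa using (((hasDerivAt_id x).const_mul (q - p)).const_add p).hasDerivWithinAt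
  rw [← himg, lintegral_image_eq_lintegral_abs_deriv_mul measurableSet_Ioo hd ?_]
  · have h1 := ProbabilityTheory.lintegral_betaPDF_eq_one ha hb
    rw [ProbabilityTheory.lintegral_betaPDF] at h1
    rw [← mul_one (ENNReal.ofReal ((q - p) ^ (a + b - 1) * ProbabilityTheory.beta a b)), ← h1,
      ← lintegral_const_mul' _ _ ENNReal.ofReal_ne_top]
    refine setLIntegral_congr_fun measurableSet_Ioo fun x hx => ?_
    rw [← ENNReal.ofReal_mul (abs_nonneg _), ← ENNReal.ofReal_mul (by positivity)]
    congr 1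
    have hx1 : 0 < 1 - x := sub_pos.2 hx.2
    rw [abs_of_pos hL, add_sub_cancel_left, show q - (p + (q - p) * x) = (q - p) * (1 - x) by ring,
      Real.mul_rpow hL.le hx.1.le, Real.mul_rpow hL.le hx1.le,
      show a + b - 1 = (a - 1) + (b - 1) + 1 by ring, Real.rpow_add hL, Real.rpow_add hL,
      Real.rpow_one]
    field_simp
  · intro x _ y _ hxy
    simpa [hL.ne'] using hxy

theorem simplex_insertNth {N : ℕ} {i : Fin (N + 1)} {y : ℝ} {x : Fin N → ℝ} :
    i.insertNth (α := fun _ => ℝ) y x ∈ simplex (N + 1) ↔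
      x ∈ simplex N ∧ y ∈ Ioo (pad x i.castSucc) (pad x i.succ) := by
  simp only [simplex, mem_ofPred_eq]
  rw [pad_insertNth, strictMono_insertNth_iff]; rfl

theorem dirichletPDF_insertNth (β : ℝ) {N : ℕ} (i : Fin (N + 1)) (r : ℝ) (t : Fin N → ℝ)
    (y : ℝ) (x : Fin N → ℝ) :
    dirichletPDF β (i.insertNth (α := fun _ => ℝ) r t) (i.insertNth (α := fun _ => ℝ) y x) =
      (Real.Gamma β / (Real.Gamma (β * (r - pad t i.castSucc)) *
        (Real.Gamma (β * (pad t i.succ - r)) *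
          ∏ j, Real.Gamma (β * gap (pad t) (i.succAbove j)))) *
        ∏ j, gap (pad x) (i.succAbove j) ^ (β * gap (pad t) (i.succAbove j) - 1)) *
      ((y - pad x i.castSucc) ^ (β * (r - pad t i.castSucc) - 1) *
        (pad x i.succ - y) ^ (β * (pad t i.succ - r) - 1)) := by
  rw [dirichletPDF, pad_insertNth, pad_insertNth]
  rw [prod_gap_insertNth i r (pad t) fun _ s => Real.Gamma (β * s),
    prod_gap_insertNth i y (pad x) fun l s => s ^
      (β * gap (i.castSucc.succ.insertNth (α := fun _ => ℝ) r (pad t)) l - 1),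
    gap_insertNth_castSucc, gap_insertNth_succ]
  have : ∀ j, gap (i.castSucc.succ.insertNth (α := fun _ => ℝ) r (pad t))
      (i.castSucc.succAbove (i.succAbove j)) = gap (pad t) (i.succAbove j) := fun j =>
    gap_insertNth_succAbove _ _ _ (Fin.succAbove_ne i j)
  simp_rw [this]
  ring

/-- In the variable `y` the density is the integrand of a Beta integral over the gap containing `y`.
Its value `Γ(a) Γ(b) / Γ(a + b)` fuses two Gamma factors into one, and `a + b` is `β` times the
merged time gap. -/
theorem lintegral_pdf_insertNth {β : ℝ} (hβ : 0 < β) {N : ℕ} (i : Fin (N + 1)) (r : ℝ)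
    (t : Fin N → ℝ) (ht : i.insertNth (α := fun _ => ℝ) r t ∈ simplex (N + 1)) (x : Fin N → ℝ) :
    ∫⁻ y, (simplex (N + 1)).indicator (fun x => ENNReal.ofReal
        (dirichletPDF β (i.insertNth (α := fun _ => ℝ) r t) x)) (i.insertNth (α := fun _ => ℝ) y x) =
      (simplex N).indicator (fun x => ENNReal.ofReal (dirichletPDF β t x)) x := by
  obtain ⟨ht', hr⟩ := simplex_insertNth.1 ht
  by_cases hx : x ∈ simplex N
  · rw [indicator_of_mem hx]
    have e : ∀ y, (simplex (N + 1)).indicator (fun x => ENNReal.ofReal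
        (dirichletPDF β (i.insertNth (α := fun _ => ℝ) r t) x)) (i.insertNth (α := fun _ => ℝ) y x) =
        (Ioo (pad x i.castSucc) (pad x i.succ)).indicator (fun y => ENNReal.ofReal
          (dirichletPDF β (i.insertNth (α := fun _ => ℝ) r t)
            (i.insertNth (α := fun _ => ℝ) y x))) y := by
      intro y
      by_cases hy : y ∈ Ioo (pad x i.castSucc) (pad x i.succ)
      · rw [indicator_of_mem hy, indicator_of_mem (simplex_insertNth.2 ⟨hx, hy⟩)]
      · rw [indicator_of_notMem hy, indicator_of_notMem fun h => hy (simplex_insertNth.1 h).2]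
    simp_rw [e]
    rw [lintegral_indicator measurableSet_Ioo]
    simp_rw [dirichletPDF_insertNth]
    have ha : 0 < β * (r - pad t i.castSucc) := mul_pos hβ (sub_pos.2 hr.1)
    have hb : 0 < β * (pad t i.succ - r) := mul_pos hβ (sub_pos.2 hr.2)
    have hG : ∀ j, 0 < Real.Gamma (β * gap (pad t) j) := fun j =>
      Real.Gamma_pos_of_pos (mul_pos hβ (strictMono_iff_gap.1 ht' j))
    have hg : ∀ j, 0 < gap (pad x) j := strictMono_iff_gap.1 hx
    have hC : 0 ≤ Real.Gamma β / (Real.Gamma (β * (r - pad t i.castSucc)) *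
        (Real.Gamma (β * (pad t i.succ - r)) *
          ∏ j, Real.Gamma (β * gap (pad t) (i.succAbove j)))) *
        ∏ j, gap (pad x) (i.succAbove j) ^ (β * gap (pad t) (i.succAbove j) - 1) := by
      have h1 := Real.Gamma_pos_of_pos ha
      have h2 := Real.Gamma_pos_of_pos hb
      have h3 := Real.Gamma_pos_of_pos hβ
      have h4 := Finset.prod_pos (s := Finset.univ) fun j _ => hG (i.succAbove j)
      have h5 := Finset.prod_pos (s := Finset.univ) fun j _ =>
        Real.rpow_pos_of_pos (hg (i.succAbove j)) (β * gap (pad t) (i.succAbove j) - 1)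
      positivity
    simp_rw [ENNReal.ofReal_mul hC]
    rw [lintegral_const_mul' _ _ ENNReal.ofReal_ne_top, lintegral_beta_Ioo ha hb
      (hx (Fin.castSucc_lt_succ)), ← ENNReal.ofReal_mul hC]
    congr 1
    rw [dirichletPDF, Fin.prod_univ_succAbove _ i, Fin.prod_univ_succAbove _ i,
      ProbabilityTheory.beta,
      show β * (r - pad t i.castSucc) + β * (pad t i.succ - r) = β * gap (pad t) i by
        rw [gap]; ring,
      show pad x i.succ - pad x i.castSucc = gap (pad x) i from rfl]
    have h1 := (Real.Gamma_pos_of_pos ha).ne'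
    have h2 := (Real.Gamma_pos_of_pos hb).ne'
    have h4 := (Finset.prod_pos (s := Finset.univ) fun j _ => hG (i.succAbove j)).ne'
    have h5 := (hG i).ne'
    field_simp
  · rw [indicator_of_notMem hx]
    refine (lintegral_congr fun y => ?_).trans lintegral_zero
    exact indicator_of_notMem (fun h => hx (simplex_insertNth.1 h).1) _

theorem lintegral_insertNth {N : ℕ} (i : Fin (N + 1)) {F : (Fin (N + 1) → ℝ) → ENNReal}
    (hF : Measurable F) : ∫⁻ x, F x = ∫⁻ x : Fin N → ℝ, ∫⁻ y : ℝ,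
      F (i.insertNth (α := fun _ => ℝ) y x) := by
  have h := (volume_preserving_piFinSuccAbove (fun _ : Fin (N + 1) => ℝ) i).symm
  rw [← h.lintegral_comp hF]
  have hm : Measurable fun p : ℝ × (Fin N → ℝ) =>
    F ((MeasurableEquiv.piFinSuccAbove (fun _ : Fin (N + 1) => ℝ) i).symm p) :=
    hF.comp (MeasurableEquiv.measurable _)
  rw [show (volume : Measure (ℝ × (Fin N → ℝ))) = volume.prod volume from rfl,
    lintegral_prod_symm _ hm.aemeasurable]
  rfl

/-- Tonelli in the coordinate `i`; the inner integral is `lintegral_pdf_insertNth`. -/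
theorem dirichletLaw_map_succAbove {β : ℝ} (hβ : 0 < β) {N : ℕ} {t : Fin (N + 1) → ℝ}
    (ht : t ∈ simplex (N + 1)) (i : Fin (N + 1)) :
    (dirichletLaw β t).map (fun x j => x (i.succAbove j)) =
      dirichletLaw β fun j => t (i.succAbove j) := by
  have hm : Measurable fun (x : Fin (N + 1) → ℝ) (j : Fin N) => x (i.succAbove j) :=
    measurable_pi_iff.2 fun j => measurable_pi_apply _
  have et : i.insertNth (α := fun _ => ℝ) (t i) (fun j => t (i.succAbove j)) = t :=
    Fin.insertNth_self_removeNth i t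
  refine Measure.ext_of_lintegral _ fun f hf => ?_
  rw [lintegral_map hf hm, dirichletLaw_eq, dirichletLaw_eq]
  refine (lintegral_withDensity_eq_lintegral_mul _ (measurable_indicator_pdf β _)
    (hf.comp hm)).trans ?_
  rw [lintegral_withDensity_eq_lintegral_mul _ (measurable_indicator_pdf β _) hf,
    lintegral_insertNth i ((measurable_indicator_pdf β _).mul (hf.comp hm))]
  refine lintegral_congr fun x => ?_
  simp only [Pi.mul_apply, Function.comp_apply, Fin.insertNth_apply_succAbove]
  have hmi : Measurable fun y : ℝ => i.insertNth (α := fun _ => ℝ) y x := by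
    refine measurable_pi_iff.2 fun k => ?_
    refine Fin.succAboveCases i ?_ (fun j => ?_) k
    · simp only [Fin.insertNth_apply_same]; exact measurable_id
    · simp
  refine (lintegral_mul_const _ ((measurable_indicator_pdf β _).comp hmi)).trans ?_
  congr 1
  simp only [Function.comp_apply]
  rw [← lintegral_pdf_insertNth hβ i (t i) _ (by rwa [et]) x, et]

theorem simplex_comp {N M : ℕ} {σ : Fin M → Fin N} (hσ : StrictMono σ) {t : Fin N → ℝ}
    (ht : t ∈ simplex N) : (fun j => t (σ j)) ∈ simplex M := by
  have h0 : ∀ j, 0 < t j := fun j => by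
    have := ht (show (0 : Fin (N + 2)) < j.castSucc.succ from Fin.succ_pos _)
    rwa [pad_zero, pad_succ_castSucc] at this
  have h1 : ∀ j, t j < 1 := fun j => by
    have := ht (show j.castSucc.succ < Fin.last (N + 1) by
      rw [← Fin.succ_last, Fin.succ_lt_succ_iff]; exact Fin.castSucc_lt_last j)
    rwa [pad_last, pad_succ_castSucc] at this
  have hm : ∀ i j, i < j → t i < t j := fun i j hij => by
    have := ht (show i.castSucc.succ < j.castSucc.succ by
      rw [Fin.succ_lt_succ_iff]; exact hij)
    rwa [pad_succ_castSucc, pad_succ_castSucc] at this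
  intro a b
  refine Fin.cases ?_ (fun a => ?_) a <;> refine Fin.cases ?_ (fun b => ?_) b
  · intro h; exact absurd h (lt_irrefl _)
  · intro _
    refine Fin.lastCases ?_ (fun b => ?_) b
    · rw [pad_zero, Fin.succ_last, pad_last]; exact one_pos
    · rw [pad_zero, pad_succ_castSucc]; exact h0 _
  · intro h; exact absurd h (not_lt.2 (Fin.zero_le _))
  · rw [Fin.succ_lt_succ_iff]
    refine Fin.lastCases ?_ (fun a => ?_) a <;> refine Fin.lastCases ?_ (fun b => ?_) b
    · intro h; exact absurd h (lt_irrefl _)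
    · intro h; exact absurd h (not_lt.2 (Fin.le_last _))
    · intro _
      rw [pad_succ_castSucc, Fin.succ_last, pad_last]; exact h1 _
    · intro h
      rw [pad_succ_castSucc, pad_succ_castSucc]; exact hm _ _ (hσ h)

/-- Marginals of the finite dimensional distributions. -/
theorem dirichletLaw_map_comp {β : ℝ} (hβ : 0 < β) {M : ℕ} : ∀ {N : ℕ} {t : Fin N → ℝ},
    t ∈ simplex N → ∀ {σ : Fin M → Fin N}, StrictMono σ →
      (dirichletLaw β t).map (fun x j => x (σ j)) = dirichletLaw β fun j => t (σ j) := by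
  intro N
  induction N with
  | zero =>
    intro t ht σ hσ
    have hM : M = 0 := by
      have := Fintype.card_le_of_injective σ hσ.injective
      simpa using this
    subst hM
    have : (fun (x : Fin 0 → ℝ) j => x (σ j)) = id := by funext x j; exact j.elim0
    rw [this, Measure.map_id, show (fun j => t (σ j)) = t from funext fun j => j.elim0]
  | succ N ih =>
    intro t ht σ hσ
    -- A surjective `σ` is the identity. Otherwise some index `i` is missed; it is integrated out
    -- and `σ` factors through `i.succAbove`.
    by_cases hs : Function.Surjective σ
    · have hM : M = N + 1 := by
        have := Fintype.card_of_bijective ⟨hσ.injective, hs⟩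
        simpa using this
      subst hM
      have hid : σ = id := (hσ.range_inj strictMono_id).1 (by
        rw [hs.range_eq, range_id])
      subst hid
      exact Measure.map_id
    · obtain ⟨i, hi⟩ := not_forall.1 hs
      have hne : ∀ j, σ j ≠ i := fun j h => hi ⟨j, h⟩
      choose τ hτ using fun j => Fin.exists_succAbove_eq (hne j)
      have hτm : StrictMono τ := fun a b hab => by
        have := hσ hab
        rw [← hτ a, ← hτ b] at this
        exact (Fin.strictMono_succAbove i).lt_iff_lt.1 this
      have h1 := ih (simplex_comp (Fin.strictMono_succAbove i) ht) hτm
      rw [← dirichletLaw_map_succAbove hβ ht i, Measure.map_map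
        (g := fun (x : Fin N → ℝ) j => x (τ j))
        (measurable_pi_iff.2 fun j => measurable_pi_apply _)
        (measurable_pi_iff.2 fun j => measurable_pi_apply _)] at h1
      simpa [Function.comp_def, hτ] using h1

theorem dirichletLaw_fin_zero {β : ℝ} (hβ : 0 < β) (t : Fin 0 → ℝ) :
    dirichletLaw β t univ = 1 := by
  have hs : ∀ x : Fin 0 → ℝ, pad x 1 = 1 := fun x => pad_last x
  have hg : ∀ x : Fin 0 → ℝ, gap (pad x) 0 = 1 := fun x => by
    rw [gap]; change pad x 1 - pad x 0 = 1; rw [hs, pad_zero, sub_zero]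
  rw [dirichletLaw_eq, withDensity_apply _ MeasurableSet.univ, Measure.restrict_univ,
    Measure.volume_pi_eq_dirac default, lintegral_dirac' _ (measurable_indicator_pdf β t),
    indicator_of_mem]
  · simp [dirichletPDF, hg, (Real.Gamma_pos_of_pos hβ).ne']
  · rw [simplex, mem_ofPred_eq, strictMono_iff_gap]
    intro i
    rw [Subsingleton.elim i 0, hg]; exact one_pos

/-- The total mass is the marginal at the empty set of times. -/
theorem isProbabilityMeasure_dirichletLaw {β : ℝ} (hβ : 0 < β) {N : ℕ} {t : Fin N → ℝ}
    (ht : t ∈ simplex N) : IsProbabilityMeasure (dirichletLaw β t) := by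
  have hσ : StrictMono (Fin.elim0 : Fin 0 → Fin N) := fun a => a.elim0
  have h := dirichletLaw_map_comp hβ ht hσ
  refine ⟨?_⟩
  rw [← dirichletLaw_fin_zero hβ (fun j => t (j.elim0)), ← h,
    Measure.map_apply (measurable_pi_iff.2 fun j => j.elim0) MeasurableSet.univ, preimage_univ]

/-- The factor `y` raises one exponent by `1`, and `Γ(s + 1) = s Γ(s)` reduces the quotient of Beta
integrals to `r`. This first moment controls the increments in the existence proof. -/
theorem lintegral_dirichletLaw_one {β : ℝ} (hβ : 0 < β) {r : ℝ} (hr : r ∈ Ioo (0 : ℝ) 1) :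
    ∫⁻ x : Fin 1 → ℝ, ENNReal.ofReal (x 0) ∂(dirichletLaw β fun _ : Fin 1 => r) = ENNReal.ofReal r := by
  have hpt : ∀ x : Fin 0 → ℝ, pad x (Fin.castSucc (0 : Fin 1)) = 0 ∧ pad x (Fin.succ (0 : Fin 1)) = 1 :=
    fun x => ⟨pad_zero x, pad_last x⟩
  have e0 : (fun _ : Fin 1 => r) =
      (0 : Fin 1).insertNth (α := fun _ => ℝ) r (default : Fin 0 → ℝ) := by
    funext i; rw [Subsingleton.elim i 0, Fin.insertNth_apply_same]
  have hm : Measurable fun x : Fin 1 → ℝ => ENNReal.ofReal (x 0) :=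
    (measurable_pi_apply 0).ennreal_ofReal
  rw [dirichletLaw_eq, lintegral_withDensity_eq_lintegral_mul _ (measurable_indicator_pdf β _) hm,
    lintegral_insertNth 0 ((measurable_indicator_pdf β _).mul hm), Measure.volume_pi_eq_dirac default,
    lintegral_dirac]
  have hs : (default : Fin 0 → ℝ) ∈ simplex 0 := by
    rw [simplex, mem_ofPred_eq, strictMono_iff_gap]
    intro i
    rw [Subsingleton.elim i 0, gap, (hpt _).1, (hpt _).2]; norm_num
  have e : ∀ y : ℝ, ((simplex 1).indicator (fun x => ENNReal.ofReal
        (dirichletPDF β (fun _ : Fin 1 => r) x)) * fun x : Fin 1 → ℝ => ENNReal.ofReal (x 0))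
        ((0 : Fin 1).insertNth (α := fun _ => ℝ) y default) =
      (Ioo (0 : ℝ) 1).indicator (fun y => ENNReal.ofReal (Real.Gamma β /
        (Real.Gamma (β * r) * Real.Gamma (β * (1 - r)))) *
          ENNReal.ofReal ((y - 0) ^ ((β * r + 1) - 1) * (1 - y) ^ (β * (1 - r) - 1))) y := by
    intro y
    rw [Pi.mul_apply, Fin.insertNth_apply_same]
    have hiff := simplex_insertNth (i := (0 : Fin 1)) (y := y) (x := default)
    rw [(hpt _).1, (hpt _).2] at hiff
    have hC : 0 ≤ Real.Gamma β / (Real.Gamma (β * r) * Real.Gamma (β * (1 - r))) := by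
      have h1 := Real.Gamma_pos_of_pos hβ
      have h2 := Real.Gamma_pos_of_pos (mul_pos hβ hr.1)
      have h3 := Real.Gamma_pos_of_pos (mul_pos hβ (sub_pos.2 hr.2))
      positivity
    by_cases hy : y ∈ Ioo (0 : ℝ) 1
    · rw [indicator_of_mem (hiff.2 ⟨hs, hy⟩), indicator_of_mem hy, e0, dirichletPDF_insertNth,
        (hpt _).1, (hpt _).2, ← ENNReal.ofReal_mul' hy.1.le, ← ENNReal.ofReal_mul hC]
      congr 1
      have hy' : y ^ (β * r + 1 - 1) = y ^ (β * r - 1) * y := by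
        rw [show β * r + 1 - 1 = (β * r - 1) + 1 by ring, Real.rpow_add hy.1, Real.rpow_one]
      simp only [Finset.univ_eq_empty, Finset.prod_empty, sub_zero, mul_one, hy']
      ring
    · rw [indicator_of_notMem fun h => hy (hiff.1 h).2, indicator_of_notMem hy, zero_mul]
  rw [lintegral_congr e, lintegral_indicator measurableSet_Ioo,
    lintegral_const_mul' _ _ ENNReal.ofReal_ne_top, lintegral_beta_Ioo (by nlinarith [mul_pos hβ hr.1]) (mul_pos hβ (sub_pos.2 hr.2)) one_pos]
  have h1 := Real.Gamma_pos_of_pos hβ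
  have h2 := Real.Gamma_pos_of_pos (mul_pos hβ hr.1)
  have h3 := Real.Gamma_pos_of_pos (mul_pos hβ (sub_pos.2 hr.2))
  rw [← ENNReal.ofReal_mul (by positivity)]
  congr 1
  rw [ProbabilityTheory.beta, sub_zero, Real.one_rpow, one_mul,
    show β * r + 1 + β * (1 - r) = β + 1 by ring, Real.Gamma_add_one hβ.ne',
    Real.Gamma_add_one (mul_pos hβ hr.1).ne']
  field_simp

/-! ### Riemann sums along a uniform grid -/

/-- The uniform grid with `N` interior points. -/
def grid (N : ℕ) (j : Fin N) : ℝ := ((j : ℝ) + 1) / (N + 1)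

/-- The value of `g` at a grid point, replaced by `0` at the left end. -/
def gridVal (N : ℕ) (g : G0) (k : ℕ) : ℝ := if k = 0 then 0 else g ((k : ℝ) / (N + 1))

theorem pad_eval_grid (N : ℕ) (g : G0) (k : Fin (N + 2)) :
    pad (fun j => g (grid N j)) k = gridVal N g k := by
  refine Fin.cases ?_ (fun k => ?_) k
  · simp [pad_zero, gridVal]
  · refine Fin.lastCases ?_ (fun k => ?_) k
    · rw [Fin.succ_last, pad_last, gridVal, if_neg (by simp)]
      have : ((N : ℝ) + 1) ≠ 0 := by positivity
      rw [Fin.val_last, show (((N + 1 : ℕ) : ℝ)) = N + 1 by push_cast; ring, div_self this,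
        g.apply_of_one_le le_rfl]
    · rw [pad_succ_castSucc, gridVal, if_neg (by simp), grid]
      simp

theorem pad_grid (N : ℕ) (k : Fin (N + 2)) : pad (grid N) k = (k : ℝ) / (N + 1) := by
  have hN : ((N : ℝ) + 1) ≠ 0 := by positivity
  refine Fin.cases ?_ (fun k => ?_) k
  · simp [pad_zero]
  · refine Fin.lastCases ?_ (fun k => ?_) k
    · rw [Fin.succ_last, pad_last, Fin.val_last,
        show (((N + 1 : ℕ) : ℝ)) = N + 1 by push_cast; ring, div_self hN]
    · rw [pad_succ_castSucc, grid]; simp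

theorem gap_grid (N : ℕ) (i : Fin (N + 1)) : gap (pad (grid N)) i = 1 / (N + 1) := by
  rw [gap, pad_grid, pad_grid, ← sub_div]
  simp

theorem grid_mem_simplex (N : ℕ) : grid N ∈ simplex N := by
  rw [simplex, mem_ofPred_eq, strictMono_iff_gap]
  intro i
  rw [gap_grid]; positivity

theorem gridVal_mem (N : ℕ) (g : G0) (k : ℕ) : gridVal N g k ∈ Icc (0 : ℝ) 1 := by
  unfold gridVal
  split_ifs
  · simp
  · exact g.apply_mem _

theorem gridVal_mono (N : ℕ) (g : G0) : Monotone (gridVal N g) := by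
  intro j k hjk
  unfold gridVal
  split_ifs with h1 h2
  · exact le_rfl
  · exact (g.apply_mem _).1
  · omega
  · refine g.monotone ?_
    gcongr

theorem floor_div_tendsto (s : ℝ) (hs : 0 ≤ s) :
    Tendsto (fun N : ℕ => ((⌊((N : ℝ) + 1) * s⌋₊ : ℕ) : ℝ) / ((N : ℝ) + 1)) atTop (𝓝 s) := by
  have h1 : Tendsto (fun N : ℕ => (N : ℝ) + 1) atTop atTop :=
    tendsto_atTop_add_const_right _ _ tendsto_natCast_atTop_atTop
  have := (tendsto_nat_floor_mul_div_atTop hs).comp h1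
  refine this.congr fun N => ?_
  simp [Function.comp, mul_comm]

/-- The sum is the integral of a step function in `s`, both of whose arguments tend to `g s`
wherever `g` is continuous. Continuity of `c` is needed only at diagonal points; dominated
convergence concludes. -/
theorem tendsto_riemannSum {c : ℝ × ℝ → ℝ} {C : ℝ}
    (hb : ∀ x ∈ Icc (0 : ℝ) 1, ∀ y ∈ Icc (0 : ℝ) 1, |c (x, y)| ≤ C)
    (hc : ∀ y ∈ Icc (0 : ℝ) 1, ContinuousWithinAt c (Icc (0 : ℝ) 1 ×ˢ Icc (0 : ℝ) 1) (y, y))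
    (g : G0) :
    Tendsto (fun N : ℕ => ∑ i : Fin (N + 1), 1 / ((N : ℝ) + 1) *
        c (pad (fun j => g (grid N j)) i.castSucc, pad (fun j => g (grid N j)) i.succ)) atTop
      (𝓝 (∫ s, c (g s, g s) ∂leb)) := by
  have e : ∀ N : ℕ, ∑ i : Fin (N + 1), 1 / ((N : ℝ) + 1) *
      c (pad (fun j => g (grid N j)) i.castSucc, pad (fun j => g (grid N j)) i.succ) =
      ∫ s, c (gridVal N g ⌊((N : ℝ) + 1) * s⌋₊, gridVal N g (⌊((N : ℝ) + 1) * s⌋₊ + 1)) ∂leb := by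
    intro N
    have hN : (0 : ℝ) < (N : ℝ) + 1 := by positivity
    have hset : ∀ k : ℕ, ∀ᵐ s ∂volume, s ∈ uIoc ((k : ℝ) / (N + 1)) (((k + 1 : ℕ) : ℝ) / (N + 1)) →
        c (gridVal N g ⌊((N : ℝ) + 1) * s⌋₊, gridVal N g (⌊((N : ℝ) + 1) * s⌋₊ + 1)) =
          c (gridVal N g k, gridVal N g (k + 1)) := by
      intro k
      -- The floor function jumps at the right end point of the cell.
      have hne : ∀ᵐ s ∂(volume : Measure ℝ), s ≠ ((k + 1 : ℕ) : ℝ) / (N + 1) := by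
        simp [ae_iff]
      filter_upwards [hne] with s hs hsI
      have hle : (k : ℝ) / (N + 1) ≤ ((k + 1 : ℕ) : ℝ) / (N + 1) := by gcongr; simp
      rw [uIoc_of_le hle] at hsI
      have hlt : s < ((k + 1 : ℕ) : ℝ) / (N + 1) := lt_of_le_of_ne hsI.2 hs
      have h1 := hsI.1
      rw [div_lt_iff₀ hN] at h1
      rw [lt_div_iff₀ hN] at hlt
      have : ⌊((N : ℝ) + 1) * s⌋₊ = k := by
        rw [Nat.floor_eq_iff (by nlinarith [Nat.cast_nonneg (α := ℝ) k])]
        push_cast at hlt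
        constructor <;> linarith
      rw [this]
    rw [← intervalIntegral_eq_leb]
    have hadj := intervalIntegral.sum_integral_adjacent_intervals (μ := volume)
      (f := fun s => c (gridVal N g ⌊((N : ℝ) + 1) * s⌋₊, gridVal N g (⌊((N : ℝ) + 1) * s⌋₊ + 1)))
      (a := fun k : ℕ => (k : ℝ) / (N + 1)) (n := N + 1) (fun k _ => by
        refine (intervalIntegrable_congr_ae ?_).2
          (intervalIntegrable_const (c := c (gridVal N g k, gridVal N g (k + 1))))
        exact (ae_restrict_iff' measurableSet_uIoc).2 (hset k))
    have hl : ((N + 1 : ℕ) : ℝ) / ((N : ℝ) + 1) = 1 := by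
      push_cast; exact div_self hN.ne'
    simp only [Nat.cast_zero, zero_div, hl] at hadj
    rw [← hadj, ← Fin.sum_univ_eq_sum_range
      (fun k => ∫ s in ((k : ℝ) / (N + 1))..(((k + 1 : ℕ) : ℝ) / (N + 1)),
        c (gridVal N g ⌊((N : ℝ) + 1) * s⌋₊, gridVal N g (⌊((N : ℝ) + 1) * s⌋₊ + 1))) (N + 1)]
    refine Finset.sum_congr rfl fun i _ => ?_
    rw [intervalIntegral.integral_congr_ae (hset i), intervalIntegral.integral_const, ← sub_div,
      pad_eval_grid, pad_eval_grid]
    simp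
  simp_rw [e]
  have hcont : ∀ᵐ s ∂leb, ContinuousAt (g : ℝ → ℝ) s :=
    ae_restrict_of_ae (g.monotone.countable_not_continuousAt.ae_notMem volume |>.mono
      fun t ht => by simpa using ht)
  refine tendsto_integral_of_dominated_convergence (fun _ => C) ?_ (integrable_const _) ?_ ?_
  · intro N
    have hm : Measurable fun s : ℝ => ⌊((N : ℝ) + 1) * s⌋₊ :=
      Nat.measurable_floor.comp (measurable_const.mul measurable_id)
    exact ((measurable_of_countable
      (fun k : ℕ => c (gridVal N g k, gridVal N g (k + 1)))).comp hm).aestronglyMeasurable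
  · exact fun N => Eventually.of_forall fun s => hb _ (gridVal_mem _ _ _) _ (gridVal_mem _ _ _)
  · filter_upwards [hcont, ae_mem_Ioo_leb] with s hs hs01
    have hf := floor_div_tendsto s hs01.1.le
    have hf' : Tendsto (fun N : ℕ => (((⌊((N : ℝ) + 1) * s⌋₊ + 1 : ℕ) : ℝ) / ((N : ℝ) + 1))) atTop
        (𝓝 s) := by
      have := hf.add tendsto_one_div_add_atTop_nhds_zero_nat
      rw [add_zero] at this
      refine this.congr fun N => ?_
      push_cast; ring
    -- At the index `0`, `gridVal` is `0` instead of `g 0`, so this index has to be avoided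
    -- eventually.
    have hpos : ∀ᶠ N : ℕ in atTop, ⌊((N : ℝ) + 1) * s⌋₊ ≠ 0 := by
      filter_upwards [hf.eventually (lt_mem_nhds hs01.1)] with N hN h0
      rw [h0] at hN; simp at hN
    have g1 : Tendsto (fun N : ℕ => gridVal N g ⌊((N : ℝ) + 1) * s⌋₊) atTop (𝓝 (g s)) := by
      refine (hs.tendsto.comp hf).congr' ?_
      filter_upwards [hpos] with N hN
      simp [gridVal, hN]
    have g2 : Tendsto (fun N : ℕ => gridVal N g (⌊((N : ℝ) + 1) * s⌋₊ + 1)) atTop (𝓝 (g s)) := by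
      refine (hs.tendsto.comp hf').congr fun N => ?_
      simp [gridVal]
    refine (hc (g s) (g.apply_mem s)).tendsto.comp (tendsto_nhdsWithin_iff.2
      ⟨g1.prodMk_nhds g2, Eventually.of_forall fun N => ⟨gridVal_mem N g _, gridVal_mem N g (_ + 1)⟩⟩)

/-- The general Riemann sum contains one further right end point, namely `1`, whose contribution `a
1 / (N + 1)` vanishes in the limit. -/
theorem tendsto_riemannSum_right {a : ℝ → ℝ} (ha : Continuous a) (g : G0) :
    Tendsto (fun N : ℕ => 1 / ((N : ℝ) + 1) * ∑ j : Fin N, a (g (grid N j))) atTop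
      (𝓝 (∫ s, a (g s) ∂leb)) := by
  obtain ⟨C, -, hC⟩ := exists_bound_Icc ha
  have h1 := tendsto_riemannSum (c := fun p => a p.2) (C := C) (fun x _ y hy => hC y hy)
    (fun y _ => (ha.comp continuous_snd).continuousWithinAt) g
  have h2 : Tendsto (fun N : ℕ => 1 / ((N : ℝ) + 1) * a 1) atTop (𝓝 0) := by
    simpa using tendsto_one_div_add_atTop_nhds_zero_nat.mul_const (a 1)
  have h3 := h1.sub h2
  rw [sub_zero] at h3
  refine h3.congr fun N => ?_
  rw [Fin.sum_univ_castSucc]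
  simp only [Fin.succ_last, pad_last, pad_succ_castSucc]
  rw [Finset.mul_sum]; ring

/-! ### Density of cylinder functions in the continuous functions -/

/-- The cylinder functions as a subalgebra of the continuous functions. -/
def cylAlgebra : Subalgebra ℝ C(G0, ℝ) where
  carrier := {f | (f : G0 → ℝ) ∈ cyl 1}
  mul_mem' := fun ha hb => cyl_mul ha hb
  add_mem' := fun ha hb => cyl_add ha hb
  algebraMap_mem' := fun r => const_mem_cyl r

/-- The choices `α = cos (ξ ·)` and `α = sin (ξ ·)` already determine the law of `g` under `leb`,
and thereby `g`. -/
theorem cylAlgebra_separatesPoints : cylAlgebra.SeparatesPoints := by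
  intro g h hgh
  by_contra hcon
  push Not at hcon
  have key : ∀ a : ℝ → ℝ, ContDiff ℝ 1 a → ∫ s, a (g s) ∂leb = ∫ s, a (h s) ∂leb := by
    intro a ha
    have hmem : (fun g => (fun x : Fin 1 → ℝ => x 0) (cylArg (fun _ : Fin 1 => a) g)) ∈ cyl 1 :=
      mem_cyl_one_iff.2 ⟨1, _, _, contDiff_apply ℝ ℝ 0, fun _ => ha, rfl⟩
    have := hcon _ ⟨⟨_, cyl_continuous hmem⟩, hmem, rfl⟩
    simpa [cylArg, intervalIntegral_eq_leb] using this
  refine hgh (G0.ext_of_integral_cos_sin (fun ξ => ?_) fun ξ => ?_)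
  · exact key (fun x => Real.cos (ξ * x)) (by fun_prop)
  · exact key (fun x => Real.sin (ξ * x)) (by fun_prop)

/-- Stone–Weierstrass on the compact space `G0`. -/
theorem exists_cyl_near {f : G0 → ℝ} (hf : Continuous f) {ε : ℝ} (hε : 0 < ε) :
    ∃ h ∈ cyl 1, ∀ g, |f g - h g| < ε := by
  obtain ⟨h, hh⟩ := ContinuousMap.exists_mem_subalgebra_near_continuous_of_separatesPoints
    cylAlgebra cylAlgebra_separatesPoints f hf ε hε
  refine ⟨_, h.2, fun g => ?_⟩
  rw [abs_sub_comm]; exact hh g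

/-! ### Uniqueness of the Dirichlet process -/

/-- The integrands on the left depend on `g` only through finitely many values, so integrals of
cylinder functions are limits of integrals against finite dimensional distributions. -/
theorem tendsto_integral_riemann (Q : Measure G0) [IsProbabilityMeasure Q] {m : ℕ}
    {U : (Fin m → ℝ) → ℝ} {A : Fin m → ℝ → ℝ} (hU : Continuous U) (hA : ∀ i, Continuous (A i)) :
    Tendsto (fun N : ℕ => ∫ g, U (fun i => 1 / ((N : ℝ) + 1) * ∑ j : Fin N, A i (g (grid N j))) ∂Q)
      atTop (𝓝 (∫ g, U (cylArg A g) ∂Q)) := by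
  choose C hC0 hC using fun i => exists_bound_Icc (hA i)
  obtain ⟨B, hB⟩ := (isCompact_univ_pi fun i => isCompact_Icc (a := -C i) (b := C i)
    ).exists_bound_of_continuousOn hU.continuousOn
  refine tendsto_integral_of_dominated_convergence (fun _ => B) ?_ (integrable_const _) ?_ ?_
  · intro N
    refine (hU.measurable.comp (measurable_pi_iff.2 fun i => ?_)).aestronglyMeasurable
    exact (Finset.measurable_fun_sum _ fun j _ =>
      (hA i).measurable.comp (G0.measurable_eval_at _)).const_mul _
  · refine fun N => Eventually.of_forall fun g => hB _ fun i _ => abs_le.1 ?_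
    rw [abs_mul, abs_of_nonneg (by positivity : (0 : ℝ) ≤ 1 / ((N : ℝ) + 1))]
    have h1 : |∑ j : Fin N, A i (g (grid N j))| ≤ ∑ _j : Fin N, C i :=
      (Finset.abs_sum_le_sum_abs _ _).trans
        (Finset.sum_le_sum fun j _ => hC i _ (g.apply_mem _))
    rw [Finset.sum_const, Finset.card_univ, Fintype.card_fin, nsmul_eq_mul] at h1
    rw [div_mul_eq_mul_div, one_mul, div_le_iff₀ (by positivity)]
    nlinarith [hC0 i]
  · refine Eventually.of_forall fun g => (hU.tendsto _).comp (tendsto_pi_nhds.2 fun i => ?_)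
    simp only [cylArg, intervalIntegral_eq_leb]
    exact tendsto_riemannSum_right (hA i) g

theorem IsDirichletProcess.integral_eq {β : ℝ} {Q : Measure G0} (hQ : IsDirichletProcess β Q)
    {N : ℕ} {t : Fin N → ℝ} (ht : t ∈ simplex N) {f : (Fin N → ℝ) → ℝ} (hf : Measurable f) :
    ∫ g, f (fun i => g (t i)) ∂Q = ∫ x, f x ∂(dirichletLaw β t) := by
  rw [← hQ.fdd N t ht, integral_map (G0.measurable_eval_pi t).aemeasurable
    hf.aestronglyMeasurable]

/-- Both laws integrate cylinder functions in the same way, by `tendsto_integral_riemann`, and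
cylinder functions are uniformly dense in the continuous functions. -/
theorem IsDirichletProcess.unique {β : ℝ} {Q Q' : Measure G0} (hQ : IsDirichletProcess β Q)
    (hQ' : IsDirichletProcess β Q') : Q = Q' := by
  have := hQ.isProbability
  have := hQ'.isProbability
  have hcyl : ∀ f ∈ cyl 1, ∫ g, f g ∂Q = ∫ g, f g ∂Q' := by
    intro f hf
    obtain ⟨m, U, A, hU, hA, rfl⟩ := mem_cyl_one_iff.1 hf
    have hAc := fun i => (hA i).continuous
    refine tendsto_nhds_unique (tendsto_integral_riemann Q hU.continuous hAc) ?_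
    refine (tendsto_integral_riemann Q' hU.continuous hAc).congr fun N => ?_
    have hm : Measurable fun x : Fin N → ℝ =>
        U (fun i => 1 / ((N : ℝ) + 1) * ∑ j : Fin N, A i (x j)) := by
      refine hU.continuous.measurable.comp (measurable_pi_iff.2 fun i => ?_)
      exact (Finset.measurable_fun_sum _ fun j _ =>
        (hAc i).measurable.comp (measurable_pi_apply j)).const_mul _
    exact (hQ'.integral_eq (grid_mem_simplex N) hm).trans
      (hQ.integral_eq (grid_mem_simplex N) hm).symm
  refine ext_of_forall_integral_eq_of_IsFiniteMeasure fun f => ?_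
  refine eq_of_forall_dist_le fun ε hε => ?_
  obtain ⟨h, hh, hn⟩ := exists_cyl_near f.continuous (half_pos hε)
  have hb : ∀ (P : Measure G0) [IsProbabilityMeasure P],
      |∫ g, f g ∂P - ∫ g, h g ∂P| ≤ ε / 2 := by
    intro P _
    obtain ⟨C, -, hC⟩ := exists_bound_of_continuous (cyl_continuous hh)
    rw [← integral_sub (f.integrable P) (Integrable.of_bound
      (cyl_continuous hh).measurable.aestronglyMeasurable C (Eventually.of_forall hC))]
    have := norm_integral_le_of_norm_le_const (μ := P) (f := fun g => f g - h g) (C := ε / 2)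
      (Eventually.of_forall fun g => (hn g).le)
    simpa using this
  have h1 := hb Q
  have h2 := hb Q'
  rw [Real.dist_eq]
  rw [hcyl h hh] at h1
  rw [abs_sub_comm] at h2
  have := abs_sub_le (∫ g, f g ∂Q) (∫ g, h g ∂Q') (∫ g, f g ∂Q')
  linarith

/-! ### Existence of the Dirichlet process -/

/-- The step function with value `x i` at time `t i`. -/
def stepVal {N : ℕ} (t x : Fin N → ℝ) (s : ℝ) : ℝ :=
  Finset.univ.sup' Finset.univ_nonempty fun o : Option (Fin N) =>
    o.elim 0 fun i => if t i ≤ s then max 0 (min (x i) 1) else 0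

theorem stepVal_monotone {N : ℕ} (t x : Fin N → ℝ) : Monotone (stepVal t x) := by
  intro r s hrs
  refine Finset.sup'_mono_fun fun o _ => ?_
  cases o with
  | none => exact le_rfl
  | some i =>
    simp only [Option.elim_some]
    split_ifs with h1 h2
    · exact le_rfl
    · exact absurd (h1.trans hrs) h2
    · exact le_max_left _ _
    · exact le_rfl

theorem stepVal_mem {N : ℕ} (t x : Fin N → ℝ) (s : ℝ) : stepVal t x s ∈ Icc (0 : ℝ) 1 := by
  constructor
  · exact Finset.le_sup' (f := fun o : Option (Fin N) =>
      o.elim 0 fun i => if t i ≤ s then max 0 (min (x i) 1) else 0) (Finset.mem_univ none)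
  · refine Finset.sup'_le _ _ fun o _ => ?_
    cases o with
    | none => exact zero_le_one
    | some i =>
      simp only [Option.elim_some]
      split_ifs
      · exact max_le zero_le_one (min_le_right _ _)
      · exact zero_le_one

theorem stepVal_rightCts {N : ℕ} (t x : Fin N → ℝ) (s : ℝ) :
    ContinuousWithinAt (stepVal t x) (Ici s) s := by
  refine ContinuousWithinAt.finset_sup'_apply _ fun o _ => ?_
  cases o with
  | none => exact continuousWithinAt_const
  | some i =>
    simp only [Option.elim_some]
    by_cases h : t i ≤ s
    · refine (continuousWithinAt_const (b := max 0 (min (x i) 1))).congr (fun r hr => ?_) ?_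
      · exact if_pos (h.trans hr)
      · exact if_pos h
    · refine (continuousWithinAt_const (b := (0 : ℝ))).congr_of_eventuallyEq ?_ (if_neg h)
      filter_upwards [mem_nhdsWithin_of_mem_nhds (Iio_mem_nhds (not_le.1 h))] with r hr
      exact if_neg (not_le.2 hr)

theorem stepVal_apply {N : ℕ} {t x : Fin N → ℝ} (ht : t ∈ simplex N) (hx : x ∈ simplex N)
    (j : Fin N) : stepVal t x (t j) = x j := by
  have hm : ∀ {z : Fin N → ℝ}, z ∈ simplex N → StrictMono z := fun {z} hz i j hij => by
    have := hz (show i.castSucc.succ < j.castSucc.succ by rw [Fin.succ_lt_succ_iff]; exact hij)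
    rwa [pad_succ_castSucc, pad_succ_castSucc] at this
  have h01 : ∀ i, x i ∈ Icc (0 : ℝ) 1 := fun i => by
    have h1 := hx.monotone (Fin.zero_le i.castSucc.succ)
    have h2 := hx.monotone (Fin.le_last i.castSucc.succ)
    rw [pad_zero, pad_succ_castSucc] at h1
    rw [pad_last, pad_succ_castSucc] at h2
    exact ⟨h1, h2⟩
  have hcl : ∀ i, max 0 (min (x i) 1) = x i := fun i => by
    rw [min_eq_left (h01 i).2, max_eq_right (h01 i).1]
  refine le_antisymm (Finset.sup'_le _ _ fun o _ => ?_) ?_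
  · cases o with
    | none => exact (h01 j).1
    | some i =>
      simp only [Option.elim_some, hcl]
      split_ifs with h
      · exact (hm hx).monotone ((hm ht).le_iff_le.1 h)
      · exact (h01 j).1
  · refine le_trans (le_of_eq ?_) (Finset.le_sup' (f := fun o : Option (Fin N) =>
      o.elim 0 fun i => if t i ≤ t j then max 0 (min (x i) 1) else 0) (Finset.mem_univ (some j)))
    simp [hcl]

/-- The step function as a monotone map. -/
def stepMap {N : ℕ} (t x : Fin N → ℝ) : G0 :=
  G0.ofFun (stepVal t x) (stepVal_monotone t x) (stepVal_mem t x) (stepVal_rightCts t x)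

/-- As a finite supremum of clamped values, `stepVal` defines a monotone map for every `x`, not only
for `x` in the simplex, and depends continuously on `x`. -/
theorem continuous_stepMap {N : ℕ} (t : Fin N → ℝ) : Continuous (stepMap t) := by
  rw [continuous_iff_continuousAt]
  intro x
  refine G0.tendsto_of_ae ?_
  filter_upwards [ae_mem_Ioo_leb] with s hs
  have e : ∀ y, stepMap t y s = stepVal t y s := fun y =>
    G0.ofFun_apply _ _ _ _ (Ioo_subset_Ico_self hs)
  simp only [e]
  have : Continuous fun y => stepVal t y s := by
    refine Continuous.finset_sup'_apply _ fun o _ => ?_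
    cases o with
    | none => exact continuous_const
    | some i =>
      simp only [Option.elim_some]
      split_ifs
      · fun_prop
      · exact continuous_const
  exact this.tendsto x

/-- The law of a step function with Dirichlet distributed values. -/
def stepLaw (β : ℝ) {N : ℕ} (t : Fin N → ℝ) : Measure G0 := (dirichletLaw β t).map (stepMap t)

theorem isProbabilityMeasure_stepLaw {β : ℝ} (hβ : 0 < β) {N : ℕ} {t : Fin N → ℝ}
    (ht : t ∈ simplex N) : IsProbabilityMeasure (stepLaw β t) := by
  have := isProbabilityMeasure_dirichletLaw hβ ht
  exact Measure.isProbabilityMeasure_map (continuous_stepMap t).measurable.aemeasurable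

theorem mem_Ioo_of_mem_simplex {N : ℕ} {t : Fin N → ℝ} (ht : t ∈ simplex N) (j : Fin N) :
    t j ∈ Ioo (0 : ℝ) 1 := by
  have h1 := ht (show (0 : Fin (N + 2)) < j.castSucc.succ from Fin.succ_pos _)
  have h2 := ht (show j.castSucc.succ < Fin.last (N + 1) by
    rw [← Fin.succ_last, Fin.succ_lt_succ_iff]; exact Fin.castSucc_lt_last j)
  rw [pad_zero, pad_succ_castSucc] at h1
  rw [pad_last, pad_succ_castSucc] at h2
  exact ⟨h1, h2⟩

/-- The Dirichlet law is carried by the simplex, where the step function takes the value `x j` at `t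
j`; consistency of the Dirichlet laws does the rest. -/
theorem stepLaw_fdd {β : ℝ} (hβ : 0 < β) {M N : ℕ} {t : Fin N → ℝ} (ht : t ∈ simplex N)
    {σ : Fin M → Fin N} (hσ : StrictMono σ) :
    (stepLaw β t).map (fun g j => g (t (σ j))) = dirichletLaw β fun j => t (σ j) := by
  rw [stepLaw, Measure.map_map (G0.measurable_eval_pi _) (continuous_stepMap t).measurable,
    ← dirichletLaw_map_comp hβ ht hσ]
  refine Measure.map_congr ?_
  filter_upwards [ae_mem_simplex β t] with x hx
  funext j
  rw [Function.comp_apply, stepMap,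
    G0.ofFun_apply _ _ _ _ (Ioo_subset_Ico_self (mem_Ioo_of_mem_simplex ht _)),
    stepVal_apply ht hx]

theorem integral_eval_eq {β : ℝ} (hβ : 0 < β) {P : Measure G0} {r : ℝ} (hr : r ∈ Ioo (0 : ℝ) 1)
    (hP : P.map (fun g (_ : Fin 1) => g r) = dirichletLaw β fun _ : Fin 1 => r) :
    ∫ g, g r ∂P = r := by
  rw [integral_eq_lintegral_of_nonneg_ae (Eventually.of_forall fun g => (g.apply_mem r).1)
    (G0.measurable_eval_at r).aestronglyMeasurable]
  have h := lintegral_dirichletLaw_one hβ hr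
  rw [← hP, lintegral_map (measurable_pi_apply 0).ennreal_ofReal
    (G0.measurable_eval_pi fun _ : Fin 1 => r)] at h
  rw [h, ENNReal.toReal_ofReal hr.1.le]

/-- The elements of a finite subset of `(0, 1)` in increasing order. -/
def sortedTimes (S : Finset (Ioo (0 : ℝ) 1)) (i : Fin S.card) : ℝ := (S.orderEmbOfFin rfl i : ℝ)

theorem mem_simplex_of_strictMono {N : ℕ} {t : Fin N → ℝ} (h : StrictMono t)
    (h01 : ∀ i, t i ∈ Ioo (0 : ℝ) 1) : t ∈ simplex N := by
  intro a b
  refine Fin.cases ?_ (fun a => ?_) a <;> refine Fin.cases ?_ (fun b => ?_) b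
  · intro h; exact absurd h (lt_irrefl _)
  · intro _
    refine Fin.lastCases ?_ (fun b => ?_) b
    · rw [pad_zero, Fin.succ_last, pad_last]; exact one_pos
    · rw [pad_zero, pad_succ_castSucc]; exact (h01 _).1
  · intro h; exact absurd h (not_lt.2 (Fin.zero_le _))
  · rw [Fin.succ_lt_succ_iff]
    refine Fin.lastCases ?_ (fun a => ?_) a <;> refine Fin.lastCases ?_ (fun b => ?_) b
    · intro h; exact absurd h (lt_irrefl _)
    · intro h; exact absurd h (not_lt.2 (Fin.le_last _))
    · intro _
      rw [pad_succ_castSucc, Fin.succ_last, pad_last]; exact (h01 _).2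
    · intro hab
      rw [pad_succ_castSucc, pad_succ_castSucc]; exact h hab

theorem sortedTimes_mem_simplex (S : Finset (Ioo (0 : ℝ) 1)) : sortedTimes S ∈ simplex S.card :=
  mem_simplex_of_strictMono (fun _ _ h => (S.orderEmbOfFin rfl).strictMono h)
    fun i => (S.orderEmbOfFin rfl i).2

theorem strictMono_of_mem_simplex {N : ℕ} {t : Fin N → ℝ} (ht : t ∈ simplex N) : StrictMono t :=
  fun i j hij => by
    have := ht (show i.castSucc.succ < j.castSucc.succ by rw [Fin.succ_lt_succ_iff]; exact hij)
    rwa [pad_succ_castSucc, pad_succ_castSucc] at this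

theorem stepLaw_sortedTimes_fdd {β : ℝ} (hβ : 0 < β) {M : ℕ} {t : Fin M → ℝ} (ht : t ∈ simplex M)
    {S : Finset (Ioo (0 : ℝ) 1)} (hS : ∀ j, (⟨t j, mem_Ioo_of_mem_simplex ht j⟩ : Ioo (0 : ℝ) 1) ∈ S) :
    (stepLaw β (sortedTimes S)).map (fun g j => g (t j)) = dirichletLaw β t := by
  have hex : ∀ j, ∃ i, sortedTimes S i = t j := fun j => by
    have : (⟨t j, mem_Ioo_of_mem_simplex ht j⟩ : Ioo (0 : ℝ) 1) ∈ range (S.orderEmbOfFin rfl) := by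
      rw [Finset.range_orderEmbOfFin]; exact hS j
    obtain ⟨i, hi⟩ := this
    exact ⟨i, by rw [sortedTimes, hi]⟩
  choose σ hσ using hex
  have hm : StrictMono σ := fun a b hab => by
    have := strictMono_of_mem_simplex ht hab
    rw [← hσ a, ← hσ b] at this
    exact (strictMono_of_mem_simplex (sortedTimes_mem_simplex S)).lt_iff_lt.1 this
  have := stepLaw_fdd hβ (sortedTimes_mem_simplex S) hm
  simpa only [hσ] using this

/-- Cosine and sine suffice, as they give the characteristic function. Both are bounded by one and
`1`-Lipschitz, which is what the error estimates below require of a test function. -/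
theorem ext_of_integral_cos_sin_dual {E : Type*} [NormedAddCommGroup E] [NormedSpace ℝ E]
    [MeasurableSpace E] [BorelSpace E] [SecondCountableTopology E] [CompleteSpace E]
    {μ ν : Measure E} [IsFiniteMeasure μ] [IsFiniteMeasure ν]
    (h : ∀ f : ℝ → ℝ, Continuous f → (∀ x, |f x| ≤ 1) → (∀ x y, |f x - f y| ≤ |x - y|) →
      ∀ L : StrongDual ℝ E, ∫ x, f (L x) ∂μ = ∫ x, f (L x) ∂ν) : μ = ν := by
  refine Measure.ext_of_charFunDual ?_
  have key : ∀ (κ : Measure E) [IsFiniteMeasure κ] (L : StrongDual ℝ E), charFunDual κ L =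
      (∫ x, Real.cos (L x) ∂κ : ℝ) + (∫ x, Real.sin (L x) ∂κ : ℝ) * Complex.I := by
    intro κ _ L
    rw [charFunDual_apply]
    have e : ∀ x, Complex.exp (L x * Complex.I)
        = ((Real.cos (L x) : ℝ) : ℂ) + ((Real.sin (L x) : ℝ) : ℂ) * Complex.I := by
      intro x
      rw [Complex.exp_mul_I]; push_cast; rfl
    simp_rw [e]
    have hb : ∀ f : ℝ → ℝ, Continuous f → (∀ x, |f x| ≤ 1) →
        Integrable (fun x => ((f (L x) : ℝ) : ℂ)) κ := fun f hf h1 =>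
      (Integrable.of_bound (hf.comp L.continuous).measurable.aestronglyMeasurable 1
          (Eventually.of_forall fun s => h1 _)).ofReal
    rw [integral_add (hb _ Real.continuous_cos Real.abs_cos_le_one)
      ((hb _ Real.continuous_sin Real.abs_sin_le_one).mul_const _), integral_mul_const,
      integral_complex_ofReal, integral_complex_ofReal]
  funext L
  rw [key, key, h _ Real.continuous_cos Real.abs_cos_le_one Real.abs_cos_sub_cos_le,
    h _ Real.continuous_sin Real.abs_sin_le_one Real.abs_sin_sub_sin_le]

/-- By monotonicity `avg δ g (t j)` lies between `g (t j)` and `g (t j + δ)`, whose means differ by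
`δ`. Discontinuous evaluations are thus replaced by continuous functionals, with an error that does
not depend on `P`. -/
theorem abs_integral_avg_sub_le {P : Measure G0} [IsProbabilityMeasure P] {M : ℕ} {t : Fin M → ℝ}
    {δ : ℝ} (hδ : 0 < δ) (h1 : ∀ j, ∫ g, g (t j) ∂P = t j) (h2 : ∀ j, ∫ g, g (t j + δ) ∂P = t j + δ)
    {f : ℝ → ℝ} (hf : Continuous f) (hf1 : ∀ x, |f x| ≤ 1) (hfl : ∀ x y, |f x - f y| ≤ |x - y|)
    (L : StrongDual ℝ (Fin M → ℝ)) :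
    |∫ g, f (L fun j => G0.avg δ g (t j)) ∂P - ∫ g, f (L fun j => g (t j)) ∂P| ≤ ‖L‖ * (M * δ) := by
  have hint : ∀ r, Integrable (fun g : G0 => g r) P := fun r =>
    Integrable.of_bound (G0.measurable_eval_at r).aestronglyMeasurable 1
      (Eventually.of_forall fun g => g.abs_apply_le r)
  have hm1 : Measurable fun g : G0 => fun j => G0.avg δ g (t j) := measurable_pi_iff.2 fun j =>
    (G0.continuous_avg hδ.le).measurable.comp (measurable_id.prodMk measurable_const)
  have hLm := L.continuous.measurable
  have i1 : Integrable (fun g => f (L fun j => G0.avg δ g (t j))) P := Integrable.of_bound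
    (hf.measurable.comp (hLm.comp hm1)).aestronglyMeasurable 1 (Eventually.of_forall fun _ => hf1 _)
  have i2 : Integrable (fun g : G0 => f (L fun j => g (t j))) P := Integrable.of_bound
    (hf.measurable.comp (hLm.comp (G0.measurable_eval_pi t))).aestronglyMeasurable 1
    (Eventually.of_forall fun _ => hf1 _)
  rw [← integral_sub i1 i2]
  have hs : ∫ g, ‖L‖ * ∑ j, (g (t j + δ) - g (t j)) ∂P = ‖L‖ * (M * δ) := by
    have hi : ∀ j ∈ Finset.univ, Integrable (fun g : G0 => g (t j + δ) - g (t j)) P :=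
      fun j _ => (hint _).sub (hint _)
    rw [integral_const_mul, integral_finsetSum _ hi]
    simp_rw [integral_sub (hint _) (hint _), h1, h2]
    simp
  rw [← hs]
  refine abs_integral_le_integral_abs.trans (integral_mono (i1.sub i2).abs
    ((integrable_finsetSum _ fun j _ => (hint _).sub (hint _)).const_mul _) fun g => ?_)
  refine (hfl _ _).trans ?_
  rw [← map_sub]
  refine (L.le_opNorm _).trans (mul_le_mul_of_nonneg_left ?_ (norm_nonneg _))
  refine (pi_norm_le_iff_of_nonneg ?_).2 fun j => ?_
  · exact Finset.sum_nonneg fun j _ => sub_nonneg.2 (g.monotone (by linarith))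
  · rw [Pi.sub_apply, Real.norm_eq_abs, abs_of_nonneg (sub_nonneg.2 (g.le_avg hδ _))]
    refine (sub_le_sub_right (g.avg_le hδ (t j)) _).trans ?_
    exact Finset.single_le_sum (f := fun j => g (t j + δ) - g (t j))
      (fun j _ => sub_nonneg.2 (g.monotone (by linarith))) (Finset.mem_univ j)

/-- Probability measures on the compact space `G0` form a compact space, so the laws of step
functions have a limit along an ultrafilter of finite sets of times. Evaluations are not continuous;
the finite dimensional distributions pass to the limit through the means `avg δ`, with an error
linear in `δ`. -/
theorem exists_isDirichletProcess {β : ℝ} (hβ : 0 < β) : ∃ Q, IsDirichletProcess β Q := by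
  let P : Finset (Ioo (0 : ℝ) 1) → ProbabilityMeasure G0 := fun S =>
    ⟨stepLaw β (sortedTimes S), isProbabilityMeasure_stepLaw hβ (sortedTimes_mem_simplex S)⟩
  let 𝓤 : Ultrafilter (Finset (Ioo (0 : ℝ) 1)) := Ultrafilter.of atTop
  have h𝓤 : (𝓤 : Filter (Finset (Ioo (0 : ℝ) 1))) ≤ atTop := Ultrafilter.of_le atTop
  obtain ⟨Q, -, hQ⟩ := isCompact_univ.ultrafilter_le_nhds (𝓤.map P) (by simp)
  have hQ' : Tendsto P 𝓤 (𝓝 Q) := hQ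
  refine ⟨Q, inferInstance, fun M t ht => ?_⟩
  have : IsProbabilityMeasure (dirichletLaw β t) := isProbabilityMeasure_dirichletLaw hβ ht
  have : IsProbabilityMeasure ((Q : Measure G0).map fun g i => g (t i)) :=
    Measure.isProbabilityMeasure_map (G0.measurable_eval_pi t).aemeasurable
  refine ext_of_integral_cos_sin_dual fun f hf hf1 hfl L => ?_
  have hmapt : ∀ κ : Measure G0, ∫ x, f (L x) ∂(κ.map fun (g : G0) i => g (t i)) =
      (∫ g : G0, f (L fun i => g (t i)) ∂κ) := fun κ =>
    integral_map (G0.measurable_eval_pi t).aemeasurable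
      (hf.comp L.continuous).measurable.aestronglyMeasurable
  rw [hmapt]
  -- The shifted times must stay below `1` for their means to be given by the Dirichlet law.
  have hδ : ∀ᶠ n : ℕ in atTop, ∀ j, t j + 1 / ((n : ℝ) + 1) ∈ Ioo (0 : ℝ) 1 := by
    rw [eventually_all]
    intro j
    have h01 := mem_Ioo_of_mem_simplex ht j
    have := (tendsto_one_div_add_atTop_nhds_zero_nat (𝕜 := ℝ)).const_add (t j)
    rw [add_zero] at this
    exact this.eventually (Ioo_mem_nhds h01.1 h01.2)
  have hest : ∀ᶠ n : ℕ in atTop, |∫ g, f (L fun j => G0.avg (1 / ((n : ℝ) + 1)) g (t j)) ∂(Q : Measure G0)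
      - ∫ x, f (L x) ∂(dirichletLaw β t)| ≤ ‖L‖ * (M * (1 / ((n : ℝ) + 1))) := by
    filter_upwards [hδ] with n hn
    have hpos : (0 : ℝ) < 1 / ((n : ℝ) + 1) := by positivity
    have hcont : Continuous fun g => f (L fun j => G0.avg (1 / ((n : ℝ) + 1)) g (t j)) := by
      refine hf.comp (L.continuous.comp (continuous_pi fun j => ?_))
      exact (G0.continuous_avg hpos.le).comp (continuous_id.prodMk continuous_const)
    have hlim := (ProbabilityMeasure.tendsto_iff_forall_integral_tendsto.1 hQ')
      (BoundedContinuousFunction.ofNormedAddCommGroup _ hcont 1 fun g => hf1 _)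
    refine le_of_tendsto (hlim.sub_const (∫ x, f (L x) ∂(dirichletLaw β t))).abs ?_
    -- The ultrafilter refines `atTop`, so every fixed time eventually belongs to `S`.
    have hev : ∀ r : Ioo (0 : ℝ) 1, ∀ᶠ S in (𝓤 : Filter (Finset (Ioo (0 : ℝ) 1))), r ∈ S := by
      intro r
      filter_upwards [h𝓤 (eventually_ge_atTop ({r} : Finset (Ioo (0 : ℝ) 1)))] with S hS
      exact hS (Finset.mem_singleton_self r)
    filter_upwards [eventually_all.2 fun j => hev ⟨t j, mem_Ioo_of_mem_simplex ht j⟩,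
      eventually_all.2 fun j => hev ⟨_, hn j⟩] with S hS1 hS2
    have : IsProbabilityMeasure (stepLaw β (sortedTimes S)) :=
      isProbabilityMeasure_stepLaw hβ (sortedTimes_mem_simplex S)
    have hone : ∀ {r : ℝ} (hr : r ∈ Ioo (0 : ℝ) 1), (⟨r, hr⟩ : Ioo (0 : ℝ) 1) ∈ S →
        ∫ g, g r ∂(stepLaw β (sortedTimes S)) = r := fun {r} hr hrS =>
      integral_eval_eq hβ hr (stepLaw_sortedTimes_fdd hβ
        (mem_simplex_of_strictMono (t := fun _ : Fin 1 => r) (fun a b h => by omega) fun _ => hr)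
        fun _ => hrS)
    have := abs_integral_avg_sub_le (P := stepLaw β (sortedTimes S)) hpos (fun j => hone _ (hS1 j))
      (fun j => hone _ (hS2 j)) hf hf1 hfl L
    rw [← stepLaw_sortedTimes_fdd hβ ht hS1, hmapt]
    exact this
  have hl1 : Tendsto (fun n : ℕ => ∫ g, f (L fun j => G0.avg (1 / ((n : ℝ) + 1)) g (t j))
      ∂(Q : Measure G0)) atTop (𝓝 (∫ g, f (L fun j => g (t j)) ∂(Q : Measure G0))) := by
    refine tendsto_integral_of_dominated_convergence (fun _ => 1) (fun n => ?_)
      (integrable_const _) (fun n => Eventually.of_forall fun _ => hf1 _)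
      (Eventually.of_forall fun g => ?_)
    · refine (hf.comp (L.continuous.comp (continuous_pi fun j => ?_))).measurable.aestronglyMeasurable
      exact (G0.continuous_avg (by positivity)).comp (continuous_id.prodMk continuous_const)
    · refine ((hf.comp L.continuous).tendsto _).comp (tendsto_pi_nhds.2 fun j => ?_)
      exact g.tendsto_avg _ (fun n => by positivity) tendsto_one_div_add_atTop_nhds_zero_nat
  have hl2 : Tendsto (fun n : ℕ => ‖L‖ * (M * (1 / ((n : ℝ) + 1)))) atTop (𝓝 0) := by
    simpa using (tendsto_one_div_add_atTop_nhds_zero_nat (𝕜 := ℝ)).const_mul (M : ℝ)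
      |>.const_mul ‖L‖
  have h3 := le_of_tendsto_of_tendsto (hl1.sub_const _).abs hl2 hest
  exact sub_eq_zero.1 (abs_eq_zero.1 (le_antisymm h3 (abs_nonneg _)))

theorem existsUnique_isDirichletProcess {β : ℝ} (hβ : 0 < β) :
    ∃! Q : Measure G0, IsDirichletProcess β Q := by
  obtain ⟨Q, hQ⟩ := exists_isDirichletProcess hβ
  exact ⟨Q, hQ, fun Q' hQ' => hQ'.unique hQ⟩

/-! ### Integration by parts for the Dirichlet distribution -/

theorem integral_dirichletLaw {β : ℝ} (hβ : 0 < β) {N : ℕ} {t : Fin N → ℝ} (ht : t ∈ simplex N)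
    (f : (Fin N → ℝ) → ℝ) :
    ∫ x, f x ∂(dirichletLaw β t) = ∫ x in simplex N, dirichletPDF β t x * f x := by
  rw [dirichletLaw_eq, integral_withDensity_eq_integral_toReal_smul (measurable_indicator_pdf β t),
    ← integral_indicator (measurableSet_simplex N)]
  · refine integral_congr_ae (Eventually.of_forall fun x => ?_)
    by_cases hx : x ∈ simplex N
    · simp only [indicator_of_mem hx, ENNReal.toReal_ofReal (dirichletPDF_pos hβ ht hx).le,
        smul_eq_mul]
    · simp [indicator_of_notMem hx]
  · refine Eventually.of_forall fun x => ?_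
    by_cases hx : x ∈ simplex N
    · rw [indicator_of_mem hx]; exact ENNReal.ofReal_lt_top
    · rw [indicator_of_notMem hx]; exact ENNReal.zero_lt_top

/-- Differentiation of parameter integrals with parameters in a compact set. -/
theorem hasDerivAt_integral_of_compact {X P : Type*} [MeasurableSpace X] [NormedAddCommGroup P]
    [NormedSpace ℝ P] [MeasurableSpace P] [BorelSpace P] [SecondCountableTopology P]
    {μ : Measure X} [IsFiniteMeasure μ]
    {G : ℝ × P → ℝ} {Ω : Set (ℝ × P)} (hΩ : IsOpen Ω) (hG : ContDiffOn ℝ 1 G Ω) {K : Set P}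
    (hK : IsCompact K) {δ : ℝ} (hδ : 0 < δ) (hsub : Icc (-δ) δ ×ˢ K ⊆ Ω) {p : X → P}
    (hp : Measurable p) (hpK : ∀ᵐ x ∂μ, p x ∈ K) :
    HasDerivAt (fun τ => ∫ x, G (τ, p x) ∂μ) (∫ x, fderiv ℝ G (0, p x) (1, 0) ∂μ) 0 := by
  have h0 : (0 : ℝ) ∈ Icc (-δ) δ := ⟨by linarith, hδ.le⟩
  have hKc : IsCompact (Icc (-δ) δ ×ˢ K) := isCompact_Icc.prod hK
  have hGc : ContinuousOn G Ω := hG.continuousOn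
  have hDc : ContinuousOn (fun z => fderiv ℝ G z (1, 0)) Ω :=
    (hG.continuousOn_fderiv_of_isOpen hΩ le_rfl).clm_apply continuousOn_const
  obtain ⟨C, hC⟩ := hKc.exists_bound_of_continuousOn (hDc.mono hsub)
  obtain ⟨B, hB⟩ := hKc.exists_bound_of_continuousOn (hGc.mono hsub)
  have hmeas : ∀ (F : ℝ × P → ℝ), ContinuousOn F Ω → ∀ τ ∈ Icc (-δ) δ,
      AEStronglyMeasurable (fun x => F (τ, p x)) μ := by
    intro F hF τ hτ
    have hFm : Measurable (Ω.indicator F) := by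
      classical
      have := hF.measurable_piecewise (continuousOn_const (c := (0 : ℝ)) (s := Ωᶜ)) hΩ.measurableSet
      rwa [show (fun _ : ℝ × P => (0 : ℝ)) = 0 from rfl, piecewise_eq_indicator] at this
    refine (hFm.comp ((measurable_const (a := τ)).prodMk hp)).aestronglyMeasurable.congr ?_
    filter_upwards [hpK] with x hx
    exact indicator_of_mem (hsub ⟨hτ, hx⟩) _
  refine (hasDerivAt_integral_of_dominated_loc_of_deriv_le (F := fun τ x => G (τ, p x))
    (F' := fun τ x => fderiv ℝ G (τ, p x) (1, 0)) (bound := fun _ => C)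
    (Icc_mem_nhds (show -δ < 0 by linarith) hδ) ?_ ?_ (hmeas _ hDc 0 h0) ?_ (integrable_const _) ?_).2
  · filter_upwards [Icc_mem_nhds (show -δ < 0 by linarith) hδ] with τ hτ
    exact hmeas G hGc τ hτ
  · refine Integrable.of_bound (hmeas G hGc 0 h0) B ?_
    filter_upwards [hpK] with x hx
    exact hB _ ⟨h0, hx⟩
  · filter_upwards [hpK] with x hx τ hτ
    exact hC _ ⟨hτ, hx⟩
  · filter_upwards [hpK] with x hx τ hτ
    have hd : HasFDerivAt G (fderiv ℝ G (τ, p x)) (τ, p x) :=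
      ((hG.differentiableOn one_ne_zero).differentiableAt
        (hΩ.mem_nhds (hsub ⟨hτ, hx⟩))).hasFDerivAt
    exact hd.comp_hasDerivAt τ ((hasDerivAt_id τ).prodMk (hasDerivAt_const τ (p x)))

/-- The difference quotients of `φ` along the gaps of `x`. -/
def gapSlope (φ : ℝ → ℝ) {N : ℕ} (x : Fin N → ℝ) (i : Fin (N + 1)) : ℝ :=
  (φ (pad x i.succ) - φ (pad x i.castSucc)) / gap (pad x) i

theorem pad_mem_Icc {N : ℕ} {x : Fin N → ℝ} (hx : x ∈ simplex N) (k : Fin (N + 2)) :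
    pad x k ∈ Icc (0 : ℝ) 1 := by
  have h1 := hx.monotone (Fin.zero_le k)
  have h2 := hx.monotone (Fin.le_last k)
  rw [pad_zero] at h1
  rw [pad_last] at h2
  exact ⟨h1, h2⟩

section Shift

variable {φ : ℝ → ℝ} {K τ : ℝ}

/-- The displacement of all coordinates by the vector field. -/
def shift (φ : ℝ → ℝ) (τ : ℝ) {N : ℕ} (x : Fin N → ℝ) (j : Fin N) : ℝ := x j + τ * φ (x j)

theorem abs_sub_le_of_deriv (hφ : ContDiff ℝ 1 φ) (hK : ∀ x ∈ Icc (0 : ℝ) 1, |deriv φ x| ≤ K)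
    {x y : ℝ} (hx : x ∈ Icc (0 : ℝ) 1) (hy : y ∈ Icc (0 : ℝ) 1) : |φ y - φ x| ≤ K * |y - x| :=
  (convex_Icc (0 : ℝ) 1).norm_image_sub_le_of_norm_deriv_le
    (fun z _ => (hφ.differentiable one_ne_zero) z) hK hx hy

theorem shift_strictMonoOn (hφ : ContDiff ℝ 1 φ) (hK : ∀ x ∈ Icc (0 : ℝ) 1, |deriv φ x| ≤ K)
    (hτ : |τ| * K < 1) : StrictMonoOn (fun y => y + τ * φ y) (Icc 0 1) := by
  intro x hx y hy hxy
  have h1 := abs_sub_le_of_deriv hφ hK hx hy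
  have h2 : |τ * (φ y - φ x)| < y - x := by
    rw [abs_mul]
    have hyx : 0 < y - x := sub_pos.2 hxy
    rw [abs_of_pos hyx] at h1
    calc |τ| * |φ y - φ x| ≤ |τ| * (K * (y - x)) := by gcongr
      _ = (|τ| * K) * (y - x) := by ring
      _ < 1 * (y - x) := mul_lt_mul_of_pos_right hτ hyx
      _ = y - x := one_mul _
  have h3 := (abs_lt.1 h2).1
  dsimp only
  linarith

theorem pad_shift (h0 : φ 0 = 0) (h1 : φ 1 = 0) {N : ℕ} (x : Fin N → ℝ) (k : Fin (N + 2)) :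
    pad (shift φ τ x) k = pad x k + τ * φ (pad x k) := by
  refine Fin.cases ?_ (fun k => ?_) k
  · rw [pad_zero, pad_zero, h0]; ring
  · refine Fin.lastCases ?_ (fun k => ?_) k
    · rw [Fin.succ_last, pad_last, pad_last, h1]; ring
    · rw [pad_succ_castSucc, pad_succ_castSucc]; rfl

/-- Since `φ` vanishes at `0` and `1`, padding commutes with the displacement. As every gap is
merely multiplied by a factor, the density changes by powers of these factors. -/
theorem gap_shift (h0 : φ 0 = 0) (h1 : φ 1 = 0) {N : ℕ} {x : Fin N → ℝ} (hx : x ∈ simplex N)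
    (i : Fin (N + 1)) :
    gap (pad (shift φ τ x)) i = gap (pad x) i * (1 + τ * gapSlope φ x i) := by
  have hg := (strictMono_iff_gap.1 hx i).ne'
  rw [gap, pad_shift h0 h1, pad_shift h0 h1, gapSlope]
  field_simp
  rw [gap]; ring

theorem abs_gapSlope_le (hφ : ContDiff ℝ 1 φ) (hK : ∀ x ∈ Icc (0 : ℝ) 1, |deriv φ x| ≤ K)
    {N : ℕ} {x : Fin N → ℝ} (hx : x ∈ simplex N) (i : Fin (N + 1)) : |gapSlope φ x i| ≤ K := by
  have hg := strictMono_iff_gap.1 hx i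
  have h := abs_sub_le_of_deriv hφ hK (pad_mem_Icc hx i.castSucc) (pad_mem_Icc hx i.succ)
  rw [gapSlope, abs_div, div_le_iff₀ (abs_pos.2 hg.ne')]
  exact h

/-- The map `y ↦ y + τ φ(y)` is strictly increasing on `[0, 1]` and fixes the end points;
surjectivity is the intermediate value theorem. -/
theorem shift_image (hφ : ContDiff ℝ 1 φ) (hK : ∀ x ∈ Icc (0 : ℝ) 1, |deriv φ x| ≤ K)
    (hτ : |τ| * K < 1) (h0 : φ 0 = 0) (h1 : φ 1 = 0) (N : ℕ) :
    shift φ τ '' simplex N = simplex N := by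
  have hm := shift_strictMonoOn hφ hK hτ
  ext y
  constructor
  · rintro ⟨x, hx, rfl⟩
    intro a b hab
    rw [pad_shift h0 h1, pad_shift h0 h1]
    exact hm (pad_mem_Icc hx a) (pad_mem_Icc hx b) (hx hab)
  · intro hy
    have hc : ContinuousOn (fun y => y + τ * φ y) (Icc (0 : ℝ) 1) :=
      (continuous_id.add (hφ.continuous.const_mul τ)).continuousOn
    have hex : ∀ j, ∃ z ∈ Icc (0 : ℝ) 1, z + τ * φ z = y j := fun j => by
      have := intermediate_value_Icc zero_le_one hc
      simp only [h0, h1, mul_zero, add_zero] at this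
      exact this (Ioo_subset_Icc_self (mem_Ioo_of_mem_simplex hy j))
    choose x hx hxy using hex
    refine ⟨x, mem_simplex_of_strictMono (fun i j hij => ?_) fun j => ?_, funext hxy⟩
    · have := strictMono_of_mem_simplex hy hij
      rw [← hxy i, ← hxy j] at this
      exact (hm.lt_iff_lt (hx i) (hx j)).1 this
    · have hyj := mem_Ioo_of_mem_simplex hy j
      rw [← hxy j] at hyj
      constructor
      · refine (hm.lt_iff_lt (by simp) (hx j)).1 ?_
        rw [h0, mul_zero, add_zero]; exact hyj.1
      · refine (hm.lt_iff_lt (hx j) (by simp)).1 ?_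
        rw [h1, mul_zero, add_zero]; exact hyj.2

/-- Change of variables under `shift φ τ`. Its Jacobian is diagonal, which gives the first product;
`gap_shift` gives the second. -/
theorem integral_shift {β : ℝ} (hβ : 0 < β) (hφ : ContDiff ℝ 1 φ)
    (hK : ∀ x ∈ Icc (0 : ℝ) 1, |deriv φ x| ≤ K) (hτ : |τ| * K < 1) (h0 : φ 0 = 0) (h1 : φ 1 = 0)
    {N : ℕ} {t : Fin N → ℝ} (ht : t ∈ simplex N) (F : (Fin N → ℝ) → ℝ) :
    ∫ x, F (shift φ τ x) * ((∏ j, (1 + τ * deriv φ (x j))) *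
        ∏ i, (1 + τ * gapSlope φ x i) ^ (β * gap (pad t) i - 1)) ∂(dirichletLaw β t) =
      ∫ x, F x ∂(dirichletLaw β t) := by
  rw [integral_dirichletLaw hβ ht, integral_dirichletLaw hβ ht]
  have hm := shift_strictMonoOn hφ hK hτ
  let D : (Fin N → ℝ) → ((Fin N → ℝ) →L[ℝ] (Fin N → ℝ)) := fun x =>
    ContinuousLinearMap.pi fun j => (ContinuousLinearMap.toSpanSingleton ℝ
      (1 + τ * deriv φ (x j))).comp (ContinuousLinearMap.proj j)
  have hD : ∀ x ∈ simplex N, HasFDerivWithinAt (shift φ τ) (D x) (simplex N) x := by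
    intro x _
    refine HasFDerivAt.hasFDerivWithinAt (hasFDerivAt_pi.2 fun j => ?_)
    have hd : HasDerivAt (fun y => y + τ * φ y) (1 + τ * deriv φ (x j)) (x j) :=
      (hasDerivAt_id _).add (((hφ.differentiable one_ne_zero) _).hasDerivAt.const_mul τ)
    exact HasFDerivAt.comp x (g := fun y => y + τ * φ y) (f := fun x : Fin N → ℝ => x j) hd.hasFDerivAt
      (hasFDerivAt_apply j x)
  have hinj : InjOn (shift φ τ) (simplex N) := by
    intro x hx y hy hxy
    funext j
    exact hm.injOn (Ioo_subset_Icc_self (mem_Ioo_of_mem_simplex hx j))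
      (Ioo_subset_Icc_self (mem_Ioo_of_mem_simplex hy j)) (congrFun hxy j)
  have hchange := integral_image_eq_integral_abs_det_fderiv_smul volume (measurableSet_simplex N)
    hD hinj (fun x => dirichletPDF β t x * F x)
  rw [shift_image hφ hK hτ h0 h1] at hchange
  rw [hchange]
  refine setIntegral_congr_fun (measurableSet_simplex N) fun x hx => ?_
  have hp1 : ∀ y ∈ Icc (0 : ℝ) 1, ∀ d, |d| ≤ K → 0 < 1 + τ * d := fun y _ d hd => by
    have : |τ * d| < 1 := by
      rw [abs_mul]
      exact (mul_le_mul_of_nonneg_left hd (abs_nonneg τ)).trans_lt hτ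
    linarith [(abs_lt.1 this).1]
  have hdet : |(D x).det| = ∏ j, (1 + τ * deriv φ (x j)) := by
    rw [ContinuousLinearMap.det_pi, abs_of_nonneg]
    · refine Finset.prod_congr rfl fun j _ => ?_
      simp [ContinuousLinearMap.det]
    · refine Finset.prod_nonneg fun j _ => ?_
      have hxj := Ioo_subset_Icc_self (mem_Ioo_of_mem_simplex hx j)
      have := hp1 _ hxj _ (hK _ hxj)
      simpa [ContinuousLinearMap.det] using this.le
  have hpdf : dirichletPDF β t (shift φ τ x) = dirichletPDF β t x *
      ∏ i, (1 + τ * gapSlope φ x i) ^ (β * gap (pad t) i - 1) := by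
    rw [dirichletPDF, dirichletPDF, mul_assoc, ← Finset.prod_mul_distrib]
    congr 1
    refine Finset.prod_congr rfl fun i _ => ?_
    rw [gap_shift h0 h1 hx, Real.mul_rpow (strictMono_iff_gap.1 hx i).le
      (hp1 0 (by simp) _ (abs_gapSlope_le hφ hK hx i)).le]
  rw [hdet, hpdf, smul_eq_mul]
  ring

/-- The right hand side of `integral_shift` does not depend on `τ`, so the derivative of the left
hand side at `τ = 0` vanishes. -/
theorem integral_dirichletLaw_byParts {β : ℝ} (hβ : 0 < β) (hφ : ContDiff ℝ 1 φ) (h0 : φ 0 = 0)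
    (h1 : φ 1 = 0) {N : ℕ} {t : Fin N → ℝ} (ht : t ∈ simplex N) {F : (Fin N → ℝ) → ℝ}
    (hF : ContDiff ℝ 1 F) :
    ∫ x, (fderiv ℝ F x (fun j => φ (x j)) + F x * (∑ j, deriv φ (x j) +
      ∑ i, (β * gap (pad t) i - 1) * gapSlope φ x i)) ∂(dirichletLaw β t) = 0 := by
  have := isProbabilityMeasure_dirichletLaw hβ ht
  obtain ⟨K, hK0, hK⟩ := exists_bound_Icc (hφ.continuous_deriv le_rfl)
  set R : ℝ := K + 1 with hR
  have hRpos : 0 < R := by linarith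
  -- The integrand is a `C¹` function of `τ` and of the vector formed by `x`, `φ(x)`, `φ'(x)` and
  -- the slopes, which stays in a fixed ball. In this way neither a second derivative of `φ` nor the
  -- shape of the simplex enters the domination.
  let G : ℝ × ((Fin N → ℝ) × (Fin N → ℝ) × (Fin N → ℝ) × (Fin (N + 1) → ℝ)) → ℝ := fun z =>
    F (z.2.1 + z.1 • z.2.2.1) * ((∏ j, (1 + z.1 * z.2.2.2.1 j)) *
      ∏ i, (1 + z.1 * z.2.2.2.2 i) ^ (β * gap (pad t) i - 1))
  let Ω : Set (ℝ × ((Fin N → ℝ) × (Fin N → ℝ) × (Fin N → ℝ) × (Fin (N + 1) → ℝ))) :=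
    {z | ∀ i, 0 < 1 + z.1 * z.2.2.2.2 i}
  have hΩ : IsOpen Ω := by
    have : Ω = ⋂ i, {z | 0 < 1 + z.1 * z.2.2.2.2 i} := by
      ext z; simp [Ω]
    rw [this]
    exact isOpen_iInter_of_finite fun i => isOpen_lt continuous_const (by fun_prop)
  have hG : ContDiffOn ℝ 1 G Ω := by
    intro z hz
    refine ContDiffAt.contDiffWithinAt ?_
    refine ContDiffAt.mul ?_ (ContDiffAt.mul ?_ ?_)
    · exact hF.contDiffAt.comp z (by fun_prop)
    · exact contDiffAt_prod fun j _ => by fun_prop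
    · refine contDiffAt_prod fun i _ => ?_
      exact ContDiffAt.rpow_const_of_ne (by fun_prop) (hz i).ne'
  let p : (Fin N → ℝ) → ((Fin N → ℝ) × (Fin N → ℝ) × (Fin N → ℝ) × (Fin (N + 1) → ℝ)) := fun x =>
    (x, (fun j => φ (x j)), (fun j => deriv φ (x j)), fun i => gapSlope φ x i)
  have hp : Measurable p := by
    refine measurable_id.prodMk (Measurable.prodMk ?_ (Measurable.prodMk ?_ ?_))
    · exact measurable_pi_iff.2 fun j => hφ.continuous.measurable.comp (measurable_pi_apply j)
    · exact measurable_pi_iff.2 fun j =>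
        (hφ.continuous_deriv le_rfl).measurable.comp (measurable_pi_apply j)
    · refine measurable_pi_iff.2 fun i => ?_
      exact ((hφ.continuous.measurable.comp (continuous_pad_apply _).measurable).sub
        (hφ.continuous.measurable.comp (continuous_pad_apply _).measurable)).div
        (continuous_gap_pad i).measurable
  have hpK : ∀ᵐ x ∂(dirichletLaw β t), p x ∈ Metric.closedBall (0 : (Fin N → ℝ) × (Fin N → ℝ) ×
      (Fin N → ℝ) × (Fin (N + 1) → ℝ)) R := by
    filter_upwards [ae_mem_simplex β t] with x hx
    have hx01 := fun j => Ioo_subset_Icc_self (mem_Ioo_of_mem_simplex hx j)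
    rw [mem_closedBall_zero_iff]
    refine max_le ?_ (max_le ?_ (max_le ?_ ?_)) <;>
      refine (pi_norm_le_iff_of_nonneg hRpos.le).2 fun j => ?_
    · rw [Real.norm_eq_abs, abs_of_nonneg (hx01 j).1]
      linarith [(hx01 j).2]
    · have := abs_sub_le_of_deriv hφ hK (show (0 : ℝ) ∈ Icc (0 : ℝ) 1 by simp) (hx01 j)
      rw [h0, sub_zero, sub_zero, abs_of_nonneg (hx01 j).1] at this
      rw [Real.norm_eq_abs]
      nlinarith [(hx01 j).2]
    · exact (hK _ (hx01 j)).trans (by linarith)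
    · exact (abs_gapSlope_le hφ hK hx j).trans (by linarith)
  -- For `|τ| ≤ 1 / (2 R)` the bases of the real powers are at least `1 / 2`.
  have hδ : 0 < 1 / (2 * R) := by positivity
  have hsub : Icc (-(1 / (2 * R))) (1 / (2 * R)) ×ˢ Metric.closedBall (0 : (Fin N → ℝ) ×
      (Fin N → ℝ) × (Fin N → ℝ) × (Fin (N + 1) → ℝ)) R ⊆ Ω := by
    rintro ⟨τ, z⟩ ⟨hτ, hz⟩ i
    rw [mem_closedBall_zero_iff] at hz
    have hb : |z.2.2.2 i| ≤ R := (norm_le_pi_norm z.2.2.2 i).trans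
      ((norm_snd_le z.2.2).trans ((norm_snd_le z.2).trans ((norm_snd_le z).trans hz)))
    have : |τ * z.2.2.2 i| ≤ 1 / 2 := by
      rw [abs_mul]
      calc |τ| * |z.2.2.2 i| ≤ 1 / (2 * R) * R := by
            gcongr
            exact abs_le.2 hτ
        _ = 1 / 2 := by field_simp
    dsimp only
    linarith [(abs_le.1 this).1]
  have hder := hasDerivAt_integral_of_compact (μ := dirichletLaw β t) hΩ hG
    (isCompact_closedBall _ _) hδ hsub hp hpK
  have hconst : (fun τ => ∫ x, G (τ, p x) ∂(dirichletLaw β t)) =ᶠ[𝓝 0]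
      fun _ => ∫ x, F x ∂(dirichletLaw β t) := by
    filter_upwards [Icc_mem_nhds (show -(1 / (2 * R)) < 0 by linarith) hδ] with τ hτ
    have hτK : |τ| * K < 1 := by
      calc |τ| * K ≤ 1 / (2 * R) * R := by
            gcongr
            · exact abs_le.2 hτ
            · linarith
        _ = 1 / 2 := by field_simp
        _ < 1 := by norm_num
    exact integral_shift hβ hφ hK hτK h0 h1 ht F
  have hzero := hder.unique ((hasDerivAt_const (0 : ℝ) _).congr_of_eventuallyEq hconst)
  rw [← hzero]
  refine integral_congr_ae ?_
  filter_upwards [hpK] with x hx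
  have hz0 : ((0 : ℝ), p x) ∈ Ω := hsub ⟨⟨by linarith, hδ.le⟩, hx⟩
  have hdG : HasFDerivAt G (fderiv ℝ G (0, p x)) (0, p x) :=
    ((hG.differentiableOn one_ne_zero).differentiableAt (hΩ.mem_nhds hz0)).hasFDerivAt
  have hd1 : HasDerivAt (fun τ => G (τ, p x)) (fderiv ℝ G (0, p x) (1, 0)) 0 :=
    HasFDerivAt.comp_hasDerivAt (l := G) (f := fun τ : ℝ => (τ, p x)) (0 : ℝ) hdG
      ((hasDerivAt_id' (0 : ℝ)).prodMk (hasDerivAt_const (0 : ℝ) (p x)))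
  have hlin : ∀ a : ℝ, HasDerivAt (fun τ : ℝ => 1 + τ * a) a 0 := fun a => by
    simpa using ((hasDerivAt_id (0 : ℝ)).mul_const a).const_add 1
  have e1 : HasDerivAt (fun τ : ℝ => F (x + τ • fun j => φ (x j)))
      (fderiv ℝ F x fun j => φ (x j)) 0 := by
    have hl : HasDerivAt (fun τ : ℝ => x + τ • fun j => φ (x j)) (fun j => φ (x j)) 0 := by
      simpa using ((hasDerivAt_id (0 : ℝ)).smul_const fun j => φ (x j)).const_add x
    have := ((hF.differentiable one_ne_zero) (x + (0 : ℝ) • fun j => φ (x j))).hasFDerivAt.comp_hasDerivAt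
      (0 : ℝ) hl
    simpa [Function.comp_def] using this
  have e2 : HasDerivAt (fun τ : ℝ => ∏ j, (1 + τ * deriv φ (x j))) (∑ j, deriv φ (x j)) 0 := by
    have := HasDerivAt.fun_finsetProd (u := Finset.univ)
      (f := fun j τ => 1 + τ * deriv φ (x j)) (fun j _ => hlin (deriv φ (x j)))
    simpa using this
  have e3 : HasDerivAt (fun τ : ℝ => ∏ i, (1 + τ * gapSlope φ x i) ^ (β * gap (pad t) i - 1))
      (∑ i, (β * gap (pad t) i - 1) * gapSlope φ x i) 0 := by
    have := HasDerivAt.fun_finsetProd (u := Finset.univ)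
      (f := fun i τ => (1 + τ * gapSlope φ x i) ^ (β * gap (pad t) i - 1))
      (fun i _ => (hlin (gapSlope φ x i)).rpow_const (p := β * gap (pad t) i - 1)
        (Or.inl (by simp)))
    simpa [mul_comm] using this
  have := hd1.unique (e1.mul (e2.mul e3))
  rw [this]
  simp

end Shift

/-! ### Taylor estimates -/

theorem abs_le_of_hasDerivAt {f f' : ℝ → ℝ} {x y B : ℝ} (hf : ∀ z, HasDerivAt f (f' z) z)
    (h0 : f x = 0) (h : ∀ z ∈ uIcc x y, |f' z| ≤ B) : |f y| ≤ B * |y - x| := by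
  have := (convex_uIcc x y).norm_image_sub_le_of_norm_hasDerivWithin_le
    (fun z _ => (hf z).hasDerivWithinAt) h left_mem_uIcc right_mem_uIcc
  rwa [h0, sub_zero] at this

theorem abs_sub_le_of_mem_uIcc {x y z : ℝ} (hz : z ∈ uIcc x y) : |z - x| ≤ |y - x| :=
  abs_sub_left_of_mem_uIcc hz

/-- The normalised error of the trapezoidal rule for `φ'`. -/
def trapKernel (φ : ℝ → ℝ) (p : ℝ × ℝ) : ℝ :=
  ((p.2 - p.1) * ((deriv φ p.1 + deriv φ p.2) / 2) - (φ p.2 - φ p.1)) / (p.2 - p.1) ^ 2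

theorem trapKernel_mul (φ : ℝ → ℝ) {x y : ℝ} (h : x ≠ y) :
    trapKernel φ (x, y) * (y - x) = (deriv φ x + deriv φ y) / 2 - (φ y - φ x) / (y - x) := by
  have : y - x ≠ 0 := sub_ne_zero.2 h.symm
  simp only [trapKernel]
  field_simp

theorem uIcc_subset_Icc01 {x y z : ℝ} (hx : x ∈ Icc (0 : ℝ) 1) (hy : y ∈ Icc (0 : ℝ) 1)
    (hz : z ∈ uIcc x y) : z ∈ Icc (0 : ℝ) 1 := uIcc_subset_Icc hx hy hz

/-- Two applications of the mean value inequality, starting from a bound on the third derivative,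
bound the trapezoidal error by `C |y - x|³`. After division by `(y - x)²` the kernel still vanishes
on the diagonal. -/
theorem exists_abs_trapKernel_le {φ : ℝ → ℝ} (hφ : ContDiff ℝ 3 φ) :
    ∃ C, 0 ≤ C ∧ ∀ x ∈ Icc (0 : ℝ) 1, ∀ y ∈ Icc (0 : ℝ) 1, |trapKernel φ (x, y)| ≤ C * |y - x| := by
  have h1 : ContDiff ℝ 2 (deriv φ) := (contDiff_succ_iff_deriv (n := 2)).1 hφ |>.2.2
  have h2 : ContDiff ℝ 1 (deriv (deriv φ)) := (contDiff_succ_iff_deriv (n := 1)).1 h1 |>.2.2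
  have h3 : Continuous (deriv (deriv (deriv φ))) := h2.continuous_deriv le_rfl
  have d0 : ∀ z, HasDerivAt φ (deriv φ z) z := fun z =>
    (hφ.differentiable (by norm_num) z).hasDerivAt
  have d1 : ∀ z, HasDerivAt (deriv φ) (deriv (deriv φ) z) z := fun z =>
    (h1.differentiable (by norm_num) z).hasDerivAt
  have d2 : ∀ z, HasDerivAt (deriv (deriv φ)) (deriv (deriv (deriv φ)) z) z := fun z =>
    (h2.differentiable (by norm_num) z).hasDerivAt
  obtain ⟨C, hC0, hC⟩ := exists_bound_Icc h3
  refine ⟨C, hC0, fun x hx y hy => ?_⟩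
  have e1 : ∀ w ∈ uIcc x y, |(deriv φ x - deriv φ w) / 2 + (w - x) * deriv (deriv φ) w / 2| ≤
      (C * |y - x|) * |w - x| := fun w hw => by
    refine abs_le_of_hasDerivAt (f := fun w => (deriv φ x - deriv φ w) / 2 +
      (w - x) * deriv (deriv φ) w / 2) (f' := fun w => (w - x) * deriv (deriv (deriv φ)) w / 2)
      (x := x) (fun z => ?_) (by simp) fun z hz => ?_
    · exact ((((d1 z).const_sub (deriv φ x)).div_const 2).fun_add
        ((((hasDerivAt_id' z).sub_const x).fun_mul (d2 z)).div_const 2)).congr_deriv (by ring)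
    · have hz' : z ∈ uIcc x y := uIcc_subset_uIcc_left hw hz
      have a1 := hC z (uIcc_subset_Icc01 hx hy hz')
      have a2 := abs_sub_le_of_mem_uIcc hz'
      rw [abs_div, abs_mul, abs_two]
      have := mul_le_mul a2 a1 (abs_nonneg _) (abs_nonneg _)
      have : 0 ≤ |y - x| * C := by positivity
      linarith
  have e2 : |(y - x) * ((deriv φ x + deriv φ y) / 2) - (φ y - φ x)| ≤
      (C * |y - x| * |y - x|) * |y - x| := by
    refine abs_le_of_hasDerivAt (f := fun w => (w - x) * ((deriv φ x + deriv φ w) / 2) -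
      (φ w - φ x)) (f' := fun w => (deriv φ x - deriv φ w) / 2 + (w - x) * deriv (deriv φ) w / 2)
      (x := x) (fun z => ?_) (by simp) fun z hz => ?_
    · exact ((((hasDerivAt_id' z).sub_const x).fun_mul
        (((d1 z).const_add (deriv φ x)).div_const 2)).fun_sub ((d0 z).sub_const (φ x))).congr_deriv
        (by ring)
    · refine (e1 z hz).trans ?_
      exact mul_le_mul_of_nonneg_left (abs_sub_le_of_mem_uIcc hz) (by positivity)
  rcases eq_or_ne x y with rfl | hne
  · simp [trapKernel]
  have hpos : 0 < |y - x| := abs_pos.2 (sub_ne_zero.2 hne.symm)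
  simp only [trapKernel]
  rw [abs_div, abs_pow, div_le_iff₀ (by positivity)]
  calc _ ≤ _ := e2
    _ = _ := by ring

theorem continuousOn_trapKernel {φ : ℝ → ℝ} (hφ : ContDiff ℝ 3 φ) :
    ContinuousOn (trapKernel φ) (Icc (0 : ℝ) 1 ×ˢ Icc (0 : ℝ) 1) := by
  obtain ⟨C, hC0, hC⟩ := exists_abs_trapKernel_le hφ
  have hc := hφ.continuous
  have hc' : Continuous (deriv φ) := hφ.continuous_deriv (by norm_num)
  rintro ⟨x, y⟩ ⟨hx, hy⟩
  rcases eq_or_ne x y with rfl | hne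
  · have e : trapKernel φ (x, x) = 0 := by simp [trapKernel]
    rw [ContinuousWithinAt, e]
    refine squeeze_zero_norm' (a := fun p : ℝ × ℝ => C * |p.2 - p.1|) ?_ ?_
    · filter_upwards [self_mem_nhdsWithin] with p hp
      exact hC _ hp.1 _ hp.2
    · have : Continuous fun p : ℝ × ℝ => C * |p.2 - p.1| := by fun_prop
      have h := this.tendsto (x, x)
      simp only [sub_self, abs_zero, mul_zero] at h
      exact h.mono_left nhdsWithin_le_nhds
  · refine ContinuousAt.continuousWithinAt ?_
    refine ContinuousAt.div (by fun_prop) (by fun_prop) ?_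
    exact pow_ne_zero _ (sub_ne_zero.2 hne.symm)

theorem exists_abs_dslope_sub_le {φ : ℝ → ℝ} (hφ : ContDiff ℝ 2 φ) :
    ∃ C, 0 ≤ C ∧ ∀ x ∈ Icc (0 : ℝ) 1, ∀ y ∈ Icc (0 : ℝ) 1,
      |dslope φ x y - deriv φ x| ≤ C * |y - x| := by
  have h1 : ContDiff ℝ 1 (deriv φ) := (contDiff_succ_iff_deriv (n := 1)).1 hφ |>.2.2
  obtain ⟨C, hC0, hC⟩ := exists_lipschitz_Icc h1
  refine ⟨C, hC0, fun x hx y hy => ?_⟩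
  rcases eq_or_ne x y with rfl | hne
  · simp
  have e := abs_le_of_hasDerivAt (f := fun w => φ w - φ x - deriv φ x * (w - x))
    (f' := fun w => deriv φ w - deriv φ x) (x := x) (y := y) (B := C * |y - x|) (fun z => ?_)
    (by simp) (fun z hz => ?_)
  · have hpos : 0 < |y - x| := abs_pos.2 (sub_ne_zero.2 hne.symm)
    have hyx : y - x ≠ 0 := sub_ne_zero.2 hne.symm
    rw [dslope_of_ne _ hne.symm, slope_def_field]
    have : (φ y - φ x) / (y - x) - deriv φ x = (φ y - φ x - deriv φ x * (y - x)) / (y - x) := by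
      field_simp
    rw [this, abs_div, div_le_iff₀ hpos]
    exact e
  · have := (((hφ.differentiable (by norm_num) z).hasDerivAt.sub_const (φ x))).fun_sub
      (((hasDerivAt_id' z).sub_const x).const_mul (deriv φ x))
    simpa using this
  · exact (hC x hx z (uIcc_subset_Icc01 hx hy hz)).trans
      (mul_le_mul_of_nonneg_left (abs_sub_le_of_mem_uIcc hz) hC0)

/-! ### The inverse of a monotone map -/

namespace G0

/-- The left continuous inverse. -/
def leftInv (g : G0) (y : ℝ) : ℝ := sInf {t | 0 ≤ t ∧ y ≤ g t}

theorem leftInv_nonneg (g : G0) (y : ℝ) : 0 ≤ g.leftInv y := Real.sInf_nonneg fun _ ht => ht.1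

theorem le_apply_leftInv (g : G0) {y : ℝ} (hy : y ≤ 1) : y ≤ g (g.leftInv y) := by
  have hne : {t | 0 ≤ t ∧ y ≤ g t}.Nonempty := ⟨1, zero_le_one, by rwa [g.apply_of_one_le le_rfl]⟩
  refine ge_of_tendsto (g.tendsto_nhdsGT (g.leftInv y)) ?_
  filter_upwards [self_mem_nhdsWithin] with t ht
  obtain ⟨r, hr, hrt⟩ := exists_lt_of_csInf_lt hne ht
  exact hr.2.trans (g.monotone hrt.le)

theorem leftInv_le_iff (g : G0) {y t : ℝ} (hy : y ≤ 1) (ht : 0 ≤ t) : g.leftInv y ≤ t ↔ y ≤ g t :=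
  ⟨fun h => (g.le_apply_leftInv hy).trans (g.monotone h),
    fun h => csInf_le ⟨0, fun _ hr => hr.1⟩ ⟨ht, h⟩⟩

theorem leftLim_mem (g : G0) (a : ℝ) : Function.leftLim (g : ℝ → ℝ) a ∈ Icc (0 : ℝ) 1 :=
  ⟨((g.apply_mem (a - 1)).1).trans (g.monotone.le_leftLim (by linarith)),
    (g.monotone.leftLim_le le_rfl).trans (g.apply_mem a).2⟩

theorem leftLim_of_nonpos (g : G0) {a : ℝ} (ha : a ≤ 0) : Function.leftLim (g : ℝ → ℝ) a = 0 := by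
  refine tendsto_nhds_unique (g.monotone.tendsto_leftLim a) ?_
  refine tendsto_const_nhds.congr' ?_
  filter_upwards [self_mem_nhdsWithin] with s hs
  rw [g.apply_of_neg (lt_of_lt_of_le hs ha)]

theorem leftLim_leftInv_le (g : G0) {y : ℝ} (hy : y ∈ Ioc (0 : ℝ) 1) :
    Function.leftLim (g : ℝ → ℝ) (g.leftInv y) ≤ y := by
  refine le_of_tendsto (g.monotone.tendsto_leftLim _) ?_
  filter_upwards [self_mem_nhdsWithin] with s hs
  rcases lt_or_ge s 0 with h | h
  · rw [g.apply_of_neg h]; exact hy.1.le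
  · exact (not_le.1 ((g.leftInv_le_iff hy.2 h).not.1 (not_le.2 hs))).le

theorem leftInv_eq (g : G0) {a y : ℝ} (hy : y ∈ Ioc (Function.leftLim (g : ℝ → ℝ) a) (g a)) :
    g.leftInv y = a := by
  have hy1 : y ≤ 1 := hy.2.trans (g.apply_mem a).2
  have ha : 0 ≤ a := by
    by_contra! h
    have := hy.2
    rw [g.apply_of_neg h] at this
    exact absurd (hy.1.trans_le this) (not_lt.2 (g.leftLim_mem a).1)
  refine le_antisymm ((g.leftInv_le_iff hy1 ha).2 hy.2) ?_
  by_contra! h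
  have := (g.le_apply_leftInv hy1).trans (g.monotone.le_leftLim h)
  exact absurd (hy.1.trans_le this) (lt_irrefl _)

/-- The index of the grid interval containing `leftInv g y`. -/
def cell (N : ℕ) (g : G0) (y : ℝ) : ℕ := ⌈((N : ℝ) + 1) * g.leftInv y⌉₊ - 1

/-- Since `leftInv g y ≤ t` means `y ≤ g t`, the half open interval for `y` corresponds to `i < (N +
1) leftInv g y ≤ i + 1` for `i > 0`; this is why `cell` uses the ceiling. -/
theorem cell_eq (N : ℕ) (g : G0) {y : ℝ} {i : ℕ} (hi : i < N + 1)
    (hy : y ∈ Ioc (gridVal N g i) (gridVal N g (i + 1))) : g.cell N y = i := by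
  have hN : (0 : ℝ) < (N : ℝ) + 1 := by positivity
  have hy1 : y ≤ 1 := hy.2.trans (gridVal_mem N g _).2
  have h1 : g.leftInv y ≤ ((i + 1 : ℕ) : ℝ) / (N + 1) := by
    rw [g.leftInv_le_iff hy1 (by positivity)]
    simpa [gridVal] using hy.2
  rw [le_div_iff₀ hN, mul_comm] at h1
  have h2 := Nat.ceil_le.2 h1
  rw [cell]
  -- For `i = 0` the inverse may be `0`; truncated subtraction then still gives the cell `0`.
  rcases Nat.eq_zero_or_pos i with rfl | hpos
  · omega
  · have h3 : (i : ℝ) / (N + 1) < g.leftInv y := by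
      rw [← not_le, g.leftInv_le_iff hy1 (by positivity), not_le]
      simpa [gridVal, hpos.ne'] using hy.1
    rw [div_lt_iff₀ hN, mul_comm] at h3
    have := Nat.lt_ceil.2 h3
    omega

/-- For `a = leftInv g y > 0` the left grid point of the cell lies strictly below `a` and the right
one is at least `a`. They tend to `a` from these sides, so the values tend to the left limit and to
`g a`. -/
theorem tendsto_gridVal_cell (g : G0) (y : ℝ) :
    Tendsto (fun N => (gridVal N g (g.cell N y), gridVal N g (g.cell N y + 1))) atTop
      (𝓝 (Function.leftLim (g : ℝ → ℝ) (g.leftInv y), g (g.leftInv y))) := by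
  set a := g.leftInv y with ha
  have ha0 : 0 ≤ a := g.leftInv_nonneg y
  have hN : ∀ N : ℕ, (0 : ℝ) < (N : ℝ) + 1 := fun N => by positivity
  have hlim1 : Tendsto (fun N : ℕ => (1 : ℝ) / ((N : ℝ) + 1)) atTop (𝓝 0) :=
    tendsto_one_div_add_atTop_nhds_zero_nat
  refine Tendsto.prodMk_nhds ?_ ?_
  -- If `a = 0`, the convention `gridVal N g 0 = 0` supplies the left limit.
  · rcases eq_or_lt_of_le ha0 with h | h
    · have : ∀ N, gridVal N g (g.cell N y) = 0 := fun N => by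
        rw [cell, ← ha, ← h]; simp [gridVal]
      simp only [this]
      rw [← h, g.leftLim_of_nonpos le_rfl]
      exact tendsto_const_nhds
    · have hge : ∀ N : ℕ, 1 ≤ ⌈((N : ℝ) + 1) * a⌉₊ := fun N =>
        Nat.one_le_iff_ne_zero.2 (Nat.ceil_pos.2 (by have := hN N; positivity)).ne'
      have hcast : ∀ N, ((g.cell N y : ℕ) : ℝ) = (⌈((N : ℝ) + 1) * a⌉₊ : ℝ) - 1 := fun N => by
        rw [cell, ← ha, Nat.cast_sub (hge N), Nat.cast_one]
      have hlt : ∀ N : ℕ, ((g.cell N y : ℕ) : ℝ) / ((N : ℝ) + 1) < a := fun N => by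
        rw [div_lt_iff₀ (hN N), hcast]
        have := Nat.ceil_lt_add_one (show 0 ≤ ((N : ℝ) + 1) * a by have := hN N; positivity)
        linarith
      have hgt : ∀ N : ℕ, a - 1 / ((N : ℝ) + 1) ≤ ((g.cell N y : ℕ) : ℝ) / ((N : ℝ) + 1) := fun N => by
        rw [le_div_iff₀ (hN N), hcast, sub_mul, div_mul_cancel₀ _ (hN N).ne']
        have := Nat.le_ceil (((N : ℝ) + 1) * a)
        linarith
      have hT : Tendsto (fun N => ((g.cell N y : ℕ) : ℝ) / ((N : ℝ) + 1)) atTop (𝓝[<] a) := by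
        refine tendsto_nhdsWithin_iff.2 ⟨?_, Eventually.of_forall hlt⟩
        refine tendsto_of_tendsto_of_tendsto_of_le_of_le (by simpa using hlim1.const_sub a)
          tendsto_const_nhds hgt fun N => (hlt N).le
      refine ((g.monotone.tendsto_leftLim a).comp hT).congr' ?_
      have hpos := (tendsto_nhdsWithin_iff.1 hT).1.eventually (lt_mem_nhds h)
      filter_upwards [hpos] with N hN'
      have : g.cell N y ≠ 0 := by
        intro h0; rw [h0] at hN'; simp at hN'
      simp [gridVal, this]
  · have hcast : ∀ N, a ≤ ((g.cell N y + 1 : ℕ) : ℝ) / ((N : ℝ) + 1) := fun N => by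
      rw [le_div_iff₀ (hN N), mul_comm, ← Nat.ceil_le, cell, ← ha]
      omega
    have hle : ∀ N, ((g.cell N y + 1 : ℕ) : ℝ) / ((N : ℝ) + 1) ≤ a + 1 / ((N : ℝ) + 1) := fun N => by
      rw [div_le_iff₀ (hN N), add_mul, div_mul_cancel₀ _ (hN N).ne', cell, ← ha]
      have h1 := Nat.ceil_lt_add_one (show 0 ≤ ((N : ℝ) + 1) * a by have := hN N; positivity)
      have h0 : 0 ≤ ((N : ℝ) + 1) * a := by have := hN N; positivity
      rcases Nat.eq_zero_or_pos ⌈((N : ℝ) + 1) * a⌉₊ with h | h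
      · rw [h]; simp; linarith
      · rw [Nat.sub_add_cancel h]; linarith
    have hT : Tendsto (fun N => ((g.cell N y + 1 : ℕ) : ℝ) / ((N : ℝ) + 1)) atTop (𝓝[≥] a) := by
      refine tendsto_nhdsWithin_iff.2 ⟨?_, Eventually.of_forall hcast⟩
      refine tendsto_of_tendsto_of_tendsto_of_le_of_le tendsto_const_nhds
        (by simpa using hlim1.const_add a) hcast hle
    refine ((g.tendsto_nhdsGE a).comp hT).congr fun N => ?_
    simp [gridVal]

end G0

/-! ### The jump sum as a limit of sums over grids -/

section JumpSum

variable {φ : ℝ → ℝ}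

theorem gridVal_zero (N : ℕ) (g : G0) : gridVal N g 0 = 0 := by simp [gridVal]

theorem gridVal_last (N : ℕ) (g : G0) : gridVal N g (N + 1) = 1 := by
  have : ((N : ℝ) + 1) ≠ 0 := by positivity
  simp [gridVal, div_self this, g.apply_of_one_le le_rfl]

/-- The intervals between consecutive grid values partition `(0, 1]`, and the integrand is constant
on each. The increments of `g` become lengths in the space variable `y`. -/
theorem integral_cell {k : ℝ × ℝ → ℝ} (N : ℕ) (g : G0) :
    IntervalIntegrable (fun y => k (gridVal N g (g.cell N y), gridVal N g (g.cell N y + 1)))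
      volume 0 1 ∧
    ∑ i ∈ Finset.range (N + 1), k (gridVal N g i, gridVal N g (i + 1)) *
        (gridVal N g (i + 1) - gridVal N g i) =
      ∫ y in (0 : ℝ)..1, k (gridVal N g (g.cell N y), gridVal N g (g.cell N y + 1)) := by
  set F : ℝ → ℝ := fun y => k (gridVal N g (g.cell N y), gridVal N g (g.cell N y + 1)) with hF
  have heq : ∀ i < N + 1, EqOn (fun _ => k (gridVal N g i, gridVal N g (i + 1))) F
      (uIoc (gridVal N g i) (gridVal N g (i + 1))) := fun i hi y hy => by
    rw [uIoc_of_le (gridVal_mono N g (Nat.le_succ i))] at hy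
    simp only [hF, G0.cell_eq N g hi hy]
  have hint : ∀ i < N + 1, IntervalIntegrable F volume (gridVal N g i) (gridVal N g (i + 1)) :=
    fun i hi => (intervalIntegrable_const (c := k (gridVal N g i, gridVal N g (i + 1)))).congr
      (heq i hi)
  have h1 := IntervalIntegrable.trans_iterate hint
  have h2 := intervalIntegral.sum_integral_adjacent_intervals hint
  rw [gridVal_zero, gridVal_last] at h1 h2
  refine ⟨h1, ?_⟩
  rw [← h2]
  refine Finset.sum_congr rfl fun i hi => ?_
  rw [← intervalIntegral.integral_congr_ae (Eventually.of_forall (heq i (Finset.mem_range.1 hi)))]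
  simp [mul_comm]

theorem countable_jumpSet (g : G0) : (jumpSet g).Countable := by
  refine g.monotone.countable_not_continuousAt.mono ?_
  intro a ha hc
  refine ha ?_
  exact tendsto_nhds_unique (g.monotone.tendsto_leftLim a) (hc.tendsto.mono_left nhdsWithin_le_nhds)

/-- Each jump contributes the interval `(g(a-), g(a)]`, on which `leftInv g` is constant. Almost
everywhere else `leftInv g y` is a continuity point of `g`, where the diagonal value of `k` is zero.
-/
theorem integral_leftInv_eq_tsum {k : ℝ × ℝ → ℝ} (hk0 : ∀ x, k (x, x) = 0) (g : G0)
    (hk : IntervalIntegrable (fun y => k (Function.leftLim (g : ℝ → ℝ) (g.leftInv y),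
      g (g.leftInv y))) volume 0 1) :
    ∫ y in (0 : ℝ)..1, k (Function.leftLim (g : ℝ → ℝ) (g.leftInv y), g (g.leftInv y)) =
      ∑' a : jumpSet g, k (Function.leftLim (g : ℝ → ℝ) a, g a) *
        (g a - Function.leftLim (g : ℝ → ℝ) a) := by
  set F : ℝ → ℝ := fun y => k (Function.leftLim (g : ℝ → ℝ) (g.leftInv y), g (g.leftInv y)) with hF
  have : Countable (jumpSet g) := (countable_jumpSet g).to_subtype
  let S : jumpSet g → Set ℝ := fun a => Ioc (Function.leftLim (g : ℝ → ℝ) a) (g a)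
  have hS : ∀ a, S a ⊆ Ioc 0 1 := fun a =>
    Ioc_subset_Ioc (g.leftLim_mem a).1 (g.apply_mem a).2
  have hU : (⋃ a, S a) ⊆ Ioc 0 1 := iUnion_subset hS
  have hdisj : Pairwise (Function.onFun Disjoint S) := fun a b hab => by
    refine disjoint_left.2 fun y hya hyb => hab ?_
    exact Subtype.ext ((g.leftInv_eq hya).symm.trans (g.leftInv_eq hyb))
  rw [intervalIntegrable_iff_integrableOn_Ioc_of_le zero_le_one] at hk
  rw [intervalIntegral.integral_of_le zero_le_one]
  have e1 : ∫ y in Ioc (0 : ℝ) 1, F y = ∫ y in ⋃ a, S a, F y := by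
    refine setIntegral_eq_of_subset_of_ae_sdiff_eq_zero measurableSet_Ioc.nullMeasurableSet hU ?_
    -- The half open interval of a jump omits its lower end point; there are only countably many of
    -- these.
    have hc : (Function.leftLim (g : ℝ → ℝ) '' jumpSet g).Countable := (countable_jumpSet g).image _
    filter_upwards [hc.ae_notMem volume] with y hy hy'
    by_cases hj : g.leftInv y ∈ jumpSet g
    · exfalso
      have hn : y ∉ S ⟨_, hj⟩ := fun h => hy'.2 (mem_iUnion.2 ⟨_, h⟩)
      have h1 := g.leftLim_leftInv_le hy'.1
      have h2 := g.le_apply_leftInv hy'.1.2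
      refine hy ⟨_, hj, ?_⟩
      by_contra hne
      exact hn ⟨lt_of_le_of_ne h1 hne, h2⟩
    · have : Function.leftLim (g : ℝ → ℝ) (g.leftInv y) = g (g.leftInv y) := not_not.1 hj
      simp only [hF, this, hk0]
  rw [e1, integral_iUnion (fun a => measurableSet_Ioc) hdisj (hk.mono_set hU)]
  refine tsum_congr fun a => ?_
  rw [setIntegral_congr_fun (g := fun _ => k (Function.leftLim (g : ℝ → ℝ) a, g a))
    measurableSet_Ioc fun y hy => by simp only [hF, g.leftInv_eq hy]]
  simp [mul_comm, (g.monotone.leftLim_le (le_refl (a : ℝ)))]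

/-- Dominated convergence in the space variable `y`. The passage from `i` to `y` makes the sum over
all jumps appear at once, without separate estimates for small jumps. -/
theorem tendsto_trapSum (hφ : ContDiff ℝ 3 φ) (g : G0) :
    Tendsto (fun N => ∑ i ∈ Finset.range (N + 1), trapKernel φ (gridVal N g i, gridVal N g (i + 1)) *
        (gridVal N g (i + 1) - gridVal N g i)) atTop
      (𝓝 (∑' a : jumpSet g, trapKernel φ (Function.leftLim (g : ℝ → ℝ) a, g a) *
        (g a - Function.leftLim (g : ℝ → ℝ) a))) := by
  obtain ⟨C, hC0, hC⟩ := exists_abs_trapKernel_le hφ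
  have hb : ∀ x ∈ Icc (0 : ℝ) 1, ∀ y ∈ Icc (0 : ℝ) 1, |trapKernel φ (x, y)| ≤ C := fun x hx y hy => by
    refine (hC x hx y hy).trans (mul_le_of_le_one_right hC0 ?_)
    rw [abs_le]; constructor <;> linarith [hx.1, hx.2, hy.1, hy.2]
  have hlim : ∀ y ∈ Ioc (0 : ℝ) 1, Tendsto (fun N => trapKernel φ
      (gridVal N g (g.cell N y), gridVal N g (g.cell N y + 1))) atTop
      (𝓝 (trapKernel φ (Function.leftLim (g : ℝ → ℝ) (g.leftInv y), g (g.leftInv y)))) := by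
    intro y hy
    have hc := continuousOn_trapKernel hφ (Function.leftLim (g : ℝ → ℝ) (g.leftInv y),
      g (g.leftInv y)) ⟨g.leftLim_mem _, g.apply_mem _⟩
    exact hc.tendsto.comp (tendsto_nhdsWithin_iff.2 ⟨g.tendsto_gridVal_cell y,
      Eventually.of_forall fun N => ⟨gridVal_mem N g (g.cell N y), gridVal_mem N g (g.cell N y + 1)⟩⟩)
  have hm : ∀ N, AEStronglyMeasurable (fun y => trapKernel φ
      (gridVal N g (g.cell N y), gridVal N g (g.cell N y + 1))) (volume.restrict (Ioc 0 1)) :=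
    fun N => ((intervalIntegrable_iff_integrableOn_Ioc_of_le zero_le_one).1
      (integral_cell (k := trapKernel φ) N g).1).aestronglyMeasurable
  have hint : IntervalIntegrable (fun y => trapKernel φ (Function.leftLim (g : ℝ → ℝ) (g.leftInv y),
      g (g.leftInv y))) volume 0 1 := by
    rw [intervalIntegrable_iff_integrableOn_Ioc_of_le zero_le_one]
    refine Integrable.of_bound (aestronglyMeasurable_of_tendsto_ae atTop hm ?_) C ?_
    · exact (ae_restrict_iff' measurableSet_Ioc).2 (Eventually.of_forall hlim)
    · exact Eventually.of_forall fun y => hb _ (g.leftLim_mem _) _ (g.apply_mem _)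
  rw [← integral_leftInv_eq_tsum (fun x => by simp [trapKernel]) g hint]
  simp_rw [fun N => (integral_cell (k := trapKernel φ) N g).2]
  refine intervalIntegral.tendsto_integral_filter_of_dominated_convergence (fun _ => C) ?_ ?_
    (by simp) ?_
  · exact Eventually.of_forall fun N => by rw [uIoc_of_le zero_le_one]; exact hm N
  · exact Eventually.of_forall fun N => Eventually.of_forall fun y _ =>
      hb _ (gridVal_mem _ _ _) _ (gridVal_mem _ _ _)
  · refine Eventually.of_forall fun y hy => hlim y ?_
    rwa [uIoc_of_le zero_le_one] at hy

end JumpSum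

/-! ### The drift as a limit -/

theorem sum_pad_castSucc {N : ℕ} (a : ℝ → ℝ) (x : Fin N → ℝ) :
    ∑ i : Fin (N + 1), a (pad x i.castSucc) = a 0 + ∑ j, a (x j) := by
  rw [Fin.sum_univ_succ]
  congr 1
  refine Finset.sum_congr rfl fun j _ => ?_
  rw [← Fin.succ_castSucc, pad_succ_castSucc]

theorem sum_pad_succ {N : ℕ} (a : ℝ → ℝ) (x : Fin N → ℝ) :
    ∑ i : Fin (N + 1), a (pad x i.succ) = (∑ j, a (x j)) + a 1 := by
  rw [Fin.sum_univ_castSucc, Fin.succ_last, pad_last]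
  simp only [pad_succ_castSucc]

theorem sum_gap_pad {N : ℕ} (x : Fin N → ℝ) :
    ∑ i : Fin (N + 1), (pad x i.succ - pad x i.castSucc) = 1 := by
  rw [Finset.sum_sub_distrib, sum_pad_castSucc (fun y => y), sum_pad_succ (fun y => y)]
  ring

/-- The divergence term of the finite dimensional integration by parts formula. -/
def gridDrift (β : ℝ) (φ : ℝ → ℝ) {N : ℕ} (x : Fin N → ℝ) : ℝ :=
  ∑ j, deriv φ (x j) + ∑ i, (β * gap (pad (grid N)) i - 1) * gapSlope φ x i

/-- Distributing `∑ φ'(x_j)` evenly to the two gaps adjacent to `x_j` leaves the boundary term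
`(φ'(0) + φ'(1)) / 2`. Together with the slopes carrying the coefficient `-1` this gives the
trapezoidal errors. -/
theorem gridDrift_eq (β : ℝ) (φ : ℝ → ℝ) {N : ℕ} {x : Fin N → ℝ} (hx : x ∈ simplex N) :
    gridDrift β φ x = (∑ i : Fin (N + 1), trapKernel φ (pad x i.castSucc, pad x i.succ) *
        (pad x i.succ - pad x i.castSucc))
      + β * (∑ i : Fin (N + 1), 1 / ((N : ℝ) + 1) * dslope φ (pad x i.castSucc) (pad x i.succ))
      - (deriv φ 0 + deriv φ 1) / 2 := by
  have hne : ∀ i : Fin (N + 1), pad x i.castSucc ≠ pad x i.succ := fun i =>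
    (hx (Fin.castSucc_lt_succ (i := i))).ne
  have h1 : ∀ i : Fin (N + 1), gapSlope φ x i = dslope φ (pad x i.castSucc) (pad x i.succ) :=
    fun i => by rw [dslope_of_ne _ (hne i).symm, slope_def_field]; rfl
  have h2 : ∀ i : Fin (N + 1), trapKernel φ (pad x i.castSucc, pad x i.succ) *
      (pad x i.succ - pad x i.castSucc) =
      (deriv φ (pad x i.castSucc) + deriv φ (pad x i.succ)) / 2 - gapSlope φ x i := fun i =>
    trapKernel_mul φ (hne i)
  simp only [h2, ← h1, gridDrift, gap_grid]
  rw [Finset.sum_sub_distrib, ← Finset.sum_div, Finset.sum_add_distrib,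
    sum_pad_castSucc (deriv φ), sum_pad_succ (deriv φ), Finset.mul_sum]
  simp only [sub_mul, one_mul, Finset.sum_sub_distrib, mul_assoc]
  ring

section Drift

variable {φ ψ : ℝ → ℝ}

theorem drift0_eq (β : ℝ) (hφ : ContDiff ℝ 1 φ) (h : EqOn φ ψ (Icc 0 1)) (g : G0) :
    drift0 β ψ g = (∑' a : jumpSet g, trapKernel φ (Function.leftLim (g : ℝ → ℝ) a, g a) *
        (g a - Function.leftLim (g : ℝ → ℝ) a)) + β * ∫ s, deriv φ (g s) ∂leb
      - (deriv φ 0 + deriv φ 1) / 2 := by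
  have hD := D01_eq_deriv (hφ.differentiable one_ne_zero) h
  rw [drift0, drift, hD (by simp), hD (by simp), intervalIntegral_eq_leb]
  have e1 : ∫ s, D01 ψ (g s) ∂leb = ∫ s, deriv φ (g s) ∂leb :=
    integral_congr_ae (Eventually.of_forall fun s => hD (g.apply_mem s))
  rw [e1]
  refine congrArg (fun x => x + _ - _) (tsum_congr fun a => ?_)
  rw [trapKernel_mul φ a.2, hD (g.apply_mem a), hD (g.leftLim_mem a), h (g.apply_mem a),
    h (g.leftLim_mem a), add_comm]

theorem drift0_congr (β : ℝ) (hφ : ContDiff ℝ 1 φ) (h : EqOn φ ψ (Icc 0 1)) :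
    drift0 β ψ = drift0 β φ := by
  funext g
  rw [drift0_eq β hφ h, drift0_eq β hφ (fun _ _ => rfl)]

theorem exists_abs_dslope_le (hφ : ContDiff ℝ 2 φ) :
    ∃ C, 0 ≤ C ∧ ∀ x ∈ Icc (0 : ℝ) 1, ∀ y ∈ Icc (0 : ℝ) 1, |dslope φ x y| ≤ C := by
  obtain ⟨C, hC0, hC⟩ := exists_abs_dslope_sub_le hφ
  obtain ⟨K, hK0, hK⟩ := exists_bound_Icc (hφ.continuous_deriv (by norm_num))
  refine ⟨C + K, by positivity, fun x hx y hy => ?_⟩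
  have h1 := hC x hx y hy
  have h2 := hK x hx
  have h3 : |y - x| ≤ 1 := by rw [abs_le]; constructor <;> linarith [hx.1, hx.2, hy.1, hy.2]
  have h4 := abs_sub_abs_le_abs_sub (dslope φ x y) (deriv φ x)
  nlinarith

theorem continuousWithinAt_dslope_diag (hφ : ContDiff ℝ 2 φ) (y : ℝ) :
    ContinuousWithinAt (fun p : ℝ × ℝ => dslope φ p.1 p.2) (Icc (0 : ℝ) 1 ×ˢ Icc (0 : ℝ) 1)
      (y, y) := by
  obtain ⟨C, hC0, hC⟩ := exists_abs_dslope_sub_le hφ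
  have hc' : Continuous (deriv φ) := hφ.continuous_deriv (by norm_num)
  have h1 : Tendsto (fun p : ℝ × ℝ => dslope φ p.1 p.2 - deriv φ p.1)
      (𝓝[Icc (0 : ℝ) 1 ×ˢ Icc (0 : ℝ) 1] (y, y)) (𝓝 0) := by
    refine squeeze_zero_norm' (a := fun p : ℝ × ℝ => C * |p.2 - p.1|) ?_ ?_
    · filter_upwards [self_mem_nhdsWithin] with p hp
      exact hC _ hp.1 _ hp.2
    · have : Continuous fun p : ℝ × ℝ => C * |p.2 - p.1| := by fun_prop
      have h := this.tendsto (y, y)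
      simp only [sub_self, abs_zero, mul_zero] at h
      exact h.mono_left nhdsWithin_le_nhds
  have h2 : Tendsto (fun p : ℝ × ℝ => deriv φ p.1) (𝓝[Icc (0 : ℝ) 1 ×ˢ Icc (0 : ℝ) 1] (y, y))
      (𝓝 (deriv φ y)) :=
    ((hc'.comp continuous_fst).tendsto (y, y)).mono_left nhdsWithin_le_nhds
  have h3 := h1.add h2
  simpa [ContinuousWithinAt] using h3

/-- The trapezoidal part tends to the jump sum, and the slopes with their uniform weights tend to `∫
φ'(g_s) ds`. -/
theorem tendsto_gridDrift (β : ℝ) (hφ : ContDiff ℝ 3 φ) {g : G0}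
    (hg : ∀ N, (fun j => g (grid N j)) ∈ simplex N) :
    Tendsto (fun N => gridDrift β φ (fun j : Fin N => g (grid N j))) atTop (𝓝 (drift0 β φ g)) := by
  have hφ2 : ContDiff ℝ 2 φ := hφ.of_le (by norm_num)
  obtain ⟨C, -, hC⟩ := exists_abs_dslope_le hφ2
  have h1 := tendsto_riemannSum (c := fun p => dslope φ p.1 p.2) hC
    (fun y _ => continuousWithinAt_dslope_diag hφ2 y) g
  have h2 := tendsto_trapSum hφ g
  have h3 := (h2.add (h1.const_mul β)).sub_const ((deriv φ 0 + deriv φ 1) / 2)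
  rw [drift0_eq β (hφ.of_le (by norm_num)) (fun _ _ => rfl)]
  simp only [dslope_same] at h3
  refine h3.congr fun N => ?_
  rw [gridDrift_eq β φ (hg N), Finset.sum_range]
  simp only [pad_eval_grid, Fin.val_castSucc, Fin.val_succ]

/-- The bound is uniform in `N`: the gaps of `x` sum to one, as do the weights `1 / (N + 1)`. -/
theorem exists_abs_gridDrift_le (β : ℝ) (hφ : ContDiff ℝ 3 φ) :
    ∃ C, 0 ≤ C ∧ ∀ N, ∀ x ∈ simplex N, |gridDrift β φ x| ≤ C := by
  obtain ⟨C, hC0, hC⟩ := exists_abs_dslope_le (hφ.of_le (by norm_num : (2 : WithTop ℕ∞) ≤ 3))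
  obtain ⟨T, hT0, hT⟩ := exists_abs_trapKernel_le hφ
  refine ⟨T + |β| * C + |(deriv φ 0 + deriv φ 1) / 2|, by positivity, fun N x hx => ?_⟩
  rw [gridDrift_eq β φ hx]
  refine (abs_sub _ _).trans (add_le_add_left ((abs_add_le _ _).trans (add_le_add ?_ ?_)) _)
  · refine (Finset.abs_sum_le_sum_abs _ _).trans ?_
    calc _ ≤ ∑ i : Fin (N + 1), T * (pad x i.succ - pad x i.castSucc) := by
          refine Finset.sum_le_sum fun i _ => ?_
          have h1 := pad_mem_Icc hx i.castSucc
          have h2 := pad_mem_Icc hx i.succ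
          have h3 : 0 ≤ pad x i.succ - pad x i.castSucc :=
            sub_nonneg.2 (hx (Fin.castSucc_lt_succ (i := i))).le
          rw [abs_mul, abs_of_nonneg h3]
          refine mul_le_mul_of_nonneg_right ((hT _ h1 _ h2).trans ?_) h3
          rw [abs_of_nonneg h3]
          exact mul_le_of_le_one_right hT0 (by linarith [h1.1, h2.2])
      _ = T := by rw [← Finset.mul_sum, sum_gap_pad, mul_one]
  · rw [abs_mul]
    refine mul_le_mul_of_nonneg_left ((Finset.abs_sum_le_sum_abs _ _).trans ?_) (abs_nonneg _)
    calc _ ≤ ∑ i : Fin (N + 1), 1 / ((N : ℝ) + 1) * C := by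
          refine Finset.sum_le_sum fun i _ => ?_
          rw [abs_mul, abs_of_pos (show 0 < 1 / ((N : ℝ) + 1) by positivity)]
          exact mul_le_mul_of_nonneg_left (hC _ (pad_mem_Icc hx _) _ (pad_mem_Icc hx _))
            (by positivity)
      _ = C := by
          have : ((N : ℝ) + 1) ≠ 0 := by positivity
          rw [Finset.sum_const, Finset.card_univ, Fintype.card_fin, nsmul_eq_mul]
          push_cast
          field_simp

end Drift

/-! ### Integration by parts -/

section ByParts

variable {β : ℝ} {Q : Measure G0} {φ : ℝ → ℝ}

/-- The finite dimensional distributions live on the open simplex, and there are countably many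
grids. -/
theorem IsDirichletProcess.ae_mem_simplex (hQ : IsDirichletProcess β Q) :
    ∀ᵐ g ∂Q, ∀ N, (fun j => g (grid N j)) ∈ simplex N := by
  rw [ae_all_iff]
  intro N
  have h := WassersteinForm.ae_mem_simplex β (grid N)
  rw [← hQ.fdd N (grid N) (grid_mem_simplex N)] at h
  exact ae_of_ae_map (G0.measurable_eval_pi (grid N)).aemeasurable h

theorem measurable_gridDrift (β : ℝ) (hφ : ContDiff ℝ 1 φ) (N : ℕ) :
    Measurable (gridDrift β φ : (Fin N → ℝ) → ℝ) := by
  have h0 := hφ.continuous.measurable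
  have h1 := (hφ.continuous_deriv le_rfl).measurable
  refine Measurable.add (Finset.measurable_fun_sum _ fun j _ => h1.comp (measurable_pi_apply j))
    (Finset.measurable_fun_sum _ fun i _ => Measurable.const_mul ?_ _)
  exact ((h0.comp (continuous_pad_apply _).measurable).sub
    (h0.comp (continuous_pad_apply _).measurable)).div (continuous_gap_pad i).measurable

theorem IsDirichletProcess.aestronglyMeasurable_drift0 (hQ : IsDirichletProcess β Q)
    (hφ : ContDiff ℝ 3 φ) : AEStronglyMeasurable (drift0 β φ) Q := by
  refine aestronglyMeasurable_of_tendsto_ae atTop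
    (f := fun (N : ℕ) (g : G0) => gridDrift β φ (fun j : Fin N => g (grid N j))) (fun N => ?_) ?_
  · exact ((measurable_gridDrift β (hφ.of_le (by norm_num)) N).comp
      (G0.measurable_eval_pi (grid N))).aestronglyMeasurable
  · filter_upwards [hQ.ae_mem_simplex] with g hg using tendsto_gridDrift β hφ hg

theorem IsDirichletProcess.exists_abs_drift0_le (hQ : IsDirichletProcess β Q)
    (hφ : ContDiff ℝ 3 φ) : ∃ C, 0 ≤ C ∧ ∀ᵐ g ∂Q, |drift0 β φ g| ≤ C := by
  obtain ⟨C, hC0, hC⟩ := exists_abs_gridDrift_le β hφ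
  refine ⟨C, hC0, ?_⟩
  filter_upwards [hQ.ae_mem_simplex] with g hg
  exact le_of_tendsto (tendsto_gridDrift β hφ hg).abs (Eventually.of_forall fun N => hC N _ (hg N))

theorem hasFDerivAt_riemann {m N : ℕ} {U : (Fin m → ℝ) → ℝ} {A : Fin m → ℝ → ℝ}
    (hU : ContDiff ℝ 1 U) (hA : ∀ i, ContDiff ℝ 1 (A i)) (x : Fin N → ℝ) (v : Fin N → ℝ) :
    fderiv ℝ (fun x : Fin N → ℝ => U fun i => 1 / ((N : ℝ) + 1) * ∑ j, A i (x j)) x v =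
      ∑ i, partialD i U (fun i => 1 / ((N : ℝ) + 1) * ∑ j, A i (x j)) *
        (1 / ((N : ℝ) + 1) * ∑ j, deriv (A i) (x j) * v j) := by
  have h1 : ∀ i, HasFDerivAt (fun x : Fin N → ℝ => 1 / ((N : ℝ) + 1) * ∑ j, A i (x j))
      ((1 / ((N : ℝ) + 1)) • ∑ j, deriv (A i) (x j) • ContinuousLinearMap.proj (R := ℝ) j) x :=
    fun i => (HasFDerivAt.fun_sum fun j _ =>
      ((hA i).differentiable one_ne_zero (x j)).hasDerivAt.comp_hasFDerivAt x
        (hasFDerivAt_apply j x)).const_mul _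
  have h2 := (hU.differentiable one_ne_zero _).hasFDerivAt.comp x (hasFDerivAt_pi.2 h1)
  have h3 := h2.fderiv
  rw [Function.comp_def] at h3
  rw [h3, ContinuousLinearMap.comp_apply, fderiv_eq_sum_partialD]
  refine Finset.sum_congr rfl fun i _ => ?_
  simp

/-- Integration by parts for cylinder functions. -/
theorem IsDirichletProcess.integral_cylGrad (hβ : 0 < β) (hQ : IsDirichletProcess β Q)
    (hφ : ContDiff ℝ 3 φ) (h0 : φ 0 = 0) (h1 : φ 1 = 0) {m : ℕ} {U : (Fin m → ℝ) → ℝ}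
    {A : Fin m → ℝ → ℝ} (hU : ContDiff ℝ 1 U) (hA : ∀ i, ContDiff ℝ 1 (A i)) :
    ∫ g, ((∫ s, cylGrad U A (g, s) * φ (g s) ∂leb) + U (cylArg A g) * drift0 β φ g) ∂Q = 0 := by
  have := hQ.isProbability
  have hφ1 : ContDiff ℝ 1 φ := hφ.of_le (by norm_num)
  let arg : (N : ℕ) → (Fin N → ℝ) → Fin m → ℝ := fun N x i => 1 / ((N : ℝ) + 1) * ∑ j, A i (x j)
  let I : (N : ℕ) → (Fin N → ℝ) → ℝ := fun N x =>
    (∑ i, partialD i U (arg N x) * (1 / ((N : ℝ) + 1) * ∑ j, deriv (A i) (x j) * φ (x j))) +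
      U (arg N x) * gridDrift β φ x
  have harg : ∀ N, ContDiff ℝ 1 (arg N) := fun N => contDiff_pi.2 fun i =>
    contDiff_const.mul (ContDiff.sum fun j _ => (hA i).comp (contDiff_apply ℝ ℝ j))
  have hargm : ∀ N, Measurable (arg N) := fun N => (harg N).continuous.measurable
  have hdA : ∀ i, Continuous (deriv (A i)) := fun i => (hA i).continuous_deriv le_rfl
  have hI : ∀ N, Measurable (I N) := fun N => by
    refine Measurable.add (Finset.measurable_fun_sum _ fun i _ => ?_) ?_
    · refine (((continuous_partialD hU i).measurable).comp (hargm N)).mul (Measurable.const_mul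
        (Finset.measurable_fun_sum _ fun j _ => ?_) _)
      exact (((hdA i).mul hφ.continuous).measurable).comp (measurable_pi_apply j)
    · exact (hU.continuous.measurable.comp (hargm N)).mul (measurable_gridDrift β hφ1 N)
  -- With Riemann sums in place of integrals the functional depends on finitely many values of `g`,
  -- and the finite dimensional formula applies.
  have hzero : ∀ N : ℕ, ∫ g : G0, I N (fun j => g (grid N j)) ∂Q = 0 := fun N => by
    rw [hQ.integral_eq (grid_mem_simplex N) (hI N)]
    have := integral_dirichletLaw_byParts hβ hφ1 h0 h1 (grid_mem_simplex N)
      (F := fun x => U (arg N x)) (hU.comp (harg N))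
    rw [← this]
    refine integral_congr_ae (Eventually.of_forall fun x => ?_)
    simp only [I, arg, hasFDerivAt_riemann hU hA, gridDrift]
  have hlim : ∀ᵐ g ∂Q, Tendsto (fun N => I N (fun j => g (grid N j))) atTop
      (𝓝 ((∫ s, cylGrad U A (g, s) * φ (g s) ∂leb) + U (cylArg A g) * drift0 β φ g)) := by
    filter_upwards [hQ.ae_mem_simplex] with g hg
    have ha : Tendsto (fun N => arg N (fun j => g (grid N j))) atTop (𝓝 (cylArg A g)) := by
      refine tendsto_pi_nhds.2 fun i => ?_
      have := tendsto_riemannSum_right (hA i).continuous g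
      rw [← intervalIntegral_eq_leb] at this
      exact this
    have hg2 : ∫ s, cylGrad U A (g, s) * φ (g s) ∂leb =
        ∑ i, partialD i U (cylArg A g) * ∫ s, deriv (A i) (g s) * φ (g s) ∂leb := by
      simp only [cylGrad, Finset.sum_mul, mul_assoc]
      rw [integral_finsetSum]
      · simp only [integral_const_mul]
      · intro i _
        exact (integrable_comp_apply ((hdA i).mul hφ.continuous) g).const_mul _
    rw [hg2]
    refine Tendsto.add (tendsto_finsetSum _ fun i _ => ?_) ?_
    · refine (((continuous_partialD hU i).tendsto _).comp ha).mul ?_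
      exact tendsto_riemannSum_right ((hdA i).mul hφ.continuous) g
    · exact ((hU.continuous.tendsto _).comp ha).mul (tendsto_gridDrift β hφ hg)
  obtain ⟨D, hD0, hD⟩ := exists_abs_gridDrift_le β hφ
  choose C hC0 hC using fun i => exists_bound_Icc (hA i).continuous
  choose K hK0 hK using fun i => exists_bound_Icc ((hdA i).mul hφ.continuous)
  have havg : ∀ (a : ℝ → ℝ) (c : ℝ) (N : ℕ) (g : G0), 0 ≤ c → (∀ x ∈ Icc (0 : ℝ) 1, |a x| ≤ c) →
      |1 / ((N : ℝ) + 1) * ∑ j : Fin N, a (g (grid N j))| ≤ c := by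
    intro a c N g hc0 hc
    have hN : (0 : ℝ) < (N : ℝ) + 1 := by positivity
    rw [abs_mul, abs_of_pos (by positivity : 0 < 1 / ((N : ℝ) + 1)), one_div, inv_mul_le_iff₀ hN]
    refine (Finset.abs_sum_le_sum_abs _ _).trans ((Finset.sum_le_sum fun j _ =>
      hc _ (g.apply_mem (grid N j))).trans ?_)
    rw [Finset.sum_const, Finset.card_univ, Fintype.card_fin, nsmul_eq_mul]
    exact mul_le_mul_of_nonneg_right (by linarith) hc0
  have hbox : ∀ (N : ℕ) (g : G0), arg N (fun j => g (grid N j)) ∈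
      (Set.pi univ fun i => Icc (-C i) (C i) : Set (Fin m → ℝ)) := fun N g i _ =>
    abs_le.1 (havg (A i) (C i) N g (hC0 i) (hC i))
  have hcomp : IsCompact (Set.pi univ fun i => Icc (-C i) (C i) : Set (Fin m → ℝ)) :=
    isCompact_univ_pi fun i => isCompact_Icc
  obtain ⟨B, hB⟩ := hcomp.exists_bound_of_continuousOn hU.continuous.continuousOn
  choose P hP using fun i => hcomp.exists_bound_of_continuousOn
    (continuous_partialD hU i).continuousOn
  have hL := tendsto_integral_of_dominated_convergence
    (F := fun (N : ℕ) (g : G0) => I N (fun j => g (grid N j)))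
    (fun _ : G0 => ∑ i, P i * K i + B * D) (μ := Q)
    (fun N => ((hI N).comp (G0.measurable_eval_pi (grid N))).aestronglyMeasurable)
    (integrable_const _) (fun N => ?_) hlim
  · refine tendsto_nhds_unique hL ?_
    simp only [hzero]
    exact tendsto_const_nhds
  · filter_upwards [hQ.ae_mem_simplex] with g hg
    refine (norm_add_le _ _).trans (add_le_add ((norm_sum_le _ _).trans
      (Finset.sum_le_sum fun i _ => ?_)) ?_)
    · rw [norm_mul]
      exact mul_le_mul (hP i _ (hbox N g)) (havg (fun x => deriv (A i) x * φ x) (K i) N g (hK0 i)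
        (hK i)) (norm_nonneg _) ((norm_nonneg _).trans (hP i _ (hbox N g)))
    · rw [norm_mul]
      exact mul_le_mul (hB _ (hbox N g)) (hD N _ (hg N)) (norm_nonneg _)
        ((norm_nonneg _).trans (hB _ (hbox N g)))

/-- The derivative in direction `φ`. -/
def dirD (φ : ℝ → ℝ) (F : G0 × ℝ → ℝ) (g : G0) : ℝ := ∫ s, F (g, s) * φ (g s) ∂leb

variable {f v : G0 → ℝ} {F V : G0 × ℝ → ℝ}

theorem IsGrad.measurable_dirD (hF : IsGrad f F) (hφ : Continuous φ) : Measurable (dirD φ F) := by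
  have : StronglyMeasurable fun p : G0 × ℝ => F p * φ (p.1 p.2) :=
    (hF.meas.mul (measurable_comp_eval hφ.measurable)).stronglyMeasurable
  exact (this.integral_prod_right (ν := leb)).measurable

theorem IsGrad.exists_abs_dirD_le (hF : IsGrad f F) (hφ : Continuous φ) :
    ∃ C, 0 ≤ C ∧ ∀ g, |dirD φ F g| ≤ C := by
  obtain ⟨C, hC⟩ := hF.bdd
  obtain ⟨K, hK0, hK⟩ := exists_bound_Icc hφ
  have h : ∀ g, |dirD φ F g| ≤ C * K := fun g => by
    have := norm_integral_le_of_norm_le_const (μ := leb) (f := fun s => F (g, s) * φ (g s))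
      (C := C * K) (Eventually.of_forall fun s => by
        rw [norm_mul]
        exact mul_le_mul (hC _) (hK _ (g.apply_mem s)) (norm_nonneg _)
          ((abs_nonneg _).trans (hC (g, s))))
    simpa [dirD] using this
  exact ⟨|C * K|, abs_nonneg _, fun g => (h g).trans (le_abs_self _)⟩

theorem IsGrad.integrable_mul_comp (hF : IsGrad f F) (hφ : Continuous φ) (g : G0) :
    Integrable (fun s => F (g, s) * φ (g s)) leb := by
  obtain ⟨C, hC⟩ := hF.bdd
  exact (integrable_comp_apply hφ g).bdd_mul (c := C)
    (hF.meas.comp measurable_prodMk_left).aestronglyMeasurable (Eventually.of_forall fun s => hC _)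

theorem IsGrad.dirD_eq {F' : G0 × ℝ → ℝ} (hF : IsGrad f F) (hF' : IsGrad f F') :
    dirD φ F = dirD φ F' := by
  funext g
  refine integral_congr_ae ?_
  filter_upwards [hF.ae_eq g, hF'.ae_eq g] with s h1 h2
  rw [← h1, ← h2]

theorem IsDirichletProcess.integral_dirD (hβ : 0 < β) (hQ : IsDirichletProcess β Q)
    (hφ : ContDiff ℝ 3 φ) (h0 : φ 0 = 0) (h1 : φ 1 = 0) (hf : f ∈ cyl 1) (hF : IsGrad f F) :
    ∫ g, (dirD φ F g + f g * drift0 β φ g) ∂Q = 0 := by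
  obtain ⟨m, U, A, hU, hA, rfl⟩ := mem_cyl_one_iff.1 hf
  rw [hF.dirD_eq (isGrad_cylGrad hU hA)]
  exact hQ.integral_cylGrad hβ hφ h0 h1 hU hA

theorem IsDirichletProcess.integrable_mul_drift0 (hQ : IsDirichletProcess β Q)
    (hφ : ContDiff ℝ 3 φ) (hf : Integrable f Q) : Integrable (fun g => f g * drift0 β φ g) Q := by
  obtain ⟨C, -, hC⟩ := hQ.exists_abs_drift0_le hφ
  exact hf.mul_bdd (c := C) (hQ.aestronglyMeasurable_drift0 hφ) hC

theorem integrable_of_continuous [IsFiniteMeasure Q] (hf : Continuous f) : Integrable f Q := by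
  obtain ⟨C, -, hC⟩ := exists_bound_of_continuous hf
  exact Integrable.of_bound hf.measurable.aestronglyMeasurable C (Eventually.of_forall hC)

theorem IsGrad.integrable_mul_dirD [IsFiniteMeasure Q] (hF : IsGrad f F) (hφ : Continuous φ)
    (hv : Integrable v Q) : Integrable (fun g => v g * dirD φ F g) Q := by
  obtain ⟨C, -, hC⟩ := hF.exists_abs_dirD_le hφ
  exact hv.mul_bdd (c := C) (hF.measurable_dirD hφ).aestronglyMeasurable (Eventually.of_forall hC)

/-- The formula `integral_dirD` for the product `f * v`, combined with the Leibniz rule. -/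
theorem IsDirichletProcess.integral_mul_dirD (hβ : 0 < β) (hQ : IsDirichletProcess β Q)
    (hφ : ContDiff ℝ 3 φ) (h0 : φ 0 = 0) (h1 : φ 1 = 0) (hf : f ∈ cyl 1) (hF : IsGrad f F)
    (hv : v ∈ cyl 1) (hV : IsGrad v V) :
    ∫ g, v g * dirD φ F g ∂Q = ∫ g, f g * (-dirD φ V g - v g * drift0 β φ g) ∂Q := by
  have := hQ.isProbability
  have hfc := cyl_continuous hf
  have hvc := cyl_continuous hv
  have h := hQ.integral_dirD hβ hφ h0 h1 (cyl_mul hf hv) (hF.mul hfc hvc hV)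
  have e : ∀ g, dirD φ (fun p => f p.1 * V p + v p.1 * F p) g + (f * v) g * drift0 β φ g =
      v g * dirD φ F g - f g * (-dirD φ V g - v g * drift0 β φ g) := fun g => by
    have : dirD φ (fun p => f p.1 * V p + v p.1 * F p) g = f g * dirD φ V g + v g * dirD φ F g := by
      simp only [dirD, add_mul, mul_assoc]
      rw [integral_add ((hV.integrable_mul_comp hφ.continuous g).const_mul _)
        ((hF.integrable_mul_comp hφ.continuous g).const_mul _), integral_const_mul,
        integral_const_mul]
    rw [this, Pi.mul_apply]; ring
  simp only [e] at h
  rw [integral_sub] at h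
  · linarith
  · exact hF.integrable_mul_dirD hφ.continuous (integrable_of_continuous hvc)
  · have i1 := hV.integrable_mul_dirD hφ.continuous (integrable_of_continuous (Q := Q) hfc)
    have i2 := hQ.integrable_mul_drift0 hφ (integrable_of_continuous (hfc.mul hvc))
    refine (i1.neg.sub i2).congr (Eventually.of_forall fun g => ?_)
    simp only [Pi.sub_apply, Pi.neg_apply, Pi.mul_apply]; ring

end ByParts

/-! ### Flows on the unit interval -/

section Flow

variable {φ : ℝ → ℝ}

/-- The flow of a vector field on `[0, 1]` vanishing at the end points. -/
theorem exists_flow (hφ : ContDiff ℝ 1 φ) (h0 : φ 0 = 0) (h1 : φ 1 = 0) :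
    ∃ ε > 0, ∃ Φ : ℝ → ℝ → ℝ, (∀ x ∈ Icc (0 : ℝ) 1, Φ 0 x = x) ∧ ∀ t ∈ Ioo (-ε) ε,
      MonotoneOn (Φ t) (Icc 0 1) ∧ MapsTo (Φ t) (Icc 0 1) (Icc 0 1) ∧
      ContinuousOn (Φ t) (Icc 0 1) ∧
      ∀ x ∈ Icc (0 : ℝ) 1, HasDerivAt (fun r => Φ r x) (φ (Φ t x)) t := by
  obtain ⟨C, hC0, hC⟩ := exists_lipschitz_Icc hφ
  obtain ⟨K, hK0, hK⟩ := exists_bound_Icc hφ.continuous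
  -- Clamping the argument gives a globally Lipschitz field. The trajectories turn out to stay in
  -- `[0, 1]`, where it coincides with `φ`.
  let v : ℝ → ℝ := fun x => φ (projIcc 0 1 zero_le_one x)
  have hv : LipschitzWith C.toNNReal v := by
    refine LipschitzWith.of_dist_le_mul fun x y => ?_
    rw [Real.coe_toNNReal C hC0, dist_comm, Real.dist_eq]
    refine (hC _ (projIcc 0 1 zero_le_one x).2 _ (projIcc 0 1 zero_le_one y).2).trans ?_
    refine mul_le_mul_of_nonneg_left ?_ hC0
    have := (LipschitzWith.projIcc (zero_le_one' ℝ)).dist_le_mul y x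
    simp only [NNReal.coe_one, one_mul, Subtype.dist_eq, Real.dist_eq] at this
    rwa [Real.dist_eq, abs_sub_comm x y]
  have hveq : ∀ x ∈ Icc (0 : ℝ) 1, v x = φ x := fun x hx => by simp only [v, projIcc_of_mem _ hx]
  -- Picard–Lindelöf in the ball of radius `2` around `1 / 2`, with starting points in the ball of
  -- radius `1 / 2`, asks for `K ε ≤ 3 / 2`.
  set ε : ℝ := 1 / (K + 1) with hε
  have hεpos : 0 < ε := by positivity
  have hball : Metric.closedBall (1 / 2 : ℝ) ((1 / 2 : NNReal) : ℝ) = Icc 0 1 := by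
    rw [Real.closedBall_eq_Icc]; norm_num
  have hpl : IsPicardLindelof (fun _ => v) (tmin := -ε) (tmax := ε)
      ⟨0, by constructor <;> linarith⟩ (1 / 2) 2 (1 / 2) K.toNNReal C.toNNReal := by
    refine IsPicardLindelof.of_time_independent (fun x _ => ?_) hv.lipschitzOnWith ?_
    · rw [Real.coe_toNNReal K hK0]; exact hK _ (projIcc 0 1 zero_le_one x).2
    · rw [Real.coe_toNNReal K hK0]
      have : K * ε ≤ 1 := by rw [hε, mul_one_div, div_le_one (by positivity)]; linarith
      simp only [sub_zero, zero_sub, neg_neg, max_self]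
      refine this.trans ?_
      norm_num
  obtain ⟨α, hα, L, hL⟩ := hpl.exists_forall_mem_closedBall_eq_hasDerivWithinAt_lipschitzOnWith
  rw [hball] at hα hL
  have hzero : (0 : ℝ) ∈ Ioo (-ε) ε := by constructor <;> linarith
  have hd : ∀ x ∈ Icc (0 : ℝ) 1, ∀ t ∈ Ioo (-ε) ε, HasDerivAt (α x) (v (α x t)) t :=
    fun x hx t ht => ((hα x hx).2 t (Ioo_subset_Icc_self ht)).hasDerivAt (Icc_mem_nhds ht.1 ht.2)
  have huniq : ∀ f g : ℝ → ℝ, (∀ t ∈ Ioo (-ε) ε, HasDerivAt f (v (f t)) t) →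
      (∀ t ∈ Ioo (-ε) ε, HasDerivAt g (v (g t)) t) → ∀ s ∈ Ioo (-ε) ε, f s = g s →
      EqOn f g (Ioo (-ε) ε) := fun f g hf hg s hs hfg =>
    ODE_solution_unique_of_mem_Ioo (v := fun _ => v) (s := fun _ => univ) (K := C.toNNReal)
      (fun _ _ => hv.lipschitzOnWith) hs (fun t ht => ⟨hf t ht, mem_univ _⟩)
      (fun t ht => ⟨hg t ht, mem_univ _⟩) hfg
  -- Trajectories that exchange their order would have met at an intermediate time, and would then
  -- coincide by uniqueness.
  have hmono : ∀ t ∈ Ioo (-ε) ε, MonotoneOn (fun x => α x t) (Icc 0 1) := by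
    intro t ht x hx y hy hxy
    by_contra! hlt
    have hcont : ContinuousOn (fun s => α x s - α y s) (uIcc 0 t) := by
      intro s hs
      have hs' : s ∈ Ioo (-ε) ε := (ordConnected_Ioo.uIcc_subset hzero ht) hs
      exact ((hd x hx s hs').continuousAt.sub (hd y hy s hs').continuousAt).continuousWithinAt
    have hmem : (0 : ℝ) ∈ uIcc (α x 0 - α y 0) (α x t - α y t) := by
      have e1 : α x 0 = x := (hα x hx).1
      have e2 : α y 0 = y := (hα y hy).1
      rw [e1, e2, uIcc_of_le (by linarith)]
      exact ⟨by linarith, by linarith⟩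
    obtain ⟨s, hs, hs0⟩ := intermediate_value_uIcc hcont hmem
    have hs' : s ∈ Ioo (-ε) ε := (ordConnected_Ioo.uIcc_subset hzero ht) hs
    have := huniq (α x) (α y) (hd x hx) (hd y hy) s hs' (sub_eq_zero.1 hs0) ht
    exact absurd this hlt.ne'
  -- Zeros of `φ` are stationary. Applied to `0` and `1`, this and monotonicity make `[0, 1]`
  -- invariant.
  have hconst : ∀ c ∈ Icc (0 : ℝ) 1, φ c = 0 → ∀ t ∈ Ioo (-ε) ε, α c t = c := by
    intro c hc hφc t ht
    refine huniq (α c) (fun _ => c) (hd c hc) (fun s _ => ?_) 0 hzero (hα c hc).1 ht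
    rw [hveq c hc, hφc]
    exact hasDerivAt_const _ _
  have hmaps : ∀ t ∈ Ioo (-ε) ε, MapsTo (fun x => α x t) (Icc 0 1) (Icc 0 1) := by
    intro t ht x hx
    have a0 := hmono t ht (left_mem_Icc.2 zero_le_one) hx hx.1
    have a1 := hmono t ht hx (right_mem_Icc.2 zero_le_one) hx.2
    simp only at a0 a1
    rw [hconst 0 (by simp) h0 t ht] at a0
    rw [hconst 1 (by simp) h1 t ht] at a1
    exact ⟨a0, a1⟩
  refine ⟨ε, hεpos, fun t x => α x t, fun x hx => (hα x hx).1, fun t ht => ⟨hmono t ht, hmaps t ht,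
    (hL t (Ioo_subset_Icc_self ht)).continuousOn, fun x hx => ?_⟩⟩
  have := hd x hx t ht
  rwa [hveq _ (hmaps t ht hx)] at this

/-- The composition `F ∘ g`. -/
def G0.compOn (g : G0) (F : ℝ → ℝ) (hm : MonotoneOn F (Icc 0 1)) (hF : MapsTo F (Icc 0 1) (Icc 0 1))
    (hc : ContinuousOn F (Icc 0 1)) : G0 where
  toFun s := ⟨F (g.toFun s), hF (g.toFun s).2⟩
  mono s t hst := Subtype.mk_le_mk.2 (hm (g.toFun s).2 (g.toFun t).2 (g.mono hst))
  rightCts t := by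
    refine Topology.IsInducing.subtypeVal.continuousWithinAt_iff.2 ?_
    have h : Continuous fun x : Icc (0 : ℝ) 1 => F x := continuousOn_iff_continuous_domRestrict.1 hc
    exact h.continuousAt.comp_continuousWithinAt (g.rightCts t)

theorem G0.compOn_apply (g : G0) {F : ℝ → ℝ} (hm : MonotoneOn F (Icc 0 1))
    (hF : MapsTo F (Icc 0 1) (Icc 0 1)) (hc : ContinuousOn F (Icc 0 1)) {s : ℝ}
    (hs : s ∈ Ico (0 : ℝ) 1) : g.compOn F hm hF hc s = F (g s) := by
  rw [apply_of_mem _ hs, apply_of_mem _ hs]; rfl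

open Classical in
-- The curve `Φ_t ∘ g` has velocity `φ ∘ g` at `t = 0`, so differentiation under the integral pairs
-- the `L²`-gradient with `φ ∘ g`.
theorem hasDirDerivAt_cyl (hφ : ContDiff ℝ 1 φ) (h0 : φ 0 = 0) (h1 : φ 1 = 0) {f : G0 → ℝ}
    {F : G0 × ℝ → ℝ} (hf : f ∈ cyl 1) (hF : IsGrad f F) (g : G0) :
    HasDirDerivAt φ f g (dirD φ F g) := by
  obtain ⟨m, U, A, hU, hA, rfl⟩ := mem_cyl_one_iff.1 hf
  rw [hF.dirD_eq (isGrad_cylGrad hU hA)]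
  obtain ⟨ε, hε, Φ, hΦ0, hΦ⟩ := exists_flow hφ h0 h1
  have hzero : (0 : ℝ) ∈ Ioo (-ε) ε := by constructor <;> linarith
  let γ : ℝ → G0 := fun t => if ht : t ∈ Ioo (-ε) ε then
    g.compOn (Φ t) (hΦ t ht).1 (hΦ t ht).2.1 (hΦ t ht).2.2.1 else g
  have hγ : ∀ t ∈ Ioo (-ε) ε, ∀ s ∈ Ico (0 : ℝ) 1, γ t s = Φ t (g s) := fun t ht s hs => by
    simp only [γ, dif_pos ht]
    exact g.compOn_apply _ _ _ hs
  have hγ0 : γ 0 = g := by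
    ext s
    rw [← G0.apply_of_mem (γ 0) s.2, ← G0.apply_of_mem g s.2, hγ 0 hzero s s.2,
      hΦ0 _ (g.apply_mem s)]
  refine ⟨γ, hγ0, ⟨ε, hε, fun s hs t ht => ?_⟩, ?_⟩
  · rw [hγ t ht s hs]
    refine ((hΦ t ht).2.2.2 (g s) (g.apply_mem s)).congr_of_eventuallyEq ?_
    filter_upwards [Ioo_mem_nhds ht.1 ht.2] with r hr using hγ r hr s hs
  · obtain ⟨K, hK0, hK⟩ := exists_bound_Icc hφ.continuous
    have hmem : ∀ t ∈ Ioo (-ε) ε, ∀ s, Φ t (g s) ∈ Icc (0 : ℝ) 1 := fun t ht s =>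
      (hΦ t ht).2.1 (g.apply_mem s)
    have hc0 : (fun s => Φ 0 (g s)) = (g : ℝ → ℝ) := funext fun s => hΦ0 _ (g.apply_mem s)
    have hd := hasDerivAt_cyl_curve hU hA (c := fun t s => Φ t (g s))
      (c' := fun t s => φ (Φ t (g s))) (M := K) (R := 1) g hc0 hε ?_ ?_ ?_ ?_ ?_
    · have e : (fun s => φ (Φ 0 (g s))) = fun s => φ (g s) := by
        funext s; rw [hΦ0 _ (g.apply_mem s)]
      simp only [hΦ0 _ (g.apply_mem _)] at hd
      refine hd.congr_of_eventuallyEq ?_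
      filter_upwards [Ioo_mem_nhds hzero.1 hzero.2] with t ht
      refine congrArg U (funext fun i => ?_)
      rw [cylArg, intervalIntegral_eq_leb]
      refine integral_congr_ae ?_
      filter_upwards [ae_mem_Ioo_leb] with s hs
      rw [hγ t ht s ⟨hs.1.le, hs.2⟩]
    · intro t ht
      have : Monotone fun s => Φ t (g s) := fun s r hsr =>
        (hΦ t ht).1 (g.apply_mem s) (g.apply_mem r) (g.monotone hsr)
      exact this.measurable
    · simp only [hΦ0 _ (g.apply_mem _)]
      exact hφ.continuous.measurable.comp g.measurable
    · intro t ht s _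
      rw [abs_of_nonneg (hmem t ht s).1]; exact (hmem t ht s).2
    · exact fun t ht s _ => hK _ (hmem t ht s)
    · exact fun t ht s _ => (hΦ t ht).2.2.2 (g s) (g.apply_mem s)

theorem HasDirDerivAt.congr {ψ : ℝ → ℝ} {f : G0 → ℝ} {g : G0} {d : ℝ} (h : HasDirDerivAt φ f g d)
    (hφ : EqOn φ ψ (Icc 0 1)) : HasDirDerivAt ψ f g d := by
  obtain ⟨γ, h0, ⟨ε, hε, hd⟩, hf⟩ := h
  refine ⟨γ, h0, ⟨ε, hε, fun s hs t ht => ?_⟩, hf⟩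
  rw [← hφ ((γ t).apply_mem s)]
  exact hd s hs t ht

end Flow

/-! ### The adjoint of the directional derivative -/

section Adjoint

variable {β : ℝ} {Q : Measure G0} {φ ψ : ℝ → ℝ} {v : G0 → ℝ} {V : G0 × ℝ → ℝ}

theorem memLp_of_continuous [IsFiniteMeasure Q] (hv : Continuous v) {p : ENNReal} : MemLp v p Q := by
  obtain ⟨C, -, hC⟩ := exists_bound_of_continuous hv
  exact MemLp.of_bound hv.measurable.aestronglyMeasurable C (Eventually.of_forall hC)

theorem IsGrad.memLp_dirD [IsFiniteMeasure Q] (hV : IsGrad v V) (hφ : Continuous φ) {p : ENNReal} :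
    MemLp (dirD φ V) p Q := by
  obtain ⟨C, -, hC⟩ := hV.exists_abs_dirD_le hφ
  exact MemLp.of_bound (hV.measurable_dirD hφ).aestronglyMeasurable C (Eventually.of_forall hC)

theorem IsDirichletProcess.memLp_mul_drift0 [IsFiniteMeasure Q] (hQ : IsDirichletProcess β Q)
    (hφ : ContDiff ℝ 3 φ) (hv : Continuous v) {p : ENNReal} :
    MemLp (fun g => v g * drift0 β φ g) p Q := by
  obtain ⟨C, hC0, hC⟩ := hQ.exists_abs_drift0_le hφ
  obtain ⟨B, hB0, hB⟩ := exists_bound_of_continuous hv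
  refine MemLp.of_bound (hv.measurable.aestronglyMeasurable.mul (hQ.aestronglyMeasurable_drift0 hφ))
    (B * C) ?_
  filter_upwards [hC] with g hg
  rw [norm_mul]
  exact mul_le_mul (hB g) hg (norm_nonneg _) hB0

theorem IsDirichletProcess.memLp_adjoint [IsFiniteMeasure Q] (hQ : IsDirichletProcess β Q)
    (hφ : ContDiff ℝ 3 φ) (hv : Continuous v) (hV : IsGrad v V) {p : ENNReal} :
    MemLp (fun g => -dirD φ V g - v g * drift0 β φ g) p Q :=
  (hV.memLp_dirD hφ.continuous).neg.sub (hQ.memLp_mul_drift0 hφ hv)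

theorem IsDirichletProcess.isAdjointValue (hβ : 0 < β) (hQ : IsDirichletProcess β Q)
    (hφ : ContDiff ℝ 3 φ) (h0 : φ 0 = 0) (h1 : φ 1 = 0) (hψ : EqOn φ ψ (Icc 0 1)) (hv : v ∈ cyl 1)
    (hV : IsGrad v V) :
    IsAdjointValue Q ψ v (fun g => -dirD φ V g - v g * drift0 β φ g) := by
  have := hQ.isProbability
  have hvc := cyl_continuous hv
  refine ⟨memLp_of_continuous hvc, hQ.memLp_adjoint hφ hvc hV, fun f hf => ?_⟩
  obtain ⟨F, hF⟩ := exists_isGrad hf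
  refine ⟨dirD φ F, hF.memLp_dirD hφ.continuous, fun g =>
    (hasDirDerivAt_cyl (hφ.of_le (by norm_num)) h0 h1 hf hF g).congr hψ, ?_⟩
  rw [← hQ.integral_mul_dirD hβ hφ h0 h1 hf hF hv hV]
  simp only [mul_comm]

/-- Data of a smooth cylinder function extended to the real line. -/
theorem IsSmoothNeumann.exists_ext {m : ℕ} {U : (Fin m → ℝ) → ℝ} {α : Fin m → ℝ → ℝ}
    (h : IsSmoothNeumann U α) : ∃ A : Fin m → ℝ → ℝ, (∀ i, ContDiff ℝ 4 (A i)) ∧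
      (∀ i, EqOn (A i) (α i) (Icc 0 1)) ∧ (∀ i, ContDiff ℝ 3 (deriv (A i))) ∧
      (∀ i, EqOn (deriv (A i)) (D01 (α i)) (Icc 0 1)) ∧
      (∀ i, deriv (A i) 0 = 0) ∧ ∀ i, deriv (A i) 1 = 0 := by
  -- The vector fields are `deriv (A i)`, and the estimates on the drift require them to be of class
  -- `C³`.
  obtain ⟨A, hA, hA'⟩ := exists_globalRep (n := 4)
    (fun i => (h.smooth_α i).of_le (WithTop.coe_le_coe.2 (le_top (a := (4 : ℕ∞)))))
  have hA4 : ∀ i, ContDiff ℝ 4 (A i) := fun i => by exact_mod_cast hA i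
  have hD : ∀ i, EqOn (deriv (A i)) (D01 (α i)) (Icc 0 1) := fun i =>
    (D01_eq_deriv ((hA4 i).differentiable (by norm_num)) (hA' i)).symm
  refine ⟨A, hA4, hA', fun i => ((contDiff_succ_iff_deriv (n := 3)).1 (hA4 i)).2.2, hD, fun i => ?_,
    fun i => ?_⟩
  · rw [hD i (by simp), h.left]
  · rw [hD i (by simp), h.right]

theorem contDiff_partialD {m : ℕ} {U : (Fin m → ℝ) → ℝ} (hU : ContDiff ℝ ∞ U) (i : Fin m) :
    ContDiff ℝ ∞ (partialD i U) :=
  (hU.fderiv_right (m := ∞) (by exact_mod_cast le_top)).clm_apply contDiff_const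

theorem dirD_cylGrad {m : ℕ} {U : (Fin m → ℝ) → ℝ} {A : Fin m → ℝ → ℝ}
    (hA : ∀ i, ContDiff ℝ 1 (A i)) (hφ : Continuous φ) (g : G0) :
    dirD φ (cylGrad U A) g =
      ∑ j, partialD j U (cylArg A g) * ∫ s, deriv (A j) (g s) * φ (g s) ∂leb := by
  simp only [dirD, cylGrad, Finset.sum_mul, mul_assoc]
  rw [integral_finsetSum]
  · simp only [integral_const_mul]
  · intro i _
    exact (integrable_comp_apply (((hA i).continuous_deriv le_rfl).mul hφ) g).const_mul _

/-- The operator in terms of the adjoints of the directional derivatives. -/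
theorem opL_eq {m : ℕ} {U : (Fin m → ℝ) → ℝ} {α A : Fin m → ℝ → ℝ}
    (hA : ∀ i, ContDiff ℝ 4 (A i)) (hA' : ∀ i, EqOn (A i) (α i) (Icc 0 1))
    (hD : ∀ i, EqOn (deriv (A i)) (D01 (α i)) (Icc 0 1)) (g : G0) :
    opL β U α g = -∑ i, (-dirD (deriv (A i)) (cylGrad (partialD i U) A) g
      - partialD i U (cylArg A g) * drift0 β (deriv (A i)) g) := by
  have hA1 : ∀ i, ContDiff ℝ 1 (A i) := fun i => (hA i).of_le (by norm_num)
  have hdA : ∀ i, ContDiff ℝ 1 (deriv (A i)) := fun i =>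
    ((contDiff_succ_iff_deriv (n := 3)).1 (hA i)).2.2.of_le (by norm_num)
  rw [opL, cylArg_congr hA']
  simp only [Finset.sum_sub_distrib, Finset.sum_neg_distrib, neg_sub, sub_neg_eq_add]
  rw [add_comm]
  congr 1
  · exact Finset.sum_congr rfl fun i _ => by rw [drift0_congr β (hdA i) (hD i)]
  · rw [Finset.sum_comm]
    refine Finset.sum_congr rfl fun j _ => ?_
    rw [dirD_cylGrad hA1 (hdA j).continuous]
    refine Finset.sum_congr rfl fun i _ => ?_
    rw [intervalIntegral_eq_leb]
    congr 1
    refine integral_congr_ae (Eventually.of_forall fun s => ?_)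
    simp only
    rw [hD i (g.apply_mem s), hD j (g.apply_mem s)]

theorem cyl_of_partialD {m : ℕ} {U : (Fin m → ℝ) → ℝ} {A : Fin m → ℝ → ℝ} (hU : ContDiff ℝ ∞ U)
    (hA : ∀ i, ContDiff ℝ 4 (A i)) (i : Fin m) : (fun g => partialD i U (cylArg A g)) ∈ cyl 1 :=
  mem_cyl_one_iff.2 ⟨m, partialD i U, A, (contDiff_partialD hU i).of_le (by exact_mod_cast le_top),
    fun i => (hA i).of_le (by norm_num), rfl⟩

theorem IsDirichletProcess.exists_adjoint_opL (hβ : 0 < β) (hQ : IsDirichletProcess β Q) {m : ℕ}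
    {U : (Fin m → ℝ) → ℝ} {α : Fin m → ℝ → ℝ} (h : IsSmoothNeumann U α) :
    ∃ w : Fin m → G0 → ℝ,
      (∀ i, IsAdjointValue Q (D01 (α i)) (fun g => partialD i U (cylArg α g)) (w i)) ∧
      opL β U α =ᵐ[Q] fun g => -∑ i, w i g := by
  obtain ⟨A, hA, hA', hφ, hD, h0, h1⟩ := h.exists_ext
  refine ⟨_, fun i => ?_, Eventually.of_forall fun g => opL_eq hA hA' hD g⟩
  have := hQ.isAdjointValue hβ (hφ i) (h0 i) (h1 i) (hD i) (cyl_of_partialD h.smooth_U hA i)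
    (isGrad_cylGrad ((contDiff_partialD h.smooth_U i).of_le (by exact_mod_cast le_top))
      fun i => (hA i).of_le (by norm_num))
  rw [cylArg_congr hA']
  exact this

theorem IsDirichletProcess.memLp_opL (hβ : 0 < β) (hQ : IsDirichletProcess β Q) {m : ℕ}
    {U : (Fin m → ℝ) → ℝ} {α : Fin m → ℝ → ℝ} (h : IsSmoothNeumann U α) :
    MemLp (opL β U α) 2 Q := by
  obtain ⟨w, hw, he⟩ := hQ.exists_adjoint_opL hβ h
  refine MemLp.ae_eq he.symm ?_
  exact (memLp_finsetSum _ fun i _ => (hw i).memLp_right).neg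

/-- The duality between the operator and the Dirichlet integral. -/
theorem IsDirichletProcess.integral_opL_mul (hβ : 0 < β) (hQ : IsDirichletProcess β Q) {m : ℕ}
    {U : (Fin m → ℝ) → ℝ} {α : Fin m → ℝ → ℝ} (h : IsSmoothNeumann U α) {f : G0 → ℝ}
    {F H : G0 × ℝ → ℝ} (hf : f ∈ cyl 1) (hF : IsGrad f F)
    (hH : IsGrad (fun g => U (cylArg α g)) H) :
    ∫ g, opL β U α g * f g ∂Q = -∫ g, (∫ s, F (g, s) * H (g, s) ∂leb) ∂Q := by
  have := hQ.isProbability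
  obtain ⟨A, hA, hA', hφ, hD, h0, h1⟩ := h.exists_ext
  have hU1 : ∀ i, ContDiff ℝ 1 (partialD i U) := fun i =>
    (contDiff_partialD h.smooth_U i).of_le (by exact_mod_cast le_top)
  have hU : ContDiff ℝ 1 U := h.smooth_U.of_le (by exact_mod_cast le_top)
  have hA1 : ∀ i, ContDiff ℝ 1 (A i) := fun i => (hA i).of_le (by norm_num)
  have hfc := cyl_continuous hf
  have hv := fun i => cyl_of_partialD h.smooth_U hA i
  have hV := fun i => isGrad_cylGrad (hU1 i) hA1
  rw [cylArg_congr hA'] at hH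
  have e1 : ∀ g, ∫ s, F (g, s) * H (g, s) ∂leb =
      ∑ i, partialD i U (cylArg A g) * dirD (deriv (A i)) F g := fun g => by
    have : ∫ s, F (g, s) * H (g, s) ∂leb = ∫ s, F (g, s) * cylGrad U A (g, s) ∂leb := by
      refine integral_congr_ae ?_
      filter_upwards [hH.ae_eq g, gradAt_cyl hU hA1 g] with s a1 a2
      rw [← a1, ← a2]
    rw [this]
    simp only [cylGrad, Finset.mul_sum, dirD]
    rw [integral_finsetSum]
    · refine Finset.sum_congr rfl fun i _ => ?_
      rw [← integral_const_mul]
      refine integral_congr_ae (Eventually.of_forall fun s => ?_)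
      simp only; ring
    · intro i _
      refine ((hF.integrable_mul_comp (hφ i).continuous g).const_mul
        (partialD i U (cylArg A g))).congr (Eventually.of_forall fun s => ?_)
      simp only; ring
  simp only [e1]
  rw [integral_finsetSum]
  · rw [← Finset.sum_neg_distrib]
    have e2 : ∀ i, ∫ g, partialD i U (cylArg A g) * dirD (deriv (A i)) F g ∂Q =
        ∫ g, f g * (-dirD (deriv (A i)) (cylGrad (partialD i U) A) g
          - partialD i U (cylArg A g) * drift0 β (deriv (A i)) g) ∂Q := fun i =>
      hQ.integral_mul_dirD hβ (hφ i) (h0 i) (h1 i) hf hF (hv i) (hV i)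
    simp only [e2, opL_eq hA hA' hD, neg_mul, Finset.sum_mul]
    rw [integral_neg, integral_finsetSum]
    · rw [← Finset.sum_neg_distrib]
      simp only [mul_comm]
    · intro i _
      have h2 : MemLp (fun g => -dirD (deriv (A i)) (cylGrad (partialD i U) A) g
          - partialD i U (cylArg A g) * drift0 β (deriv (A i)) g) 2 Q :=
        hQ.memLp_adjoint (hφ i) (cyl_continuous (hv i)) (hV i)
      exact h2.integrable_mul (memLp_of_continuous (p := 2) hfc)
  · intro i _
    exact hF.integrable_mul_dirD (hφ i).continuous (integrable_of_continuous (cyl_continuous (hv i)))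

end Adjoint

/-! ### Weak limits in Hilbert spaces -/

section WeakLimits

variable {H K : Type*} [NormedAddCommGroup H] [InnerProductSpace ℝ H] [CompleteSpace H]
  [NormedAddCommGroup K] [InnerProductSpace ℝ K] [CompleteSpace K]

/-- Banach–Alaoglu in the dual, transported by the Riesz isomorphism; the ultrafilter replaces a
subsequence. -/
theorem exists_weak_limit {ι : Type*} (𝒰 : Ultrafilter ι) {y : ι → H} {M : ℝ}
    (hM : ∀ i, ‖y i‖ ≤ M) :
    ∃ z, ∀ w, Tendsto (fun i => ⟪y i, w⟫) 𝒰 (𝓝 ⟪z, w⟫) := by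
  let Y : ι → WeakDual ℝ H := fun i =>
    StrongDual.toWeakDual (InnerProductSpace.toDual ℝ H (y i))
  have hc := WeakDual.isCompact_closedBall (0 : StrongDual ℝ H) M
  have hmem : ∀ i, Y i ∈ WeakDual.toStrongDual ⁻¹' Metric.closedBall (0 : StrongDual ℝ H) M := by
    intro i
    simpa [Y] using hM i
  obtain ⟨z, -, hz⟩ := hc.ultrafilter_le_nhds (𝒰.map Y)
    (by rw [le_principal_iff]; exact Filter.mem_map.2 (Eventually.of_forall hmem))
  refine ⟨(InnerProductSpace.toDual ℝ H).symm (WeakDual.toStrongDual z), fun w => ?_⟩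
  have h1 : Tendsto Y 𝒰 (𝓝 z) := hz
  have h2 := ((WeakDual.eval_continuous w).tendsto z).comp h1
  rw [InnerProductSpace.toDual_symm_apply]
  exact h2

/-- A closed subspace is weakly closed: a functional separating the limit from `S`, split into its
components on `H` and `K`, would contradict the two weak convergences. -/
theorem mem_of_weak_limit {S : Submodule ℝ (H × K)} (hS : IsClosed (S : Set (H × K))) {ι : Type*}
    {l : Filter ι} [l.NeBot] {x : ι → H} {y : ι → K} {x₀ : H} {y₀ : K}
    (hmem : ∀ i, (x i, y i) ∈ S) (hx : ∀ w, Tendsto (fun i => ⟪x i, w⟫) l (𝓝 ⟪x₀, w⟫))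
    (hy : ∀ w, Tendsto (fun i => ⟪y i, w⟫) l (𝓝 ⟪y₀, w⟫)) : (x₀, y₀) ∈ S := by
  by_contra hn
  obtain ⟨f, u, hu, hu'⟩ := geometric_hahn_banach_closed_point S.convex hS hn
  let p := (InnerProductSpace.toDual ℝ H).symm (f.comp (ContinuousLinearMap.inl ℝ H K))
  let q := (InnerProductSpace.toDual ℝ K).symm (f.comp (ContinuousLinearMap.inr ℝ H K))
  have hf : ∀ a b, f (a, b) = ⟪a, p⟫ + ⟪b, q⟫ := fun a b => by
    rw [real_inner_comm, real_inner_comm q b, InnerProductSpace.toDual_symm_apply,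
      InnerProductSpace.toDual_symm_apply]
    simp [← map_add]
  have h : Tendsto (fun i => f (x i, y i)) l (𝓝 (f (x₀, y₀))) := by
    simp only [hf]
    exact (hx p).add (hy q)
  exact absurd (le_of_tendsto h (Eventually.of_forall fun i => (hu _ (hmem i)).le)) (not_le.2 hu')

theorem tendsto_inner_of_tendsto {ι : Type*} {l : Filter ι} {x : ι → H} {x₀ : H}
    (h : Tendsto x l (𝓝 x₀)) (w : H) : Tendsto (fun i => ⟪x i, w⟫) l (𝓝 ⟪x₀, w⟫) :=
  h.inner tendsto_const_nhds

/-- For a closed operator, bounded images already put the limit into the domain. The norm bound is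
weak lower semicontinuity, obtained by testing the weak limit with itself. -/
theorem exists_mem_of_norm_le {S : Submodule ℝ (H × K)} (hS : IsClosed (S : Set (H × K)))
    {x : ℕ → H} {y : ℕ → K} {x₀ : H} (hx : Tendsto x atTop (𝓝 x₀)) (hmem : ∀ n, (x n, y n) ∈ S)
    {B : ℕ → ℝ} {b : ℝ} (hB : ∀ n, ‖y n‖ ≤ B n) (hb : Tendsto B atTop (𝓝 b)) :
    ∃ y₀, (x₀, y₀) ∈ S ∧ ‖y₀‖ ≤ b := by
  obtain ⟨M, hM⟩ := hb.bddAbove_range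
  have hle : ((hyperfilter ℕ : Ultrafilter ℕ) : Filter ℕ) ≤ atTop := Nat.hyperfilter_le_atTop
  obtain ⟨z, hz⟩ := exists_weak_limit (hyperfilter ℕ) (M := M)
    (fun n => (hB n).trans (hM (mem_range_self n)))
  refine ⟨z, mem_of_weak_limit hS hmem (tendsto_inner_of_tendsto (hx.mono_left hle)) hz, ?_⟩
  have h1 : ‖z‖ * ‖z‖ ≤ b * ‖z‖ := by
    rw [← real_inner_self_eq_norm_mul_norm]
    refine le_of_tendsto_of_tendsto' (hz z) ((hb.mono_left hle).mul_const ‖z‖) fun n => ?_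
    exact (real_inner_le_norm _ _).trans (mul_le_mul_of_nonneg_right (hB n) (norm_nonneg _))
  rcases eq_or_lt_of_le (norm_nonneg z) with h | h
  · rw [← h]
    exact ge_of_tendsto' hb fun n => (norm_nonneg _).trans (hB n)
  · exact le_of_mul_le_mul_right h1 h

/-- Weak limits of `y n` exist and equal `y₀`, because `S` is the graph of a function. Norms bounded
by a sequence tending to `‖y₀‖` then make the convergence strong. -/
theorem tendsto_of_norm_le_tendsto {S : Submodule ℝ (H × K)} (hS : IsClosed (S : Set (H × K)))
    (hg : ∀ p ∈ S, p.1 = 0 → p.2 = 0) {x : ℕ → H} {y : ℕ → K} {x₀ : H} {y₀ : K}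
    (hx : Tendsto x atTop (𝓝 x₀)) (hmem : ∀ n, (x n, y n) ∈ S) (h₀ : (x₀, y₀) ∈ S) {B : ℕ → ℝ}
    (hB : ∀ n, ‖y n‖ ≤ B n) (hb : Tendsto B atTop (𝓝 ‖y₀‖)) : Tendsto y atTop (𝓝 y₀) := by
  obtain ⟨M, hM⟩ := hb.bddAbove_range
  rw [tendsto_iff_ultrafilter]
  intro 𝒰 h𝒰
  obtain ⟨z, hz⟩ := exists_weak_limit 𝒰 (M := M) (fun n => (hB n).trans (hM (mem_range_self n)))
  have hzm := mem_of_weak_limit hS hmem (tendsto_inner_of_tendsto (hx.mono_left h𝒰)) hz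
  have hzy : z = y₀ := by
    have := hg _ (S.sub_mem hzm h₀) (by simp)
    exact sub_eq_zero.1 this
  rw [hzy] at hz
  rw [tendsto_iff_norm_sub_tendsto_zero]
  have h1 : Tendsto (fun n => B n ^ 2 - 2 * ⟪y n, y₀⟫ + ‖y₀‖ ^ 2) 𝒰 (𝓝 0) := by
    have := (((hb.mono_left h𝒰).pow 2).sub ((hz y₀).const_mul 2)).add_const (‖y₀‖ ^ 2)
    rw [real_inner_self_eq_norm_sq] at this
    convert this using 2
    ring
  have h2 : Tendsto (fun n => ‖y n - y₀‖ ^ 2) 𝒰 (𝓝 0) := by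
    refine squeeze_zero (fun n => by positivity) (fun n => ?_) h1
    rw [norm_sub_sq_real]
    have := pow_le_pow_left₀ (norm_nonneg _) (hB n) 2
    linarith
  have h3 := (Real.continuous_sqrt.tendsto 0).comp h2
  simpa [Function.comp_def, Real.sqrt_sq (norm_nonneg _)] using h3

end WeakLimits

/-! ### The form of a closed operator -/

section FormOf

variable {H K : Type*} [NormedAddCommGroup H] [InnerProductSpace ℝ H]
  [NormedAddCommGroup K] [InnerProductSpace ℝ K]

/-- The form `⟨T u, T v⟩`. -/
abbrev formOf (T : H →ₗ.[ℝ] K) : SymmForm H where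
  dom := T.domain
  form := LinearMap.mk₂ ℝ (fun u v => ⟪T u, T v⟫)
    (fun u v w => by rw [LinearPMap.map_add, inner_add_left])
    (fun c u v => by rw [LinearPMap.map_smul, real_inner_smul_left, smul_eq_mul])
    (fun u v w => by rw [LinearPMap.map_add, inner_add_right])
    (fun c u v => by rw [LinearPMap.map_smul, real_inner_smul_right, smul_eq_mul])
  symm u v := real_inner_comm _ _
  nonneg u := real_inner_self_nonneg

variable {T : H →ₗ.[ℝ] K}

theorem formOf_apply (u v : T.domain) : (formOf T).form u v = ⟪T u, T v⟫ := rfl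

theorem formOf_energy (u : T.domain) : (formOf T).energy u = ‖T u‖ ^ 2 + ‖(u : H)‖ ^ 2 := by
  rw [← real_inner_self_eq_norm_sq]; rfl

theorem tendsto_norm_of_sq {ι : Type*} {l : Filter ι} {x : ι → H}
    (h : Tendsto (fun i => ‖x i‖ ^ 2) l (𝓝 0)) : Tendsto x l (𝓝 0) := by
  rw [tendsto_zero_iff_norm_tendsto_zero]
  have h3 := (Real.continuous_sqrt.tendsto 0).comp h
  simpa [Function.comp_def, Real.sqrt_sq (norm_nonneg _)] using h3

theorem cauchySeq_of_norm_sq {x : ℕ → H}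
    (h : ∀ ε > 0, ∃ N, ∀ p ≥ N, ∀ q ≥ N, ‖x p - x q‖ ^ 2 < ε) : CauchySeq x := by
  rw [Metric.cauchySeq_iff]
  intro ε hε
  obtain ⟨N, hN⟩ := h (ε ^ 2) (by positivity)
  refine ⟨N, fun p hp q hq => ?_⟩
  rw [dist_eq_norm]
  exact lt_of_pow_lt_pow_left₀ 2 hε.le (hN p hp q hq)

theorem formOf_isClosed [CompleteSpace H] [CompleteSpace K] (hT : T.IsClosed) :
    (formOf T).IsClosed := by
  intro u hu
  have e : ∀ p q, (formOf T).energy (u p - u q) =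
      ‖T (u p) - T (u q)‖ ^ 2 + ‖(u p : H) - u q‖ ^ 2 := fun p q => by
    have := formOf_energy (T := T) (u p - u q)
    rw [LinearPMap.map_sub] at this
    exact this
  have h1 : CauchySeq fun n => (u n : H) := cauchySeq_of_norm_sq fun ε hε => by
    obtain ⟨N, hN⟩ := hu ε hε
    refine ⟨N, fun p hp q hq => ?_⟩
    have := hN p hp q hq
    rw [e] at this
    nlinarith [sq_nonneg ‖T (u p) - T (u q)‖]
  have h2 : CauchySeq fun n => T (u n) := cauchySeq_of_norm_sq fun ε hε => by
    obtain ⟨N, hN⟩ := hu ε hε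
    refine ⟨N, fun p hp q hq => ?_⟩
    have := hN p hp q hq
    rw [e] at this
    nlinarith [sq_nonneg ‖(u p : H) - u q‖]
  obtain ⟨x, hx⟩ := cauchySeq_tendsto_of_complete h1
  obtain ⟨y, hy⟩ := cauchySeq_tendsto_of_complete h2
  have hmem : (x, y) ∈ T.graph := by
    have := hT.mem_of_tendsto (hx.prodMk_nhds hy)
      (Eventually.of_forall fun n => T.mem_graph (u n))
    exact this
  obtain ⟨v, hv, hv'⟩ := T.mem_graph_iff.1 hmem
  simp only at hv hv'
  refine ⟨v, ?_⟩
  have e2 : ∀ n, (formOf T).energy ((u n : T.domain) - v : T.domain) =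
      ‖T (u n) - y‖ ^ 2 + ‖(u n : H) - x‖ ^ 2 := fun n => by
    rw [← hv, ← hv', ← LinearPMap.map_sub]; exact formOf_energy _
  refine Tendsto.congr (fun n => (e2 n).symm) ?_
  have a1 := ((tendsto_iff_norm_sub_tendsto_zero.1 hy).pow 2).add
    ((tendsto_iff_norm_sub_tendsto_zero.1 hx).pow 2)
  simpa using a1

end FormOf

/-! ### Generators and Friedrichs extensions -/

section Friedrichs

variable {H : Type*} [NormedAddCommGroup H] [InnerProductSpace ℝ H]

theorem SymmForm.energy_nonneg (E : SymmForm H) (u : E.dom) : 0 ≤ E.energy u :=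
  add_nonneg (E.nonneg u) (by positivity)

/-- Cauchy–Schwarz, from the discriminant of `t ↦ E(u + t v, u + t v)`. -/
theorem SymmForm.abs_form_le (E : SymmForm H) (u v : E.dom) :
    |E.form u v| ≤ √(E.energy u) * √(E.energy v) := by
  have key : ∀ t : ℝ, 0 ≤ E.form v v * (t * t) + 2 * E.form u v * t + E.form u u := fun t => by
    have := E.nonneg (u + t • v)
    simp only [map_add, map_smul, LinearMap.add_apply, LinearMap.smul_apply, smul_eq_mul] at this
    rw [E.symm v u] at this
    linarith
  have hd := discrim_le_zero key
  rw [discrim] at hd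
  have h1 : E.form u v ^ 2 ≤ E.energy u * E.energy v := by
    have a1 : E.form u u ≤ E.energy u := le_add_of_nonneg_right (by positivity)
    have a2 : E.form v v ≤ E.energy v := le_add_of_nonneg_right (by positivity)
    have := mul_le_mul a1 a2 (E.nonneg v) (E.energy_nonneg u)
    nlinarith
  rw [← Real.sqrt_mul (E.energy_nonneg u)]
  exact Real.abs_le_sqrt h1

theorem SymmForm.norm_le_sqrt_energy (E : SymmForm H) (u : E.dom) : ‖(u : H)‖ ≤ √(E.energy u) :=
  Real.le_sqrt_of_sq_le (le_add_of_nonneg_left (E.nonneg u))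

variable {E : SymmForm H} {L : H →ₗ.[ℝ] H}

/-- An element of the generator's domain is approximated in energy by the core, and symmetry moves
`L` to the other side. Conversely, a form Cauchy sequence from `Dom(L)` converges in energy because
`E` is closed, and the identity against `Dom(L)` extends to all of `Dom(E)` by density. -/
theorem SymmForm.generatorGraph_eq_friedrichsGraph (hE : E.IsClosed)
    (hdom : L.domain ≤ E.dom)
    (hL : ∀ (u : L.domain) (v : E.dom), E.form ⟨u, hdom u.2⟩ v = -⟪L u, (v : H)⟫)
    (hcore : ∀ u : E.dom, ∀ ε > 0, ∃ v : L.domain, E.energy (u - ⟨v, hdom v.2⟩) < ε) :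
    E.generatorGraph = friedrichsGraph L := by
  have hq : ∀ u v : L.domain, -⟪L (u - v), ((u - v : L.domain) : H)⟫ =
      E.form (⟨u, hdom u.2⟩ - ⟨v, hdom v.2⟩) (⟨u, hdom u.2⟩ - ⟨v, hdom v.2⟩) := fun u v => by
    have := hL (u - v) ⟨(u - v : L.domain), hdom (u - v).2⟩
    rw [← this]; rfl
  ext ⟨x, f⟩
  constructor
  · rintro ⟨hx, hxf⟩
    simp only at hx hxf
    choose u hu using fun n : ℕ => hcore ⟨x, hx⟩ (1 / ((n : ℝ) + 1)) (by positivity)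
    have hlim : Tendsto (fun n => E.energy (⟨x, hx⟩ - ⟨u n, hdom (u n).2⟩)) atTop (𝓝 0) :=
      squeeze_zero (fun n => E.energy_nonneg _) (fun n => (hu n).le)
        tendsto_one_div_add_atTop_nhds_zero_nat
    have hs : Tendsto (fun n => √(E.energy (⟨x, hx⟩ - ⟨u n, hdom (u n).2⟩))) atTop (𝓝 0) := by
      simpa [Function.comp_def] using (Real.continuous_sqrt.tendsto 0).comp hlim
    refine ⟨⟨u, ?_, fun ε hε => ?_⟩, fun v => ?_⟩
    · rw [tendsto_iff_norm_sub_tendsto_zero]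
      refine squeeze_zero (fun _ => norm_nonneg _) (fun n => ?_) hs
      rw [norm_sub_rev]
      exact E.norm_le_sqrt_energy (⟨x, hx⟩ - ⟨u n, hdom (u n).2⟩)
    · obtain ⟨N, hN⟩ := eventually_atTop.1 (hlim.eventually (gt_mem_nhds (show 0 < ε / 4 by linarith)))
      refine ⟨N, fun i hi j hj => ?_⟩
      rw [hq]
      set a := (⟨x, hx⟩ : E.dom) - ⟨u i, hdom (u i).2⟩
      set b := (⟨x, hx⟩ : E.dom) - ⟨u j, hdom (u j).2⟩
      have hab : (⟨u i, hdom (u i).2⟩ : E.dom) - ⟨u j, hdom (u j).2⟩ = b - a := by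
        simp only [a, b]; abel
      -- This amounts to `E(b - a, b - a) ≤ 2 E(a, a) + 2 E(b, b)`.
      have h1 := E.nonneg (a + b)
      have h2 : E.form a a < ε / 4 := lt_of_le_of_lt (le_add_of_nonneg_right (by positivity)) (hN i hi)
      have h3 : E.form b b < ε / 4 := lt_of_le_of_lt (le_add_of_nonneg_right (by positivity)) (hN j hj)
      rw [hab]
      simp only [map_add, map_sub, LinearMap.add_apply, LinearMap.sub_apply] at h1 ⊢
      linarith
    · have := hL v ⟨x, hx⟩
      rw [E.symm, hxf] at this
      simp only at this
      rw [real_inner_comm]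
      linarith
  · rintro ⟨⟨u, hu, hc⟩, hv⟩
    simp only at hu hv
    have hcx : CauchySeq fun n => (u n : H) := hu.cauchySeq
    obtain ⟨w, hw⟩ := hE (fun n => ⟨u n, hdom (u n).2⟩) fun ε hε => by
      obtain ⟨N, hN⟩ := hc (ε / 2) (by linarith)
      obtain ⟨M, hM⟩ := Metric.cauchySeq_iff.1 hcx (√(ε / 2)) (Real.sqrt_pos.2 (by linarith))
      refine ⟨max N M, fun p hp q hq' => ?_⟩
      have a1 := hN p (le_of_max_le_left hp) q (le_of_max_le_left hq')
      have a2 := hM p (le_of_max_le_right hp) q (le_of_max_le_right hq')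
      rw [dist_eq_norm, Real.lt_sqrt (norm_nonneg _)] at a2
      rw [hq] at a1
      have : E.energy (⟨u p, hdom (u p).2⟩ - ⟨u q, hdom (u q).2⟩) =
        E.form (⟨u p, hdom (u p).2⟩ - ⟨u q, hdom (u q).2⟩)
          (⟨u p, hdom (u p).2⟩ - ⟨u q, hdom (u q).2⟩) + ‖(u p : H) - u q‖ ^ 2 := rfl
      rw [this]; linarith
    have hs : Tendsto (fun n => √(E.energy (⟨u n, hdom (u n).2⟩ - w))) atTop (𝓝 0) := by
      simpa [Function.comp_def] using (Real.continuous_sqrt.tendsto 0).comp hw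
    have hwx : (w : H) = x := by
      refine tendsto_nhds_unique (f := fun n => (u n : H)) (l := atTop) ?_ hu
      rw [tendsto_iff_norm_sub_tendsto_zero]
      exact squeeze_zero (fun _ => norm_nonneg _)
        (fun n => E.norm_le_sqrt_energy (⟨u n, hdom (u n).2⟩ - w)) hs
    subst hwx
    refine ⟨w.2, fun v => ?_⟩
    choose z hz using fun n : ℕ => hcore v (1 / ((n : ℝ) + 1)) (by positivity)
    have hlim : Tendsto (fun n => E.energy (v - ⟨z n, hdom (z n).2⟩)) atTop (𝓝 0) :=
      squeeze_zero (fun n => E.energy_nonneg _) (fun n => (hz n).le)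
        tendsto_one_div_add_atTop_nhds_zero_nat
    have hs' : Tendsto (fun n => √(E.energy (v - ⟨z n, hdom (z n).2⟩))) atTop (𝓝 0) := by
      simpa [Function.comp_def] using (Real.continuous_sqrt.tendsto 0).comp hlim
    -- The sum `E(w, ·) + ⟪f, ·⟫` vanishes on `Dom(L)`, so `v` may be replaced by its distance to
    -- the approximants `z n`.
    have e : ∀ n, E.form w v + ⟪f, (v : H)⟫ =
        E.form w (v - ⟨z n, hdom (z n).2⟩) + ⟪f, ((v - ⟨z n, hdom (z n).2⟩ : E.dom) : H)⟫ := by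
      intro n
      have h1 := hL (z n) w
      have h2 := hv (z n)
      rw [E.symm, real_inner_comm, h2] at h1
      rw [map_sub, h1, Submodule.coe_sub, inner_sub_right]
      ring
    have hzero : |E.form w v + ⟪f, (v : H)⟫| ≤ 0 := by
      have hT : Tendsto (fun n => (√(E.energy w) + ‖f‖) * √(E.energy (v - ⟨z n, hdom (z n).2⟩)))
          atTop (𝓝 0) := by simpa using hs'.const_mul (√(E.energy w) + ‖f‖)
      refine ge_of_tendsto' hT fun n => ?_
      rw [e n, add_mul]
      refine (abs_add_le _ _).trans (add_le_add (E.abs_form_le _ _) ?_)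
      exact (abs_real_inner_le_norm _ _).trans
        (mul_le_mul_of_nonneg_left (E.norm_le_sqrt_energy _) (norm_nonneg _))
    have := abs_nonpos_iff.1 hzero
    change E.form w v = _
    linarith

theorem SymmForm.isNonposSymmetric (hdom : L.domain ≤ E.dom)
    (hL : ∀ (u : L.domain) (v : E.dom), E.form ⟨u, hdom u.2⟩ v = -⟪L u, (v : H)⟫)
    (hcore : ∀ u : E.dom, ∀ ε > 0, ∃ v : L.domain, E.energy (u - ⟨v, hdom v.2⟩) < ε)
    (hdense : Dense (E.dom : Set H)) : IsNonposSymmetric L where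
  dense := by
    refine Metric.dense_iff.2 fun x ε hε => ?_
    obtain ⟨u, hu, hud⟩ := Metric.dense_iff.1 hdense x (ε / 2) (by linarith)
    obtain ⟨v, hv⟩ := hcore ⟨u, hud⟩ ((ε / 2) ^ 2) (by positivity)
    refine ⟨v, ?_, v.2⟩
    have h1 := E.norm_le_sqrt_energy (⟨u, hud⟩ - ⟨v, hdom v.2⟩)
    have h2 : √(E.energy (⟨u, hud⟩ - ⟨v, hdom v.2⟩)) < ε / 2 := by
      rw [Real.sqrt_lt' (by linarith)]; exact hv
    rw [Metric.mem_ball, dist_comm] at hu ⊢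
    have h3 : ‖u - (v : H)‖ < ε / 2 := lt_of_le_of_lt h1 h2
    calc dist x (v : H) ≤ dist x u + dist u v := dist_triangle _ _ _
      _ < ε / 2 + ε / 2 := add_lt_add hu (by rwa [dist_eq_norm])
      _ = ε := by ring
  symm u v := by
    have h1 := hL u ⟨v, hdom v.2⟩
    have h2 := hL v ⟨u, hdom u.2⟩
    rw [E.symm, h1] at h2
    simp only at h2
    rw [real_inner_comm (L v)]
    linarith
  nonpos u := by
    have h1 := hL u ⟨u, hdom u.2⟩
    have h2 := E.nonneg ⟨u, hdom u.2⟩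
    rw [h1] at h2
    simp only at h2
    linarith

end Friedrichs

/-! ### Recurrence -/

section Recurrence

variable {X : Type*} [MeasurableSpace X] {m : Measure X}

theorem inner_L2_eq (u v : Lp ℝ 2 m) : ⟪u, v⟫ = ∫ x, u x * v x ∂m := by
  rw [L2.inner_def]
  exact integral_congr_ae (Eventually.of_forall fun x => by simp [mul_comm])

theorem inner_L2_congr {u v : Lp ℝ 2 m} {f h : X → ℝ} (hu : u =ᵐ[m] f) (hv : v =ᵐ[m] h) :
    ⟪u, v⟫ = ∫ x, f x * h x ∂m := by
  rw [inner_L2_eq]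
  refine integral_congr_ae ?_
  filter_upwards [hu, hv] with x h1 h2
  rw [h1, h2]

theorem integrable_L2_mul (u v : Lp ℝ 2 m) : Integrable (fun x => u x * v x) m :=
  (Lp.memLp u).integrable_mul (Lp.memLp v)

variable {K : Type*} [NormedAddCommGroup K] [InnerProductSpace ℝ K]

/-- The absolute value operates on the domain of `T`, and `T` annihilates constants. -/
structure IsMarkovGradient (T : Lp ℝ 2 m →ₗ.[ℝ] K) : Prop where
  abs : ∀ u : T.domain, ∃ v : T.domain,
    ((v : Lp ℝ 2 m) =ᵐ[m] fun x => |(u : Lp ℝ 2 m) x|) ∧ ‖T v‖ ≤ ‖T u‖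
  one : ∃ e : T.domain, ((e : Lp ℝ 2 m) =ᵐ[m] fun _ => 1) ∧ T e = 0

namespace IsMarkovGradient

variable {T : Lp ℝ 2 m →ₗ.[ℝ] K}

/-- The positive part is `(u + |u|) / 2`. The last inequality is Cauchy–Schwarz together with `‖T
|u|‖ ≤ ‖T u‖`. -/
theorem posPart (hT : IsMarkovGradient T) (u : T.domain) : ∃ v : T.domain,
    ((v : Lp ℝ 2 m) =ᵐ[m] fun x => max ((u : Lp ℝ 2 m) x) 0) ∧ ‖T v‖ ≤ ‖T u‖ ∧
      0 ≤ ⟪T u, T v⟫ := by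
  obtain ⟨w, hw, hle⟩ := hT.abs u
  refine ⟨(1 / 2 : ℝ) • (u + w), ?_, ?_, ?_⟩
  · rw [Submodule.coe_smul, Submodule.coe_add]
    filter_upwards [hw, Lp.coeFn_smul (1 / 2 : ℝ) ((u : Lp ℝ 2 m) + (w : Lp ℝ 2 m)),
      Lp.coeFn_add (u : Lp ℝ 2 m) (w : Lp ℝ 2 m)] with x h1 h2 h3
    rw [h2, Pi.smul_apply, h3, Pi.add_apply, h1, smul_eq_mul]
    rcases le_total ((u : Lp ℝ 2 m) x) 0 with h | h
    · rw [max_eq_right h, abs_of_nonpos h]; ring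
    · rw [max_eq_left h, abs_of_nonneg h]; ring
  · rw [LinearPMap.map_smul, LinearPMap.map_add, norm_smul]
    have := norm_add_le (T u) (T w)
    norm_num
    linarith
  · rw [LinearPMap.map_smul, LinearPMap.map_add, real_inner_smul_right, inner_add_right,
      real_inner_self_eq_norm_sq]
    have h1 := abs_real_inner_le_norm (T u) (T w)
    have h2 := neg_abs_le ⟪T u, T w⟫
    nlinarith [norm_nonneg (T u), norm_nonneg (T w)]

/-- With `T 1 = 0`, two applications of `posPart` suffice: the contraction is `1 - (1 - u⁺)⁺`. -/
theorem unitContraction (hT : IsMarkovGradient T) (u : T.domain) : ∃ v : T.domain,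
    ((v : Lp ℝ 2 m) =ᵐ[m] fun x => min (max 0 ((u : Lp ℝ 2 m) x)) 1) ∧ ‖T v‖ ≤ ‖T u‖ := by
  obtain ⟨e, he, hTe⟩ := hT.one
  obtain ⟨p, hp, hpT, -⟩ := hT.posPart u
  obtain ⟨q, hq, hqT, -⟩ := hT.posPart (e - p)
  refine ⟨e - q, ?_, ?_⟩
  · rw [Submodule.coe_sub] at hq ⊢
    filter_upwards [he, hp, hq, Lp.coeFn_sub (e : Lp ℝ 2 m) (q : Lp ℝ 2 m),
      Lp.coeFn_sub (e : Lp ℝ 2 m) (p : Lp ℝ 2 m)] with x h1 h2 h3 h4 h5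
    rw [h4, Pi.sub_apply, h3, h5, Pi.sub_apply, h1, h2, max_comm 0]
    rcases le_total (max ((u : Lp ℝ 2 m) x) 0) 1 with h | h
    · rw [min_eq_left h, max_eq_left (by linarith)]; ring
    · rw [min_eq_right h, max_eq_right (by linarith)]; ring
  · rw [LinearPMap.map_sub, hTe, zero_sub, norm_neg]
    rw [LinearPMap.map_sub, hTe, zero_sub, norm_neg] at hqT
    exact hqT.trans hpT

/-- Weak maximum principle: test with `w⁺`, for which `⟪w, w⁺⟫ = ‖w⁺‖²` and `⟪T w, T w⁺⟫ ≥ 0`. -/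
theorem le_zero_of_subsolution (hT : IsMarkovGradient T) {w : T.domain} {a : ℝ} (ha : 0 < a)
    (h : ∀ v : T.domain, (∀ᵐ x ∂m, 0 ≤ (v : Lp ℝ 2 m) x) →
      ⟪T w, T v⟫ + a * ⟪(w : Lp ℝ 2 m), (v : Lp ℝ 2 m)⟫ ≤ 0) :
    ∀ᵐ x ∂m, (w : Lp ℝ 2 m) x ≤ 0 := by
  obtain ⟨v, hv, -, hv0⟩ := hT.posPart w
  have h1 := h v (by filter_upwards [hv] with x hx; rw [hx]; exact le_max_right _ _)
  have h2 : ⟪(w : Lp ℝ 2 m), (v : Lp ℝ 2 m)⟫ = ‖(v : Lp ℝ 2 m)‖ ^ 2 := by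
    rw [← real_inner_self_eq_norm_sq, inner_L2_eq, inner_L2_eq]
    refine integral_congr_ae ?_
    filter_upwards [hv] with x hx
    rw [hx]
    rcases le_total ((w : Lp ℝ 2 m) x) 0 with h | h
    · rw [max_eq_right h]; ring
    · rw [max_eq_left h]
  have h3 : ‖(v : Lp ℝ 2 m)‖ = 0 := by
    rw [h2] at h1
    have : a * ‖(v : Lp ℝ 2 m)‖ ^ 2 = 0 := le_antisymm (by linarith) (by positivity)
    simpa [ha.ne'] using this
  have h4 : (v : Lp ℝ 2 m) =ᵐ[m] 0 := by
    rw [norm_eq_zero.1 h3]; exact Lp.coeFn_zero _ _ _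
  filter_upwards [hv, h4] with x h5 h6
  rw [h5] at h6
  exact (le_max_left _ _).trans h6.le

variable {f : Lp ℝ 2 m} {u : ℕ → T.domain}

/-- Weak limits of the sequence `a_n G_{a_n} f` along ultrafilters. -/
theorem exists_weak_limit_resolvent [CompleteSpace K] (hT : T.IsClosed)
    (hu : ∀ (n : ℕ) (v : T.domain), ⟪T (u n), T v⟫ +
      (1 / ((n : ℝ) + 1)) * ⟪(u n : Lp ℝ 2 m), (v : Lp ℝ 2 m)⟫ = ⟪f, (v : Lp ℝ 2 m)⟫)
    (𝒰 : Ultrafilter ℕ) (h𝒰 : (𝒰 : Filter ℕ) ≤ atTop) :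
    ∃ z : T.domain, T z = 0 ∧
      (∀ w, Tendsto (fun n : ℕ => ⟪(1 / ((n : ℝ) + 1)) • (u n : Lp ℝ 2 m), w⟫) 𝒰
        (𝓝 ⟪(z : Lp ℝ 2 m), w⟫)) ∧
      ∀ v : T.domain, T v = 0 → ⟪(z : Lp ℝ 2 m), (v : Lp ℝ 2 m)⟫ = ⟪f, (v : Lp ℝ 2 m)⟫ := by
  set a : ℕ → ℝ := fun n => 1 / ((n : ℝ) + 1) with ha
  have ha0 : ∀ n, 0 < a n := fun n => by positivity
  have halim : Tendsto a atTop (𝓝 0) := tendsto_one_div_add_atTop_nhds_zero_nat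
  let h : ℕ → T.domain := fun n => a n • u n
  have hcoe : ∀ n, ((h n : T.domain) : Lp ℝ 2 m) = a n • (u n : Lp ℝ 2 m) := fun n => rfl
  -- Testing the resolvent equation with `h n` bounds `‖h n‖` by `‖f‖` and `‖T (h n)‖²` by a
  -- multiple of `a n`; weak limits therefore lie in the kernel of `T`.
  have hself : ∀ n, ‖T (h n)‖ ^ 2 + a n * ‖(h n : Lp ℝ 2 m)‖ ^ 2 = a n * ⟪f, (h n : Lp ℝ 2 m)⟫ := by
    intro n
    have := hu n (h n)
    have e1 : T (h n) = a n • T (u n) := LinearPMap.map_smul _ _ _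
    rw [← real_inner_self_eq_norm_sq, ← real_inner_self_eq_norm_sq, ← this, hcoe, e1,
      real_inner_smul_left, real_inner_smul_left]
    simp only [ha]
    ring
  have hnorm : ∀ n, ‖(h n : Lp ℝ 2 m)‖ ≤ ‖f‖ := fun n => by
    have h1 := hself n
    have h2 := real_inner_le_norm f (h n : Lp ℝ 2 m)
    have h3 : a n * ‖(h n : Lp ℝ 2 m)‖ ^ 2 ≤ a n * (‖f‖ * ‖(h n : Lp ℝ 2 m)‖) :=
      le_trans (by nlinarith [sq_nonneg ‖T (h n)‖]) (mul_le_mul_of_nonneg_left h2 (ha0 n).le)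
    have h4 := le_of_mul_le_mul_left h3 (ha0 n)
    rcases eq_or_lt_of_le (norm_nonneg (h n : Lp ℝ 2 m)) with h5 | h5
    · rw [← h5]; exact norm_nonneg _
    · rw [sq] at h4; exact le_of_mul_le_mul_right h4 h5
  have hTlim : Tendsto (fun n => T (h n)) atTop (𝓝 0) := by
    refine tendsto_norm_of_sq ?_
    refine squeeze_zero (g := fun n => a n * (‖f‖ * ‖f‖)) (fun n => by positivity) (fun n => ?_)
      (by simpa using halim.mul_const (‖f‖ * ‖f‖))
    have h1 := hself n
    have h2 := (real_inner_le_norm f (h n : Lp ℝ 2 m)).trans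
      (mul_le_mul_of_nonneg_left (hnorm n) (norm_nonneg f))
    have h3 := mul_le_mul_of_nonneg_left h2 (ha0 n).le
    have h4 : 0 ≤ a n * ‖(h n : Lp ℝ 2 m)‖ ^ 2 := mul_nonneg (ha0 n).le (by positivity)
    linarith
  obtain ⟨z, hz⟩ := exists_weak_limit 𝒰 hnorm
  have hmem : (z, (0 : K)) ∈ T.graph := mem_of_weak_limit hT (fun n => T.mem_graph (h n)) hz
    (tendsto_inner_of_tendsto (hTlim.mono_left h𝒰))
  obtain ⟨z', hz1, hz2⟩ := T.mem_graph_iff.1 hmem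
  simp only at hz1 hz2
  subst hz1
  refine ⟨z', hz2, hz, fun v hv => ?_⟩
  refine tendsto_nhds_unique (hz v) (tendsto_const_nhds.congr fun n => ?_)
  have := hu n v
  rw [hv, inner_zero_right, zero_add] at this
  rw [← this, hcoe, real_inner_smul_left]

/-- A mean ergodic argument: `a_n u_n` converges in `L²` to the projection `h` of `f` onto the
kernel of `T`. Where `h > 0`, division by `a_n → 0` sends a subsequence of `u_n` to infinity, and
monotonicity in `n` sends the whole sequence there. Where `h = 0`, testing with the kernel elements
`1 - (k h ∧ 1)` shows that every `u_n` vanishes. -/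
theorem isRecurrent [CompleteSpace K] (hM : IsMarkovGradient T) (hT : T.IsClosed) :
    IsRecurrent (formOf T) := by
  intro f hf _ u hu
  change ℕ → T.domain at u
  have hu' : ∀ (n : ℕ) (v : T.domain), ⟪T (u n), T v⟫ +
      (1 / ((n : ℝ) + 1)) * ⟪(u n : Lp ℝ 2 m), (v : Lp ℝ 2 m)⟫ = ⟪f, (v : Lp ℝ 2 m)⟫ := hu
  set a : ℕ → ℝ := fun n => 1 / ((n : ℝ) + 1) with ha
  have ha0 : ∀ n, 0 < a n := fun n => by positivity
  have halim : Tendsto a atTop (𝓝 0) := tendsto_one_div_add_atTop_nhds_zero_nat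
  have hfv : ∀ v : T.domain, (∀ᵐ x ∂m, 0 ≤ (v : Lp ℝ 2 m) x) → 0 ≤ ⟪f, (v : Lp ℝ 2 m)⟫ := by
    intro v hv
    rw [inner_L2_eq]
    refine integral_nonneg_of_ae ?_
    filter_upwards [hf, hv] with x h1 h2 using mul_nonneg h1 h2
  have hpos : ∀ n, ∀ᵐ x ∂m, 0 ≤ (u n : Lp ℝ 2 m) x := by
    intro n
    have := hM.le_zero_of_subsolution (w := -u n) (ha0 n) fun v hv => by
      have h1 := hu' n v
      have h2 := hfv v hv
      rw [LinearPMap.map_neg, Submodule.coe_neg, inner_neg_left, inner_neg_left]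
      linarith
    filter_upwards [this, Lp.coeFn_neg (u n : Lp ℝ 2 m)] with x h1 h2
    rw [Submodule.coe_neg, h2, Pi.neg_apply] at h1
    linarith
  -- Since `a` decreases and `u (n + 1) ≥ 0`, the difference is a subsolution at level `a n`.
  have hmono : ∀ n, ∀ᵐ x ∂m, (u n : Lp ℝ 2 m) x ≤ (u (n + 1) : Lp ℝ 2 m) x := by
    intro n
    have := hM.le_zero_of_subsolution (w := u n - u (n + 1)) (ha0 n) fun v hv => by
      have h1 := hu' n v
      have h2 := hu' (n + 1) v
      have h3 : a (n + 1) ≤ a n := by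
        simp only [ha]
        push_cast
        gcongr
        linarith
      have h4 : 0 ≤ ⟪(u (n + 1) : Lp ℝ 2 m), (v : Lp ℝ 2 m)⟫ := by
        rw [inner_L2_eq]
        refine integral_nonneg_of_ae ?_
        filter_upwards [hpos (n + 1), hv] with x h1 h2 using mul_nonneg h1 h2
      have h5 : ⟪T (u n), T v⟫ + a n * ⟪(u n : Lp ℝ 2 m), (v : Lp ℝ 2 m)⟫ =
          ⟪f, (v : Lp ℝ 2 m)⟫ := h1
      have h6 : ⟪T (u (n + 1)), T v⟫ + a (n + 1) * ⟪(u (n + 1) : Lp ℝ 2 m), (v : Lp ℝ 2 m)⟫ =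
          ⟪f, (v : Lp ℝ 2 m)⟫ := h2
      rw [LinearPMap.map_sub, Submodule.coe_sub, inner_sub_left, inner_sub_left]
      nlinarith
    filter_upwards [this, Lp.coeFn_sub (u n : Lp ℝ 2 m) (u (n + 1) : Lp ℝ 2 m)] with x h1 h2
    rw [Submodule.coe_sub, h2, Pi.sub_apply] at h1
    linarith
  obtain ⟨h, hTh, -, hh⟩ := exists_weak_limit_resolvent hT hu' (hyperfilter ℕ)
    Nat.hyperfilter_le_atTop
  have hstrong : Tendsto (fun n => a n • (u n : Lp ℝ 2 m)) atTop (𝓝 (h : Lp ℝ 2 m)) := by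
    rw [tendsto_iff_ultrafilter]
    intro 𝒰 h𝒰
    obtain ⟨z, hTz, hz, hzv⟩ := exists_weak_limit_resolvent hT hu' 𝒰 h𝒰
    have hzh : (z : Lp ℝ 2 m) = h := by
      have hk : T (z - h) = 0 := by rw [LinearPMap.map_sub, hTz, hTh, sub_zero]
      have h1 := hzv _ hk
      have h2 := hh _ hk
      have h3 : ⟪(z : Lp ℝ 2 m) - h, (z : Lp ℝ 2 m) - h⟫ = (0 : ℝ) := by
        conv_lhs => rw [inner_sub_left]
        rw [Submodule.coe_sub] at h1 h2
        rw [h1, h2, sub_self]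
      exact sub_eq_zero.1 (inner_self_eq_zero.1 h3)
    rw [hzh] at hz
    -- The right hand side tends to `⟪h, f⟫ = ‖h‖²` along the ultrafilter, which upgrades weak to
    -- strong convergence.
    have hle : ∀ n, ‖a n • (u n : Lp ℝ 2 m)‖ ^ 2 ≤ ⟪a n • (u n : Lp ℝ 2 m), f⟫ := fun n => by
      have h1 := hu' n (u n)
      have h2 : 0 ≤ ⟪T (u n), T (u n)⟫ := real_inner_self_nonneg
      rw [norm_smul, mul_pow, Real.norm_eq_abs, sq_abs, real_inner_smul_left,
        real_inner_comm f, ← real_inner_self_eq_norm_sq, sq, mul_assoc]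
      refine mul_le_mul_of_nonneg_left ?_ (ha0 n).le
      change a n * _ ≤ _
      have h3 : ⟪T (u n), T (u n)⟫ + a n * ⟪(u n : Lp ℝ 2 m), (u n : Lp ℝ 2 m)⟫ =
          ⟪f, (u n : Lp ℝ 2 m)⟫ := h1
      linarith
    rw [tendsto_iff_norm_sub_tendsto_zero]
    have hsq : Tendsto (fun n => a n • (u n : Lp ℝ 2 m) - (h : Lp ℝ 2 m)) 𝒰 (𝓝 0) := by
      refine tendsto_norm_of_sq (squeeze_zero (fun n => by positivity) (g := fun n =>
        ⟪a n • (u n : Lp ℝ 2 m), f⟫ - 2 * ⟪a n • (u n : Lp ℝ 2 m), (h : Lp ℝ 2 m)⟫ +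
          ‖(h : Lp ℝ 2 m)‖ ^ 2) (fun n => ?_) ?_)
      · rw [norm_sub_sq_real]
        linarith [hle n]
      · have := ((hz f).sub ((hz h).const_mul 2)).add_const (‖(h : Lp ℝ 2 m)‖ ^ 2)
        have e := hh h hTh
        rw [real_inner_self_eq_norm_sq] at e this
        rw [real_inner_comm, ← e] at this
        convert this using 2
        ring
    exact tendsto_zero_iff_norm_tendsto_zero.1 hsq
  obtain ⟨ns, hns, hae⟩ : ∃ ns : ℕ → ℕ, StrictMono ns ∧ ∀ᵐ x ∂m,
      Tendsto (fun i => (a (ns i) • (u (ns i) : Lp ℝ 2 m) : Lp ℝ 2 m) x) atTop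
        (𝓝 ((h : Lp ℝ 2 m) x)) :=
    (tendstoInMeasure_of_tendsto_Lp hstrong).exists_seq_tendsto_ae
  have hsm : ∀ᵐ x ∂m, ∀ n, (a n • (u n : Lp ℝ 2 m) : Lp ℝ 2 m) x = a n * (u n : Lp ℝ 2 m) x := by
    rw [ae_all_iff]
    intro n
    filter_upwards [Lp.coeFn_smul (a n) (u n : Lp ℝ 2 m)] with x hx
    rw [hx, Pi.smul_apply, smul_eq_mul]
  have hall : ∀ᵐ x ∂m, ∀ n, 0 ≤ (u n : Lp ℝ 2 m) x := ae_all_iff.2 hpos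
  have hh0 : ∀ᵐ x ∂m, 0 ≤ (h : Lp ℝ 2 m) x := by
    filter_upwards [hae, hsm, hall] with x h1 h2 h3
    refine ge_of_tendsto' h1 fun i => ?_
    rw [h2]
    exact mul_nonneg (ha0 _).le (h3 _)
  have hoff : ∀ n, ∀ᵐ x ∂m, (h : Lp ℝ 2 m) x = 0 → (u n : Lp ℝ 2 m) x = 0 := by
    intro n
    obtain ⟨e, he, hTe⟩ := hM.one
    have hsum : Integrable (fun x => (u n : Lp ℝ 2 m) x) m := by
      refine (integrable_L2_mul (u n : Lp ℝ 2 m) e).congr ?_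
      filter_upwards [he] with x hx
      rw [hx, mul_one]
    -- The kernel element `e - v = 1 - ((k + 1) h ∧ 1)` dominates the indicator of `{h = 0}`, while
    -- its product with `h` is at most `1 / (k + 1)`.
    have hle : ∀ k : ℕ, a n * ∫ x, indicator {x | (h : Lp ℝ 2 m) x = 0}
        (fun x => (u n : Lp ℝ 2 m) x) x ∂m ≤ 1 / ((k : ℝ) + 1) * ‖(e : Lp ℝ 2 m)‖ ^ 2 := by
      intro k
      obtain ⟨v, hv, hvT⟩ := hM.unitContraction (((k : ℝ) + 1) • h)
      have hTv : T v = 0 := by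
        rw [LinearPMap.map_smul, hTh, smul_zero, norm_zero] at hvT
        exact norm_le_zero_iff.1 hvT
      have hT0 : T (e - v) = 0 := by rw [LinearPMap.map_sub, hTe, hTv, sub_zero]
      have h1 := hu' n (e - v)
      have h2 := hh _ hT0
      rw [hT0, inner_zero_right, zero_add, ← h2, Submodule.coe_sub] at h1
      have hev : ((e : Lp ℝ 2 m) - v : Lp ℝ 2 m) =ᵐ[m]
          fun x => 1 - min (max 0 (((k : ℝ) + 1) * (h : Lp ℝ 2 m) x)) 1 := by
        filter_upwards [Lp.coeFn_sub (e : Lp ℝ 2 m) (v : Lp ℝ 2 m), he, hv,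
          Lp.coeFn_smul ((k : ℝ) + 1) (h : Lp ℝ 2 m)] with x a1 a2 a3 a4
        rw [a1, Pi.sub_apply, a2, a3, Submodule.coe_smul, a4]
        rfl
      calc a n * ∫ x, indicator {x | (h : Lp ℝ 2 m) x = 0} (fun x => (u n : Lp ℝ 2 m) x) x ∂m
          ≤ a n * ⟪(u n : Lp ℝ 2 m), (e : Lp ℝ 2 m) - v⟫ := by
            refine mul_le_mul_of_nonneg_left ?_ (ha0 n).le
            rw [inner_L2_eq]
            refine integral_mono_ae ?_ (integrable_L2_mul _ _) ?_
            · refine hsum.indicator₀ ?_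
              exact nullMeasurableSet_eq_fun (Lp.aestronglyMeasurable _).aemeasurable
                aemeasurable_const
            · filter_upwards [hev, hall] with x a1 a2
              simp only [a1, indicator_apply, mem_ofPred_eq]
              split_ifs with hx
              · rw [hx]; simp
              · exact mul_nonneg (a2 n) (sub_nonneg.2 (min_le_right _ _))
        _ = ⟪(h : Lp ℝ 2 m), (e : Lp ℝ 2 m) - v⟫ := h1
        _ ≤ ∫ x, 1 / ((k : ℝ) + 1) * ((e : Lp ℝ 2 m) x * (e : Lp ℝ 2 m) x) ∂m := by
            rw [inner_L2_eq]
            refine integral_mono_ae (integrable_L2_mul _ _)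
              ((integrable_L2_mul _ _).const_mul _) ?_
            filter_upwards [hev, hh0, he] with x a1 a2 a3
            have hk : (0 : ℝ) < (k : ℝ) + 1 := by positivity
            simp only [a1, a3, mul_one]
            rw [max_eq_right (by positivity)]
            rcases le_total (((k : ℝ) + 1) * (h : Lp ℝ 2 m) x) 1 with hx | hx
            · rw [min_eq_left hx, le_div_iff₀ hk]
              nlinarith [mul_nonneg hk.le a2]
            · rw [min_eq_right hx, sub_self, mul_zero]; positivity
        _ = 1 / ((k : ℝ) + 1) * ‖(e : Lp ℝ 2 m)‖ ^ 2 := by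
            rw [integral_const_mul, ← inner_L2_eq, real_inner_self_eq_norm_sq]
    have hnn : 0 ≤ᵐ[m] indicator {x | (h : Lp ℝ 2 m) x = 0} (fun x => (u n : Lp ℝ 2 m) x) := by
      filter_upwards [hall] with x hx
      exact indicator_nonneg (fun _ _ => hx n) x |>.trans_eq rfl
    have hint0 : ∫ x, indicator {x | (h : Lp ℝ 2 m) x = 0} (fun x => (u n : Lp ℝ 2 m) x) x ∂m = 0 := by
      refine le_antisymm ?_ (integral_nonneg_of_ae hnn)
      have hl : Tendsto (fun k : ℕ => 1 / ((k : ℝ) + 1) * ‖(e : Lp ℝ 2 m)‖ ^ 2) atTop (𝓝 0) := by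
        simpa [ha] using halim.mul_const (‖(e : Lp ℝ 2 m)‖ ^ 2)
      have := ge_of_tendsto' hl hle
      exact nonpos_of_mul_nonpos_right this (ha0 n)
    have hz := (integral_eq_zero_iff_of_nonneg_ae hnn (hsum.indicator₀
      (nullMeasurableSet_eq_fun (Lp.aestronglyMeasurable _).aemeasurable aemeasurable_const))).1 hint0
    filter_upwards [hz] with x hx h0
    simpa [indicator_apply, h0] using hx
  filter_upwards [hae, hsm, hh0, ae_all_iff.2 hoff, ae_all_iff.2 hmono] with x h1 h2 h3 h4 h5
  rcases eq_or_lt_of_le h3 with h6 | h6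
  · exact Or.inl fun n => h4 n h6.symm
  · right
    have hm : Monotone fun n => (u n : Lp ℝ 2 m) x := monotone_nat_of_le_succ h5
    refine tendsto_atTop_of_monotone_of_subseq hm (l := atTop) (φ := ns) ?_
    have hinv : Tendsto (fun i => (a (ns i))⁻¹) atTop atTop :=
      (tendsto_nhdsWithin_iff.2 ⟨halim.comp hns.tendsto_atTop,
        Eventually.of_forall fun i => ha0 _⟩).inv_tendsto_nhdsGT_zero
    refine (Tendsto.atTop_mul_pos h6 hinv h1).congr fun i => ?_
    simp only [Function.comp_def, h2]
    rw [inv_mul_cancel_left₀ (ha0 _).ne']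

end IsMarkovGradient

end Recurrence

/-! ### The gradient as an operator -/

/-- A continuous function is a bounded pointwise limit on `(0, 1)` of smooth functions vanishing
at the end points. -/
theorem exists_smooth_vanishing_approx {φ : ℝ → ℝ} (hφ : Continuous φ) :
    ∃ f : ℕ → ℝ → ℝ, (∀ n, ContDiff ℝ ∞ (f n)) ∧ (∀ n, f n 0 = 0) ∧ (∀ n, f n 1 = 0) ∧
      (∃ C, 0 ≤ C ∧ ∀ n, ∀ x ∈ Icc (0 : ℝ) 1, |f n x| ≤ C) ∧
      ∀ x ∈ Ioo (0 : ℝ) 1, Tendsto (fun n => f n x) atTop (𝓝 (φ x)) := by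
  choose p hp using fun n : ℕ => exists_polynomial_near_of_continuousOn 0 1 φ hφ.continuousOn
    (1 / ((n : ℝ) + 1)) (by positivity)
  -- A cut-off with values in `[0, 1]` on the unit interval: it vanishes at both end points and
  -- tends to `1` in between.
  let χ : ℕ → ℝ → ℝ := fun n x => (1 - (1 - x) ^ (n + 1)) * (1 - x ^ (n + 1))
  obtain ⟨C, hC0, hC⟩ := exists_bound_Icc hφ
  refine ⟨fun n x => (p n).eval x * χ n x, fun n => ?_, fun n => by simp [χ], fun n => by simp [χ],
    ⟨C + 1, by positivity, fun n x hx => ?_⟩, fun x hx => ?_⟩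
  · exact (by simpa using (p n).contDiff_aeval (𝕜 := ℝ) ∞ : ContDiff ℝ ∞ fun x => (p n).eval x).mul ((contDiff_const.sub ((contDiff_const.sub contDiff_id).pow _)).mul
      (contDiff_const.sub (contDiff_id.pow _)))
  · have h1 : |(p n).eval x| ≤ C + 1 := by
      have a1 := (hp n x hx).le
      have a2 : 1 / ((n : ℝ) + 1) ≤ 1 := by
        rw [div_le_one (by positivity)]; linarith [(Nat.cast_nonneg n : (0 : ℝ) ≤ n)]
      have a3 := abs_sub_abs_le_abs_sub ((p n).eval x) (φ x)
      linarith [hC x hx]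
    have b1 : (1 - x) ^ (n + 1) ≤ 1 := pow_le_one₀ (by linarith [hx.2]) (by linarith [hx.1])
    have b2 : 0 ≤ (1 - x) ^ (n + 1) := pow_nonneg (by linarith [hx.2]) _
    have b3 : x ^ (n + 1) ≤ 1 := pow_le_one₀ hx.1 hx.2
    have b4 : 0 ≤ x ^ (n + 1) := pow_nonneg hx.1 _
    have h2 : |χ n x| ≤ 1 := by
      rw [abs_of_nonneg (mul_nonneg (by linarith) (by linarith))]
      exact mul_le_one₀ (by linarith) (by linarith) (by linarith)
    rw [abs_mul]
    calc _ ≤ (C + 1) * 1 := mul_le_mul h1 h2 (abs_nonneg _) (by positivity)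
      _ = C + 1 := mul_one _
  · have h1 : Tendsto (fun n => (p n).eval x) atTop (𝓝 (φ x)) := by
      rw [tendsto_iff_dist_tendsto_zero]
      exact squeeze_zero (fun _ => dist_nonneg)
        (fun n => (hp n x (Ioo_subset_Icc_self hx)).le) tendsto_one_div_add_atTop_nhds_zero_nat
    have h2 : ∀ y : ℝ, 0 ≤ y → y < 1 → Tendsto (fun n : ℕ => 1 - y ^ (n + 1)) atTop (𝓝 1) := by
      intro y hy0 hy1
      have := ((tendsto_pow_atTop_nhds_zero_of_lt_one hy0 hy1).comp
        (tendsto_add_atTop_nat 1)).const_sub 1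
      simpa [Function.comp_def] using this
    have h3 := h1.mul ((h2 (1 - x) (by linarith [hx.2]) (by linarith [hx.1])).mul
      (h2 x hx.1.le hx.2))
    simpa using h3

section Operator

variable {β : ℝ} {Q : Measure G0}

/-- A grid time below `s` has a positive value and one above `s` a value less than `1`. Hence the
values of a field at the end points are irrelevant, and fields vanishing there approximate all
continuous ones. -/
theorem IsDirichletProcess.ae_apply_mem_Ioo (hQ : IsDirichletProcess β Q) :
    ∀ᵐ g ∂Q, ∀ s ∈ Ioo (0 : ℝ) 1, g s ∈ Ioo (0 : ℝ) 1 := by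
  filter_upwards [hQ.ae_mem_simplex] with g hg s hs
  obtain ⟨n, hn⟩ := exists_nat_one_div_lt (lt_min hs.1 (sub_pos.2 hs.2))
  have hpos : (0 : ℝ) < (n : ℝ) + 1 := by positivity
  have hlt : 1 / ((n : ℝ) + 2) < 1 / ((n : ℝ) + 1) :=
    one_div_lt_one_div_of_lt hpos (by linarith)
  have h0 := mem_Ioo_of_mem_simplex (hg (n + 1)) 0
  have h1 := mem_Ioo_of_mem_simplex (hg (n + 1)) (Fin.last n)
  constructor
  · refine h0.1.trans_le (g.monotone ?_)
    have : grid (n + 1) 0 = 1 / ((n : ℝ) + 2) := by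
      simp only [grid]; push_cast; norm_num; ring
    rw [this]
    linarith [min_le_left s (1 - s)]
  · refine lt_of_le_of_lt (g.monotone ?_) h1.2
    have : grid (n + 1) (Fin.last n) = 1 - 1 / ((n : ℝ) + 2) := by
      simp only [grid, Fin.val_last]; push_cast; field_simp; ring
    rw [this]
    linarith [min_le_right s (1 - s)]

theorem IsDirichletProcess.ae_prod_apply_mem_Ioo (hQ : IsDirichletProcess β Q) :
    ∀ᵐ z ∂(Q.prod leb), z.1 z.2 ∈ Ioo (0 : ℝ) 1 := by
  refine (Measure.ae_prod_mem_iff_ae_ae_mem (s := {z : G0 × ℝ | z.1 z.2 ∈ Ioo (0 : ℝ) 1})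
    (G0.measurable_eval measurableSet_Ioo)).2 ?_
  filter_upwards [hQ.ae_apply_mem_Ioo] with g hg
  filter_upwards [ae_mem_Ioo_leb] with s hs using hg s hs

variable [IsProbabilityMeasure Q]

theorem IsGrad.memLp {f : G0 → ℝ} {F : G0 × ℝ → ℝ} (hF : IsGrad f F) {p : ENNReal} :
    MemLp F p (Q.prod leb) := by
  obtain ⟨C, hC⟩ := hF.bdd
  exact MemLp.of_bound hF.meas.aestronglyMeasurable C (Eventually.of_forall hC)

variable (Q) in
/-- The class of a cylinder function. -/
def cylLp {f : G0 → ℝ} (hf : f ∈ cyl 1) : Lp ℝ 2 Q :=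
  (memLp_of_continuous (cyl_continuous hf)).toLp f

variable (Q) in
/-- The class of the gradient of a cylinder function. -/
def gradLp {f : G0 → ℝ} {F : G0 × ℝ → ℝ} (hF : IsGrad f F) : Lp ℝ 2 (Q.prod leb) :=
  hF.memLp.toLp F

theorem coeFn_cylLp {f : G0 → ℝ} (hf : f ∈ cyl 1) : cylLp Q hf =ᵐ[Q] f := MemLp.coeFn_toLp _

theorem coeFn_gradLp {f : G0 → ℝ} {F : G0 × ℝ → ℝ} (hF : IsGrad f F) :
    gradLp Q hF =ᵐ[Q.prod leb] F := MemLp.coeFn_toLp _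

theorem mem_gradGraph_iff {p : Lp ℝ 2 Q × Lp ℝ 2 (Q.prod leb)} : p ∈ gradGraph Q ↔
    ∃ (f : G0 → ℝ) (F : G0 × ℝ → ℝ) (hf : f ∈ cyl 1) (hF : IsGrad f F),
      p = (cylLp Q hf, gradLp Q hF) := by
  constructor
  · rintro ⟨f, hf, h1, h2⟩
    obtain ⟨F, hF⟩ := exists_isGrad hf
    refine ⟨f, F, hf, hF, Prod.ext (Lp.ext (h1.trans (coeFn_cylLp hf).symm)) (Lp.ext ?_)⟩
    refine EventuallyEq.trans ?_ (coeFn_gradLp hF).symm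
    refine (Measure.ae_prod_mem_iff_ae_ae_mem (s := {z | p.2 z = F z})
      (measurableSet_eq_fun (Lp.stronglyMeasurable p.2).measurable hF.meas)).2 ?_
    filter_upwards [h2] with g hg
    filter_upwards [hg, hF.ae_eq g] with s a1 a2
    exact a1.trans a2
  · rintro ⟨f, F, hf, hF, rfl⟩
    refine ⟨f, hf, coeFn_cylLp hf, ?_⟩
    filter_upwards [Measure.ae_ae_of_ae_prod (coeFn_gradLp (Q := Q) hF)] with g hg
    filter_upwards [hg, hF.ae_eq g] with s a1 a2
    exact a1.trans a2.symm

variable (Q) in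
/-- The graph of the gradient as a linear subspace. -/
def gradSubmodule : Submodule ℝ (Lp ℝ 2 Q × Lp ℝ 2 (Q.prod leb)) where
  carrier := gradGraph Q
  add_mem' := by
    intro a b ha hb
    obtain ⟨f, F, hf, hF, rfl⟩ := mem_gradGraph_iff.1 ha
    obtain ⟨h, H, hh, hH, rfl⟩ := mem_gradGraph_iff.1 hb
    exact mem_gradGraph_iff.2 ⟨f + h, F + H, cyl_add hf hh,
      hF.add (cyl_continuous hf) (cyl_continuous hh) hH, rfl⟩
  zero_mem' := by
    refine mem_gradGraph_iff.2 ⟨(0 : ℝ) • fun _ => 0, _, cyl_smul 0 (const_mem_cyl 0),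
      (exists_isGrad (const_mem_cyl 0)).choose_spec.smul 0 continuous_const, ?_⟩
    refine Prod.ext (Lp.ext ?_) (Lp.ext ?_)
    · filter_upwards [coeFn_cylLp (Q := Q) (cyl_smul 0 (const_mem_cyl 0)),
        Lp.coeFn_zero ℝ 2 Q] with x h1 h2
      refine h2.trans (Eq.trans ?_ h1.symm)
      simp
    · filter_upwards [coeFn_gradLp (Q := Q) ((exists_isGrad (const_mem_cyl 0)).choose_spec.smul 0
        continuous_const), Lp.coeFn_zero ℝ 2 (Q.prod leb)] with x h1 h2
      refine h2.trans (Eq.trans ?_ h1.symm)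
      simp
  smul_mem' := by
    intro c a ha
    obtain ⟨f, F, hf, hF, rfl⟩ := mem_gradGraph_iff.1 ha
    exact mem_gradGraph_iff.2 ⟨c • f, c • F, cyl_smul c hf, hF.smul c (cyl_continuous hf), rfl⟩

/-- Pairing of a gradient with an elementary tensor. -/
theorem integral_tensor {f v : G0 → ℝ} {F : G0 × ℝ → ℝ} {φ : ℝ → ℝ} (hF : IsGrad f F)
    (hv : Continuous v) (hφ : Continuous φ) :
    ∫ z, F z * (v z.1 * φ (z.1 z.2)) ∂(Q.prod leb) = ∫ g, v g * dirD φ F g ∂Q := by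
  obtain ⟨C, hC⟩ := hF.bdd
  obtain ⟨B, hB0, hB⟩ := exists_bound_of_continuous hv
  obtain ⟨K, hK0, hK⟩ := exists_bound_Icc hφ
  rw [integral_prod]
  · refine integral_congr_ae (Eventually.of_forall fun g => ?_)
    simp only [dirD]
    rw [← integral_const_mul]
    refine integral_congr_ae (Eventually.of_forall fun s => ?_)
    simp only; ring
  · refine Integrable.of_bound (hF.meas.mul ((hv.measurable.comp measurable_fst).mul
      (measurable_comp_eval hφ.measurable))).aestronglyMeasurable (C * (B * K))
      (Eventually.of_forall fun z => ?_)
    rw [norm_mul, norm_mul]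
    exact mul_le_mul (hC z) (mul_le_mul (hB _) (hK _ (z.1.apply_mem _)) (norm_nonneg _) hB0)
      (by positivity) ((abs_nonneg (F z)).trans (hC z))

theorem measurable_tensor {v : G0 → ℝ} {φ : ℝ → ℝ} (hv : Continuous v) (hφ : Continuous φ) :
    Measurable fun z : G0 × ℝ => v z.1 * φ (z.1 z.2) :=
  (hv.measurable.comp measurable_fst).mul (measurable_comp_eval hφ.measurable)

theorem memLp_tensor {v : G0 → ℝ} {φ : ℝ → ℝ} (hv : Continuous v) (hφ : Continuous φ) {p : ENNReal} :
    MemLp (fun z : G0 × ℝ => v z.1 * φ (z.1 z.2)) p (Q.prod leb) := by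
  obtain ⟨B, hB0, hB⟩ := exists_bound_of_continuous hv
  obtain ⟨K, hK0, hK⟩ := exists_bound_Icc hφ
  refine MemLp.of_bound (measurable_tensor hv hφ).aestronglyMeasurable (B * K)
    (Eventually.of_forall fun z => ?_)
  rw [norm_mul]
  exact mul_le_mul (hB _) (hK _ (z.1.apply_mem _)) (norm_nonneg _) hB0

/-- An element orthogonal to the elementary tensors with smooth vanishing second factor is
orthogonal to all elementary tensors. -/
theorem IsDirichletProcess.integral_tensor_eq_zero (hQ : IsDirichletProcess β Q)
    {y : G0 × ℝ → ℝ} (hy : Integrable y (Q.prod leb))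
    (h : ∀ v ∈ cyl 1, ∀ φ : ℝ → ℝ, ContDiff ℝ 3 φ → φ 0 = 0 → φ 1 = 0 →
      ∫ z, y z * (v z.1 * φ (z.1 z.2)) ∂(Q.prod leb) = 0)
    {v : G0 → ℝ} {φ : ℝ → ℝ} (hv : Continuous v) (hφ : Continuous φ) :
    ∫ z, y z * (v z.1 * φ (z.1 z.2)) ∂(Q.prod leb) = 0 := by
  choose w hw hwv using fun n : ℕ => exists_cyl_near hv (show 0 < 1 / ((n : ℝ) + 1) by positivity)
  obtain ⟨f, hf, hf0, hf1, ⟨C, hC0, hC⟩, hlim⟩ := exists_smooth_vanishing_approx hφ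
  obtain ⟨B, hB0, hB⟩ := exists_bound_of_continuous hv
  have hwB : ∀ n g, |w n g| ≤ B + 1 := fun n g => by
    have a1 := (hwv n g).le
    have a2 : 1 / ((n : ℝ) + 1) ≤ 1 := by
      rw [div_le_one (by positivity)]; linarith [(Nat.cast_nonneg n : (0 : ℝ) ≤ n)]
    have a3 := abs_sub_abs_le_abs_sub (w n g) (v g)
    rw [abs_sub_comm] at a3
    linarith [hB g]
  have hwlim : ∀ g, Tendsto (fun n => w n g) atTop (𝓝 (v g)) := fun g => by
    rw [tendsto_iff_dist_tendsto_zero]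
    refine squeeze_zero (fun _ => dist_nonneg) (fun n => ?_) tendsto_one_div_add_atTop_nhds_zero_nat
    rw [dist_comm]; exact (hwv n g).le
  have hT := tendsto_integral_of_dominated_convergence (μ := Q.prod leb)
    (F := fun n z => y z * (w n z.1 * f n (z.1 z.2))) (f := fun z => y z * (v z.1 * φ (z.1 z.2)))
    (fun z => |y z| * ((B + 1) * C)) (fun n => hy.aestronglyMeasurable.mul
      (measurable_tensor (cyl_continuous (hw n)) (hf n).continuous).aestronglyMeasurable)
    (hy.abs.mul_const _) (fun n => Eventually.of_forall fun z => ?_) ?_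
  · refine tendsto_nhds_unique hT (tendsto_const_nhds.congr fun n => ?_)
    exact (h _ (hw n) _ ((hf n).of_le (WithTop.coe_le_coe.2 (le_top (a := (3 : ℕ∞))))) (hf0 n)
      (hf1 n)).symm
  · rw [norm_mul, norm_mul]
    exact mul_le_mul_of_nonneg_left (mul_le_mul (hwB n _) (hC n _ (z.1.apply_mem _))
      (norm_nonneg _) (by positivity)) (norm_nonneg _)
  · filter_upwards [hQ.ae_prod_apply_mem_Ioo] with z hz
    exact ((hwlim _).mul (hlim _ hz)).const_mul _

/-- Let `f_n → 0` with gradients tending to `p.2`. Integration by parts moves the derivative from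
`f_n` to the tensor `v(g) φ(g_s)`, so `p.2` is orthogonal to these tensors when `φ(0) = φ(1) = 0`,
and by approximation to all of them. Gradients of cylinder functions are finite sums of tensors, so
`p.2` is orthogonal to its own approximating sequence. -/
theorem IsDirichletProcess.closure_gradSubmodule_fst_eq_zero (hβ : 0 < β)
    (hQ : IsDirichletProcess β Q) {p : Lp ℝ 2 Q × Lp ℝ 2 (Q.prod leb)}
    (hp : p ∈ (gradSubmodule Q).topologicalClosure) (h0 : p.1 = 0) : p.2 = 0 := by
  obtain ⟨x, hx, hxl⟩ := mem_closure_iff_seq_limit.1 hp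
  choose f F hf hF hxe using fun n => mem_gradGraph_iff.1 (hx n)
  have hl1 : Tendsto (fun n => cylLp Q (hf n)) atTop (𝓝 0) := by
    have := (continuous_fst.tendsto p).comp hxl
    rw [h0] at this
    exact this.congr fun n => by simp [hxe]
  have hl2 : Tendsto (fun n => gradLp Q (hF n)) atTop (𝓝 p.2) := by
    have := (continuous_snd.tendsto p).comp hxl
    exact this.congr fun n => by simp [hxe]
  have hinner : ∀ w : Lp ℝ 2 (Q.prod leb), Tendsto (fun n => ⟪gradLp Q (hF n), w⟫) atTop
      (𝓝 ⟪p.2, w⟫) := fun w => hl2.inner tendsto_const_nhds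
  have key : ∀ v ∈ cyl 1, ∀ φ : ℝ → ℝ, ContDiff ℝ 3 φ → φ 0 = 0 → φ 1 = 0 →
      ∫ z, p.2 z * (v z.1 * φ (z.1 z.2)) ∂(Q.prod leb) = 0 := by
    intro v hv φ hφ hφ0 hφ1
    have hvc := cyl_continuous hv
    obtain ⟨V, hV⟩ := exists_isGrad hv
    set w : Lp ℝ 2 (Q.prod leb) := (memLp_tensor (Q := Q) hvc hφ.continuous).toLp _ with hw
    have hwae : w =ᵐ[Q.prod leb] fun z => v z.1 * φ (z.1 z.2) := MemLp.coeFn_toLp _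
    set a : Lp ℝ 2 Q := (hQ.memLp_adjoint hφ hvc hV).toLp _ with ha
    have haae : a =ᵐ[Q] fun g => -dirD φ V g - v g * drift0 β φ g := MemLp.coeFn_toLp _
    rw [← inner_L2_congr (u := p.2) (Filter.EventuallyEq.refl _ _) hwae]
    refine tendsto_nhds_unique (hinner w) ?_
    have e : ∀ n, ⟪gradLp Q (hF n), w⟫ = ⟪cylLp Q (hf n), a⟫ := fun n => by
      rw [inner_L2_congr (coeFn_gradLp (hF n)) hwae, inner_L2_congr (coeFn_cylLp (hf n)) haae,
        integral_tensor (hF n) hvc hφ.continuous]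
      exact hQ.integral_mul_dirD hβ hφ hφ0 hφ1 (hf n) (hF n) hv hV
    simp only [e]
    simpa using hl1.inner (tendsto_const_nhds (x := a))
  have horth : ∀ n, ⟪gradLp Q (hF n), p.2⟫ = (0 : ℝ) := by
    intro n
    obtain ⟨m, U, A, hU, hA, hfe⟩ := mem_cyl_one_iff.1 (hf n)
    have hy : Integrable (p.2 : G0 × ℝ → ℝ) (Q.prod leb) := (Lp.memLp p.2).integrable one_le_two
    have hae : gradLp Q (hF n) =ᵐ[Q.prod leb] cylGrad U A := by
      have hG := isGrad_cylGrad hU hA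
      have : cylLp Q (hf n) = cylLp Q (mem_cyl_one_iff.2 ⟨m, U, A, hU, hA, rfl⟩) := by
        congr 1
      refine (coeFn_gradLp (hF n)).trans ?_
      refine (Measure.ae_prod_mem_iff_ae_ae_mem (s := {z | F n z = cylGrad U A z})
        (measurableSet_eq_fun (hF n).meas hG.meas)).2 (Eventually.of_forall fun g => ?_)
      have hF' := hF n
      rw [hfe] at hF'
      filter_upwards [hF'.ae_eq g, hG.ae_eq g] with s a1 a2
      exact a1.symm.trans a2
    rw [real_inner_comm, inner_L2_congr (Filter.EventuallyEq.refl _ _) hae]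
    simp only [cylGrad, Finset.mul_sum]
    rw [integral_finsetSum]
    · refine Finset.sum_eq_zero fun i _ => ?_
      exact hQ.integral_tensor_eq_zero hy key (continuous_partialD_cylArg hU hA i)
        ((hA i).continuous_deriv le_rfl)
    · intro i _
      exact (Lp.memLp p.2).integrable_mul (memLp_tensor (p := 2)
        (continuous_partialD_cylArg hU hA i) ((hA i).continuous_deriv le_rfl))
  have := tendsto_nhds_unique (hinner p.2) (by simp only [horth]; exact tendsto_const_nhds)
  exact inner_self_eq_zero.1 this

variable (Q) in
/-- The gradient as an operator. -/
def gradOp : Lp ℝ 2 Q →ₗ.[ℝ] Lp ℝ 2 (Q.prod leb) := (gradSubmodule Q).toLinearPMap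

/-! ### Closability of the gradient. -/

section GradOp

variable (hβ : 0 < β) (hQ : IsDirichletProcess β Q)
include hβ hQ

theorem gradOp_graph : (gradOp Q).graph = gradSubmodule Q :=
  Submodule.toLinearPMap_graph_eq _ fun _ hx h0 =>
    hQ.closure_gradSubmodule_fst_eq_zero hβ (Submodule.le_topologicalClosure _ hx) h0

theorem gradOp_isClosable : (gradOp Q).IsClosable := by
  refine ⟨(gradSubmodule Q).topologicalClosure.toLinearPMap, ?_⟩
  rw [gradOp_graph hβ hQ, Submodule.toLinearPMap_graph_eq]
  exact fun _ hx h0 => hQ.closure_gradSubmodule_fst_eq_zero hβ hx h0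

theorem gradOp_closure_isClosed : (gradOp Q).closure.IsClosed :=
  (gradOp_isClosable hβ hQ).closure_isClosed

theorem mem_gradOp_closure_graph {f : G0 → ℝ} {F : G0 × ℝ → ℝ} (hf : f ∈ cyl 1) (hF : IsGrad f F) :
    (cylLp Q hf, gradLp Q hF) ∈ (gradOp Q).closure.graph := by
  rw [← (gradOp_isClosable hβ hQ).graph_closure_eq_closure_graph, gradOp_graph hβ hQ]
  exact Submodule.le_topologicalClosure _ (mem_gradGraph_iff.2 ⟨f, F, hf, hF, rfl⟩)

theorem exists_seq_gradOp_closure (u : (gradOp Q).closure.domain) :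
    ∃ (f : ℕ → G0 → ℝ) (F : ℕ → G0 × ℝ → ℝ) (hf : ∀ n, f n ∈ cyl 1) (hF : ∀ n, IsGrad (f n) (F n)),
      Tendsto (fun n => cylLp Q (hf n)) atTop (𝓝 u) ∧
      Tendsto (fun n => gradLp Q (hF n)) atTop (𝓝 ((gradOp Q).closure u)) := by
  have h := (gradOp Q).closure.mem_graph u
  rw [← (gradOp_isClosable hβ hQ).graph_closure_eq_closure_graph, gradOp_graph hβ hQ] at h
  obtain ⟨x, hx, hxl⟩ := mem_closure_iff_seq_limit.1 h
  choose f F hf hF hxe using fun n => mem_gradGraph_iff.1 (hx n)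
  refine ⟨f, F, hf, hF, ?_, ?_⟩
  · exact ((continuous_fst.tendsto _).comp hxl).congr fun n => by simp [hxe]
  · exact ((continuous_snd.tendsto _).comp hxl).congr fun n => by simp [hxe]

theorem exists_of_mem_graph {x : Lp ℝ 2 Q} {y : Lp ℝ 2 (Q.prod leb)}
    (h : (x, y) ∈ (gradOp Q).closure.graph) :
    ∃ hx : x ∈ (gradOp Q).closure.domain, (gradOp Q).closure ⟨x, hx⟩ = y := by
  obtain ⟨z, h1, h2⟩ := (gradOp Q).closure.mem_graph_iff.1 h
  simp only at h1 h2
  subst h1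
  exact ⟨z.2, h2⟩

end GradOp

/-! ### The form on cylinder functions and its closure -/

theorem wForm_eq {f h : G0 → ℝ} {F H : G0 × ℝ → ℝ} (hF : IsGrad f F) (hH : IsGrad h H) :
    wForm Q f h = ⟪gradLp Q hF, gradLp Q hH⟫ := by
  rw [inner_L2_congr (coeFn_gradLp hF) (coeFn_gradLp hH), integral_prod]
  · refine integral_congr_ae (Eventually.of_forall fun g => ?_)
    exact inner_L2_congr (hF.ae_eq g) (hH.ae_eq g)
  · exact (hF.memLp (p := 2)).integrable_mul (hH.memLp (p := 2))

theorem wForm_sub_self {f h : G0 → ℝ} {F H : G0 × ℝ → ℝ} (hf : f ∈ cyl 1) (hh : h ∈ cyl 1)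
    (hF : IsGrad f F) (hH : IsGrad h H) :
    wForm Q (f - h) (f - h) = ‖gradLp Q hF - gradLp Q hH‖ ^ 2 := by
  have := hF.sub (cyl_continuous hf) (cyl_continuous hh) hH
  rw [wForm_eq this this, real_inner_self_eq_norm_sq]
  rfl

theorem tendsto_cylLp_iff {f : ℕ → G0 → ℝ} (hf : ∀ n, f n ∈ cyl 1) (u : Lp ℝ 2 Q) :
    Tendsto (fun n => cylLp Q (hf n)) atTop (𝓝 u) ↔
      Tendsto (fun n => eLpNorm (f n - ⇑u) 2 Q) atTop (𝓝 0) := by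
  rw [Lp.tendsto_Lp_iff_tendsto_eLpNorm']
  refine tendsto_congr fun n => eLpNorm_congr_ae ?_
  filter_upwards [coeFn_cylLp (Q := Q) (hf n)] with g hg
  simp [hg]

theorem cauchySeq_gradLp {f : ℕ → G0 → ℝ} {F : ℕ → G0 × ℝ → ℝ} (hf : ∀ n, f n ∈ cyl 1)
    (hF : ∀ n, IsGrad (f n) (F n)) : CauchySeq (fun n => gradLp Q (hF n)) ↔
      FormCauchy (wForm Q) f := by
  have e : ∀ p q, wForm Q (f p - f q) (f p - f q) = ‖gradLp Q (hF p) - gradLp Q (hF q)‖ ^ 2 :=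
    fun p q => wForm_sub_self (hf p) (hf q) (hF p) (hF q)
  constructor
  · intro h ε hε
    obtain ⟨N, hN⟩ := Metric.cauchySeq_iff.1 h (√ε) (Real.sqrt_pos.2 hε)
    refine ⟨N, fun p hp q hq => ?_⟩
    have := hN p hp q hq
    rw [dist_eq_norm, Real.lt_sqrt (norm_nonneg _)] at this
    rwa [e]
  · intro h
    refine cauchySeq_of_norm_sq fun ε hε => ?_
    obtain ⟨N, hN⟩ := h ε hε
    refine ⟨N, fun p hp q hq => ?_⟩
    rw [← e]
    exact hN p hp q hq

section Closure

variable (hβ : 0 < β) (hQ : IsDirichletProcess β Q)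
include hβ hQ

theorem formClosable_wForm : FormClosable Q (cyl 1) (wForm Q) := by
  intro f hf hc h0
  choose F hF using fun n => exists_isGrad (hf n)
  obtain ⟨y, hy⟩ := cauchySeq_tendsto_of_complete ((cauchySeq_gradLp (Q := Q) hf hF).2 hc)
  have hx : Tendsto (fun n => cylLp Q (hf n)) atTop (𝓝 0) := by
    rw [tendsto_cylLp_iff]
    refine h0.congr fun n => eLpNorm_congr_ae ?_
    filter_upwards [Lp.coeFn_zero ℝ 2 Q] with g hg
    simp [hg]
  have hmem : ((0 : Lp ℝ 2 Q), y) ∈ (gradOp Q).closure.graph :=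
    (gradOp_closure_isClosed hβ hQ).mem_of_tendsto (hx.prodMk_nhds hy)
      (Eventually.of_forall fun n => mem_gradOp_closure_graph hβ hQ (hf n) (hF n))
  have hy0 : y = 0 := (gradOp Q).closure.graph_fst_eq_zero_snd hmem rfl
  rw [hy0] at hy
  have := (hy.norm).pow 2
  simp only [norm_zero, ne_eq, OfNat.ofNat_ne_zero, not_false_eq_true, zero_pow] at this
  refine this.congr fun n => ?_
  rw [wForm_eq (hF n) (hF n), real_inner_self_eq_norm_sq]

theorem exists_of_isApproximating {f : ℕ → G0 → ℝ} {u : Lp ℝ 2 Q}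
    (h : IsApproximating Q (cyl 1) (wForm Q) f u) {F : ℕ → G0 × ℝ → ℝ}
    (hF : ∀ n, IsGrad (f n) (F n)) :
    ∃ hu : u ∈ (gradOp Q).closure.domain,
      Tendsto (fun n => gradLp Q (hF n)) atTop (𝓝 ((gradOp Q).closure ⟨u, hu⟩)) := by
  obtain ⟨y, hy⟩ := cauchySeq_tendsto_of_complete ((cauchySeq_gradLp (Q := Q) h.mem hF).2 h.cauchy)
  have hx := (tendsto_cylLp_iff h.mem u).2 h.tendsto
  have hmem : (u, y) ∈ (gradOp Q).closure.graph :=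
    (gradOp_closure_isClosed hβ hQ).mem_of_tendsto (hx.prodMk_nhds hy)
      (Eventually.of_forall fun n => mem_gradOp_closure_graph hβ hQ (h.mem n) (hF n))
  obtain ⟨hu, rfl⟩ := exists_of_mem_graph hβ hQ hmem
  exact ⟨hu, hy⟩

/-- The form of two cylinder functions is the inner product of their gradients, so approximating
sequences for the form are exactly the sequences that converge in the graph of the closed gradient.
-/
theorem isFormClosure_gradOp : IsFormClosure Q (cyl 1) (wForm Q) (formOf (gradOp Q).closure) where
  mem_dom u := by
    constructor
    · intro hu
      obtain ⟨f, F, hf, hF, h1, h2⟩ := exists_seq_gradOp_closure hβ hQ ⟨u, hu⟩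
      exact ⟨f, hf, (cauchySeq_gradLp hf hF).1 h2.cauchySeq, (tendsto_cylLp_iff hf u).1 h1⟩
    · rintro ⟨f, hf⟩
      choose F hF using fun n => exists_isGrad (hf.mem n)
      exact (exists_of_isApproximating hβ hQ hf hF).1
  form_eq u v f h hf hh := by
    choose F hF using fun n => exists_isGrad (hf.mem n)
    choose H hH using fun n => exists_isGrad (hh.mem n)
    obtain ⟨_, h1⟩ := exists_of_isApproximating hβ hQ hf hF
    obtain ⟨_, h2⟩ := exists_of_isApproximating hβ hQ hh hH
    simp only [fun n => wForm_eq (Q := Q) (hF n) (hH n)]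
    exact h1.inner h2

end Closure

end Operator

/-! ### Full support -/

section Support

variable {β : ℝ} {Q : Measure G0}

/-- At a continuity point of `g₀`, monotonicity squeezes `g N s` between its values at the two
neighbouring grid points. -/
theorem tendsto_of_grid_near {g : ℕ → G0} {g₀ : G0}
    (h : ∀ (N : ℕ) (j : Fin N), |g N (grid N j) - g₀ (grid N j)| < 1 / ((N : ℝ) + 1)) :
    Tendsto g atTop (𝓝 g₀) := by
  have h' : ∀ N k : ℕ, 0 < k →
      |g N ((k : ℝ) / ((N : ℝ) + 1)) - g₀ ((k : ℝ) / ((N : ℝ) + 1))| ≤ 1 / ((N : ℝ) + 1) := by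
    intro N k hk
    rcases lt_or_ge k (N + 1) with hkN | hkN
    · have := (h N ⟨k - 1, by omega⟩).le
      have e : grid N ⟨k - 1, by omega⟩ = (k : ℝ) / ((N : ℝ) + 1) := by
        simp only [grid]
        rw [Nat.cast_sub hk]
        simp
      rwa [e] at this
    · have : (1 : ℝ) ≤ (k : ℝ) / ((N : ℝ) + 1) := by
        rw [le_div_iff₀ (by positivity), one_mul]; exact_mod_cast hkN
      rw [G0.apply_of_one_le _ this, G0.apply_of_one_le _ this, sub_self, abs_zero]
      positivity
  refine G0.tendsto_of_ae ?_
  have hcont : ∀ᵐ s ∂leb, ContinuousAt (g₀ : ℝ → ℝ) s :=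
    ae_restrict_of_ae (g₀.monotone.countable_not_continuousAt.ae_notMem volume |>.mono
      fun s hs => by simpa using hs)
  filter_upwards [hcont, ae_mem_Ioo_leb] with s hs hs01
  have hfl := floor_div_tendsto s hs01.1.le
  have hone : Tendsto (fun N : ℕ => 1 / ((N : ℝ) + 1)) atTop (𝓝 0) :=
    tendsto_one_div_add_atTop_nhds_zero_nat
  have hlow := (hs.tendsto.comp hfl).sub hone
  have hfl' : Tendsto (fun N : ℕ => ((⌊((N : ℝ) + 1) * s⌋₊ + 1 : ℕ) : ℝ) / ((N : ℝ) + 1)) atTop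
      (𝓝 s) := by
    have := hfl.add hone
    rw [add_zero] at this
    refine this.congr fun N => ?_
    push_cast
    rw [add_div]
  have hup := (hs.tendsto.comp hfl').add hone
  rw [sub_zero] at hlow
  rw [add_zero] at hup
  refine tendsto_of_tendsto_of_tendsto_of_le_of_le' hlow hup ?_ (Eventually.of_forall fun N => ?_)
  · obtain ⟨M, hM⟩ := exists_nat_one_div_lt hs01.1
    filter_upwards [eventually_ge_atTop M] with N hN
    have hk : 0 < ⌊((N : ℝ) + 1) * s⌋₊ := by
      rw [Nat.floor_pos]
      have : (M : ℝ) ≤ N := by exact_mod_cast hN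
      have h2 : 1 < s * ((M : ℝ) + 1) := by rwa [div_lt_iff₀ (by positivity)] at hM
      nlinarith [hs01.1]
    have h1 := (abs_le.1 (h' N _ hk)).1
    have h2 : g N ((⌊((N : ℝ) + 1) * s⌋₊ : ℕ) / ((N : ℝ) + 1)) ≤ g N s := by
      refine (g N).monotone ?_
      rw [div_le_iff₀ (by positivity), mul_comm s]
      exact Nat.floor_le (mul_nonneg (by positivity) hs01.1.le)
    simp only [Function.comp_def]
    linarith
  · have h1 := (abs_le.1 (h' N _ (Nat.succ_pos ⌊((N : ℝ) + 1) * s⌋₊))).2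
    have h2 : g N s ≤ g N ((⌊((N : ℝ) + 1) * s⌋₊ + 1 : ℕ) / ((N : ℝ) + 1)) := by
      refine (g N).monotone ?_
      rw [le_div_iff₀ (by positivity), mul_comm s]
      push_cast
      exact (Nat.lt_floor_add_one _).le
    simp only [Function.comp_def, Nat.succ_eq_add_one] at h1 ⊢
    linarith

theorem pad_mix {N : ℕ} (x y : Fin N → ℝ) (η : ℝ) (k : Fin (N + 2)) :
    pad (fun j => (1 - η) * x j + η * y j) k = (1 - η) * pad x k + η * pad y k := by
  refine Fin.cases ?_ (fun i => ?_) k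
  · simp [pad_zero]
  · refine Fin.lastCases ?_ (fun i => ?_) i
    · rw [Fin.succ_last, pad_last, pad_last, pad_last]; ring
    · simp only [pad_succ_castSucc]

theorem dirichletLaw_pos_of_isOpen (hβ : 0 < β) {N : ℕ} {t : Fin N → ℝ} (ht : t ∈ simplex N)
    {W : Set (Fin N → ℝ)} (hW : IsOpen W) (hne : (W ∩ simplex N).Nonempty) :
    dirichletLaw β t W ≠ 0 := by
  intro h0
  rw [dirichletLaw_eq, withDensity_apply _ hW.measurableSet,
    setLIntegral_eq_zero_iff hW.measurableSet (measurable_indicator_pdf β t)] at h0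
  refine ((hW.inter (isOpen_simplex N)).measure_pos volume hne).ne' (measure_mono_null ?_ h0)
  rintro x ⟨hx, hxs⟩ hc
  have := hc hx
  rw [indicator_of_mem hxs, ENNReal.ofReal_eq_zero] at this
  exact absurd this (not_le.2 (dirichletPDF_pos hβ ht hxs))

/-- Values of `g` on the grid may coincide; mixing in a small multiple of the grid itself makes them
strictly increasing. -/
theorem exists_mem_simplex_near (g : G0) (N : ℕ) {ε : ℝ} (hε : 0 < ε) :
    ∃ x ∈ simplex N, ∀ j, |x j - g (grid N j)| < ε := by
  set η : ℝ := min 1 (ε / 2) with hη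
  have hη0 : 0 < η := lt_min one_pos (by positivity)
  refine ⟨fun j => (1 - η) * g (grid N j) + η * grid N j, ?_, fun j => ?_⟩
  · refine strictMono_iff_gap.2 fun i => ?_
    have h1 : 0 ≤ gap (pad fun j => g (grid N j)) i := by
      rw [gap, pad_eval_grid, pad_eval_grid]
      exact sub_nonneg.2 (gridVal_mono N g (Fin.castSucc_lt_succ (i := i)).le)
    have h2 : 0 < gap (pad (grid N)) i := by rw [gap_grid]; positivity
    have h3 : gap (pad fun j => (1 - η) * g (grid N j) + η * grid N j) i =
        (1 - η) * gap (pad fun j => g (grid N j)) i + η * gap (pad (grid N)) i := by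
      simp only [gap, pad_mix]; ring
    rw [h3]
    have := mul_nonneg (sub_nonneg.2 (min_le_left 1 (ε / 2))) h1
    have := mul_pos hη0 h2
    rw [← hη] at *
    linarith
  · have h1 := g.apply_mem (grid N j)
    have h2 := mem_Ioo_of_mem_simplex (grid_mem_simplex N) j
    have h3 : |grid N j - g (grid N j)| ≤ 1 := by
      rw [abs_le]; constructor <;> linarith [h1.1, h1.2, h2.1, h2.2]
    have h4 : (1 - η) * g (grid N j) + η * grid N j - g (grid N j) =
        η * (grid N j - g (grid N j)) := by ring
    rw [h4, abs_mul, abs_of_pos hη0]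
    calc η * _ ≤ η * 1 := mul_le_mul_of_nonneg_left h3 hη0.le
      _ ≤ ε / 2 := by rw [mul_one]; exact min_le_right _ _
      _ < ε := by linarith

/-- The Dirichlet density is positive on the simplex. If `W` were null, then for each `N` some map
outside `W` would be close to `g₀` on the grid; these maps converge to `g₀ ∈ W`, which is absurd for
open `W`. -/
theorem IsDirichletProcess.isOpenPosMeasure (hβ : 0 < β) (hQ : IsDirichletProcess β Q) :
    Q.IsOpenPosMeasure := by
  refine ⟨fun W hW ⟨g₀, hg₀⟩ hW0 => ?_⟩
  have key : ∀ N : ℕ, ∃ g ∉ W, ∀ j : Fin N, |g (grid N j) - g₀ (grid N j)| < 1 / ((N : ℝ) + 1) := by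
    intro N
    by_contra! hc
    let B : Set (Fin N → ℝ) := {x | ∀ j, |x j - g₀ (grid N j)| < 1 / ((N : ℝ) + 1)}
    have hB : IsOpen B := by
      have : B = ⋂ j, {x : Fin N → ℝ | |x j - g₀ (grid N j)| < 1 / ((N : ℝ) + 1)} := by
        ext x; simp [B]
      rw [this]
      exact isOpen_iInter_of_finite fun j => isOpen_lt (by fun_prop) continuous_const
    obtain ⟨x, hx, hxn⟩ := exists_mem_simplex_near g₀ N (ε := 1 / ((N : ℝ) + 1)) (by positivity)
    refine dirichletLaw_pos_of_isOpen hβ (grid_mem_simplex N) hB ⟨x, hxn, hx⟩ ?_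
    rw [← hQ.fdd N (grid N) (grid_mem_simplex N),
      Measure.map_apply (G0.measurable_eval_pi _) hB.measurableSet]
    refine measure_mono_null (fun g hg => ?_) hW0
    by_contra hgW
    obtain ⟨j, hj⟩ := hc g hgW
    exact absurd (hg j) (not_lt.2 hj)
  choose g hgW hg using key
  exact absurd ((tendsto_of_grid_near hg).eventually (hW.mem_nhds hg₀)).exists
    fun ⟨n, hn⟩ => hgW n hn

end Support

/-! ### Convergence in `L²` -/

section Convergence

variable {X : Type*} [MeasurableSpace X] {m : Measure X}

theorem tendsto_L2_of_dominated {x : ℕ → Lp ℝ 2 m} {x₀ b : Lp ℝ 2 m}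
    (hb : ∀ n, ∀ᵐ z ∂m, |x n z| ≤ b z)
    (hl : ∀ᵐ z ∂m, Tendsto (fun n => x n z) atTop (𝓝 (x₀ z))) : Tendsto x atTop (𝓝 x₀) := by
  rw [← tendsto_sub_nhds_zero_iff]
  refine tendsto_norm_of_sq ?_
  have e : ∀ n, ‖x n - x₀‖ ^ 2 = ∫ z, (x n z - x₀ z) * (x n z - x₀ z) ∂m := fun n => by
    rw [← real_inner_self_eq_norm_sq]
    exact inner_L2_congr (Lp.coeFn_sub _ _) (Lp.coeFn_sub _ _)
  simp only [e]
  have hb' : ∀ᵐ z ∂m, ∀ n, |x n z| ≤ b z := ae_all_iff.2 hb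
  have hmeas : ∀ n, AEStronglyMeasurable (fun z => x n z - x₀ z) m := fun n =>
    (Lp.aestronglyMeasurable _).sub (Lp.aestronglyMeasurable _)
  have := tendsto_integral_of_dominated_convergence (μ := m)
    (F := fun n z => (x n z - x₀ z) * (x n z - x₀ z)) (f := fun _ => 0)
    (fun z => 4 * (b z * b z)) (fun n => (hmeas n).mul (hmeas n))
    ((integrable_L2_mul b b).const_mul 4) (fun n => ?_) ?_
  · simpa using this
  · filter_upwards [hb', hl] with z h1 h2
    have h3 : |x₀ z| ≤ b z := le_of_tendsto' h2.abs h1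
    rw [Real.norm_eq_abs, abs_mul_self]
    have h4 := abs_le.1 (h1 n)
    have h5 := abs_le.1 h3
    nlinarith
  · filter_upwards [hl] with z h2
    have := (h2.sub_const (x₀ z)).mul (h2.sub_const (x₀ z))
    simpa using this

theorem exists_subseq_ae {x : ℕ → Lp ℝ 2 m} {x₀ : Lp ℝ 2 m} (h : Tendsto x atTop (𝓝 x₀)) :
    ∃ ns : ℕ → ℕ, StrictMono ns ∧ ∀ᵐ z ∂m, Tendsto (fun i => x (ns i) z) atTop (𝓝 (x₀ z)) :=
  (tendstoInMeasure_of_tendsto_Lp h).exists_seq_tendsto_ae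

end Convergence

section L2Mul

variable {X : Type*} [MeasurableSpace X] {m : Measure X}

theorem memLp_bdd_mul {f : X → ℝ} (hf : AEStronglyMeasurable f m) {C : ℝ}
    (hC : ∀ᵐ z ∂m, |f z| ≤ C) (y : Lp ℝ 2 m) : MemLp (fun z => f z * y z) 2 m := by
  refine (Lp.memLp y).of_le_mul (c := C) (hf.mul (Lp.aestronglyMeasurable y)) ?_
  filter_upwards [hC] with z hz
  rw [norm_mul]
  exact mul_le_mul_of_nonneg_right hz (norm_nonneg _)

/-- Split `f_n y_n - u y₀ = f_n (y_n - y₀) + (f_n - u) y₀`: the uniform bound handles the first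
term, dominated convergence the second. -/
theorem tendsto_L2_mul {f : ℕ → X → ℝ} {u : X → ℝ} {C : ℝ}
    (hm : ∀ n, AEStronglyMeasurable (f n) m) (hC : ∀ n, ∀ᵐ z ∂m, |f n z| ≤ C)
    (hl : ∀ᵐ z ∂m, Tendsto (fun n => f n z) atTop (𝓝 (u z))) {y : ℕ → Lp ℝ 2 m} {y₀ : Lp ℝ 2 m}
    (hy : Tendsto y atTop (𝓝 y₀)) {a : ℕ → Lp ℝ 2 m} {a₀ : Lp ℝ 2 m}
    (ha : ∀ n, a n =ᵐ[m] fun z => f n z * y n z) (ha₀ : a₀ =ᵐ[m] fun z => u z * y₀ z) :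
    Tendsto a atTop (𝓝 a₀) := by
  let b : ℕ → Lp ℝ 2 m := fun n => (memLp_bdd_mul (hm n) (hC n) y₀).toLp _
  have hb : ∀ n, b n =ᵐ[m] fun z => f n z * y₀ z := fun n => MemLp.coeFn_toLp _
  have h1 : Tendsto b atTop (𝓝 a₀) := by
    refine tendsto_L2_of_dominated (b := C • |y₀|) (fun n => ?_) ?_
    · filter_upwards [hb n, hC n, Lp.coeFn_smul C |y₀|, Lp.coeFn_abs y₀] with z e1 e2 e3 e4
      rw [e1, e3, Pi.smul_apply, e4, abs_mul, smul_eq_mul]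
      exact mul_le_mul_of_nonneg_right e2 (abs_nonneg _)
    · filter_upwards [ae_all_iff.2 hb, hl, ha₀] with z e1 e2 e3
      simp only [e1, e3]
      exact e2.mul_const _
  have h2 : Tendsto (fun n => a n - b n) atTop (𝓝 0) := by
    rw [tendsto_zero_iff_norm_tendsto_zero]
    have h3 := (tendsto_iff_norm_sub_tendsto_zero.1 hy).const_mul |C|
    rw [mul_zero] at h3
    refine squeeze_zero (fun _ => norm_nonneg _) (fun n => ?_) h3
    refine Lp.norm_le_mul_norm_of_ae_le_mul ?_
    filter_upwards [ha n, hb n, hC n, Lp.coeFn_sub (a n) (b n), Lp.coeFn_sub (y n) y₀]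
      with z e1 e2 e3 e4 e5
    rw [e4, e5, Pi.sub_apply, Pi.sub_apply, e1, e2, ← mul_sub, norm_mul]
    exact mul_le_mul_of_nonneg_right (e3.trans (le_abs_self C)) (norm_nonneg _)
  simpa using h2.add h1

theorem norm_L2_le_of_bound [IsProbabilityMeasure m] {x : Lp ℝ 2 m} {C : ℝ} (hC : 0 ≤ C)
    (h : ∀ᵐ z ∂m, |x z| ≤ C) : ‖x‖ ≤ C := by
  have := Lp.norm_le_of_ae_bound (f := x) hC h
  simpa [measureUnivNNReal] using this

end L2Mul

/-! ### Contractions -/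

theorem abs_sub_le_of_abs_deriv_le {ψ : ℝ → ℝ} (hψ : ContDiff ℝ 1 ψ) (h1 : ∀ x, |deriv ψ x| ≤ 1)
    (x y : ℝ) : |ψ x - ψ y| ≤ |x - y| := by
  have := Convex.norm_image_sub_le_of_norm_deriv_le (f := ψ) (s := univ) (C := 1)
    (fun x _ => (hψ.differentiable one_ne_zero) x) (fun x _ => h1 x) convex_univ
    (mem_univ y) (mem_univ x)
  simpa using this

/-- A bounded `C¹` function which is the identity on a given interval and has slope at most one. -/
theorem exists_truncation (M : ℝ) : ∃ (ψ : ℝ → ℝ) (C : ℝ), ContDiff ℝ 1 ψ ∧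
    (∀ x, |deriv ψ x| ≤ 1) ∧ (∀ x, |x| ≤ M → ψ x = x) ∧ ∀ x, |ψ x| ≤ C := by
  -- The truncation is the primitive of a bump function with values in `[0, 1]` that equals `1` for
  -- `|x| ≤ |M| + 1`.
  let χ : ContDiffBump (0 : ℝ) := ⟨|M| + 1, |M| + 2, by positivity, by linarith⟩
  have hder : ∀ x, HasDerivAt (fun x => ∫ t in (0 : ℝ)..x, χ t) (χ x) x := fun x =>
    intervalIntegral.integral_hasDerivAt_right (χ.continuous.intervalIntegrable _ _)
      (χ.continuous.stronglyMeasurableAtFilter _ _) χ.continuous.continuousAt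
  have hd : deriv (fun x => ∫ t in (0 : ℝ)..x, χ t) = χ := funext fun x => (hder x).deriv
  refine ⟨fun x => ∫ t in (0 : ℝ)..x, χ t, ∫ t, |χ t|, ?_, fun x => ?_, fun x hx => ?_, fun x => ?_⟩
  · rw [contDiff_one_iff_deriv, hd]
    exact ⟨fun x => (hder x).differentiableAt, χ.continuous⟩
  · rw [hd, abs_of_nonneg χ.nonneg]
    exact χ.le_one
  · have : EqOn χ (fun _ => (1 : ℝ)) (uIcc 0 x) := fun t ht => by
      refine χ.one_of_mem_closedBall ?_
      rw [mem_closedBall_zero_iff, Real.norm_eq_abs]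
      have h1 := abs_sub_left_of_mem_uIcc ht
      rw [sub_zero, sub_zero] at h1
      have := le_abs_self M
      change |t| ≤ |M| + 1
      linarith
    change ∫ t in (0 : ℝ)..x, χ t = x
    rw [intervalIntegral.integral_congr this]
    simp
  · have hint : Integrable χ := χ.continuous.integrable_of_hasCompactSupport χ.hasCompactSupport
    refine (intervalIntegral.norm_integral_le_integral_norm_uIoc (f := χ)).trans ?_
    exact setIntegral_le_integral hint.norm (Eventually.of_forall fun _ => norm_nonneg _)

section Contraction

variable {β : ℝ} {Q : Measure G0} [IsProbabilityMeasure Q]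

theorem norm_gradLp_comp_le {ψ : ℝ → ℝ} (hψ : ContDiff ℝ 1 ψ) (h1 : ∀ x, |deriv ψ x| ≤ 1)
    {f : G0 → ℝ} {F : G0 × ℝ → ℝ} (hf : f ∈ cyl 1) (hF : IsGrad f F) :
    ‖gradLp Q (hF.comp hψ (cyl_continuous hf))‖ ≤ ‖gradLp Q hF‖ := by
  refine Lp.norm_le_norm_of_ae_le ?_
  filter_upwards [coeFn_gradLp (Q := Q) (hF.comp hψ (cyl_continuous hf)),
    coeFn_gradLp (Q := Q) hF] with z h2 h3
  rw [h2, h3, norm_mul]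
  exact mul_le_of_le_one_left (norm_nonneg _) (h1 _)

variable (hβ : 0 < β) (hQ : IsDirichletProcess β Q)
include hβ hQ

/-- The functions `√(x² + ε²)` have slope at most one and differ from `|x|` by at most `ε`. The
gradients of the compositions stay bounded, so `exists_mem_of_norm_le` places `|u|` in the domain
with the required norm. -/
theorem isMarkovGradient_gradOp : IsMarkovGradient (gradOp Q).closure where
  abs u := by
    obtain ⟨f, F, hf, hF, h1, h2⟩ := exists_seq_gradOp_closure hβ hQ u
    let ε : ℕ → ℝ := fun n => 1 / ((n : ℝ) + 1)
    have hε : ∀ n, 0 < ε n := fun n => by positivity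
    have hεl : Tendsto ε atTop (𝓝 0) := tendsto_one_div_add_atTop_nhds_zero_nat
    let ψ : ℕ → ℝ → ℝ := fun n x => √(x ^ 2 + ε n ^ 2)
    have hpos : ∀ n x, 0 < x ^ 2 + ε n ^ 2 := fun n x =>
      add_pos_of_nonneg_of_pos (sq_nonneg x) (pow_pos (hε n) 2)
    have hψ : ∀ n, ContDiff ℝ 1 (ψ n) := fun n =>
      ContDiff.sqrt (by fun_prop) fun x => (hpos n x).ne'
    have hle : ∀ n x, |x| ≤ ψ n x := fun n x =>
      Real.abs_le_sqrt (le_add_of_nonneg_right (sq_nonneg _))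
    have hψ1 : ∀ n x, |deriv (ψ n) x| ≤ 1 := by
      intro n x
      have hd : HasDerivAt (ψ n) (2 * x / (2 * ψ n x)) x :=
        ((((hasDerivAt_id' x).pow 2).add_const (ε n ^ 2)).sqrt (hpos n x).ne').congr_deriv
          (by simp [ψ])
      rw [hd.deriv, mul_div_mul_left _ _ two_ne_zero, abs_div]
      refine div_le_one_of_le₀ ((hle n x).trans (le_abs_self _)) (abs_nonneg _)
    have hψd : ∀ n x, abs (ψ n x - |x|) ≤ ε n := by
      intro n x
      rw [abs_of_nonneg (sub_nonneg.2 (hle n x)), sub_le_iff_le_add]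
      refine Real.sqrt_le_iff.2 ⟨by have := hε n; positivity, ?_⟩
      nlinarith [mul_nonneg (hε n).le (abs_nonneg x), sq_abs x]
    have hx : Tendsto (fun n => cylLp Q (cyl_comp (hψ n) (hf n))) atTop (𝓝 |(u : Lp ℝ 2 Q)|) := by
      rw [tendsto_iff_norm_sub_tendsto_zero]
      have hsum := hεl.add (tendsto_iff_norm_sub_tendsto_zero.1 h1)
      rw [add_zero] at hsum
      refine squeeze_zero (fun _ => norm_nonneg _) (fun n => ?_) hsum
      calc _ ≤ ‖cylLp Q (cyl_comp (hψ n) (hf n)) - |cylLp Q (hf n)|‖ +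
            ‖|cylLp Q (hf n)| - |(u : Lp ℝ 2 Q)|‖ := norm_sub_le_norm_sub_add_norm_sub _ _ _
        _ ≤ _ := by
          refine add_le_add (norm_L2_le_of_bound (hε n).le ?_) (norm_abs_sub_abs _ _)
          filter_upwards [Lp.coeFn_sub (cylLp Q (cyl_comp (hψ n) (hf n))) |cylLp Q (hf n)|,
            Lp.coeFn_abs (cylLp Q (hf n)), coeFn_cylLp (Q := Q) (hf n),
            coeFn_cylLp (Q := Q) (cyl_comp (hψ n) (hf n))] with g e1 e2 e3 e4
          rw [e1, Pi.sub_apply, e2, e3, e4]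
          exact hψd n _
    obtain ⟨y, hy, hyle⟩ := exists_mem_of_norm_le (gradOp_closure_isClosed hβ hQ) hx
      (fun n => mem_gradOp_closure_graph hβ hQ (cyl_comp (hψ n) (hf n))
        ((hF n).comp (hψ n) (cyl_continuous (hf n))))
      (fun n => norm_gradLp_comp_le (hψ n) (hψ1 n) (hf n) (hF n)) h2.norm
    obtain ⟨hv, rfl⟩ := exists_of_mem_graph hβ hQ hy
    exact ⟨⟨_, hv⟩, Lp.coeFn_abs _, hyle⟩
  one := by
    obtain ⟨F, hF⟩ := exists_isGrad (const_mem_cyl 1)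
    -- Writing the constant as a composition with a constant function makes its gradient carry the
    -- factor `deriv ψ = 0`.
    have hc : (fun _ => (1 : ℝ)) ∘ (fun _ : G0 => (1 : ℝ)) ∈ cyl 1 :=
      cyl_comp contDiff_const (const_mem_cyl 1)
    obtain ⟨hv, h0⟩ := exists_of_mem_graph hβ hQ (mem_gradOp_closure_graph hβ hQ hc
      (hF.comp (ψ := fun _ => 1) contDiff_const continuous_const))
    refine ⟨⟨_, hv⟩, coeFn_cylLp hc, h0.trans (Lp.ext ?_)⟩
    filter_upwards [coeFn_gradLp (Q := Q) (hF.comp (ψ := fun _ => 1) contDiff_const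
      continuous_const), Lp.coeFn_zero ℝ 2 (Q.prod leb)] with z e1 e2
    rw [e1, e2]
    simp

/-- Bounded elements of the domain are limits of bounded sequences of cylinder functions. -/
theorem exists_bounded_seq (u : (gradOp Q).closure.domain) (hu : MemLp (u : Lp ℝ 2 Q) ⊤ Q) :
    ∃ (f : ℕ → G0 → ℝ) (F : ℕ → G0 × ℝ → ℝ) (_ : ∀ n, f n ∈ cyl 1)
      (hF : ∀ n, IsGrad (f n) (F n)) (C : ℝ), (∀ n g, |f n g| ≤ C) ∧
      (∀ᵐ g ∂Q, Tendsto (fun n => f n g) atTop (𝓝 ((u : Lp ℝ 2 Q) g))) ∧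
      Tendsto (fun n => gradLp Q (hF n)) atTop (𝓝 ((gradOp Q).closure u)) := by
  obtain ⟨f, F, hf, hF, h1, h2⟩ := exists_seq_gradOp_closure hβ hQ u
  have hbd : ∀ᵐ g ∂Q, |(u : Lp ℝ 2 Q) g| ≤ (eLpNormEssSup (u : Lp ℝ 2 Q) Q).toReal := by
    have h3 : eLpNormEssSup (u : Lp ℝ 2 Q) Q ≠ ⊤ := by
      rw [← eLpNorm_exponent_top]; exact hu.2.ne
    filter_upwards [ae_le_eLpNormEssSup (f := (u : Lp ℝ 2 Q)) (μ := Q)] with g hg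
    rw [← ENNReal.ofReal_le_iff_le_toReal h3, ← Real.norm_eq_abs, ofReal_norm]
    exact hg
  obtain ⟨ψ, C, hψ, hψ1, hid, hC⟩ := exists_truncation (eLpNormEssSup (u : Lp ℝ 2 Q) Q).toReal
  have hx : Tendsto (fun n => cylLp Q (cyl_comp hψ (hf n))) atTop (𝓝 (u : Lp ℝ 2 Q)) := by
    rw [tendsto_iff_norm_sub_tendsto_zero]
    refine squeeze_zero (fun _ => norm_nonneg _) (fun n => ?_)
      (tendsto_iff_norm_sub_tendsto_zero.1 h1)
    refine Lp.norm_le_norm_of_ae_le ?_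
    filter_upwards [Lp.coeFn_sub (cylLp Q (cyl_comp hψ (hf n))) (u : Lp ℝ 2 Q),
      Lp.coeFn_sub (cylLp Q (hf n)) (u : Lp ℝ 2 Q), coeFn_cylLp (Q := Q) (hf n),
      coeFn_cylLp (Q := Q) (cyl_comp hψ (hf n)), hbd] with g e1 e2 e3 e4 e5
    rw [e1, e2, Pi.sub_apply, Pi.sub_apply, e3, e4]
    conv_lhs => rw [← hid _ e5]
    exact abs_sub_le_of_abs_deriv_le hψ hψ1 _ _
  -- Truncation does not increase the norm of the gradients, and the untruncated norms converge to
  -- that of the limit; hence the convergence is strong.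
  have hy := tendsto_of_norm_le_tendsto (gradOp_closure_isClosed hβ hQ)
    (fun p hp h0 => (gradOp Q).closure.graph_fst_eq_zero_snd hp h0) hx
    (fun n => mem_gradOp_closure_graph hβ hQ (cyl_comp hψ (hf n))
      ((hF n).comp hψ (cyl_continuous (hf n)))) ((gradOp Q).closure.mem_graph u)
    (fun n => norm_gradLp_comp_le hψ hψ1 (hf n) (hF n)) h2.norm
  obtain ⟨ns, hns, hae⟩ := exists_subseq_ae hx
  refine ⟨fun n => ψ ∘ f (ns n), _, fun n => cyl_comp hψ (hf (ns n)),
    fun n => (hF (ns n)).comp hψ (cyl_continuous (hf (ns n))), C, fun n g => hC _, ?_,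
    hy.comp hns.tendsto_atTop⟩
  filter_upwards [hae, ae_all_iff.2 fun n => coeFn_cylLp (Q := Q) (cyl_comp hψ (hf (ns n)))]
    with g e1 e2
  exact e1.congr e2

/-- The product rule for bounded elements of the domain. -/
theorem exists_mul_gradOp_closure (u v : (gradOp Q).closure.domain)
    (hu : MemLp (u : Lp ℝ 2 Q) ⊤ Q) (hv : MemLp (v : Lp ℝ 2 Q) ⊤ Q) :
    ∃ w : (gradOp Q).closure.domain,
      ((w : Lp ℝ 2 Q) =ᵐ[Q] fun g => (u : Lp ℝ 2 Q) g * (v : Lp ℝ 2 Q) g) ∧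
      (gradOp Q).closure w =ᵐ[Q.prod leb] fun z =>
        (u : Lp ℝ 2 Q) z.1 * (gradOp Q).closure v z + (v : Lp ℝ 2 Q) z.1 * (gradOp Q).closure u z := by
  obtain ⟨f, F, hf, hF, C, hC, hfl, hFl⟩ := exists_bounded_seq hβ hQ u hu
  obtain ⟨h, H, hh, hH, B, hB, hhl, hHl⟩ := exists_bounded_seq hβ hQ v hv
  have hub : ∀ᵐ g ∂Q, |(u : Lp ℝ 2 Q) g| ≤ C := by
    filter_upwards [hfl] with g hg using le_of_tendsto' hg.abs fun n => hC n g
  have hvb : ∀ᵐ g ∂Q, |(v : Lp ℝ 2 Q) g| ≤ B := by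
    filter_upwards [hhl] with g hg using le_of_tendsto' hg.abs fun n => hB n g
  have hfst : Tendsto (Prod.fst : G0 × ℝ → G0) (ae (Q.prod leb)) (ae Q) :=
    Measure.quasiMeasurePreserving_fst.tendsto_ae
  have hum : AEStronglyMeasurable (fun z : G0 × ℝ => (u : Lp ℝ 2 Q) z.1) (Q.prod leb) :=
    ((Lp.stronglyMeasurable _).comp_measurable measurable_fst).aestronglyMeasurable
  have hvm : AEStronglyMeasurable (fun z : G0 × ℝ => (v : Lp ℝ 2 Q) z.1) (Q.prod leb) :=
    ((Lp.stronglyMeasurable _).comp_measurable measurable_fst).aestronglyMeasurable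
  have hfm : ∀ n, AEStronglyMeasurable (fun z : G0 × ℝ => f n z.1) (Q.prod leb) := fun n =>
    ((cyl_continuous (hf n)).measurable.comp measurable_fst).aestronglyMeasurable
  have hhm : ∀ n, AEStronglyMeasurable (fun z : G0 × ℝ => h n z.1) (Q.prod leb) := fun n =>
    ((cyl_continuous (hh n)).measurable.comp measurable_fst).aestronglyMeasurable
  let a₀ : Lp ℝ 2 (Q.prod leb) :=
    (memLp_bdd_mul hum (hfst.eventually hub) ((gradOp Q).closure v)).toLp _
  let b₀ : Lp ℝ 2 (Q.prod leb) :=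
    (memLp_bdd_mul hvm (hfst.eventually hvb) ((gradOp Q).closure u)).toLp _
  let a : ℕ → Lp ℝ 2 (Q.prod leb) := fun n =>
    (memLp_bdd_mul (hfm n) (Eventually.of_forall fun z => hC n z.1) (gradLp Q (hH n))).toLp _
  let b : ℕ → Lp ℝ 2 (Q.prod leb) := fun n =>
    (memLp_bdd_mul (hhm n) (Eventually.of_forall fun z => hB n z.1) (gradLp Q (hF n))).toLp _
  have hal : Tendsto a atTop (𝓝 a₀) := tendsto_L2_mul hfm
    (fun n => Eventually.of_forall fun z => hC n z.1) (hfst.eventually hfl) hHl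
    (fun n => MemLp.coeFn_toLp _) (MemLp.coeFn_toLp _)
  have hbl : Tendsto b atTop (𝓝 b₀) := tendsto_L2_mul hhm
    (fun n => Eventually.of_forall fun z => hB n z.1) (hfst.eventually hhl) hFl
    (fun n => MemLp.coeFn_toLp _) (MemLp.coeFn_toLp _)
  have hgrad : ∀ n, gradLp Q ((hF n).mul (cyl_continuous (hf n)) (cyl_continuous (hh n)) (hH n)) =
      a n + b n := by
    intro n
    refine Lp.ext ?_
    filter_upwards [coeFn_gradLp (Q := Q)
      ((hF n).mul (cyl_continuous (hf n)) (cyl_continuous (hh n)) (hH n)),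
      Lp.coeFn_add (a n) (b n), coeFn_gradLp (Q := Q) (hF n), coeFn_gradLp (Q := Q) (hH n),
      MemLp.coeFn_toLp (memLp_bdd_mul (hfm n) (Eventually.of_forall fun z => hC n z.1)
        (gradLp Q (hH n))), MemLp.coeFn_toLp (memLp_bdd_mul (hhm n)
        (Eventually.of_forall fun z => hB n z.1) (gradLp Q (hF n)))] with z e1 e2 e3 e4 e5 e6
    rw [e1, e2, Pi.add_apply]
    refine Eq.symm (congrArg₂ (· + ·) (e5.trans ?_) (e6.trans ?_))
    · rw [e4]
    · rw [e3]
  have huv := memLp_bdd_mul (Lp.aestronglyMeasurable (u : Lp ℝ 2 Q)) hub (v : Lp ℝ 2 Q)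
  have hx : Tendsto (fun n => cylLp Q (cyl_mul (hf n) (hh n))) atTop (𝓝 (huv.toLp _)) := by
    refine tendsto_L2_of_dominated (b := cylLp Q (const_mem_cyl (C * B))) (fun n => ?_) ?_
    · filter_upwards [coeFn_cylLp (Q := Q) (cyl_mul (hf n) (hh n)),
        coeFn_cylLp (Q := Q) (const_mem_cyl (C * B))] with g e1 e2
      rw [e1, e2, Pi.mul_apply, abs_mul]
      exact mul_le_mul (hC n g) (hB n g) (abs_nonneg _) ((abs_nonneg _).trans (hC n g))
    · filter_upwards [ae_all_iff.2 fun n => coeFn_cylLp (Q := Q) (cyl_mul (hf n) (hh n)),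
        huv.coeFn_toLp, hfl, hhl] with g e1 e2 e3 e4
      rw [e2]
      exact (e3.mul e4).congr fun n => (e1 n).symm
  have hmem : (huv.toLp _, a₀ + b₀) ∈ (gradOp Q).closure.graph := by
    refine (gradOp_closure_isClosed hβ hQ).mem_of_tendsto (hx.prodMk_nhds (hal.add hbl))
      (Eventually.of_forall fun n => ?_)
    rw [← hgrad]
    exact mem_gradOp_closure_graph hβ hQ (cyl_mul (hf n) (hh n)) _
  obtain ⟨hw, hwT⟩ := exists_of_mem_graph hβ hQ hmem
  refine ⟨⟨_, hw⟩, huv.coeFn_toLp, ?_⟩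
  rw [hwT]
  filter_upwards [Lp.coeFn_add a₀ b₀, MemLp.coeFn_toLp (memLp_bdd_mul hum (hfst.eventually hub)
    ((gradOp Q).closure v)), MemLp.coeFn_toLp (memLp_bdd_mul hvm (hfst.eventually hvb)
    ((gradOp Q).closure u))] with z e1 e2 e3
  rw [e1]
  exact congrArg₂ (· + ·) e2 e3

end Contraction

/-! ### The square field operator. -/

section SquareField

variable {Q : Measure G0}

theorem integrable_squareField (F G : Lp ℝ 2 (Q.prod leb)) : Integrable (squareField F G) Q :=
  (integrable_L2_mul F G).integral_prod_left

/-- After the product rule is inserted, the terms containing `Dw` cancel and `2 w Du Dv` remains. -/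
theorem two_mul_integral_squareField [SFinite Q] {u v w : Lp ℝ 2 Q} {Du Dv Dw Duv Duw Dvw : Lp ℝ 2 (Q.prod leb)}
    (huv : Duv =ᵐ[Q.prod leb] fun z => u z.1 * Dv z + v z.1 * Du z)
    (huw : Duw =ᵐ[Q.prod leb] fun z => u z.1 * Dw z + w z.1 * Du z)
    (hvw : Dvw =ᵐ[Q.prod leb] fun z => v z.1 * Dw z + w z.1 * Dv z) :
    2 * ∫ g, w g * squareField Du Dv g ∂Q = ⟪Du, Dvw⟫ + ⟪Duw, Dv⟫ - ⟪Duv, Dw⟫ := by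
  have i1 := integrable_L2_mul Du Dvw
  have i2 := integrable_L2_mul Duw Dv
  have i3 := integrable_L2_mul Duv Dw
  have hae : (fun z => Du z * Dvw z + Duw z * Dv z - Duv z * Dw z) =ᵐ[Q.prod leb]
      fun z => 2 * (w z.1 * (Du z * Dv z)) := by
    filter_upwards [huv, huw, hvw] with z e1 e2 e3
    rw [e1, e2, e3]
    ring
  have hint : Integrable (fun z : G0 × ℝ => 2 * (w z.1 * (Du z * Dv z))) (Q.prod leb) :=
    ((i1.add i2).sub i3).congr hae
  rw [inner_L2_eq, inner_L2_eq, inner_L2_eq, ← integral_add i1 i2,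
    ← integral_sub (i1.fun_add i2) i3, integral_congr_ae hae, integral_prod _ hint,
    ← integral_const_mul]
  refine integral_congr_ae (Eventually.of_forall fun g => ?_)
  simp only [squareField, integral_const_mul]

end SquareField

/-! ### Smooth approximation -/

/-- Mollification: differentiation commutes with convolution, and `U` and its derivative are
uniformly continuous. -/
theorem exists_smooth_near_of_hasCompactSupport {m : ℕ} {U : (Fin m → ℝ) → ℝ} (hU : ContDiff ℝ 1 U)
    (hc : HasCompactSupport U) {ε : ℝ} (hε : 0 < ε) :
    ∃ V : (Fin m → ℝ) → ℝ, ContDiff ℝ ∞ V ∧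
      ∀ x, |V x - U x| ≤ ε ∧ ‖fderiv ℝ V x - fderiv ℝ U x‖ ≤ ε := by
  have hUc := hU.continuous
  have hDc := hU.continuous_fderiv one_ne_zero
  obtain ⟨δ₁, hδ₁, h1⟩ := Metric.uniformContinuous_iff.1
    (hc.uniformContinuous_of_continuous hUc) ε hε
  obtain ⟨δ₂, hδ₂, h2⟩ := Metric.uniformContinuous_iff.1
    ((hc.fderiv (𝕜 := ℝ)).uniformContinuous_of_continuous hDc) ε hε
  have hδ := lt_min hδ₁ hδ₂
  let χ : ContDiffBump (0 : Fin m → ℝ) := ⟨min δ₁ δ₂ / 2, min δ₁ δ₂, by positivity, by linarith⟩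
  have hloc : LocallyIntegrable (χ.normed volume) (volume : Measure (Fin m → ℝ)) :=
    χ.continuous_normed.locallyIntegrable
  have hD : ∀ x, HasFDerivAt
      (convolution (χ.normed volume) U (ContinuousLinearMap.lsmul ℝ ℝ) volume)
      (convolution (χ.normed volume) (fderiv ℝ U) (ContinuousLinearMap.lsmul ℝ ℝ) volume x) x :=
    fun x => (hc.hasFDerivAt_convolution_right (ContinuousLinearMap.lsmul ℝ ℝ) hloc hU x)
  refine ⟨convolution (χ.normed volume) U (ContinuousLinearMap.lsmul ℝ ℝ) volume,
    χ.hasCompactSupport_normed.contDiff_convolution_left _ χ.contDiff_normed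
      hUc.locallyIntegrable, fun x => ⟨?_, ?_⟩⟩
  · rw [← Real.dist_eq]
    refine χ.dist_normed_convolution_le hUc.aestronglyMeasurable fun y hy => (h1 ?_).le
    exact (Metric.mem_ball.1 hy).trans_le (min_le_left _ _)
  · rw [(hD x).fderiv, ← dist_eq_norm]
    refine χ.dist_normed_convolution_le hDc.aestronglyMeasurable fun y hy => (h2 ?_).le
    exact (Metric.mem_ball.1 hy).trans_le (min_le_right _ _)

/-- A cut-off equal to one near the ball of radius `R` reduces this to compact support without
changing `U` or its derivative there. -/
theorem exists_smooth_near {m : ℕ} {U : (Fin m → ℝ) → ℝ} (hU : ContDiff ℝ 1 U) (R : ℝ) {ε : ℝ}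
    (hε : 0 < ε) : ∃ V : (Fin m → ℝ) → ℝ, ContDiff ℝ ∞ V ∧ ∀ x, ‖x‖ ≤ R →
      |V x - U x| ≤ ε ∧ ∀ i, |partialD i V x - partialD i U x| ≤ ε := by
  let χ : ContDiffBump (0 : Fin m → ℝ) := ⟨|R| + 1, |R| + 2, by positivity, by linarith⟩
  obtain ⟨V, hV, h⟩ := exists_smooth_near_of_hasCompactSupport (U := fun x => χ x * U x)
    (χ.contDiff.mul hU) χ.hasCompactSupport.mul_right hε
  refine ⟨V, hV, fun x hx => ?_⟩
  have hx' : x ∈ Metric.ball (0 : Fin m → ℝ) (|R| + 1) := by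
    rw [mem_ball_zero_iff]; linarith [le_abs_self R]
  have heq : (fun x => χ x * U x) =ᶠ[𝓝 x] U := by
    filter_upwards [Metric.isOpen_ball.mem_nhds hx'] with y hy
    rw [χ.one_of_mem_closedBall (Metric.ball_subset_closedBall hy), one_mul]
  obtain ⟨h1, h2⟩ := h x
  rw [heq.fderiv_eq] at h2
  rw [heq.eq_of_nhds] at h1
  refine ⟨h1, fun i => ?_⟩
  rw [partialD, partialD, ← sub_apply, ← Real.norm_eq_abs]
  refine (ContinuousLinearMap.le_opNorm _ _).trans ?_
  rw [Pi.norm_single, norm_one, mul_one]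
  exact h2

/-- The derivative is approximated by smooth functions vanishing at the end points and then
integrated. The derivatives converge boundedly, but only on the open interval. -/
theorem exists_smooth_neumann_approx {a : ℝ → ℝ} (ha : ContDiff ℝ 1 a) :
    ∃ A : ℕ → ℝ → ℝ, (∀ n, ContDiff ℝ ∞ (A n)) ∧ (∀ n, deriv (A n) 0 = 0) ∧
      (∀ n, deriv (A n) 1 = 0) ∧
      (∃ C, 0 ≤ C ∧ ∀ n, ∀ x ∈ Icc (0 : ℝ) 1, |A n x| ≤ C ∧ |deriv (A n) x| ≤ C) ∧
      (∀ x ∈ Icc (0 : ℝ) 1, Tendsto (fun n => A n x) atTop (𝓝 (a x))) ∧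
      ∀ x ∈ Ioo (0 : ℝ) 1, Tendsto (fun n => deriv (A n) x) atTop (𝓝 (deriv a x)) := by
  have hac := ha.continuous_deriv le_rfl
  obtain ⟨f, hf, hf0, hf1, ⟨C, hC0, hC⟩, hl⟩ := exists_smooth_vanishing_approx hac
  have hder : ∀ n x, HasDerivAt (fun x => a 0 + ∫ t in (0 : ℝ)..x, f n t) (f n x) x := fun n x =>
    (intervalIntegral.integral_hasDerivAt_right ((hf n).continuous.intervalIntegrable _ _)
      ((hf n).continuous.stronglyMeasurableAtFilter _ _) (hf n).continuous.continuousAt).const_add _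
  have hd : ∀ n, deriv (fun x => a 0 + ∫ t in (0 : ℝ)..x, f n t) = f n := fun n =>
    funext fun x => (hder n x).deriv
  refine ⟨fun n x => a 0 + ∫ t in (0 : ℝ)..x, f n t, fun n => ?_, fun n => by rw [hd, hf0],
    fun n => by rw [hd, hf1], ⟨|a 0| + C, by positivity, fun n x hx => ⟨?_, ?_⟩⟩, fun x hx => ?_,
    fun x hx => ?_⟩
  · rw [contDiff_infty_iff_deriv, hd]
    exact ⟨fun x => (hder n x).differentiableAt, hf n⟩
  · refine (abs_add_le _ _).trans (add_le_add_right ?_ _)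
    have h1 : ∀ t ∈ uIoc 0 x, ‖f n t‖ ≤ C := fun t ht => by
      rw [uIoc_of_le hx.1] at ht
      exact hC n t ⟨ht.1.le, ht.2.trans hx.2⟩
    have := intervalIntegral.norm_integral_le_of_norm_le_const h1
    rw [sub_zero, abs_of_nonneg hx.1] at this
    exact this.trans (mul_le_of_le_one_right hC0 hx.2)
  · rw [hd]
    exact (hC n x hx).trans (le_add_of_nonneg_left (abs_nonneg _))
  · have e : a x = a 0 + ∫ t in (0 : ℝ)..x, deriv a t := by
      rw [intervalIntegral.integral_deriv_eq_sub
        (fun t _ => (ha.differentiable one_ne_zero) t) (hac.intervalIntegrable _ _)]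
      ring
    rw [e]
    refine Tendsto.const_add _ (intervalIntegral.tendsto_integral_filter_of_dominated_convergence
      (fun _ => C) (Eventually.of_forall fun n => (hf n).continuous.aestronglyMeasurable)
      (Eventually.of_forall fun n => Eventually.of_forall fun t ht => ?_)
      intervalIntegrable_const ?_)
    · rw [uIoc_of_le hx.1] at ht
      exact hC n t ⟨ht.1.le, ht.2.trans hx.2⟩
    · have h1 : ∀ᵐ t ∂(volume : Measure ℝ), t ≠ 1 := by simp [ae_iff]
      filter_upwards [h1] with t ht1 ht
      rw [uIoc_of_le hx.1] at ht
      exact hl t ⟨ht.1, lt_of_le_of_ne (ht.2.trans hx.2) ht1⟩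
  · simp only [hd]
    exact hl x hx

/-! ### Density of the smooth cylinder functions with boundary conditions. -/

section Core

variable {β : ℝ} {Q : Measure G0}

theorem tendsto_L2_of_bounded {X : Type*} [MeasurableSpace X] {m : Measure X} [IsFiniteMeasure m]
    {x : ℕ → Lp ℝ 2 m} {x₀ : Lp ℝ 2 m} {C : ℝ} (hC : ∀ n, ∀ᵐ z ∂m, |x n z| ≤ C)
    (hl : ∀ᵐ z ∂m, Tendsto (fun n => x n z) atTop (𝓝 (x₀ z))) : Tendsto x atTop (𝓝 x₀) := by
  refine tendsto_L2_of_dominated (b := (memLp_const C).toLp _) (fun n => ?_) hl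
  filter_upwards [hC n, (memLp_const C).coeFn_toLp (μ := m) (p := 2)] with z h1 h2
  rwa [h2]

/-- Approximation of cylinder functions by smooth ones satisfying the boundary conditions. -/
theorem exists_seq_cylNeumann [IsProbabilityMeasure Q] (hQ : IsDirichletProcess β Q) {m : ℕ}
    {U : (Fin m → ℝ) → ℝ} {A : Fin m → ℝ → ℝ} (hU : ContDiff ℝ 1 U) (hA : ∀ i, ContDiff ℝ 1 (A i))
    (hUA : (fun g => U (cylArg A g)) ∈ cyl 1) :
    ∃ (f : ℕ → G0 → ℝ) (F : ℕ → G0 × ℝ → ℝ) (hf : ∀ n, f n ∈ cylNeumann)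
      (hF : ∀ n, IsGrad (f n) (F n)),
      Tendsto (fun n => cylLp Q (cylNeumann_subset (hf n))) atTop (𝓝 (cylLp Q hUA)) ∧
      Tendsto (fun n => gradLp Q (hF n)) atTop (𝓝 (gradLp Q (isGrad_cylGrad hU hA))) := by
  choose a ha ha0 ha1 hbd hal hdal using fun i : Fin m => exists_smooth_neumann_approx (hA i)
  choose C hC0 hC using hbd
  let α : ℕ → Fin m → ℝ → ℝ := fun n i => a i n
  have hα1 : ∀ n i, ContDiff ℝ 1 (α n i) := fun n i => (ha i n).of_le (by exact_mod_cast le_top)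
  -- All arguments `cylArg (α n) g` lie in the ball of radius `R`, where `V n` has to be close to
  -- `U`.
  set R := ∑ i, C i with hR
  have hR0 : 0 ≤ R := Finset.sum_nonneg fun i _ => hC0 i
  choose V hV hVU using fun n : ℕ => exists_smooth_near hU R (ε := 1 / ((n : ℝ) + 1)) (by positivity)
  have hV1 : ∀ n, ContDiff ℝ 1 (V n) := fun n => (hV n).of_le (by exact_mod_cast le_top)
  have hone : ∀ n : ℕ, 1 / ((n : ℝ) + 1) ≤ 1 := fun n => by
    rw [div_le_one (by positivity)]; linarith [(Nat.cast_nonneg n : (0 : ℝ) ≤ n)]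
  have hnorm : ∀ n g, ‖cylArg (α n) g‖ ≤ R := fun n g => by
    refine (pi_norm_le_iff_of_nonneg hR0).2 fun i => ?_
    have h1 : ∀ s ∈ uIoc (0 : ℝ) 1, ‖α n i (g s)‖ ≤ C i := fun s _ =>
      (hC i n _ (g.apply_mem s)).1
    have := intervalIntegral.norm_integral_le_of_norm_le_const h1
    rw [sub_zero, abs_one, mul_one] at this
    exact this.trans (Finset.single_le_sum (fun i _ => hC0 i) (Finset.mem_univ i))
  have harg : ∀ g, Tendsto (fun n => cylArg (α n) g) atTop (𝓝 (cylArg A g)) := fun g => by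
    refine tendsto_pi_nhds.2 fun i => ?_
    refine intervalIntegral.tendsto_integral_filter_of_dominated_convergence (fun _ => C i)
      (Eventually.of_forall fun n => ?_)
      (Eventually.of_forall fun n => Eventually.of_forall fun s _ => (hC i n _ (g.apply_mem s)).1)
      intervalIntegrable_const (Eventually.of_forall fun s _ => hal i _ (g.apply_mem s))
    exact ((ha i n).continuous.measurable.comp g.measurable).aestronglyMeasurable
  have hlim : ∀ (P : (Fin m → ℝ) → ℝ) (W : ℕ → (Fin m → ℝ) → ℝ), Continuous P →
      (∀ n x, ‖x‖ ≤ R → |W n x - P x| ≤ 1 / ((n : ℝ) + 1)) →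
      (∃ B, 0 ≤ B ∧ ∀ n g, |W n (cylArg (α n) g)| ≤ B) ∧
      ∀ g, Tendsto (fun n => W n (cylArg (α n) g)) atTop (𝓝 (P (cylArg A g))) := by
    intro P W hP hW
    constructor
    · obtain ⟨B, hB⟩ := (isCompact_closedBall (0 : Fin m → ℝ) R).exists_bound_of_continuousOn
        hP.continuousOn
      refine ⟨|B| + 1, by positivity, fun n g => ?_⟩
      have h1 := hB _ (mem_closedBall_zero_iff.2 (hnorm n g))
      rw [Real.norm_eq_abs] at h1
      have h2 := (hW n _ (hnorm n g)).trans (hone n)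
      have h3 := abs_sub_abs_le_abs_sub (W n (cylArg (α n) g)) (P (cylArg (α n) g))
      linarith [le_abs_self B]
    · intro g
      have h1 := (hP.tendsto _).comp (harg g)
      have h2 : Tendsto (fun n => W n (cylArg (α n) g) - P (cylArg (α n) g)) atTop (𝓝 0) :=
        squeeze_zero_norm (fun n => hW n _ (hnorm n g)) tendsto_one_div_add_atTop_nhds_zero_nat
      simpa [Function.comp_def] using h2.add h1
  obtain ⟨⟨B, hB0, hB⟩, hBl⟩ := hlim U V hU.continuous fun n x hx => (hVU n x hx).1
  have hp := fun i : Fin m => hlim (partialD i U) (fun n => partialD i (V n)) (continuous_partialD hU i)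
    fun n x hx => (hVU n x hx).2 i
  have hpl := fun i => (hp i).2
  have hpB : ∀ i, ∃ B, 0 ≤ B ∧ ∀ n g, |partialD i (V n) (cylArg (α n) g)| ≤ B := fun i => (hp i).1
  choose B' hB0' hB' using hpB
  have hN : ∀ n, (fun g => V n (cylArg (α n) g)) ∈ cylNeumann := fun n =>
    ⟨m, V n, α n, ⟨hV n, fun i => (ha i n).contDiffOn, fun i => by
      rw [D01_eq_deriv ((hα1 n i).differentiable one_ne_zero) (eqOn_refl _ _) (by simp)]
      exact ha0 i n, fun i => by
      rw [D01_eq_deriv ((hα1 n i).differentiable one_ne_zero) (eqOn_refl _ _) (by simp)]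
      exact ha1 i n⟩, rfl⟩
  refine ⟨_, _, hN, fun n => isGrad_cylGrad (hV1 n) (hα1 n),
    tendsto_L2_of_bounded (C := B) (fun n => ?_) ?_,
    tendsto_L2_of_bounded (C := ∑ i, B' i * C i) (fun n => ?_) ?_⟩
  · filter_upwards [coeFn_cylLp (Q := Q) (cylNeumann_subset (hN n))] with g hg
    rw [hg]
    exact hB n g
  · filter_upwards [ae_all_iff.2 fun n => coeFn_cylLp (Q := Q) (cylNeumann_subset (hN n)),
      coeFn_cylLp (Q := Q) hUA] with g h1 h2
    rw [h2]
    exact (hBl g).congr fun n => (h1 n).symm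
  · filter_upwards [coeFn_gradLp (Q := Q) (isGrad_cylGrad (hV1 n) (hα1 n))] with z hz
    rw [hz]
    refine (Finset.abs_sum_le_sum_abs _ _).trans (Finset.sum_le_sum fun i _ => ?_)
    rw [abs_mul]
    exact mul_le_mul (hB' i n z.1) (hC i n _ (z.1.apply_mem _)).2 (abs_nonneg _) (hB0' i)
  -- The derivatives need not converge at the end points, but almost every `g s` lies in `(0, 1)`.
  · filter_upwards [ae_all_iff.2 fun n => coeFn_gradLp (Q := Q) (isGrad_cylGrad (hV1 n) (hα1 n)),
      coeFn_gradLp (Q := Q) (isGrad_cylGrad hU hA), hQ.ae_prod_apply_mem_Ioo] with z h1 h2 h3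
    rw [h2]
    refine Tendsto.congr (fun n => (h1 n).symm) ?_
    exact tendsto_finsetSum _ fun i _ => (hpl i z.1).mul (hdal i _ h3)

section

variable [IsProbabilityMeasure Q] (hβ : 0 < β) (hQ : IsDirichletProcess β Q)
include hβ hQ

theorem gradLp_unique {f : G0 → ℝ} {F F' : G0 × ℝ → ℝ} (hf : f ∈ cyl 1) (hF : IsGrad f F)
    (hF' : IsGrad f F') : gradLp Q hF = gradLp Q hF' :=
  (gradOp Q).closure.mem_graph_snd_inj (mem_gradOp_closure_graph hβ hQ hf hF)
    (mem_gradOp_closure_graph hβ hQ hf hF') rfl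

theorem exists_cylNeumann_near (u : (gradOp Q).closure.domain) {ε : ℝ} (hε : 0 < ε) :
    ∃ (f : G0 → ℝ) (F : G0 × ℝ → ℝ) (hf : f ∈ cylNeumann) (hF : IsGrad f F),
      ‖(u : Lp ℝ 2 Q) - cylLp Q (cylNeumann_subset hf)‖ < ε ∧
      ‖(gradOp Q).closure u - gradLp Q hF‖ < ε := by
  obtain ⟨h, H, hh, hH, h1, h2⟩ := exists_seq_gradOp_closure hβ hQ u
  obtain ⟨n, hn1, hn2⟩ := ((Metric.tendsto_nhds.1 h1 (ε / 2) (by positivity)).and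
    (Metric.tendsto_nhds.1 h2 (ε / 2) (by positivity))).exists
  obtain ⟨m, U, A, hU, hA, hfe⟩ := mem_cyl_one_iff.1 (hh n)
  obtain ⟨f, F, hf, hF, h3, h4⟩ := exists_seq_cylNeumann hQ hU hA (hfe ▸ hh n)
  obtain ⟨k, hk1, hk2⟩ := ((Metric.tendsto_nhds.1 h3 (ε / 2) (by positivity)).and
    (Metric.tendsto_nhds.1 h4 (ε / 2) (by positivity))).exists
  have e1 : cylLp Q (hh n) = cylLp Q (hfe ▸ hh n : (fun g => U (cylArg A g)) ∈ cyl 1) := by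
    congr 1
  have e2 : gradLp Q (hH n) = gradLp Q (isGrad_cylGrad hU hA) :=
    gradLp_unique hβ hQ (hh n) (hH n) (hfe ▸ isGrad_cylGrad hU hA)
  refine ⟨f k, F k, hf k, hF k, ?_, ?_⟩
  · rw [← dist_eq_norm]
    rw [dist_comm] at hn1 hk1
    rw [e1] at hn1
    linarith [dist_triangle (u : Lp ℝ 2 Q)
      (cylLp Q (hfe ▸ hh n : (fun g => U (cylArg A g)) ∈ cyl 1)) (cylLp Q (cylNeumann_subset (hf k)))]
  · rw [← dist_eq_norm]
    rw [dist_comm] at hn2 hk2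
    rw [e2] at hn2
    linarith [dist_triangle ((gradOp Q).closure u) (gradLp Q (isGrad_cylGrad hU hA))
      (gradLp Q (hF k))]

end

end Core

/-! ### The Dirichlet form and its generator -/

section Generator

variable {β : ℝ} {Q : Measure G0} [IsProbabilityMeasure Q]

/-- Continuous functions are dense in `L²`, and cylinder functions are uniformly dense among them.
-/
theorem exists_cylLp_near (u : Lp ℝ 2 Q) {ε : ℝ} (hε : 0 < ε) :
    ∃ (f : G0 → ℝ) (hf : f ∈ cyl 1), ‖u - cylLp Q hf‖ < ε := by
  obtain ⟨v, hv, f, rfl⟩ := Metric.dense_iff.1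
    (ContinuousMap.toLp_denseRange (p := 2) ℝ Q ℝ ENNReal.ofNat_ne_top) u (ε / 2) (by positivity)
  obtain ⟨h, hh, hfh⟩ := exists_cyl_near f.continuous (ε := ε / 2) (by positivity)
  refine ⟨h, hh, ?_⟩
  have h1 : ‖u - ContinuousMap.toLp 2 Q ℝ f‖ < ε / 2 := by
    rw [← dist_eq_norm, dist_comm]; exact hv
  have h2 : ‖ContinuousMap.toLp 2 Q ℝ f - cylLp Q hh‖ ≤ ε / 2 := by
    refine norm_L2_le_of_bound (by positivity) ?_
    filter_upwards [Lp.coeFn_sub (ContinuousMap.toLp 2 Q ℝ f) (cylLp Q hh),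
      ContinuousMap.coeFn_toLp (p := 2) (𝕜 := ℝ) Q f, coeFn_cylLp (Q := Q) hh] with g e1 e2 e3
    rw [e1, Pi.sub_apply, e2, e3]
    exact (hfh g).le
  linarith [norm_sub_le_norm_sub_add_norm_sub u (ContinuousMap.toLp 2 Q ℝ f) (cylLp Q hh)]

variable (hβ : 0 < β) (hQ : IsDirichletProcess β Q)
include hβ hQ

theorem cylLp_mem_domain {f : G0 → ℝ} (hf : f ∈ cyl 1) :
    cylLp Q hf ∈ (gradOp Q).closure.domain := by
  obtain ⟨F, hF⟩ := exists_isGrad hf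
  exact (exists_of_mem_graph hβ hQ (mem_gradOp_closure_graph hβ hQ hf hF)).1

theorem gradOp_closure_cylLp {f : G0 → ℝ} {F : G0 × ℝ → ℝ} (hf : f ∈ cyl 1) (hF : IsGrad f F) :
    (gradOp Q).closure ⟨cylLp Q hf, cylLp_mem_domain hβ hQ hf⟩ = gradLp Q hF :=
  (exists_of_mem_graph hβ hQ (mem_gradOp_closure_graph hβ hQ hf hF)).2

theorem dense_gradOp_closure_domain : Dense ((gradOp Q).closure.domain : Set (Lp ℝ 2 Q)) := by
  refine Metric.dense_iff.2 fun u ε hε => ?_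
  obtain ⟨f, hf, h⟩ := exists_cylLp_near u hε
  refine ⟨cylLp Q hf, ?_, cylLp_mem_domain hβ hQ hf⟩
  rwa [Metric.mem_ball, dist_comm, dist_eq_norm]

theorem isDirichletForm_gradOp : IsDirichletForm (formOf (gradOp Q).closure) where
  dense := dense_gradOp_closure_domain hβ hQ
  closed := formOf_isClosed (gradOp_closure_isClosed hβ hQ)
  markov u := by
    obtain ⟨v, hv, hle⟩ := (isMarkovGradient_gradOp hβ hQ).unitContraction u
    refine ⟨v, hv, ?_⟩
    rw [formOf_apply, formOf_apply, real_inner_self_eq_norm_sq, real_inner_self_eq_norm_sq]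
    gcongr

theorem exists_cylNeumann_energy_lt (u : (gradOp Q).closure.domain) {ε : ℝ} (hε : 0 < ε) :
    ∃ (f : G0 → ℝ) (hf : f ∈ cylNeumann), (formOf (gradOp Q).closure).energy
      (u - ⟨cylLp Q (cylNeumann_subset hf), cylLp_mem_domain hβ hQ (cylNeumann_subset hf)⟩) < ε := by
  obtain ⟨f, F, hf, hF, h1, h2⟩ := exists_cylNeumann_near hβ hQ u (ε := √(ε / 2)) (by positivity)
  refine ⟨f, hf, ?_⟩
  rw [formOf_energy, LinearPMap.map_sub, gradOp_closure_cylLp hβ hQ _ hF, Submodule.coe_sub]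
  rw [Real.lt_sqrt (norm_nonneg _)] at h1 h2
  change _ + ‖(u : Lp ℝ 2 Q) - cylLp Q (cylNeumann_subset hf)‖ ^ 2 < ε
  linarith

theorem isCore_cylNeumann : IsCore (formOf (gradOp Q).closure) cylNeumann where
  mem f hf := ⟨⟨_, cylLp_mem_domain hβ hQ (cylNeumann_subset hf)⟩,
    coeFn_cylLp (cylNeumann_subset hf)⟩
  dense u ε hε := by
    obtain ⟨f, hf, h⟩ := exists_cylNeumann_energy_lt hβ hQ u hε
    exact ⟨f, hf, _, coeFn_cylLp (cylNeumann_subset hf), h⟩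

/-- On the compact space `G0` every continuous function has compact support, so the cylinder
functions serve for both density conditions. -/
theorem isRegularForm_gradOp : IsRegularForm (formOf (gradOp Q).closure) where
  locallyCompact := inferInstance
  separable := inferInstance
  finiteOnCompacts := inferInstance
  fullSupport := hQ.isOpenPosMeasure hβ
  dense_dom u ε hε := by
    obtain ⟨f, hf, h⟩ := exists_cylNeumann_energy_lt hβ hQ u hε
    exact ⟨_, f, cyl_continuous (cylNeumann_subset hf), HasCompactSupport.of_compactSpace f,
      coeFn_cylLp (cylNeumann_subset hf), h⟩
  dense_cc f hf _ ε hε := by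
    obtain ⟨h, hh, hfh⟩ := exists_cyl_near hf hε
    exact ⟨⟨_, cylLp_mem_domain hβ hQ hh⟩, h, cyl_continuous hh,
      HasCompactSupport.of_compactSpace h, coeFn_cylLp hh, hfh⟩

theorem eq_of_mem_generatorGraph {x y y' : Lp ℝ 2 Q}
    (h : (x, y) ∈ (formOf (gradOp Q).closure).generatorGraph)
    (h' : (x, y') ∈ (formOf (gradOp Q).closure).generatorGraph) : y = y' := by
  obtain ⟨hx, h1⟩ := h
  obtain ⟨_, h2⟩ := h'
  refine (dense_gradOp_closure_domain hβ hQ).eq_of_inner_left (𝕜 := ℝ) fun v hv => ?_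
  have := (h1 ⟨v, hv⟩).symm.trans (h2 ⟨v, hv⟩)
  exact neg_injective this

/-- The identity `E(u, v) = -⟪L u, v⟫` holds for cylinder functions `v` by `integral_opL_mul` and
extends to `Dom(E)` along sequences converging together with their gradients. -/
theorem opL_mem_generatorGraph {m : ℕ} {U : (Fin m → ℝ) → ℝ} {α : Fin m → ℝ → ℝ}
    (h : IsSmoothNeumann U α) {p : Lp ℝ 2 Q × Lp ℝ 2 Q} (h1 : p.1 =ᵐ[Q] fun g => U (cylArg α g))
    (h2 : p.2 =ᵐ[Q] opL β U α) : p ∈ (formOf (gradOp Q).closure).generatorGraph := by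
  have hc : (fun g => U (cylArg α g)) ∈ cyl 1 := cylNeumann_subset ⟨m, U, α, h, rfl⟩
  obtain ⟨H, hH⟩ := exists_isGrad hc
  obtain ⟨x, y⟩ := p
  have hx : x = cylLp Q hc := Lp.ext (h1.trans (coeFn_cylLp hc).symm)
  subst hx
  refine ⟨cylLp_mem_domain hβ hQ hc, fun v => ?_⟩
  rw [formOf_apply, gradOp_closure_cylLp hβ hQ hc hH]
  obtain ⟨f, F, hf, hF, h3, h4⟩ := exists_seq_gradOp_closure hβ hQ v
  have e : ∀ n, ⟪gradLp Q hH, gradLp Q (hF n)⟫ = -⟪y, cylLp Q (hf n)⟫ := fun n => by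
    rw [inner_L2_congr h2 (coeFn_cylLp (hf n)), hQ.integral_opL_mul hβ h (hf n) (hF n) hH, neg_neg,
      real_inner_comm, inner_L2_congr (coeFn_gradLp (hF n)) (coeFn_gradLp hH), integral_prod]
    exact ((hF n).memLp (p := 2)).integrable_mul (hH.memLp (p := 2))
  have l1 : Tendsto (fun n => ⟪gradLp Q hH, gradLp Q (hF n)⟫) atTop
      (𝓝 ⟪gradLp Q hH, (gradOp Q).closure v⟫) := tendsto_const_nhds.inner h4
  have l2 : Tendsto (fun n => -⟪y, cylLp Q (hf n)⟫) atTop (𝓝 (-⟪y, (v : Lp ℝ 2 Q)⟫)) :=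
    (tendsto_const_nhds.inner h3).neg
  exact tendsto_nhds_unique l1 (l2.congr fun n => (e n).symm)

theorem exists_opGraph {f : G0 → ℝ} (hf : f ∈ cylNeumann) :
    ∃ y, (cylLp Q (cylNeumann_subset hf), y) ∈ opGraph β Q := by
  obtain ⟨m, U, α, h, rfl⟩ := hf
  have hL := hQ.memLp_opL hβ h
  exact ⟨hL.toLp _, m, U, α, h, coeFn_cylLp (cylNeumann_subset ⟨m, U, α, h, rfl⟩), hL.coeFn_toLp⟩

/-- The operator is the restriction of the generator to the smooth cylinder functions. This
description does not mention the representation by `U` and `α`; well-definedness and linearity are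
inherited from the generator. -/
theorem mem_opGraph_iff {p : Lp ℝ 2 Q × Lp ℝ 2 Q} : p ∈ opGraph β Q ↔
    (∃ f ∈ cylNeumann, p.1 =ᵐ[Q] f) ∧ p ∈ (formOf (gradOp Q).closure).generatorGraph := by
  constructor
  · rintro ⟨m, U, α, h, h1, h2⟩
    exact ⟨⟨_, ⟨m, U, α, h, rfl⟩, h1⟩, opL_mem_generatorGraph hβ hQ h h1 h2⟩
  · rintro ⟨⟨f, hf, h1⟩, hp⟩
    obtain ⟨y, hy⟩ := exists_opGraph hβ hQ hf
    obtain ⟨x, y'⟩ := p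
    have hx : x = cylLp Q (cylNeumann_subset hf) := Lp.ext (h1.trans (coeFn_cylLp _).symm)
    subst hx
    obtain ⟨m, U, α, h, h3, h4⟩ := hy
    rw [eq_of_mem_generatorGraph hβ hQ hp (opL_mem_generatorGraph hβ hQ h h3 h4)]
    exact ⟨m, U, α, h, h3, h4⟩

/-- The graph of the operator as a linear subspace. -/
def opSubmodule : Submodule ℝ (Lp ℝ 2 Q × Lp ℝ 2 Q) where
  carrier := opGraph β Q
  add_mem' := by
    intro a b ha hb
    rw [mem_opGraph_iff hβ hQ] at ha hb ⊢
    obtain ⟨⟨f, hf, ha1⟩, ha2, ha3⟩ := ha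
    obtain ⟨⟨h, hh, hb1⟩, hb2, hb3⟩ := hb
    refine ⟨⟨f + h, cylNeumann_add hf hh, (Lp.coeFn_add _ _).trans (ha1.add hb1)⟩,
      Submodule.add_mem _ ha2 hb2, fun v => ?_⟩
    have := congrArg₂ (· + ·) (ha3 v) (hb3 v)
    rw [Prod.snd_add, inner_add_left, neg_add]
    refine Eq.trans ?_ this
    change _ = ((formOf (gradOp Q).closure).form _ + (formOf (gradOp Q).closure).form _) v
    rw [← map_add]
    rfl
  zero_mem' := by
    rw [mem_opGraph_iff hβ hQ]
    refine ⟨⟨_, const_mem_cylNeumann 0, Lp.coeFn_zero _ _ _⟩, Submodule.zero_mem _, fun v => ?_⟩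
    rw [Prod.snd_zero, inner_zero_left, neg_zero]
    exact congrArg (fun l => l v) (map_zero (formOf (gradOp Q).closure).form)
  smul_mem' := by
    intro c a ha
    rw [mem_opGraph_iff hβ hQ] at ha ⊢
    obtain ⟨⟨f, hf, ha1⟩, ha2, ha3⟩ := ha
    refine ⟨⟨c • f, cylNeumann_smul c hf, (Lp.coeFn_smul _ _).trans (ha1.const_smul c)⟩,
      Submodule.smul_mem _ c ha2, fun v => ?_⟩
    have := congrArg (fun r => c * r) (ha3 v)
    rw [Prod.smul_snd, real_inner_smul_left, ← mul_neg]
    refine Eq.trans ?_ this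
    change _ = (c • (formOf (gradOp Q).closure).form _) v
    rw [← map_smul]
    rfl

/-- The value of the generator at a point is unique, so the graph defines an operator; its domain is
dense in energy, and the abstract criterion for Friedrichs extensions applies. -/
theorem exists_generator_core : ∃ L : Lp ℝ 2 Q →ₗ.[ℝ] Lp ℝ 2 Q,
    (L.graph : Set (Lp ℝ 2 Q × Lp ℝ 2 Q)) = opGraph β Q ∧
    (∀ u ∈ cylNeumann, ∃ v : L.domain, (v : Lp ℝ 2 Q) =ᵐ[Q] u) ∧
    IsNonposSymmetric L ∧ (formOf (gradOp Q).closure).generatorGraph = friedrichsGraph L := by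
  have hgraph : (opSubmodule hβ hQ).toLinearPMap.graph = opSubmodule hβ hQ := by
    refine Submodule.toLinearPMap_graph_eq _ fun p hp h0 => ?_
    have h1 := ((mem_opGraph_iff hβ hQ).1 hp).2
    have h2 := ((mem_opGraph_iff hβ hQ).1 (opSubmodule hβ hQ).zero_mem).2
    obtain ⟨x, y⟩ := p
    simp only at h0
    subst h0
    exact eq_of_mem_generatorGraph hβ hQ h1 h2
  set L := (opSubmodule hβ hQ).toLinearPMap
  have hL : ∀ u : L.domain, ((u : Lp ℝ 2 Q), L u) ∈ (formOf (gradOp Q).closure).generatorGraph := by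
    intro u
    have h1 := L.mem_graph u
    rw [hgraph] at h1
    exact ((mem_opGraph_iff hβ hQ).1 h1).2
  have hdom : L.domain ≤ (formOf (gradOp Q).closure).dom := fun u hu => (hL ⟨u, hu⟩).1
  have hL' : ∀ (u : L.domain) (v : (formOf (gradOp Q).closure).dom),
      (formOf (gradOp Q).closure).form ⟨u, hdom u.2⟩ v = -⟪L u, (v : Lp ℝ 2 Q)⟫ :=
    fun u v => (hL u).2 v
  have hmem : ∀ {f : G0 → ℝ} (hf : f ∈ cylNeumann), cylLp Q (cylNeumann_subset hf) ∈ L.domain := by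
    intro f hf
    obtain ⟨y, hy⟩ := exists_opGraph hβ hQ hf
    refine L.mem_domain_of_mem_graph (y := y) ?_
    rw [hgraph]
    exact hy
  have hcore : ∀ u : (formOf (gradOp Q).closure).dom, ∀ ε > 0, ∃ v : L.domain,
      (formOf (gradOp Q).closure).energy (u - ⟨v, hdom v.2⟩) < ε := by
    intro u ε hε
    obtain ⟨f, hf, h⟩ := exists_cylNeumann_energy_lt hβ hQ u hε
    exact ⟨⟨_, hmem hf⟩, h⟩
  refine ⟨L, by rw [hgraph]; rfl, fun f hf => ⟨⟨_, hmem hf⟩, coeFn_cylLp (cylNeumann_subset hf)⟩,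
    ?_, ?_⟩
  · exact SymmForm.isNonposSymmetric hdom hL' hcore (dense_gradOp_closure_domain hβ hQ)
  · exact SymmForm.generatorGraph_eq_friedrichsGraph
      (formOf_isClosed (gradOp_closure_isClosed hβ hQ)) hdom hL' hcore

end Generator


end WassersteinForm

end

/-! ### The Wasserstein Dirichlet form. -/

theorem mainTheorem5 (β : ℝ) (hβ : 0 < β) :
    (∃! Q : Measure G0, IsDirichletProcess β Q) ∧
    ∀ Q : Measure G0, IsDirichletProcess β Q →
      FormClosable Q (cyl 1) (wForm Q) ∧
      ∃ E : SymmForm (Lp ℝ 2 Q),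
        IsFormClosure Q (cyl 1) (wForm Q) E ∧
        IsDirichletForm E ∧ IsRegularForm E ∧ IsRecurrent E ∧
        IsCore E cylNeumann ∧
        (∃ L : Lp ℝ 2 Q →ₗ.[ℝ] Lp ℝ 2 Q,
          (L.graph : Set (Lp ℝ 2 Q × Lp ℝ 2 Q)) = opGraph β Q ∧
          (∀ u ∈ cylNeumann, ∃ v : L.domain, (v : Lp ℝ 2 Q) =ᵐ[Q] u) ∧
          (∀ (m : ℕ) (U : (Fin m → ℝ) → ℝ) (α : Fin m → ℝ → ℝ), IsSmoothNeumann U α →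
            ∃ w : Fin m → G0 → ℝ,
              (∀ i, IsAdjointValue Q (D01 (α i)) (fun g => partialD i U (cylArg α g)) (w i)) ∧
              opL β U α =ᵐ[Q] fun g => -∑ i, w i g) ∧
          IsNonposSymmetric L ∧
          E.generatorGraph = friedrichsGraph L) ∧
        ∃ D : Lp ℝ 2 Q →ₗ.[ℝ] Lp ℝ 2 (Q.prod leb),
          (D.graph : Set (Lp ℝ 2 Q × Lp ℝ 2 (Q.prod leb))) = gradGraph Q ∧
          (∀ u ∈ cyl 1, ∃ v : D.domain, (v : Lp ℝ 2 Q) =ᵐ[Q] u) ∧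
          D.IsClosable ∧
          ∃ hdom : E.dom = D.closure.domain,
            (∀ u v : E.dom,
              E.form u v = ∫ z, D.closure ⟨u, hdom.le u.2⟩ z * D.closure ⟨v, hdom.le v.2⟩ z
                ∂(Q.prod leb)) ∧
            ∀ u v w : E.dom,
              MemLp (u : Lp ℝ 2 Q) ⊤ Q → MemLp (v : Lp ℝ 2 Q) ⊤ Q → MemLp (w : Lp ℝ 2 Q) ⊤ Q →
              Integrable
                (squareField (D.closure ⟨u, hdom.le u.2⟩) (D.closure ⟨v, hdom.le v.2⟩)) Q ∧
              ∃ uv uw vw : E.dom,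
                (uv : Lp ℝ 2 Q) =ᵐ[Q] (fun g => (u : Lp ℝ 2 Q) g * (v : Lp ℝ 2 Q) g) ∧
                (uw : Lp ℝ 2 Q) =ᵐ[Q] (fun g => (u : Lp ℝ 2 Q) g * (w : Lp ℝ 2 Q) g) ∧
                (vw : Lp ℝ 2 Q) =ᵐ[Q] (fun g => (v : Lp ℝ 2 Q) g * (w : Lp ℝ 2 Q) g) ∧
                2 * ∫ g, (w : Lp ℝ 2 Q) g *
                    squareField (D.closure ⟨u, hdom.le u.2⟩) (D.closure ⟨v, hdom.le v.2⟩) g ∂Q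
                  = E.form u vw + E.form uw v - E.form uv w := by
  refine ⟨existsUnique_isDirichletProcess hβ, fun Q hQ => ?_⟩
  have := hQ.isProbability
  obtain ⟨L, hLg, hLm, hLs, hLf⟩ := exists_generator_core hβ hQ
  refine ⟨formClosable_wForm hβ hQ, formOf (gradOp Q).closure, isFormClosure_gradOp hβ hQ,
    isDirichletForm_gradOp hβ hQ, isRegularForm_gradOp hβ hQ,
    (isMarkovGradient_gradOp hβ hQ).isRecurrent (gradOp_closure_isClosed hβ hQ),
    isCore_cylNeumann hβ hQ,
    ⟨L, hLg, hLm, fun m U α h => hQ.exists_adjoint_opL hβ h, hLs, hLf⟩,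
    gradOp Q, congrArg _ (gradOp_graph hβ hQ), fun u hu => ?_, gradOp_isClosable hβ hQ, rfl,
    fun u v => inner_L2_eq _ _, fun u v w hu hv hw => ⟨integrable_squareField _ _, ?_⟩⟩
  · obtain ⟨F, hF⟩ := exists_isGrad hu
    have hmem : (cylLp Q hu, gradLp Q hF) ∈ (gradOp Q).graph := by
      rw [gradOp_graph hβ hQ]
      exact mem_gradGraph_iff.2 ⟨u, F, hu, hF, rfl⟩
    exact ⟨⟨_, (gradOp Q).mem_domain_of_mem_graph hmem⟩, coeFn_cylLp hu⟩
  · obtain ⟨uv, huv, hduv⟩ := exists_mul_gradOp_closure hβ hQ u v hu hv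
    obtain ⟨uw, huw, hduw⟩ := exists_mul_gradOp_closure hβ hQ u w hu hw
    obtain ⟨vw, hvw, hdvw⟩ := exists_mul_gradOp_closure hβ hQ v w hv hw
    exact ⟨uv, uw, vw, huv, huw, hvw, two_mul_integral_squareField hduv hduw hdvw⟩
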